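/- **Setting.** Let $n,m\ge 1$. The honeycomb lattice has white vertices $\mathsf w_{x,y}$ and black vertices $\mathsf b_{x,y}$, $(x,y)\in\mathbb Z^2$; the vertex $\mathsf w_{x,y}$ is joined to $\mathsf b_{x,y}$ ($a$-edge), $\mathsf b_{x+1,y}$ ($b$-edge) and $\mathsf b_{x,y-1}$ ($c$-edge). The positive edge weights $a_{ij},b_{ij},c_{ij}$ at $\mathsf w_{x,y}$ depend only on $i = y \bmod m$ and $j = x \bmod n$, with representatives $0\le i<m$, $0\le j<n$. *Column* $x$ consists of the vertices $\mathsf w_{x,\cdot},\mathsf b_{x,\cdot}$; *thread* $x$ is the vertical dual path between the columns $x$ and $x+1$, which crosses exactly the $b$-edges at the vertices $\mathsf w_{x,y}$, $y\in\mathbb Z$. The family $\mathbf B_j$ consists of the threads $x\equiv j \pmod n$. Let $K(z,w)$ be the $nm\times nm$ Kasteleyn matrix of the quotient graph on the torus, where $c$-edges leaving the $n\times m$ fundamental domain get a factor $z$ and $b$-edges leaving it a factor $w$, and $P=\det K$. In a magnetic field $B=(B_x,B_y)$, the edge weights $K_B$ are the original ones multiplied by $e^{B_x}$ (resp. $e^{B_y}$)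 for the $c$- (resp. $b$-) edges leaving a fundamental domain, and the Gibbs measure $\mu_B$ is the probability measure on perfect matchings with $$\mu_B(e_1,\dots,e_k)=\prod_i K_B(\mathsf w_i,\mathsf b_i)\,\det\bigl[K_B^{-1}(\mathsf b_i,\mathsf w_j)\bigr]$$ for distinct edges $e_i=\mathsf w_i\mathsf b_i$, where $$K_B^{-1}(\mathsf b,\mathsf w)=\iint_{\mathbb T^2} \bigl[K(e^{B_x}z,e^{B_y}w)\bigr]^{-1}_{\mathsf b\mathsf w}z^{-Y}w^{X}\frac{dz}{2i\pi z}\frac{dw}{2i\pi w}$$ and $(X,Y)$ is the lattice vector from the fundamental domain of $\mathsf w$ to that of $\mathsf b$. **Tentacle.** Put $\kappa_j=\sum_{i}\log(a_{ij}/c_{ij})$. Fix a column type $j_0$ with $\kappa_j\neq\kappa_{j_0}$ for all $j\ne j_0$ (generic weights). Let $r=(-1)^m e^{\kappa_{j_0}}$ be the corresponding root of $P(\cdot,0)$, let $\beta=-\partial_2P(r,0)/(r\,\partial_1P(r,0))$, let $\gamma\in(-1,1)$, and let $\mu_t$ be the Gibbs measure in the field $B(t)=(\kappa_{j_0}+\gamma\beta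 t,\ \log t)$, $t\to0^+$. A *bead* on thread $x$ at row $y$ is a dimer on the $b$-edge at $\mathsf w_{x,y}$; its rescaled height is $\xi=t\beta\sqrt{1-\gamma^2}\,y/m$. Columns $x\not\equiv j_0 \pmod n$ are called *frozen*; in a frozen column of type $j$ the non-typical edges are the $c$-edges if $\kappa_j>\kappa_{j_0}$ and the $a$-edges if $\kappa_j<\kappa_{j_0}$. The *bead model of index $\gamma$* is the determinantal point process on $\mathbb Z\times\mathbb R$ with kernel $J_\gamma(k-k',\xi-\xi')$, where $$J_\gamma(k,\xi)=\int_{[-1,1]}e^{-i\xi\phi}(\gamma+i\phi\sqrt{1-\gamma^2})^k\frac{d\phi}{2\pi}\quad(k\ge0),$$ $$J_\gamma(k,\xi)=-\lim_{R\to\infty}\int_{1<|\phi|<R}e^{-i\xi\phi}(\gamma+i\phi\sqrt{1-\gamma^2})^k\frac{d\phi}{2\pi}\quad(k<0).$$ **Proposition.** As $t\to0^+$: 1. The limiting bead models on the different families of threads are perfectly correlated: there is a bead model $N$ of index $\gamma$ such that the rescaled bead processes on all threads converge jointly, in the sense of finite-dimensional distributions of numbers of beads in bounded intervals, to the process whose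 restriction to thread $x$ is $N(\{k(x)\}\times\cdot)$, with $k(x)=\lfloor (x-j_0)/n\rfloor$. So the limit is the same for the $n$ threads, one of each family $\mathbf B_j$, that lie between two consecutive non-frozen columns. 2. The distance between beads on the two sides of a frozen column converges in probability to zero: for every frozen column $x$ and all $R,\varepsilon>0$, with $\mu_t$-probability tending to $1$, every bead of rescaled height in $[-R,R]$ on one of the threads $x-1$, $x$ is joined by a (possibly empty) sequence of successive non-typical edges of column $x$ to a bead of the other thread, and the rescaled heights of these two beads differ by at most $\varepsilon$. -/

import Mathlib

open Filter Topology MeasureTheory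

noncomputable section

namespace BeadDimer

/-! ### The honeycomb lattice and its dimer configurations

White vertices `w (x, y)` and black vertices `b (x, y)` are both labelled by `ℤ × ℤ`, `x` being the
column and `y` the row.  The white vertex `w (x, y)` is joined to `b (x, y)` by an `a`-edge, to
`b (x + 1, y)` by a `b`-edge and to `b (x, y - 1)` by a `c`-edge.  Column `x` (the strip made of the
vertices `w (x, ·)` and `b (x, ·)`) is a zigzag line of `a`- and `c`-edges; the thread `x` is the
vertical dual path between the columns `x` and `x + 1`, which crosses `b`-edges only. -/

/-- The three types of edges of the honeycomb lattice. -/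
inductive EdgeType
  | a
  | b
  | c

/-- An edge of the honeycomb lattice: its white end and its type. -/
abbrev Edge : Type := (ℤ × ℤ) × EdgeType

/-- The white end of an edge. -/
def whiteEnd (e : Edge) : ℤ × ℤ := e.1

/-- The black end of an edge. -/
def blackEnd : Edge → ℤ × ℤ
  | (v, EdgeType.a) => v
  | (v, EdgeType.b) => (v.1 + 1, v.2)
  | (v, EdgeType.c) => (v.1, v.2 - 1)

/-- Dimer configurations (perfect matchings): every vertex is on exactly one edge. -/
def DimerConfig : Type :=
  {M : Set Edge // (∀ v, ∃! e, e ∈ M ∧ whiteEnd e = v) ∧ (∀ u, ∃! e, e ∈ M ∧ blackEnd e = u)}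

/-- The `σ`-algebra generated by the events `e ∈ M`, for `e` an edge. -/
instance : MeasurableSpace DimerConfig :=
  MeasurableSpace.generateFrom {s | ∃ e : Edge, s = {M : DimerConfig | e ∈ M.1}}

/-! ### Periodic weights, Kasteleyn matrix, Gibbs measures -/

/-- Positive edge weights, periodic with an `n × m` fundamental domain (`n` columns and `m` rows):
`a i j`, `b i j`, `c i j` are the weights of the edges at the white vertices in row `i`, column `j`
of a fundamental domain. -/
structure Weights (n m : ℕ) where
  a : ZMod m → ZMod n → ℝ
  b : ZMod m → ZMod n → ℝ
  c : ZMod m → ZMod n → ℝ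
  a_pos : ∀ i j, 0 < a i j
  b_pos : ∀ i j, 0 < b i j
  c_pos : ∀ i j, 0 < c i j

variable {n m : ℕ}

/-- The Kasteleyn matrix `K(z, w)` of the quotient graph on the torus, with rows indexed by white
vertices and columns by black vertices `(i, j)` (row, column).  The `c`-edges leaving the fundamental
domain carry a factor `z`, the `b`-edges leaving it a factor `w`. -/
def Weights.kasteleyn (W : Weights n m) {R : Type*} [CommRing R] [Algebra ℝ R] (z w : R) :
    Matrix (ZMod m × ZMod n) (ZMod m × ZMod n) R :=
  Matrix.of fun v u =>
    (if u = v then algebraMap ℝ R (W.a v.1 v.2) else 0)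
    + (if u = (v.1, v.2 + 1) then
        algebraMap ℝ R (W.b v.1 v.2) * (if v.2 + 1 = 0 then w else 1) else 0)
    + (if u = (v.1 - 1, v.2) then
        algebraMap ℝ R (W.c v.1 v.2) * (if v.1 = 0 then z else 1) else 0)

/-- The projection of a vertex of the honeycomb lattice to the quotient graph. -/
def proj (n m : ℕ) (v : ℤ × ℤ) : ZMod m × ZMod n := ((v.2 : ZMod m), (v.1 : ZMod n))

/-- The inverse Kasteleyn operator `K⁻¹_B (b_u, w_v)` in the magnetic field `(Bx, By)`: with `(X, Y)`
the lattice vector from the fundamental domain of `w_v` to that of `b_u`,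
`∬ [K(e^Bx z, e^By w)]⁻¹_{u v} z^(-Y) w^X (dz / 2πiz) (dw / 2πiw)` over the unit torus. -/
def Weights.invKasteleyn [NeZero n] [NeZero m] (W : Weights n m) (Bx By : ℝ) (u v : ℤ × ℤ) : ℂ :=
  ((2 * Real.pi * Complex.I)⁻¹) ^ 2 *
    ∮ z in C(0, 1), ∮ w in C(0, 1),
      z ^ (-(u.2 / (m : ℤ) - v.2 / (m : ℤ)) - 1) * w ^ ((u.1 / (n : ℤ) - v.1 / (n : ℤ)) - 1) *
        (W.kasteleyn (Complex.exp Bx * z) (Complex.exp By * w))⁻¹ (proj n m u) (proj n m v)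

/-- The weight of an edge in the magnetic field `(Bx, By)`: the edges leaving the fundamental domain
vertically (horizontally) have their weight multiplied by `e^Bx` (`e^By`). -/
def Weights.edgeWeight (W : Weights n m) (Bx By : ℝ) : Edge → ℝ
  | (v, EdgeType.a) => W.a v.2 v.1
  | (v, EdgeType.b) => W.b v.2 v.1 * (if (v.1 : ZMod n) + 1 = 0 then Real.exp By else 1)
  | (v, EdgeType.c) => W.c v.2 v.1 * (if (v.2 : ZMod m) = 0 then Real.exp Bx else 1)

/-- The Gibbs measure of the dimer model in the magnetic field `(Bx, By)`: the probability measure on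
dimer configurations whose local statistics are `∏ K(wᵢ, bᵢ) · det [K⁻¹_B (bᵢ, wⱼ)]`. -/
structure IsGibbsMeasure [NeZero n] [NeZero m] (W : Weights n m) (Bx By : ℝ)
    (μ : Measure DimerConfig) : Prop where
  isProbabilityMeasure : IsProbabilityMeasure μ
  localStatistics : ∀ (k : ℕ) (e : Fin k → Edge), Function.Injective e →
    ((μ.real {M | ∀ l, e l ∈ M.1} : ℝ) : ℂ) =
      (∏ l, (W.edgeWeight Bx By (e l) : ℂ)) *
        (Matrix.of fun i j : Fin k =>
          W.invKasteleyn Bx By (blackEnd (e i)) (whiteEnd (e j))).det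

/-! ### Tentacles -/

/-- The abscissa `∑ᵢ log (a i j / c i j)` of the vertical tentacle attached to the columns of
type `j`. -/
def Weights.abscissa [NeZero m] (W : Weights n m) (j : ZMod n) : ℝ :=
  ∑ i, Real.log (W.a i j / W.c i j)

/-- The characteristic polynomial `P(z, w) = det K(z, w)`, on `ℝ × ℝ`. -/
def Weights.charPoly [NeZero n] [NeZero m] (W : Weights n m) (z w : ℝ) : ℝ :=
  (W.kasteleyn z w).det

/-- The root `(-1)^m e^c` of `P(·, 0)` attached to the tentacle of abscissa `c`. -/
def Weights.root [NeZero m] (W : Weights n m) (j : ZMod n) : ℝ :=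
  (-1) ^ m * Real.exp (W.abscissa j)

/-- The width parameter `β = - ∂₂P / (r ∂₁P)` of the tentacle, taken at `(r, 0)`, `r` the root
attached to the tentacle. -/
def Weights.beta [NeZero n] [NeZero m] (W : Weights n m) (j : ZMod n) : ℝ :=
  -(deriv (fun w => W.charPoly (W.root j) w) 0 /
    (W.root j * deriv (fun z => W.charPoly z 0) (W.root j)))

/-- The horizontal component `c + γ β t` of the magnetic field deep inside the tentacle, the vertical
one being `log t`. -/
def Weights.fieldX [NeZero n] [NeZero m] (W : Weights n m) (j : ZMod n) (γ t : ℝ) : ℝ :=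
  W.abscissa j + γ * W.beta j * t

/-! ### Beads and their rescaled positions -/

/-- There is a bead on the thread `x` at the row `y`. -/
def IsBead (M : DimerConfig) (x y : ℤ) : Prop := ((x, y), EdgeType.b) ∈ M.1

/-- The rescaled vertical coordinate `t β √(1-γ²) (y / m)` of the row `y` (a fundamental domain has
height `m`, so that `y / m` is the height in units of fundamental domains). -/
def Weights.height [NeZero n] [NeZero m] (W : Weights n m) (j : ZMod n) (γ t : ℝ) (y : ℤ) : ℝ :=
  t * W.beta j * Real.sqrt (1 - γ ^ 2) * ((y : ℝ) / m)

/-- The number of beads on the thread `x` whose rescaled position is in `A`. -/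
def Weights.beadCount [NeZero n] [NeZero m] (W : Weights n m) (j : ZMod n) (γ t : ℝ)
    (M : DimerConfig) (x : ℤ) (A : Set ℝ) : ℕ :=
  {y : ℤ | IsBead M x y ∧ W.height j γ t y ∈ A}.ncard

/-- The threads `x` with the same value of `bundle j x` are those between two consecutive columns of
type `j`; `bundle j x = k` for `j + k n ≤ x < j + (k + 1) n`.  Each bundle contains exactly one
thread of each of the `n` families. -/
def bundle [NeZero n] (j : ZMod n) (x : ℤ) : ℤ := (x - (j.val : ℤ)) / (n : ℤ)

/-- In a column `x` whose type `i` is frozen: the bead of the thread `x - 1` at row `u` and the bead of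
the thread `x` at row `v` are the two ends of one (possibly empty) sequence of successive non-typical
edges of the column.  The typical edges of the frozen column are the `a`-edges if the abscissa of its
type is larger than the abscissa of the tentacle, the `c`-edges if it is smaller. -/
def Weights.Paired [NeZero n] [NeZero m] (W : Weights n m) (j : ZMod n)
    (M : DimerConfig) (x u v : ℤ) : Prop :=
  IsBead M (x - 1) u ∧ IsBead M x v ∧
    ((W.abscissa j < W.abscissa (x : ZMod n) ∧ v ≤ u ∧
        ∀ y, v < y → y ≤ u → ((x, y), EdgeType.c) ∈ M.1) ∨
      (W.abscissa (x : ZMod n) < W.abscissa j ∧ u < v ∧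
        ∀ y, u < y → y < v → ((x, y), EdgeType.a) ∈ M.1))

/-- Each bead at height at most `R` in absolute value, on either side of the column `x`, is paired
through the column with a bead on the other side that is at distance at most `ε`. -/
def Weights.SidesClose [NeZero n] [NeZero m] (W : Weights n m) (j : ZMod n) (γ t R ε : ℝ)
    (x : ℤ) (M : DimerConfig) : Prop :=
  (∀ u, IsBead M (x - 1) u → |W.height j γ t u| ≤ R →
    ∃ v, W.Paired j M x u v ∧ |W.height j γ t u - W.height j γ t v| ≤ ε) ∧
  (∀ v, IsBead M x v → |W.height j γ t v| ≤ R →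
    ∃ u, W.Paired j M x u v ∧ |W.height j γ t u - W.height j γ t v| ≤ ε)

/-! ### The bead model -/

/-- Locally finite configurations of points on `ℤ × ℝ`. -/
def PointConfig : Type :=
  {S : Set (ℤ × ℝ) // ∀ (k : ℤ) (r : ℝ), {ξ : ℝ | (k, ξ) ∈ S ∧ |ξ| ≤ r}.Finite}

/-- The number of points on the thread `k` with position in `A`. -/
def PointConfig.count (S : PointConfig) (k : ℤ) (A : Set ℝ) : ℕ :=
  {ξ : ℝ | (k, ξ) ∈ S.1 ∧ ξ ∈ A}.ncard

/-- The `σ`-algebra generated by the numbers of points in bounded Borel sets. -/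
instance : MeasurableSpace PointConfig :=
  ⨆ (k : ℤ) (A : {A : Set ℝ // MeasurableSet A ∧ Bornology.IsBounded A}),
    MeasurableSpace.comap (fun S : PointConfig => S.count k A.1) ⊤

/-- The integrand `e^(-iξφ) (γ + iφ√(1-γ²))^x` of the kernel of the bead model. -/
def beadIntegrand (γ : ℝ) (x : ℤ) (ξ φ : ℝ) : ℂ :=
  Complex.exp (-(Complex.I * ξ * φ)) * ((γ : ℂ) + Complex.I * φ * Real.sqrt (1 - γ ^ 2)) ^ x

/-- The kernel `J_γ (x, ξ)` of the bead model.  For `x < 0` the integral over `ℝ \ [-1, 1]` is the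
improper integral `lim_{R → ∞} ∫_{1 < |φ| < R}`, as it is not absolutely convergent for `x = -1`. -/
def beadKernel (γ : ℝ) (x : ℤ) (ξ : ℝ) : ℂ :=
  if 0 ≤ x then (2 * Real.pi : ℂ)⁻¹ * ∫ φ in (-1 : ℝ)..1, beadIntegrand γ x ξ φ
  else -((2 * Real.pi : ℂ)⁻¹ * limUnder atTop fun R : ℝ =>
    (∫ φ in (-R)..(-1 : ℝ), beadIntegrand γ x ξ φ) + ∫ φ in (1 : ℝ)..R, beadIntegrand γ x ξ φ)

/-- The bead model of index `γ`: the determinantal point process on `ℤ × ℝ` with kernel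
`J_γ (x - x', ξ - ξ')`, i.e. for disjoint bounded Borel sets `{k_l} × A_l` the joint factorial moments
of order `(N_l)` of the numbers of points are the integrals of `det J_γ` over `∏ A_l ^ N_l`. -/
structure IsBeadModel (γ : ℝ) (ν : Measure PointConfig) : Prop where
  isProbabilityMeasure : IsProbabilityMeasure ν
  factorialMoments : ∀ (p : ℕ) (k : Fin p → ℤ) (A : Fin p → Set ℝ) (N : Fin p → ℕ),
    (∀ l, MeasurableSet (A l)) → (∀ l, Bornology.IsBounded (A l)) →
    (∀ l l', l ≠ l' → k l = k l' → Disjoint (A l) (A l')) →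
    Integrable (fun S : PointConfig => ∏ l, ((S.count (k l) (A l)).descFactorial (N l) : ℝ)) ν ∧
    ((∫ S : PointConfig, ∏ l, ((S.count (k l) (A l)).descFactorial (N l) : ℝ) ∂ν : ℝ) : ℂ) =
      ∫ ξ in {ξ : (Σ l : Fin p, Fin (N l)) → ℝ | ∀ q, ξ q ∈ A q.1},
        (Matrix.of fun q r : Σ l : Fin p, Fin (N l) =>
          beadKernel γ (k q.1 - k r.1) (ξ q - ξ r)).det

end BeadDimer

end

set_option linter.unusedSectionVars false

/-! ### Cyclic matrices and the factorisation of `P(·, 0)` over the columns. -/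

noncomputable section

namespace BeadDimer

/-! ### Cyclic products and determinants -/

/-! In the field `B(t)` the matrix to invert is `K(e^Bx z, t w)`, a small perturbation of `K(ζ, 0)`.
At `w = 0` the matrix is block triangular in the columns, so `P(ζ, 0)` is a product of one linear
factor per column (`Weights.det_kasteleyn_zero`). Genericity says that the root `r` of the column
type `j₀` is simple and alone on its circle. Hence, for small `t`, the integrand has, as a function
of `z`, a single pole in an annulus around the unit circle, and this pole is `(-1)^m (1 + β (w - γ)
t + o(t))` (`PoleData.hasDerivAt_pole`). When the vertical separation is `Y ~ η / t`, moving the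
circle to the side where `z^(-Y)` decays leaves only a residue, present or absent according to the
sign of `β (re w - γ)`, and `pole^(-Y)` tends, up to sign, to `exp (-η β (w - γ))`. What remains is
an integral over an arc of the unit circle `|w| = 1` cut at the abscissa `γ`. Replacing the arc by
the chord with the same ends, or by the two outer half-lines of the line `re w = γ`, gives `J_γ`
(`Weights.tendsto_kerInt`, `beadKernel_eq`).

The residue is the adjugate of `K(r, 0)`. Its columns and rows are kernel vectors, which solve
cyclic recursions with positive coefficients (after a gauge change); off the column `j₀` the product
of the coefficients around the cycle is not one. This gives the supports and the signs of the kernel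
vectors, hence the rank one structure `ψ i * φ i'` (`Weights.rootAdj_rank_one`) and `β ≠ 0`.
Properly normalised, `ψ i * φ i` sums to one over a fundamental domain: it is the share of each row
in the beads, and it disappears when rows are summed.

It suffices to treat one thread per bundle, the one between two columns of fundamental domains.
There the expected numbers of tuples of beads, that is the joint factorial moments of the counts,
converge to integrals of `det J_γ` by dominated convergence, the domination being Hadamard's
inequality (`Weights.tendsto_tupleCount`). The resulting bound `(D √N)^N` on the moments of order
`N` also makes the inversion series from factorial moments to probabilities converge uniformly in
`t` (`Weights.tendsto_ncard_of_disjoint`). The existence of the bead model is part of the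
conclusion: it is a limit of the laws of the beads, labelled in order of distance to the origin, in
a compact space of probability measures (`Weights.exists_beadModel`).

In a frozen column the diagonal entries of the adjugate vanish, so there is no residue, and the
probability of an `a`-edge tends to one or zero, uniformly over the rows. A bounded window has of
order `1 / t` rows, so non-typical edges may occur, but by Markov's inequality there are only `o(1 /
t)` of them with high probability. From a bead on one side, the matching constraint forces a walk
along successive non-typical edges up to a bead on the other side; a walk of macroscopic length
would use too many such edges (`Weights.tendsto_not_sidesClose`). Composing these pairings across
the frozen columns of a bundle matches the beads of every thread with those of the representative
one, with vanishing displacement. Since beads are rarely close to the ends of a given interval, the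
counts then agree with probability tending to one (`Weights.tendsto_beadCount_ne`), and the joint
limit follows. -/

theorem prod_range_natCast_zmod {M : Type*} [CommMonoid M] (m : ℕ) [NeZero m] (f : ZMod m → M) :
    ∏ l ∈ Finset.range m, f (l : ZMod m) = ∏ i, f i := by
  obtain ⟨k, rfl⟩ := Nat.exists_eq_succ_of_ne_zero (NeZero.ne m)
  rw [Finset.prod_range]
  refine Fintype.prod_congr _ _ fun i => ?_
  exact congrArg f (ZMod.natCast_zmod_val (n := k + 1) i)

theorem prod_range_add_zmod {M : Type*} [CommMonoid M] (m : ℕ) [NeZero m] (f : ZMod m → M)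
    (i : ZMod m) : ∏ l ∈ Finset.range m, f (i + l) = ∏ j, f j := by
  rw [prod_range_natCast_zmod m fun l => f (i + l)]
  exact Fintype.prod_equiv (Equiv.addLeft i) _ _ fun j => rfl

/-- A strict linear recursive inequality around a cycle. -/
theorem cyclic_lt {m : ℕ} [NeZero m] {ρ g : ZMod m → ℝ} (hρ : ∀ i, 0 < ρ i)
    (h : ∀ i, ρ (i + 1) * g i < g (i + 1)) (i : ZMod m) : (∏ j, ρ j) * g i < g i := by
  have key : ∀ k : ℕ, (∏ l ∈ Finset.range (k + 1), ρ (i + 1 + l)) * g i < g (i + 1 + k) := by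
    intro k
    induction k with
    | zero => simpa using h i
    | succ k ih =>
      rw [Finset.prod_range_succ]
      have h1 := h (i + 1 + k)
      have h2 := mul_lt_mul_of_pos_left ih (hρ (i + 1 + k + 1))
      have e : i + 1 + ((k + 1 : ℕ) : ZMod m) = i + 1 + k + 1 := by push_cast; ring
      rw [e]
      calc _ = ρ (i + 1 + k + 1) * ((∏ l ∈ Finset.range (k + 1), ρ (i + 1 + l)) * g i) := by ring
        _ < _ := h2
        _ < _ := h1
  -- After `m = k + 1` steps the recursion is back at `i`, having met each `ρ j` exactly once.
  obtain ⟨k, hk⟩ := Nat.exists_eq_succ_of_ne_zero (NeZero.ne m)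
  have h1 := key k
  have e : i + 1 + (k : ZMod m) = i := by
    have : ((k + 1 : ℕ) : ZMod m) = 0 := by rw [← Nat.succ_eq_add_one, ← hk]; simp
    push_cast at this
    rw [add_assoc, add_comm 1, this, add_zero]
  rw [e, ← Nat.succ_eq_add_one, ← hk, prod_range_add_zmod m ρ] at h1
  exact h1

/-- A linear recursion around a cycle. -/
theorem cyclic_eq {m : ℕ} [NeZero m] {R : Type*} [CommRing R] {ρ g : ZMod m → R}
    (h : ∀ i, g (i + 1) = ρ (i + 1) * g i) (i : ZMod m) : g i = (∏ j, ρ j) * g i := by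
  have key : ∀ k : ℕ, g (i + 1 + k) = (∏ l ∈ Finset.range (k + 1), ρ (i + 1 + l)) * g i := by
    intro k
    induction k with
    | zero => simpa using h i
    | succ k ih =>
      have e : i + 1 + ((k + 1 : ℕ) : ZMod m) = i + 1 + k + 1 := by push_cast; ring
      rw [Finset.prod_range_succ, e, h, ih]
      ring
  obtain ⟨k, hk⟩ := Nat.exists_eq_succ_of_ne_zero (NeZero.ne m)
  have h1 := key k
  have e : i + 1 + (k : ZMod m) = i := by
    have : ((k + 1 : ℕ) : ZMod m) = 0 := by rw [← Nat.succ_eq_add_one, ← hk]; simp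
    push_cast at this
    rw [add_assoc, add_comm 1, this, add_zero]
  rw [e, ← Nat.succ_eq_add_one, ← hk, prod_range_add_zmod m ρ] at h1
  exact h1

theorem forall_zmod_of_succ {m : ℕ} [NeZero m] {p : ZMod m → Prop} {i : ZMod m} (hi : p i)
    (h : ∀ j, p j → p (j + 1)) (j : ZMod m) : p j := by
  have key : ∀ k : ℕ, p (i + k) := by
    intro k
    induction k with
    | zero => simpa using hi
    | succ k ih => simpa [add_assoc] using h _ ih
  simpa using key (j - i).val

/-- A permutation of a cycle that moves each point by `0` or `1` is the identity or the rotation. -/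
theorem perm_zmod_eq {m : ℕ} [NeZero m] (σ : Equiv.Perm (ZMod m))
    (h : ∀ i, σ i = i ∨ σ i = i + 1) : σ = 1 ∨ σ = Equiv.addRight (1 : ZMod m) := by
  by_cases hσ : ∀ i, σ i = i
  · exact Or.inl (Equiv.ext hσ)
  push Not at hσ
  obtain ⟨i, hi⟩ := hσ
  right
  refine Equiv.ext fun j => ?_
  refine forall_zmod_of_succ (p := fun j => σ j = j + 1) ((h i).resolve_left hi) ?_ j
  intro j hj
  rcases h (j + 1) with h1 | h1
  · have : j = j + 1 := σ.injective (hj.trans h1.symm)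
    exact h1.trans (by rw [← this]; exact this)
  · exact h1

theorem sign_addRight_zmod (m : ℕ) [NeZero m] :
    Equiv.Perm.sign (Equiv.addRight (1 : ZMod m)) = (-1) ^ (m - 1) := by
  obtain ⟨k, rfl⟩ := Nat.exists_eq_succ_of_ne_zero (NeZero.ne m)
  have := sign_finRotate (k + 1)
  rw [← this]
  congr 1
  refine Equiv.ext fun i => ?_
  exact (finRotate_apply (n := k + 1) i).symm

/-- The determinant of a cyclic bidiagonal matrix. -/
theorem det_cyclic {m : ℕ} [NeZero m] {R : Type*} [CommRing R] (a c : ZMod m → R) :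
    (Matrix.of fun i i' : ZMod m =>
      (if i' = i then a i else 0) + (if i' = i - 1 then c i else 0)).det =
      ∏ i, a i - (-1) ^ m * ∏ i, c i := by
  -- For `m = 1` the two entries of a row lie at the same place, and the rotation is the identity.
  by_cases hm : m = 1
  · subst hm
    rw [Matrix.det_unique]
    have h0 : ∀ x y : ZMod 1, x = y := fun x y => Subsingleton.elim x y
    have e1 : ∏ i, a i = a default := Fintype.prod_unique a
    have e2 : ∏ i, c i = c default := Fintype.prod_unique c
    rw [e1, e2, Matrix.of_apply, if_pos rfl, if_pos (h0 _ _), pow_one, neg_one_mul,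
      sub_neg_eq_add]
    exact congrArg₂ (· + ·) (congrArg a (h0 _ _)) (congrArg c (h0 _ _))
  have hne : (1 : ZMod m) ≠ 0 := by
    have : Fact (1 < m) := ⟨by have := NeZero.ne m; omega⟩
    exact one_ne_zero
  rw [Matrix.det_apply']
  -- A permutation with a nonzero term moves each index by `0` or `1`, so only the identity and the
  -- rotation remain.
  have hsupp : ∀ σ : Equiv.Perm (ZMod m), σ ∉ ({1, Equiv.addRight (1 : ZMod m)} : Finset _) →
      ((Equiv.Perm.sign σ : ℤ) : R) * ∏ i, (Matrix.of fun i i' : ZMod m =>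
        (if i' = i then a i else 0) + (if i' = i - 1 then c i else 0)) (σ i) i = 0 := by
    intro σ hσ
    have : ∃ i, σ i ≠ i ∧ σ i ≠ i + 1 := by
      by_contra hcon
      push Not at hcon
      apply hσ
      have := perm_zmod_eq σ fun i => by
        by_cases h : σ i = i
        · exact Or.inl h
        · exact Or.inr (hcon i h)
      simpa using this
    obtain ⟨i, h1, h2⟩ := this
    rw [Finset.prod_eq_zero (Finset.mem_univ i), mul_zero]
    rw [Matrix.of_apply, if_neg (Ne.symm h1), if_neg, add_zero]
    intro h
    exact h2 (by linear_combination -h)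
  rw [← Finset.sum_subset (Finset.subset_univ _) fun σ _ hσ => hsupp σ hσ]
  rw [Finset.sum_pair]
  · rw [sign_addRight_zmod]
    have e1 : ∀ i : ZMod m, (Matrix.of fun i i' : ZMod m =>
        (if i' = i then a i else 0) + (if i' = i - 1 then c i else 0))
          ((1 : Equiv.Perm (ZMod m)) i) i = a i := by
      intro i
      have : i ≠ i - 1 := fun h => hne (by linear_combination h)
      simp [this]
    have e2 : ∀ i : ZMod m, (Matrix.of fun i i' : ZMod m =>
        (if i' = i then a i else 0) + (if i' = i - 1 then c i else 0))
          (Equiv.addRight (1 : ZMod m) i) i = c (i + 1) := by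
      intro i
      simp [hne]
    simp_rw [e1, e2]
    rw [Fintype.prod_equiv (Equiv.addRight (1 : ZMod m)) (fun i => c (i + 1)) c fun i => rfl]
    obtain ⟨k, rfl⟩ := Nat.exists_eq_succ_of_ne_zero (NeZero.ne m)
    simp [pow_succ]
  · intro h
    have := congrArg (fun σ => σ (0 : ZMod m)) h
    simp at this
    exact hne this.symm

/-! ### The characteristic polynomial at `w = 0` -/

variable {n m : ℕ} [NeZero n] [NeZero m]

theorem val_add_one_of_ne {j : ZMod n} (h : j + 1 ≠ 0) : (j + 1).val = j.val + 1 := by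
  obtain ⟨k, rfl⟩ := Nat.exists_eq_succ_of_ne_zero (NeZero.ne n)
  rcases Nat.lt_or_ge (j.val + 1) (k + 1) with h1 | h1
  · have e : (j + 1) = ((j.val + 1 : ℕ) : ZMod (k + 1)) := by push_cast; simp
    rw [e, ZMod.val_natCast, Nat.mod_eq_of_lt h1]
  · exfalso
    have h2 := ZMod.val_lt j
    have e : (j + 1) = ((j.val + 1 : ℕ) : ZMod (k + 1)) := by push_cast; simp
    have : j.val + 1 = k + 1 := by omega
    rw [this] at e
    exact h (by rw [e]; exact ZMod.natCast_self _)

-- With `w = 0` the `b`-edges from the last column of the fundamental domain back to the first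
-- disappear. The other `b`-edges raise the column index by one, and the `a`- and `c`-edges keep it.
omit [NeZero m] in
theorem Weights.kasteleyn_blockTriangular (W : Weights n m) {R : Type*} [CommRing R] [Algebra ℝ R]
    (z : R) : (W.kasteleyn z 0).BlockTriangular fun v => v.2.val := by
  intro v u huv
  have h1 : u ≠ v := by rintro rfl; exact lt_irrefl _ huv
  have h3 : u ≠ (v.1 - 1, v.2) := by rintro rfl; exact lt_irrefl _ huv
  simp only [Weights.kasteleyn, Matrix.of_apply, if_neg h1, if_neg h3, zero_add, add_zero]
  split_ifs with h4 h5
  · simp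
  · exfalso
    rw [h4] at huv
    simp only at huv
    rw [val_add_one_of_ne h5] at huv
    omega
  · rfl

/-- The factor of the characteristic polynomial at `w = 0` attached to the column type `j`. -/
def Weights.columnDet (W : Weights n m) {R : Type*} [CommRing R] [Algebra ℝ R] (z : R)
    (j : ZMod n) : R :=
  ∏ i, algebraMap ℝ R (W.a i j) - (-1) ^ m * z * ∏ i, algebraMap ℝ R (W.c i j)

/-- Each diagonal block is the cyclic bidiagonal matrix of one column, and `z` enters its product of
`c`-weights once, through the row `0`. So each column contributes a factor of degree one, with one
root. -/
theorem Weights.det_kasteleyn_zero (W : Weights n m) {R : Type*} [CommRing R] [Algebra ℝ R]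
    (z : R) : (W.kasteleyn z 0).det = ∏ j, W.columnDet z j := by
  rw [(W.kasteleyn_blockTriangular z).det]
  have himg : Finset.univ.image (fun v : ZMod m × ZMod n => v.2.val) =
      Finset.univ.image (fun j : ZMod n => j.val) := by
    ext k
    simp
  rw [himg, Finset.prod_image fun i _ j _ h => ZMod.val_injective n h]
  refine Finset.prod_congr rfl fun j _ => ?_
  let e : ZMod m ≃ {v : ZMod m × ZMod n // v.2.val = j.val} :=
    { toFun := fun i => ⟨(i, j), rfl⟩
      invFun := fun v => v.1.1
      left_inv := fun i => rfl
      right_inv := fun v => Subtype.ext (Prod.ext rfl (ZMod.val_injective n v.2).symm) }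
  rw [← Matrix.det_submatrix_equiv_self e]
  have : ((W.kasteleyn z 0).toSquareBlock (fun v => v.2.val) j.val).submatrix e e =
      Matrix.of fun i i' : ZMod m => (if i' = i then algebraMap ℝ R (W.a i j) else 0) +
        (if i' = i - 1 then algebraMap ℝ R (W.c i j) * (if i = 0 then z else 1) else 0) := by
    ext i i'
    -- A `b`-edge stays in its column only if `n = 1`; it then leaves the fundamental domain and
    -- carries the factor `w = 0`.
    have hb : (if i' = i ∧ j = j + 1 then
        algebraMap ℝ R (W.b i j) * (if j + 1 = 0 then 0 else 1) else 0) = 0 := by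
      split_ifs with h1 h2
      · simp
      · exfalso
        have := val_add_one_of_ne h2
        rw [← h1.2] at this
        omega
      · rfl
    simp only [e, Matrix.submatrix_apply, Matrix.toSquareBlock, Matrix.toSquareBlockProp,
      Weights.kasteleyn, Matrix.of_apply, Equiv.coe_fn_mk, Prod.mk.injEq, and_true,
      Matrix.toBlock_apply, hb, add_zero]
  rw [this, det_cyclic, Finset.prod_mul_distrib, Finset.prod_ite_eq' Finset.univ (0 : ZMod m)
    fun _ => z]
  simp [Weights.columnDet]
  ring

end BeadDimer

end

/-! ### Kernel vectors and adjugate of `K(r, 0)`: supports, signs and rank. -/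

noncomputable section

namespace BeadDimer

variable {n m : ℕ} [NeZero n] [NeZero m]

/-! ### The kernel of the Kasteleyn matrix at the root of a tentacle -/

theorem Weights.exp_abscissa (W : Weights n m) (j : ZMod n) :
    Real.exp (W.abscissa j) = (∏ i, W.a i j) / ∏ i, W.c i j := by
  rw [Weights.abscissa, Real.exp_sum, ← Finset.prod_div_distrib]
  exact Finset.prod_congr rfl fun i _ => Real.exp_log (div_pos (W.a_pos i j) (W.c_pos i j))

theorem Weights.prod_c_pos (W : Weights n m) (j : ZMod n) : 0 < ∏ i, W.c i j :=
  Finset.prod_pos fun i _ => W.c_pos i j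

theorem Weights.kasteleyn_mulVec (W : Weights n m) {R : Type*} [CommRing R] [Algebra ℝ R] (z w : R)
    (f : ZMod m × ZMod n → R) (v : ZMod m × ZMod n) :
    (W.kasteleyn z w).mulVec f v = algebraMap ℝ R (W.a v.1 v.2) * f v +
      algebraMap ℝ R (W.b v.1 v.2) * (if v.2 + 1 = 0 then w else 1) * f (v.1, v.2 + 1) +
      algebraMap ℝ R (W.c v.1 v.2) * (if v.1 = 0 then z else 1) * f (v.1 - 1, v.2) := by
  simp only [Matrix.mulVec, dotProduct, Weights.kasteleyn, Matrix.of_apply, add_mul,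
    Finset.sum_add_distrib, ite_mul, zero_mul, Finset.sum_ite_eq',
    Finset.mem_univ, if_true]

/-- The alternating sign of the row `i`. -/
def rowSign (i : ZMod m) : ℝ := (-1) ^ i.val

omit [NeZero m] in
theorem rowSign_mul_self (i : ZMod m) : rowSign i * rowSign i = 1 := by
  rw [rowSign, ← pow_add, ← two_mul, pow_mul]
  simp

/-- Reversing the rows costs the sign `(-1)^(m - 1)`. For `i = 0` this is the sign of the last row,
which the factor `(-1)^m` of the root turns into the sign of an ordinary step. -/
theorem rowSign_neg_one_sub (i : ZMod m) : rowSign (-1 - i) = (-1) ^ (m - 1) * rowSign i := by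
  obtain ⟨k, rfl⟩ := Nat.exists_eq_succ_of_ne_zero (NeZero.ne m)
  have hi := ZMod.val_lt i
  have e : (-1 - i : ZMod (k + 1)) = ((k - i.val : ℕ) : ZMod (k + 1)) := by
    rw [Nat.cast_sub (by omega), ZMod.natCast_zmod_val]
    have : ((k + 1 : ℕ) : ZMod (k + 1)) = 0 := ZMod.natCast_self _
    push_cast at this
    linear_combination -this
  have e2 : (-1 - i : ZMod (k + 1)).val = k - i.val := by
    rw [e, ZMod.val_natCast, Nat.mod_eq_of_lt (by omega)]
  rw [rowSign, rowSign, e2, show k.succ - 1 = k from rfl, ← pow_add]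
  generalize i.val = p at *
  obtain ⟨d, rfl⟩ := Nat.exists_eq_add_of_le (show p ≤ k by omega)
  rw [Nat.add_sub_cancel_left, show p + d + p = d + 2 * p by ring, pow_add, pow_mul]
  simp

/-- All the values of `g` are positive, or all are negative. -/
def SameSign {ι : Type*} (g : ι → ℝ) : Prop := (∀ i, 0 < g i) ∨ ∀ i, g i < 0

theorem SameSign.ne_zero {ι : Type*} {g : ι → ℝ} (h : SameSign g) (i : ι) : g i ≠ 0 :=
  h.elim (fun h => (h i).ne') fun h => (h i).ne

theorem SameSign.mul_pos {ι : Type*} {g : ι → ℝ} (h : SameSign g) (i j : ι) : 0 < g i * g j :=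
  h.elim (fun h => _root_.mul_pos (h i) (h j)) fun h => mul_pos_of_neg_of_neg (h i) (h j)

theorem SameSign.neg {ι : Type*} {g : ι → ℝ} (h : SameSign g) : SameSign fun i => -g i :=
  h.elim (fun h => Or.inr fun i => neg_lt_zero.2 (h i)) fun h => Or.inl fun i => neg_pos.2 (h i)

/-- Going once round the cycle gives `(∏ c / ∏ a) * g i < g i`, so the sign of every `g i` is that
of `1 - ∏ c / ∏ a`. -/
theorem sameSign_of_cyclic_pos {a c g : ZMod m → ℝ} (ha : ∀ i, 0 < a i) (hc : ∀ i, 0 < c i)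
    (hne : ∏ i, c i ≠ ∏ i, a i) (h : ∀ i, 0 < a i * g i - c i * g (i - 1)) : SameSign g := by
  have hρ : ∀ i, 0 < c i / a i := fun i => div_pos (hc i) (ha i)
  have hA : 0 < ∏ i, a i := Finset.prod_pos fun i _ => ha i
  have key := cyclic_lt (g := g) hρ fun i => by
    have h1 := h (i + 1)
    rw [add_sub_cancel_right] at h1
    rw [div_mul_eq_mul_div, div_lt_iff₀ (ha _)]
    linarith
  rw [Finset.prod_div_distrib] at key
  rcases lt_or_gt_of_ne hne with h1 | h1
  · left
    intro i
    have h2 : (∏ i, c i) / ∏ i, a i < 1 := (div_lt_one hA).2 h1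
    have h3 := key i
    by_contra h4
    nlinarith
  · right
    intro i
    have h2 : 1 < (∏ i, c i) / ∏ i, a i := (one_lt_div hA).2 h1
    have h3 := key i
    by_contra h4
    nlinarith

theorem sameSign_of_cyclic {a c g : ZMod m → ℝ} (ha : ∀ i, 0 < a i) (hc : ∀ i, 0 < c i)
    (hne : ∏ i, c i ≠ ∏ i, a i) (h : SameSign fun i => a i * g i - c i * g (i - 1)) :
    SameSign g := by
  rcases h with h | h
  · exact sameSign_of_cyclic_pos ha hc hne h
  · have := (sameSign_of_cyclic_pos (g := fun i => -g i) ha hc hne fun i => by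
      have := h i
      simp only at this
      linarith).neg
    simpa using this

/-- Going once round the cycle multiplies `g i` by `∏ c / ∏ a`, which is not one. -/
theorem eq_zero_of_cyclic {a c g : ZMod m → ℝ} (ha : ∀ i, 0 < a i)
    (hne : ∏ i, c i ≠ ∏ i, a i) (h : ∀ i, a i * g i - c i * g (i - 1) = 0) (i : ZMod m) :
    g i = 0 := by
  have hA : 0 < ∏ i, a i := Finset.prod_pos fun i _ => ha i
  have key := cyclic_eq (ρ := fun i => c i / a i) (g := g) (fun i => by
    have h1 := h (i + 1)
    rw [add_sub_cancel_right] at h1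
    rw [div_mul_eq_mul_div, eq_div_iff (ha _).ne']
    linarith) i
  rw [Finset.prod_div_distrib] at key
  have h2 : (∏ i, c i) / ∏ i, a i ≠ 1 := fun h => hne ((div_eq_one_iff_eq hA.ne').1 h)
  by_contra h3
  apply h2
  field_simp at key ⊢
  exact key.symm

/-- For the column `j₀` itself, where the product around the cycle is one: all ratios are positive,
so the sign of row `0` propagates. -/
theorem sameSign_of_cyclic_homogeneous {a c g : ZMod m → ℝ} (ha : ∀ i, 0 < a i) (hc : ∀ i, 0 < c i)
    (h : ∀ i, a i * g i - c i * g (i - 1) = 0) (h0 : g 0 ≠ 0) : SameSign g := by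
  have hstep : ∀ i, g (i + 1) = c (i + 1) / a (i + 1) * g i := fun i => by
    have h1 := h (i + 1)
    rw [add_sub_cancel_right] at h1
    rw [div_mul_eq_mul_div, eq_div_iff (ha _).ne']
    linarith
  rcases lt_or_gt_of_ne h0 with h1 | h1
  · right
    refine forall_zmod_of_succ h1 fun j hj => ?_
    rw [hstep]
    exact mul_neg_of_pos_of_neg (div_pos (hc _) (ha _)) hj
  · left
    refine forall_zmod_of_succ h1 fun j hj => ?_
    rw [hstep]
    exact mul_pos (div_pos (hc _) (ha _)) hj

theorem eq_zero_of_cyclic_homogeneous {a c g : ZMod m → ℝ} (ha : ∀ i, 0 < a i)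
    (h : ∀ i, a i * g i - c i * g (i - 1) = 0) (h0 : g 0 = 0) (i : ZMod m) : g i = 0 := by
  refine forall_zmod_of_succ (p := fun i => g i = 0) h0 (fun j hj => ?_) i
  have h1 := h (j + 1)
  rw [add_sub_cancel_right, hj, mul_zero, sub_zero] at h1
  exact (mul_eq_zero.1 h1).resolve_left (ha _).ne'

/-- The modulus of the weight of the `c`-edges at the root of the tentacle `j₀`. -/
def Weights.rootC (W : Weights n m) (j₀ : ZMod n) (i : ZMod m) (j : ZMod n) : ℝ :=
  W.c i j * if i = 0 then Real.exp (W.abscissa j₀) else 1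

theorem Weights.rootC_pos (W : Weights n m) (j₀ : ZMod n) (i : ZMod m) (j : ZMod n) :
    0 < W.rootC j₀ i j := by
  rw [Weights.rootC]
  split_ifs
  · exact mul_pos (W.c_pos i j) (Real.exp_pos _)
  · simpa using W.c_pos i j

theorem Weights.prod_rootC (W : Weights n m) (j₀ j : ZMod n) :
    ∏ i, W.rootC j₀ i j = Real.exp (W.abscissa j₀) * ∏ i, W.c i j := by
  simp only [Weights.rootC, Finset.prod_mul_distrib]
  rw [Finset.prod_ite_eq' Finset.univ (0 : ZMod m) fun _ => Real.exp (W.abscissa j₀)]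
  simp [mul_comm]

/-- Genericity in the form in which it is used: at the root of the tentacle `j₀`, the cyclic
recursion of any other column has a product around the cycle different from one. -/
theorem Weights.prod_rootC_ne (W : Weights n m) {j₀ j : ZMod n}
    (h : W.abscissa j ≠ W.abscissa j₀) : ∏ i, W.rootC j₀ i j ≠ ∏ i, W.a i j := by
  rw [W.prod_rootC]
  intro h1
  apply h
  apply Real.exp_injective
  rw [W.exp_abscissa j, div_eq_iff (W.prod_c_pos j).ne', h1]

/-- The equations of a kernel vector, in the gauge where they are positive. -/
theorem Weights.kernel_column_eq (W : Weights n m) (j₀ : ZMod n) {f : ZMod m × ZMod n → ℝ}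
    (hf : (W.kasteleyn (W.root j₀) 0).mulVec f = 0) (i : ZMod m) (j : ZMod n) :
    W.a i j * (rowSign i * f (i, j)) - W.rootC j₀ i j * (rowSign (i - 1) * f (i - 1, j)) =
      -((if j + 1 = 0 then 0 else W.b i j) * (rowSign i * f (i, j + 1))) := by
  have h1 := congrFun hf (i, j)
  rw [W.kasteleyn_mulVec] at h1
  simp only [Algebra.algebraMap_self, RingHom.id_apply, Pi.zero_apply] at h1
  -- The gauge `rowSign` changes the sign of every `c`-term. At the row `0`, where the recursion
  -- wraps around, the sign `(-1)^m` of the root provides the missing factor.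
  have h2 : rowSign i * (W.c i j * (if i = 0 then W.root j₀ else 1)) =
      -(W.rootC j₀ i j * rowSign (i - 1)) := by
    rw [Weights.rootC]
    split_ifs with h3
    · subst h3
      obtain ⟨k, hk⟩ := Nat.exists_eq_succ_of_ne_zero (NeZero.ne m)
      have e := rowSign_neg_one_sub (0 : ZMod m)
      have e0 : rowSign (0 : ZMod m) = 1 := by simp [rowSign]
      rw [show (0 - 1 : ZMod m) = -1 - 0 by ring, e, e0, Weights.root]
      have : (-1 : ℝ) ^ m = -(-1) ^ (m - 1) := by
        rw [hk, pow_succ]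
        simp
      rw [this]
      ring
    · have e : rowSign i = -rowSign (i - 1) := by
        have h4 : (i - 1 : ZMod m) + 1 ≠ 0 := by simpa using h3
        have h5 := val_add_one_of_ne h4
        rw [sub_add_cancel] at h5
        rw [rowSign, rowSign, h5, pow_succ]
        ring
      rw [e]
      ring
  have h3 : (if j + 1 = 0 then (0 : ℝ) else W.b i j) = W.b i j * if j + 1 = 0 then 0 else 1 := by
    split_ifs <;> simp
  rw [h3]
  linear_combination rowSign i * h1 - f (i - 1, j) * h2

/-- Downward induction on the columns of the fundamental domain. -/
theorem zmod_downward_induction {p : ZMod n → Prop} (h : ∀ j, (j + 1 ≠ 0 → p (j + 1)) → p j)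
    (j : ZMod n) : p j := by
  have key : ∀ k : ℕ, ∀ j : ZMod n, n ≤ j.val + k → p j := by
    intro k
    induction k with
    | zero => intro j hj; exact absurd (ZMod.val_lt j) (by omega)
    | succ k ih =>
      intro j hj
      refine h j fun h1 => ih _ ?_
      rw [val_add_one_of_ne h1]
      omega
  exact key n j (by omega)

/-- By triangularity a column is driven only by the column to its right. Starting from the last
column, the columns after `j₀` have no source and a recursion without nonzero periodic solution. -/
theorem Weights.kernel_eq_zero_right (W : Weights n m) {j₀ : ZMod n}
    (hgen : ∀ j, j ≠ j₀ → W.abscissa j ≠ W.abscissa j₀) {f : ZMod m × ZMod n → ℝ}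
    (hf : (W.kasteleyn (W.root j₀) 0).mulVec f = 0) (j : ZMod n) (hj : j₀.val < j.val)
    (i : ZMod m) : f (i, j) = 0 := by
  induction j using zmod_downward_induction generalizing i with | h j ih
  have hne : j ≠ j₀ := by rintro rfl; exact lt_irrefl _ hj
  have h1 := eq_zero_of_cyclic (a := fun i => W.a i j) (c := fun i => W.rootC j₀ i j)
    (g := fun i => rowSign i * f (i, j)) (fun i => W.a_pos i j) (W.prod_rootC_ne (hgen j hne))
    (fun i => by
      rw [W.kernel_column_eq j₀ hf]
      split_ifs with h2
      · simp
      · rw [ih h2 (by rw [val_add_one_of_ne h2]; omega)]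
        simp) i
  have h2 := rowSign_mul_self i
  exact (mul_eq_zero.1 h1).resolve_left fun h3 => by rw [h3] at h2; simp at h2

/-- The kernel is at most a line: the value at `(0, j₀)` determines the column `j₀`, and every other
column is determined by the one to its right. -/
theorem Weights.kernel_eq_zero (W : Weights n m) {j₀ : ZMod n}
    (hgen : ∀ j, j ≠ j₀ → W.abscissa j ≠ W.abscissa j₀) {f : ZMod m × ZMod n → ℝ}
    (hf : (W.kasteleyn (W.root j₀) 0).mulVec f = 0) (h0 : f (0, j₀) = 0) : f = 0 := by
  funext v
  obtain ⟨i, j⟩ := v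
  induction j using zmod_downward_induction generalizing i with | h j ih
  have h2 : ∀ i, W.a i j * (rowSign i * f (i, j)) -
      W.rootC j₀ i j * (rowSign (i - 1) * f (i - 1, j)) = 0 := fun i => by
    rw [W.kernel_column_eq j₀ hf]
    split_ifs with h2
    · simp
    · rw [ih h2]
      simp
  have h1 : rowSign i * f (i, j) = 0 := by
    by_cases hne : j = j₀
    · subst hne
      exact eq_zero_of_cyclic_homogeneous (a := fun i => W.a i j) (c := fun i => W.rootC j i j)
        (g := fun i => rowSign i * f (i, j)) (fun i => W.a_pos i j) h2 (by simp [h0]) i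
    · exact eq_zero_of_cyclic (a := fun i => W.a i j) (c := fun i => W.rootC j₀ i j)
        (g := fun i => rowSign i * f (i, j)) (fun i => W.a_pos i j)
        (W.prod_rootC_ne (hgen j hne)) h2 i
  have h2 := rowSign_mul_self i
  exact (mul_eq_zero.1 h1).resolve_left fun h3 => by rw [h3] at h2; simp at h2

/-- In the column `j₀` the solution is homogeneous and of constant sign. To the left, each column
solves a recursion whose source, a positive multiple of minus the next column, has constant sign. -/
theorem Weights.kernel_sameSign (W : Weights n m) {j₀ : ZMod n}
    (hgen : ∀ j, j ≠ j₀ → W.abscissa j ≠ W.abscissa j₀) {f : ZMod m × ZMod n → ℝ}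
    (hf : (W.kasteleyn (W.root j₀) 0).mulVec f = 0) (h0 : f ≠ 0) (j : ZMod n)
    (hj : j.val ≤ j₀.val) : SameSign fun i => rowSign i * f (i, j) := by
  induction j using zmod_downward_induction with | h j ih
  by_cases hne : j = j₀
  · subst hne
    refine sameSign_of_cyclic_homogeneous (a := fun i => W.a i j) (c := fun i => W.rootC j i j)
      (fun i => W.a_pos i j) (fun i => W.rootC_pos j i j) (fun i => ?_) ?_
    · rw [W.kernel_column_eq j hf]
      split_ifs with h2
      · simp
      · rw [W.kernel_eq_zero_right hgen hf (j + 1) (by rw [val_add_one_of_ne h2]; omega)]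
        simp
    · intro h1
      exact h0 (W.kernel_eq_zero hgen hf (by simpa [rowSign] using h1))
  · have hlt : j.val < j₀.val := lt_of_le_of_ne hj fun h => hne (ZMod.val_injective n h)
    have h2 : j + 1 ≠ 0 := by
      intro h3
      have h4 : (j.val + 1 : ℕ) = (j + 1 : ZMod n) := by push_cast; simp
      rw [h3] at h4
      have h5 := (ZMod.natCast_eq_zero_iff _ _).1 h4
      have h6 := ZMod.val_lt j₀
      exact absurd (Nat.le_of_dvd (by omega) h5) (by omega)
    have h3 := ih h2 (by rw [val_add_one_of_ne h2]; omega)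
    refine sameSign_of_cyclic (a := fun i => W.a i j) (c := fun i => W.rootC j₀ i j)
      (fun i => W.a_pos i j) (fun i => W.rootC_pos j₀ i j) (W.prod_rootC_ne (hgen j hne)) ?_
    simp only [W.kernel_column_eq j₀ hf, if_neg h2]
    rcases h3 with h3 | h3
    · exact Or.inr fun i => neg_lt_zero.2 (mul_pos (W.b_pos i j) (h3 i))
    · exact Or.inl fun i => neg_pos.2 (mul_neg_of_pos_of_neg (W.b_pos i j) (h3 i))

/-! ### The reflected weights -/

/-- The weights obtained by a rotation of the lattice by a half-turn. -/
def Weights.reflect (W : Weights n m) : Weights n m where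
  a i j := W.a (-1 - i) (-1 - j)
  b i j := W.b (-1 - i) (-1 - j - 1)
  c i j := W.c (-1 - i + 1) (-1 - j)
  a_pos _ _ := W.a_pos _ _
  b_pos _ _ := W.b_pos _ _
  c_pos _ _ := W.c_pos _ _

/-- The half-turn of the fundamental domain. -/
def halfTurn (v : ZMod m × ZMod n) : ZMod m × ZMod n := (-1 - v.1, -1 - v.2)

omit [NeZero n] [NeZero m] in
theorem halfTurn_halfTurn (v : ZMod m × ZMod n) : halfTurn (halfTurn v) = v := by
  simp [halfTurn]

-- A half-turn exchanges the white and the black vertices, hence transposes the matrix. The shifts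
-- in `Weights.reflect` come from this: the weight of an edge is now read at the image of its black
-- end. Edges leaving a fundamental domain are sent to such edges.
omit [NeZero n] [NeZero m] in
theorem Weights.kasteleyn_reflect (W : Weights n m) {R : Type*} [CommRing R] [Algebra ℝ R]
    (z w : R) (u v : ZMod m × ZMod n) :
    W.reflect.kasteleyn z w (halfTurn u) (halfTurn v) = W.kasteleyn z w v u := by
  obtain ⟨i, j⟩ := u
  obtain ⟨k, l⟩ := v
  simp only [Weights.kasteleyn, Matrix.of_apply, halfTurn, Weights.reflect, Prod.mk.injEq]
  have e1 : (-1 - k = -1 - i ∧ -1 - l = -1 - j) ↔ (i = k ∧ j = l) := by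
    constructor
    · rintro ⟨h1, h2⟩
      exact ⟨by linear_combination h1, by linear_combination h2⟩
    · rintro ⟨rfl, rfl⟩
      exact ⟨rfl, rfl⟩
  have e2 : (-1 - k = -1 - i ∧ -1 - l = -1 - j + 1) ↔ (i = k ∧ j = l + 1) := by
    constructor
    · rintro ⟨h1, h2⟩
      exact ⟨by linear_combination h1, by linear_combination h2⟩
    · rintro ⟨rfl, rfl⟩
      exact ⟨rfl, by ring⟩
  have e3 : (-1 - k = -1 - i - 1 ∧ -1 - l = -1 - j) ↔ (i = k - 1 ∧ j = l) := by
    constructor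
    · rintro ⟨h1, h2⟩
      exact ⟨by linear_combination h1, by linear_combination h2⟩
    · rintro ⟨rfl, rfl⟩
      exact ⟨by ring, rfl⟩
  simp only [e1, e2, e3]
  congr 1
  · congr 1
    · split_ifs with h
      · obtain ⟨rfl, rfl⟩ := h
        simp
      · rfl
    · by_cases h : i = k ∧ j = l + 1
      · obtain ⟨rfl, rfl⟩ := h
        have e4 : (-1 - (l + 1) + 1 = 0) ↔ (l + 1 = 0) := by
          constructor
          · intro h; linear_combination -h
          · intro h; linear_combination -h
        simp [e4]
      · simp [h]
  · by_cases h : i = k - 1 ∧ j = l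
    · obtain ⟨rfl, rfl⟩ := h
      have e4 : (-1 - (k - 1) = 0) ↔ (k = 0) := by
        constructor
        · intro h; linear_combination -h
        · intro h; linear_combination -h
      simp [e4]
    · simp [h]

theorem Weights.abscissa_reflect (W : Weights n m) (j : ZMod n) :
    W.reflect.abscissa j = W.abscissa (-1 - j) := by
  apply Real.exp_injective
  rw [Weights.exp_abscissa, Weights.exp_abscissa]
  congr 1
  · exact Fintype.prod_equiv (Equiv.subLeft (-1 : ZMod m)) _ _ fun i => rfl
  · exact Fintype.prod_equiv ((Equiv.subLeft (-1 : ZMod m)).trans (Equiv.addRight 1)) _ _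
      fun i => rfl

theorem Weights.root_reflect (W : Weights n m) (j : ZMod n) :
    W.reflect.root (-1 - j) = W.root j := by
  rw [Weights.root, Weights.root, W.abscissa_reflect]
  simp

/-- This transfers the results on right kernel vectors to left ones; as the half-turn reverses the
order of the columns, left kernel vectors are supported on the columns from `j₀` on. -/
theorem Weights.vecMul_reflect (W : Weights n m) {j₀ : ZMod n} {f : ZMod m × ZMod n → ℝ}
    (hf : Matrix.vecMul f (W.kasteleyn (W.root j₀) 0) = 0) :
    (W.reflect.kasteleyn (W.reflect.root (-1 - j₀)) 0).mulVec (f ∘ halfTurn) = 0 := by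
  funext v
  have h1 := congrFun hf (halfTurn v)
  rw [W.root_reflect]
  simp only [Matrix.vecMul, Matrix.mulVec, dotProduct, Pi.zero_apply] at h1 ⊢
  refine Eq.trans ?_ h1
  refine Fintype.sum_equiv (Function.Involutive.toPerm halfTurn halfTurn_halfTurn) _ _ fun u => ?_
  change _ = f (halfTurn u) * W.kasteleyn (W.root j₀) 0 (halfTurn u) (halfTurn v)
  rw [← W.kasteleyn_reflect, halfTurn_halfTurn, halfTurn_halfTurn,
    mul_comm]
  rfl

theorem val_neg_one_sub (j : ZMod n) : (-1 - j).val = n - 1 - j.val := by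
  obtain ⟨k, rfl⟩ := Nat.exists_eq_succ_of_ne_zero (NeZero.ne n)
  have hi := ZMod.val_lt j
  have e : (-1 - j : ZMod (k + 1)) = ((k - j.val : ℕ) : ZMod (k + 1)) := by
    rw [Nat.cast_sub (by omega), ZMod.natCast_zmod_val]
    have : ((k + 1 : ℕ) : ZMod (k + 1)) = 0 := ZMod.natCast_self _
    push_cast at this
    linear_combination -this
  refine (congrArg ZMod.val e).trans ?_
  rw [ZMod.val_natCast, Nat.mod_eq_of_lt (by omega)]
  rfl

theorem Weights.reflect_generic (W : Weights n m) {j₀ : ZMod n}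
    (hgen : ∀ j, j ≠ j₀ → W.abscissa j ≠ W.abscissa j₀) (j : ZMod n) (hj : j ≠ -1 - j₀) :
    W.reflect.abscissa j ≠ W.reflect.abscissa (-1 - j₀) := by
  rw [W.abscissa_reflect, W.abscissa_reflect, sub_sub_cancel]
  exact hgen _ fun h => hj (by rw [← h]; ring)

theorem Weights.leftKernel_eq_zero_left (W : Weights n m) {j₀ : ZMod n}
    (hgen : ∀ j, j ≠ j₀ → W.abscissa j ≠ W.abscissa j₀) {f : ZMod m × ZMod n → ℝ}
    (hf : Matrix.vecMul f (W.kasteleyn (W.root j₀) 0) = 0) (j : ZMod n) (hj : j.val < j₀.val)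
    (i : ZMod m) : f (i, j) = 0 := by
  have h1 := W.reflect.kernel_eq_zero_right (W.reflect_generic hgen) (W.vecMul_reflect hf)
    (-1 - j) (by
      rw [val_neg_one_sub, val_neg_one_sub]
      have := ZMod.val_lt j₀
      omega) (-1 - i)
  simpa [halfTurn] using h1

theorem Weights.leftKernel_sameSign (W : Weights n m) {j₀ : ZMod n}
    (hgen : ∀ j, j ≠ j₀ → W.abscissa j ≠ W.abscissa j₀) {f : ZMod m × ZMod n → ℝ}
    (hf : Matrix.vecMul f (W.kasteleyn (W.root j₀) 0) = 0) (h0 : f ≠ 0) (j : ZMod n)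
    (hj : j₀.val ≤ j.val) : SameSign fun i => rowSign i * f (i, j) := by
  have h1 := W.reflect.kernel_sameSign (W.reflect_generic hgen) (W.vecMul_reflect hf) (by
      intro h2
      apply h0
      funext v
      simpa [halfTurn_halfTurn] using congrFun h2 (halfTurn v)) (-1 - j) (by
      rw [val_neg_one_sub, val_neg_one_sub]
      have := ZMod.val_lt j
      omega)
  have h2 : ∀ i : ZMod m, rowSign i * f (i, j) =
      (-1) ^ (m - 1) * (rowSign (-1 - i) * (f ∘ halfTurn) (-1 - i, -1 - j)) := fun i => by
    rw [rowSign_neg_one_sub]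
    simp only [Function.comp_apply, halfTurn, sub_sub_cancel]
    rw [← mul_assoc, ← mul_assoc, ← pow_add, ← two_mul, pow_mul]
    simp
  rcases neg_one_pow_eq_or ℝ (m - 1) with h3 | h3 <;> simp only [h2, h3]
  · rcases h1 with h1 | h1
    · exact Or.inl fun i => by simpa using h1 (-1 - i)
    · exact Or.inr fun i => by simpa using h1 (-1 - i)
  · rcases h1 with h1 | h1
    · exact Or.inr fun i => by simpa using h1 (-1 - i)
    · exact Or.inl fun i => by simpa using h1 (-1 - i)

end BeadDimer

end

noncomputable section

namespace BeadDimer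

variable {n m : ℕ} [NeZero n] [NeZero m]

/-! ### The adjugate of the Kasteleyn matrix at the root of a tentacle -/

/-- Jacobi's formula for the derivative of a determinant along a line. -/
theorem hasDerivAt_det_add_smul {𝕜 ι : Type*} [NontriviallyNormedField 𝕜] [Fintype ι]
    [DecidableEq ι] (M E : Matrix ι ι 𝕜) (x : 𝕜) (s₀ : 𝕜) (hx : x = s₀) :
    HasDerivAt (fun s => (M + (s - s₀) • E).det) (∑ v, ∑ u, E v u * M.adjugate u v) x := by
  subst hx
  have h1 : ∀ u, ∑ v, E v u * M.adjugate u v = (M.updateCol u fun v => E v u).det := fun u => by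
    rw [← Matrix.cramer_apply, Matrix.cramer_eq_adjugate_mulVec]
    simp only [Matrix.mulVec, dotProduct]
    exact Finset.sum_congr rfl fun v _ => mul_comm _ _
  rw [Finset.sum_comm]
  simp only [h1, Matrix.det_apply']
  rw [Finset.sum_comm]
  refine HasDerivAt.fun_sum fun σ _ => ?_
  have h2 : ∀ u, HasDerivAt (fun s => (M + (s - x) • E) (σ u) u) (E (σ u) u) x := fun u => by
    have := (((hasDerivAt_id x).sub_const x).mul_const (E (σ u) u)).const_add (M (σ u) u)
    simpa using this
  have h3 := (HasDerivAt.fun_finsetProd fun u (_ : u ∈ Finset.univ) => h2 u).const_mul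
    ((Equiv.Perm.sign σ : ℤ) : 𝕜)
  refine h3.congr_deriv ?_
  rw [← Finset.mul_sum]
  congr 1
  refine Finset.sum_congr rfl fun u _ => ?_
  rw [← Finset.prod_erase_mul Finset.univ _ (Finset.mem_univ u), Matrix.updateCol_self, smul_eq_mul]
  congr 1
  refine Finset.prod_congr rfl fun k hk => ?_
  rw [Matrix.updateCol_ne (Finset.ne_of_mem_erase hk)]
  simp

/-- The derivative of the Kasteleyn matrix in `z`. -/
def Weights.kasteleynDz (W : Weights n m) (R : Type*) [CommRing R] [Algebra ℝ R] :
    Matrix (ZMod m × ZMod n) (ZMod m × ZMod n) R :=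
  Matrix.of fun v u => if u = (v.1 - 1, v.2) ∧ v.1 = 0 then algebraMap ℝ R (W.c v.1 v.2) else 0

/-- The derivative of the Kasteleyn matrix in `w`. -/
def Weights.kasteleynDw (W : Weights n m) (R : Type*) [CommRing R] [Algebra ℝ R] :
    Matrix (ZMod m × ZMod n) (ZMod m × ZMod n) R :=
  Matrix.of fun v u => if u = (v.1, v.2 + 1) ∧ v.2 + 1 = 0 then algebraMap ℝ R (W.b v.1 v.2) else 0

theorem Weights.kasteleyn_z (W : Weights n m) {R : Type*} [CommRing R] [Algebra ℝ R] (z z₀ w : R) :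
    W.kasteleyn z w = W.kasteleyn z₀ w + (z - z₀) • W.kasteleynDz R := by
  ext v u
  simp only [Weights.kasteleyn, Weights.kasteleynDz, Matrix.of_apply, Matrix.add_apply,
    Matrix.smul_apply, smul_eq_mul]
  rw [ite_and]
  split_ifs <;> ring

theorem Weights.kasteleyn_w (W : Weights n m) {R : Type*} [CommRing R] [Algebra ℝ R] (z w w₀ : R) :
    W.kasteleyn z w = W.kasteleyn z w₀ + (w - w₀) • W.kasteleynDw R := by
  ext v u
  simp only [Weights.kasteleyn, Weights.kasteleynDw, Matrix.of_apply, Matrix.add_apply,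
    Matrix.smul_apply, smul_eq_mul]
  rw [ite_and]
  split_ifs <;> ring

theorem Weights.kasteleyn_map (W : Weights n m) {R S : Type*} [CommRing R] [Algebra ℝ R]
    [CommRing S] [Algebra ℝ S] (f : R →ₐ[ℝ] S) (z w : R) :
    (W.kasteleyn z w).map f = W.kasteleyn (f z) (f w) := by
  ext v u
  simp only [Weights.kasteleyn, Matrix.of_apply, Matrix.map_apply, map_add, apply_ite f, map_mul,
    AlgHom.commutes, map_zero, map_one]

/-- The adjugate of `K (r, 0)`, `r` the root of the tentacle `j₀`. -/
def Weights.rootAdj (W : Weights n m) (j₀ : ZMod n) :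
    Matrix (ZMod m × ZMod n) (ZMod m × ZMod n) ℝ :=
  (W.kasteleyn (W.root j₀) 0).adjugate

theorem Weights.adjugate_ofReal (W : Weights n m) (j₀ : ZMod n) (u v : ZMod m × ZMod n) :
    (W.kasteleyn (W.root j₀ : ℂ) 0).adjugate u v = (W.rootAdj j₀ u v : ℂ) := by
  have h1 := W.kasteleyn_map (Algebra.ofId ℝ ℂ) (W.root j₀) 0
  rw [map_zero] at h1
  have h2 : (Algebra.ofId ℝ ℂ) (W.root j₀) = (W.root j₀ : ℂ) := rfl
  rw [h2] at h1
  rw [← h1, Weights.rootAdj]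
  have h3 := (Algebra.ofId ℝ ℂ).map_adjugate (W.kasteleyn (W.root j₀) 0)
  have h4 := congrFun (congrFun h3 u) v
  simp only [AlgHom.mapMatrix_apply, Matrix.map_apply] at h4
  exact h4.symm

/-- `∂₁P (r, 0)`. -/
def Weights.dz (W : Weights n m) (j₀ : ZMod n) : ℝ :=
  ∑ v, ∑ u, W.kasteleynDz ℝ v u * W.rootAdj j₀ u v

/-- `∂₂P (r, 0)`. -/
def Weights.dw (W : Weights n m) (j₀ : ZMod n) : ℝ :=
  ∑ v, ∑ u, W.kasteleynDw ℝ v u * W.rootAdj j₀ u v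

theorem Weights.hasDerivAt_dz (W : Weights n m) (j₀ : ZMod n) :
    HasDerivAt (fun z : ℝ => W.charPoly z 0) (W.dz j₀) (W.root j₀) := by
  have h1 := hasDerivAt_det_add_smul (W.kasteleyn (W.root j₀) 0) (W.kasteleynDz ℝ) (W.root j₀)
    (W.root j₀) rfl
  simp only [← W.kasteleyn_z] at h1
  exact h1

theorem Weights.hasDerivAt_dw (W : Weights n m) (j₀ : ZMod n) :
    HasDerivAt (fun w : ℝ => W.charPoly (W.root j₀) w) (W.dw j₀) 0 := by
  have h1 := hasDerivAt_det_add_smul (W.kasteleyn (W.root j₀) 0) (W.kasteleynDw ℝ) 0 0 rfl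
  simp only [← W.kasteleyn_w] at h1
  exact h1

theorem Weights.hasDerivAt_dz_complex (W : Weights n m) (j₀ : ZMod n) :
    HasDerivAt (fun z : ℂ => (W.kasteleyn z 0).det) (W.dz j₀ : ℂ) (W.root j₀ : ℂ) := by
  have h1 := hasDerivAt_det_add_smul (W.kasteleyn (W.root j₀ : ℂ) 0) (W.kasteleynDz ℂ) (W.root j₀)
    (W.root j₀) rfl
  simp only [← W.kasteleyn_z] at h1
  refine h1.congr_deriv (Eq.symm ?_)
  simp only [Weights.dz, Complex.ofReal_sum, Complex.ofReal_mul, W.adjugate_ofReal,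
    Weights.kasteleynDz, Matrix.of_apply]
  refine Finset.sum_congr rfl fun v _ => Finset.sum_congr rfl fun u _ => ?_
  split_ifs <;> simp

theorem Weights.hasDerivAt_dw_complex (W : Weights n m) (j₀ : ZMod n) :
    HasDerivAt (fun w : ℂ => (W.kasteleyn (W.root j₀ : ℂ) w).det) (W.dw j₀ : ℂ) 0 := by
  have h1 := hasDerivAt_det_add_smul (W.kasteleyn (W.root j₀ : ℂ) 0) (W.kasteleynDw ℂ) 0 0 rfl
  simp only [← W.kasteleyn_w] at h1
  refine h1.congr_deriv (Eq.symm ?_)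
  simp only [Weights.dw, Complex.ofReal_sum, Complex.ofReal_mul, W.adjugate_ofReal,
    Weights.kasteleynDw, Matrix.of_apply]
  refine Finset.sum_congr rfl fun v _ => Finset.sum_congr rfl fun u _ => ?_
  split_ifs <;> simp

theorem Weights.beta_eq (W : Weights n m) (j₀ : ZMod n) :
    W.beta j₀ = -(W.dw j₀ / (W.root j₀ * W.dz j₀)) := by
  rw [Weights.beta, (W.hasDerivAt_dz j₀).deriv, (W.hasDerivAt_dw j₀).deriv]

theorem Weights.columnDet_eq (W : Weights n m) (j : ZMod n) {R : Type*} [CommRing R] [Algebra ℝ R]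
    (z : R) : W.columnDet z j =
      algebraMap ℝ R ((-1) ^ m * ∏ i, W.c i j) * (algebraMap ℝ R (W.root j) - z) := by
  have h1 : (-1) ^ m * (∏ i, W.c i j) * W.root j = ∏ i, W.a i j := by
    rw [Weights.root, W.exp_abscissa]
    have := (W.prod_c_pos j).ne'
    field_simp
    rw [← pow_mul, mul_comm m 2, pow_mul]
    simp
  rw [mul_sub, ← map_mul, h1, Weights.columnDet]
  simp only [map_mul, map_prod, map_pow, map_neg, map_one]
  ring

theorem Weights.root_ne_zero (W : Weights n m) (j : ZMod n) : W.root j ≠ 0 :=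
  mul_ne_zero (by simp) (Real.exp_pos _).ne'

theorem Weights.abs_root (W : Weights n m) (j : ZMod n) :
    |W.root j| = Real.exp (W.abscissa j) := by
  rw [Weights.root, abs_mul]
  simp

theorem Weights.det_kasteleyn_root (W : Weights n m) (j₀ : ZMod n) :
    (W.kasteleyn (W.root j₀) 0).det = 0 := by
  rw [W.det_kasteleyn_zero, Finset.prod_eq_zero (Finset.mem_univ j₀)]
  rw [W.columnDet_eq]
  simp

/-- `P (ζ, 0) / (ζ - r)`. -/
def Weights.cofactor (W : Weights n m) (j₀ : ZMod n) {R : Type*} [CommRing R] [Algebra ℝ R]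
    (z : R) : R :=
  -algebraMap ℝ R ((-1) ^ m * ∏ i, W.c i j₀) * ∏ j ∈ Finset.univ.erase j₀, W.columnDet z j

theorem Weights.det_kasteleyn_zero_eq (W : Weights n m) (j₀ : ZMod n) {R : Type*} [CommRing R]
    [Algebra ℝ R] (z : R) :
    (W.kasteleyn z 0).det = (z - algebraMap ℝ R (W.root j₀)) * W.cofactor j₀ z := by
  rw [W.det_kasteleyn_zero, ← Finset.mul_prod_erase _ _ (Finset.mem_univ j₀), W.columnDet_eq j₀,
    Weights.cofactor]
  ring

theorem Weights.dz_eq (W : Weights n m) (j₀ : ZMod n) :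
    W.dz j₀ = W.cofactor j₀ (W.root j₀) := by
  refine (W.hasDerivAt_dz j₀).unique ?_
  simp only [Weights.charPoly, W.det_kasteleyn_zero_eq j₀]
  have h1 : DifferentiableAt ℝ (fun z : ℝ => W.cofactor j₀ z) (W.root j₀) := by
    unfold Weights.cofactor Weights.columnDet
    fun_prop
  have h2 := ((hasDerivAt_id (W.root j₀)).sub_const (W.root j₀)).mul h1.hasDerivAt
  refine h2.congr_deriv ?_
  simp

theorem Weights.columnDet_ne_zero (W : Weights n m) {j : ZMod n} {z : ℂ}
    (h : z ≠ W.root j) : W.columnDet z j ≠ 0 := by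
  rw [W.columnDet_eq]
  refine mul_ne_zero ?_ (sub_ne_zero.2 (Ne.symm h))
  have := (W.prod_c_pos j).ne'
  rw [Complex.coe_algebraMap, Complex.ofReal_ne_zero]
  exact mul_ne_zero (by simp) this

theorem Weights.root_ne_root (W : Weights n m) {j j₀ : ZMod n}
    (h : W.abscissa j ≠ W.abscissa j₀) : W.root j ≠ W.root j₀ := by
  intro h1
  have h2 := congrArg abs h1
  rw [W.abs_root, W.abs_root] at h2
  exact h (Real.exp_injective h2)

/-- The root `r` is simple since the roots of the other factors have other moduli. -/
theorem Weights.dz_ne_zero (W : Weights n m) {j₀ : ZMod n}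
    (hgen : ∀ j, j ≠ j₀ → W.abscissa j ≠ W.abscissa j₀) : W.dz j₀ ≠ 0 := by
  rw [W.dz_eq, Weights.cofactor]
  refine mul_ne_zero ?_ (Finset.prod_ne_zero_iff.2 fun j hj => ?_)
  · have := (W.prod_c_pos j₀).ne'
    simpa using this
  · rw [W.columnDet_eq]
    have h1 := (W.prod_c_pos j).ne'
    have h2 := W.root_ne_root (hgen j (Finset.ne_of_mem_erase hj))
    simpa [sub_eq_zero] using ⟨h1, h2⟩

theorem Weights.rootAdj_col (W : Weights n m) (j₀ : ZMod n) (v : ZMod m × ZMod n) :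
    (W.kasteleyn (W.root j₀) 0).mulVec (fun u => W.rootAdj j₀ u v) = 0 := by
  have h1 := (W.kasteleyn (W.root j₀) 0).mul_adjugate
  rw [W.det_kasteleyn_root, zero_smul] at h1
  funext u
  exact congrFun (congrFun h1 u) v

theorem Weights.rootAdj_row (W : Weights n m) (j₀ : ZMod n) (u : ZMod m × ZMod n) :
    Matrix.vecMul (fun v => W.rootAdj j₀ u v) (W.kasteleyn (W.root j₀) 0) = 0 := by
  have h1 := (W.kasteleyn (W.root j₀) 0).adjugate_mul
  rw [W.det_kasteleyn_root, zero_smul] at h1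
  funext v
  exact congrFun (congrFun h1 u) v

/-- The columns of the adjugate are right kernel vectors, which vanish after `j₀`; its rows are left
kernel vectors, which vanish before `j₀`. An entry within one column type can only survive at `j₀`.
-/
theorem Weights.rootAdj_eq_zero (W : Weights n m) {j₀ : ZMod n}
    (hgen : ∀ j, j ≠ j₀ → W.abscissa j ≠ W.abscissa j₀) {j : ZMod n} (hj : j ≠ j₀)
    (i i' : ZMod m) : W.rootAdj j₀ (i, j) (i', j) = 0 := by
  rcases lt_trichotomy j.val j₀.val with h | h | h
  · exact W.leftKernel_eq_zero_left hgen (W.rootAdj_row j₀ (i, j)) j h i'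
  · exact absurd (ZMod.val_injective n h) hj
  · exact W.kernel_eq_zero_right hgen (W.rootAdj_col j₀ (i', j)) j h i

/-- The adjugate is not zero, since its pairing with `∂K/∂z` is `∂₁P(r, 0) ≠ 0`. A nonzero right
kernel vector vanishes nowhere on the first column, a nonzero left one nowhere on the last. -/
theorem Weights.rootAdj_ne_zero (W : Weights n m) {j₀ : ZMod n}
    (hgen : ∀ j, j ≠ j₀ → W.abscissa j ≠ W.abscissa j₀) (i i' : ZMod m) :
    W.rootAdj j₀ (i, 0) (i', -1) ≠ 0 := by
  obtain ⟨u, v, huv⟩ : ∃ u v, W.rootAdj j₀ u v ≠ 0 := by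
    by_contra hcon
    push Not at hcon
    apply W.dz_ne_zero hgen
    simp [Weights.dz, hcon]
  have h1 := (W.kernel_sameSign hgen (W.rootAdj_col j₀ v) (fun h => huv (congrFun h u)) 0
    (by simp)).ne_zero i
  have h2 : W.rootAdj j₀ (i, 0) v ≠ 0 := right_ne_zero_of_mul h1
  have h3 := (W.leftKernel_sameSign hgen (W.rootAdj_row j₀ (i, 0)) (fun h => h2 (congrFun h v)) (-1)
    (by
      have e : (-1 : ZMod n).val = n - 1 := by simpa using val_neg_one_sub (0 : ZMod n)
      rw [e]
      have := ZMod.val_lt j₀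
      omega)).ne_zero i'
  exact right_ne_zero_of_mul h3

/-- The adjugate at the root has rank one. -/
theorem Weights.rootAdj_rank_one (W : Weights n m) {j₀ : ZMod n}
    (hgen : ∀ j, j ≠ j₀ → W.abscissa j ≠ W.abscissa j₀) :
    ∃ ψ φ : ZMod m → ℝ, (∀ i i', W.rootAdj j₀ (i, 0) (i', -1) = ψ i * φ i') ∧
      SameSign fun i => ψ i * φ i := by
  set A := W.rootAdj j₀ with hA
  have h00 : A (0, 0) (0, -1) ≠ 0 := W.rootAdj_ne_zero hgen 0 0
  -- Two columns of the adjugate are proportional: the combination that cancels at `(0, j₀)` lies in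
  -- the kernel, hence is zero.
  have hprop : ∀ i i', A (i, 0) (i', -1) * A (0, 0) (0, -1) =
      A (i, 0) (0, -1) * A (0, 0) (i', -1) := by
    intro i i'
    have hcol : ∀ v, (W.kasteleyn (W.root j₀) 0).mulVec (fun u => A u v) = 0 := W.rootAdj_col j₀
    set x := A (0, j₀) (0, -1) with hx
    set y := A (0, j₀) (i', -1) with hy
    have h1 : (W.kasteleyn (W.root j₀) 0).mulVec
        (x • (fun u => A u (i', -1)) - y • fun u => A u (0, -1)) = 0 := by
      rw [Matrix.mulVec_sub, Matrix.mulVec_smul, Matrix.mulVec_smul, hcol, hcol]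
      simp
    have h2 := W.kernel_eq_zero hgen h1 (by simp [hx, hy]; ring)
    have h3 := congrFun h2 (i, 0)
    have h4 := congrFun h2 (0, 0)
    simp only [Pi.sub_apply, Pi.smul_apply, smul_eq_mul, Pi.zero_apply] at h3 h4
    have hx0 : x ≠ 0 := by
      intro hx0
      have := W.kernel_eq_zero hgen (hcol (0, -1)) hx0
      exact h00 (congrFun this (0, 0))
    apply mul_left_cancel₀ hx0
    linear_combination A (0, 0) (0, -1) * h3 - A (i, 0) (0, -1) * h4
  refine ⟨fun i => A (i, 0) (0, -1), fun i => A (0, 0) (i, -1) / A (0, 0) (0, -1), ?_, ?_⟩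
  · intro i i'
    rw [← mul_div_assoc, eq_div_iff h00, hprop]
  · have h1 := W.kernel_sameSign hgen (W.rootAdj_col j₀ (0, -1)) (fun h => h00 (congrFun h (0, 0))) 0
      (by simp)
    have h2 := W.leftKernel_sameSign hgen (W.rootAdj_row j₀ (0, 0))
      (fun h => h00 (congrFun h (0, -1))) (-1) (by
        have e : (-1 : ZMod n).val = n - 1 := by simpa using val_neg_one_sub (0 : ZMod n)
        rw [e]
        have := ZMod.val_lt j₀
        omega)
    -- The gauge signs of the row `i` enter once through the right and once through the left kernel
    -- vector, so they cancel on the diagonal.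
    have key : ∀ i, 0 < (A (i, 0) (0, -1) * A (0, 0) (i, -1)) := fun i => by
      have h3 := h1.mul_pos i 0
      have h4 := h2.mul_pos i 0
      have h5 := mul_pos h3 h4
      have h6 := rowSign_mul_self i
      have h7 := rowSign_mul_self (0 : ZMod m)
      have h8 : rowSign i * W.rootAdj j₀ (i, 0) (0, -1) * (rowSign (0 : ZMod m) * W.rootAdj j₀ (0, 0) (0, -1)) *
          (rowSign i * W.rootAdj j₀ (0, 0) (i, -1) * (rowSign (0 : ZMod m) * W.rootAdj j₀ (0, 0) (0, -1))) =
          (A (i, 0) (0, -1) * A (0, 0) (i, -1)) * A (0, 0) (0, -1) ^ 2 := by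
        linear_combination (A (i, 0) (0, -1) * A (0, 0) (i, -1)) * A (0, 0) (0, -1) ^ 2 *
          (rowSign (0 : ZMod m) * rowSign (0 : ZMod m) * h6 + h7)
      rw [h8] at h5
      exact pos_of_mul_pos_left h5 (by positivity)
    rcases lt_or_gt_of_ne h00 with h3 | h3
    · right
      intro i
      change A (i, 0) (0, -1) * (A (0, 0) (i, -1) / A (0, 0) (0, -1)) < 0
      rw [← mul_div_assoc]
      exact div_neg_of_pos_of_neg (key i) h3
    · left
      intro i
      change 0 < A (i, 0) (0, -1) * (A (0, 0) (i, -1) / A (0, 0) (0, -1))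
      rw [← mul_div_assoc]
      exact div_pos (key i) h3

theorem Weights.dw_eq (W : Weights n m) (j₀ : ZMod n) :
    W.dw j₀ = ∑ i, W.b i (-1) * W.rootAdj j₀ (i, 0) (i, -1) := by
  simp only [Weights.dw, Weights.kasteleynDw, Matrix.of_apply, Algebra.algebraMap_self,
    RingHom.id_apply]
  rw [Fintype.sum_prod_type]
  refine Finset.sum_congr rfl fun i _ => ?_
  rw [Finset.sum_eq_single (-1 : ZMod n)]
  · rw [Finset.sum_eq_single (i, 0)]
    · simp
    · intro u _ hu
      rw [if_neg, zero_mul]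
      rintro ⟨h, _⟩
      exact hu (by simpa using h)
    · simp
  · intro j _ hj
    refine Finset.sum_eq_zero fun u _ => ?_
    rw [if_neg, zero_mul]
    rintro ⟨_, h⟩
    exact hj (eq_neg_of_add_eq_zero_left h)
  · simp

/-- By `Weights.dw_eq`, `∂₂P(r, 0)` is a sum of the terms `b i * ψ i * φ i`, which all have the same
sign. -/
theorem Weights.beta_ne_zero (W : Weights n m) {j₀ : ZMod n}
    (hgen : ∀ j, j ≠ j₀ → W.abscissa j ≠ W.abscissa j₀) : W.beta j₀ ≠ 0 := by
  rw [W.beta_eq, neg_ne_zero]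
  refine div_ne_zero ?_ (mul_ne_zero (W.root_ne_zero j₀) (W.dz_ne_zero hgen))
  obtain ⟨ψ, φ, h1, h2⟩ := W.rootAdj_rank_one hgen
  rw [W.dw_eq]
  simp only [h1]
  rcases h2 with h2 | h2
  · exact (Finset.sum_pos (fun i _ => mul_pos (W.b_pos i _) (h2 i)) Finset.univ_nonempty).ne'
  · exact (Finset.sum_neg (fun i _ => mul_neg_of_pos_of_neg (W.b_pos i _) (h2 i))
      Finset.univ_nonempty).ne

/-- The weights with the `a`-edge at `v` increased by one. -/
def Weights.addA (W : Weights n m) (v : ZMod m × ZMod n) : Weights n m where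
  a i j := W.a i j + if (i, j) = v then 1 else 0
  b := W.b
  c := W.c
  a_pos i j := by
    have := W.a_pos i j
    split_ifs <;> linarith
  b_pos := W.b_pos
  c_pos := W.c_pos

/-- A diagonal cofactor is the increment of the determinant when an `a`-weight grows by one, and at
`w = 0` only the factor of its own column changes. This makes the probability of an `a`-edge in a
frozen column explicit. -/
theorem Weights.adjugate_diag (W : Weights n m) (z : ℂ) (i : ZMod m) (j : ZMod n) :
    W.a i j * (W.kasteleyn z 0).adjugate (i, j) (i, j) * W.columnDet z j =
      (W.kasteleyn z 0).det * ∏ i, (W.a i j : ℂ) := by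
  have h1 : (W.kasteleyn z 0).adjugate (i, j) (i, j) =
      ((W.addA (i, j)).kasteleyn z 0).det - (W.kasteleyn z 0).det := by
    rw [Matrix.adjugate_apply]
    have h2 : (W.addA (i, j)).kasteleyn z 0 = (W.kasteleyn z 0).updateRow (i, j)
        ((W.kasteleyn z 0) (i, j) + Pi.single (i, j) 1) := by
      ext v u
      by_cases hv : v = (i, j)
      · subst hv
        rw [Matrix.updateRow_self]
        by_cases hu : u = (i, j)
        · subst hu
          simp only [Weights.kasteleyn, Matrix.of_apply, Weights.addA, Pi.add_apply,
            Pi.single_eq_same, if_true, map_add, map_one]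
          ring
        · simp [Weights.kasteleyn, Weights.addA, hu]
      · rw [Matrix.updateRow_ne hv]
        have hv' : ¬(v.1 = i ∧ v.2 = j) := fun h => hv (Prod.ext h.1 h.2)
        simp [Weights.kasteleyn, Weights.addA, hv']
    rw [h2, Matrix.det_updateRow_add, Matrix.updateRow_eq_self]
    ring
  have h2 : ∀ j', j' ≠ j → (W.addA (i, j)).columnDet z j' = W.columnDet z j' := by
    intro j' hj'
    simp [Weights.columnDet, Weights.addA, hj']
  have h3 : (W.a i j : ℂ) * ((W.addA (i, j)).columnDet z j - W.columnDet z j) =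
      ∏ i, (W.a i j : ℂ) := by
    simp only [Weights.columnDet, Weights.addA]
    rw [← Finset.mul_prod_erase _ _ (Finset.mem_univ i), ← Finset.mul_prod_erase (a := i) _
      (fun i => (algebraMap ℝ ℂ) (W.a i j)) (Finset.mem_univ i), ← Finset.mul_prod_erase (a := i) _
      (fun i => (W.a i j : ℂ)) (Finset.mem_univ i)]
    have h4 : ∏ x ∈ Finset.univ.erase i, (algebraMap ℝ ℂ)
        (W.a x j + if (x, j) = (i, j) then 1 else 0) =
        ∏ x ∈ Finset.univ.erase i, (W.a x j : ℂ) :=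
      Finset.prod_congr rfl fun x hx => by simp [Finset.ne_of_mem_erase hx]
    rw [h4]
    simp only [if_true, map_add, map_one, Complex.coe_algebraMap]
    ring
  rw [h1, Weights.det_kasteleyn_zero, Weights.det_kasteleyn_zero,
    ← Finset.mul_prod_erase _ _ (Finset.mem_univ j),
    ← Finset.mul_prod_erase _ (fun j => W.columnDet z j) (Finset.mem_univ j),
    Finset.prod_congr rfl fun j' hj' => h2 j' (Finset.ne_of_mem_erase hj')]
  linear_combination (∏ j' ∈ Finset.univ.erase j, W.columnDet z j') * W.columnDet z j * h3

end BeadDimer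

end

/-! ### Complex analysis: perturbation of a simple root, contours and residues. -/

noncomputable section

namespace BeadDimer

/-! ### Simple roots of a family of functions of one variable -/

/-- The implicit function of a family of functions with one simple root in an annulus, with a uniform
linear lower bound. -/
theorem exists_root_family {P : ℂ × ℂ → ℂ} (hP : ContDiff ℂ 1 P) {r d₁ d₂ : ℂ} (h0 : P (r, 0) = 0)
    (h1 : HasDerivAt (fun z => P (z, 0)) d₁ r) (h2 : HasDerivAt (fun w => P (r, w)) d₂ 0)
    (hd : d₁ ≠ 0) {a b : ℝ} (hb : ‖r‖ < b)
    (hne : ∀ ζ, a ≤ ‖ζ‖ → ‖ζ‖ ≤ b → ζ ≠ r → P (ζ, 0) ≠ 0) :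
    ∃ ρ : ℂ → ℂ, ρ 0 = r ∧ HasDerivAt ρ (-(d₂ / d₁)) 0 ∧ ∃ c > 0, ∀ᶠ τ in 𝓝 0, P (ρ τ, τ) = 0 ∧
      ∀ ζ, a ≤ ‖ζ‖ → ‖ζ‖ ≤ b → c * ‖ζ - ρ τ‖ ≤ ‖P (ζ, τ)‖ := by
  have hstrict : HasStrictFDerivAt P (fderiv ℂ P (r, 0)) (r, 0) :=
    hP.contDiffAt.hasStrictFDerivAt (by simp)
  set D := fderiv ℂ P (r, 0) with hD
  have hD1 : ∀ x : ℂ, D (x, 0) = x * d₁ := fun x => by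
    have h3 : HasDerivAt (fun z : ℂ => P (z, 0)) (D (1, 0)) r := by
      have := hstrict.hasFDerivAt.comp_hasDerivAt (x := r) (f := fun z : ℂ => (z, (0 : ℂ)))
        (f' := (1, 0)) ((hasDerivAt_id r).prodMk (hasDerivAt_const r 0))
      exact this
    rw [h1.unique h3, show ((x, 0) : ℂ × ℂ) = x • ((1, 0) : ℂ × ℂ) by simp, map_smul, smul_eq_mul]
  have hD2 : ∀ x : ℂ, D (0, x) = x * d₂ := fun x => by
    have h3 : HasDerivAt (fun z : ℂ => P (r, z)) (D (0, 1)) 0 := by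
      have := hstrict.hasFDerivAt.comp_hasDerivAt (x := (0 : ℂ)) (f := fun z : ℂ => (r, z))
        (f' := (0, 1)) ((hasDerivAt_const 0 r).prodMk (hasDerivAt_id 0))
      exact this
    rw [h2.unique h3, show ((0, x) : ℂ × ℂ) = x • ((0, 1) : ℂ × ℂ) by simp, map_smul, smul_eq_mul]
  -- the implicit function
  let S : ℂ × ℂ → ℂ := fun p => P (p.2, p.1)
  have hS : HasStrictFDerivAt S (D.comp ((ContinuousLinearMap.snd ℂ ℂ ℂ).prod
      (ContinuousLinearMap.fst ℂ ℂ ℂ))) (0, r) :=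
    HasStrictFDerivAt.comp (f := fun p : ℂ × ℂ => (p.2, p.1)) (0, r) hstrict
      ((ContinuousLinearMap.snd ℂ ℂ ℂ).prod (ContinuousLinearMap.fst ℂ ℂ ℂ)).hasStrictFDerivAt
  have hinr : (D.comp ((ContinuousLinearMap.snd ℂ ℂ ℂ).prod (ContinuousLinearMap.fst ℂ ℂ ℂ))) ∘L
      (.inr ℂ ℂ ℂ) = (ContinuousLinearEquiv.unitsEquivAut ℂ (Units.mk0 d₁ hd) : ℂ →L[ℂ] ℂ) := by
    ext
    simp [hD1]
  have hinv : ((D.comp ((ContinuousLinearMap.snd ℂ ℂ ℂ).prod (ContinuousLinearMap.fst ℂ ℂ ℂ))) ∘L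
      (.inr ℂ ℂ ℂ)).IsInvertible := ⟨_, hinr.symm⟩
  set ρ := hS.implicitFunctionOfProdDomain hinv with hρ
  have hρd := (hS.hasStrictFDerivAt_implicitFunctionOfProdDomain hinv).hasFDerivAt.hasDerivAt
  have hρ0 : ρ 0 = r := by
    have := (hS.eventually_apply_eq_iff_implicitFunctionOfProdDomain hinv).self_of_nhds
    exact this.1 rfl
  have hρz := hS.eventually_apply_implicitFunctionOfProdDomain hinv
  refine ⟨ρ, hρ0, ?_, ?_⟩
  · refine hρd.congr_deriv ?_
    rw [hinr, ContinuousLinearMap.inverse_equiv]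
    simp [hD2, ContinuousLinearEquiv.unitsEquivAut, div_eq_mul_inv]
  -- the lower bound near the root
  have hρc : Tendsto ρ (𝓝 0) (𝓝 r) := by
    have := hρd.continuousAt.tendsto
    rw [← hρ] at this
    rwa [hρ0] at this
  have hd2 : 0 < ‖d₁‖ / 2 := by positivity
  -- Strict differentiability compares `P` at `(ζ, τ)` and `(ρ τ, τ)`; the second coordinates agree,
  -- so only `d₁` enters the linear term.
  have hnear := hstrict.isLittleO.def hd2
  obtain ⟨δ, hδ, hball⟩ := Metric.eventually_nhds_iff.1 hnear
  have hcpt : IsCompact {ζ : ℂ | a ≤ ‖ζ‖ ∧ ‖ζ‖ ≤ b ∧ δ ≤ ‖ζ - r‖} := by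
    refine Metric.isCompact_of_isClosed_isBounded ?_ ?_
    · refine (isClosed_le continuous_const continuous_norm).inter
        ((isClosed_le continuous_norm continuous_const).inter
          (isClosed_le continuous_const (continuous_id.sub continuous_const).norm))
    · exact (Metric.isBounded_closedBall (x := (0 : ℂ)) (r := b)).subset fun ζ hζ => by
        simpa using hζ.2.1
  obtain ⟨e, he, hfar⟩ : ∃ e > 0, ∀ ζ ∈ {ζ : ℂ | a ≤ ‖ζ‖ ∧ ‖ζ‖ ≤ b ∧ δ ≤ ‖ζ - r‖},
      e < ‖P (ζ, 0)‖ := by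
    rcases Set.eq_empty_or_nonempty {ζ : ℂ | a ≤ ‖ζ‖ ∧ ‖ζ‖ ≤ b ∧ δ ≤ ‖ζ - r‖} with hem | hem
    · exact ⟨1, one_pos, fun ζ hζ => by rw [hem] at hζ; exact hζ.elim⟩
    · obtain ⟨x, hx, hmin⟩ := hcpt.exists_isMinOn hem (f := fun ζ => ‖P (ζ, 0)‖)
        (hP.continuous.comp (by fun_prop : Continuous fun ζ : ℂ => (ζ, (0 : ℂ)))).norm.continuousOn
      have hpos : 0 < ‖P (x, 0)‖ := norm_pos_iff.2 (hne x hx.1 hx.2.1 fun h => by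
        have := hx.2.2
        rw [h, sub_self, norm_zero] at this
        linarith)
      exact ⟨‖P (x, 0)‖ / 2, by positivity, fun ζ hζ => by
        have : ‖P (x, 0)‖ ≤ ‖P (ζ, 0)‖ := hmin hζ
        linarith⟩
  have hfar' : ∀ᶠ τ in 𝓝 (0 : ℂ), ∀ ζ ∈ {ζ : ℂ | a ≤ ‖ζ‖ ∧ ‖ζ‖ ≤ b ∧ δ ≤ ‖ζ - r‖},
      e < ‖P (ζ, τ)‖ := by
    refine hcpt.eventually_forall_of_forall_eventually fun ζ hζ => ?_
    have hc : Continuous fun p : ℂ × ℂ => ‖P (p.2, p.1)‖ :=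
      (hP.continuous.comp (by fun_prop : Continuous fun p : ℂ × ℂ => (p.2, p.1))).norm
    exact hc.continuousAt.eventually (lt_mem_nhds (hfar ζ hζ))
  have hb0 : 0 < b := (norm_nonneg r).trans_lt hb
  -- The first constant serves for `ζ` near `r`. Away from `r`, `‖P‖` is at least `e` by
  -- compactness, while `‖ζ - ρ τ‖` is at most `b + ‖r‖ + 1`.
  refine ⟨min (‖d₁‖ / 2) (e / (b + ‖r‖ + 1)), by positivity, ?_⟩
  have hρδ : ∀ᶠ τ in 𝓝 (0 : ℂ), ‖ρ τ - r‖ < min δ 1 := by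
    have := hρc.eventually (Metric.ball_mem_nhds r (show 0 < min δ 1 by positivity))
    simpa [dist_eq_norm] using this
  have hτδ : ∀ᶠ τ in 𝓝 (0 : ℂ), ‖τ‖ < δ := by
    filter_upwards [Metric.ball_mem_nhds (0 : ℂ) hδ] with τ hτ
    simpa using hτ
  filter_upwards [hρz, hfar', hρδ, hτδ] with τ hz hf hρ1 hτ
  have hz' : P (ρ τ, τ) = 0 := hz.trans h0
  refine ⟨hz', fun ζ hζa hζb => ?_⟩
  by_cases hζ : δ ≤ ‖ζ - r‖
  · have h3 := hf ζ ⟨hζa, hζb, hζ⟩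
    have h4 : ‖ζ - ρ τ‖ ≤ b + ‖r‖ + 1 := by
      calc ‖ζ - ρ τ‖ = ‖ζ - r - (ρ τ - r)‖ := by ring_nf
        _ ≤ ‖ζ‖ + ‖r‖ + ‖ρ τ - r‖ := (norm_sub_le _ _).trans (by gcongr; exact norm_sub_le _ _)
        _ ≤ b + ‖r‖ + 1 := by
          have := lt_of_lt_of_le hρ1 (min_le_right _ _)
          linarith
    calc min (‖d₁‖ / 2) (e / (b + ‖r‖ + 1)) * ‖ζ - ρ τ‖
        ≤ e / (b + ‖r‖ + 1) * (b + ‖r‖ + 1) := by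
          gcongr
          exact min_le_right _ _
      _ = e := by
        have : b + ‖r‖ + 1 ≠ 0 := by positivity
        field_simp
      _ ≤ _ := h3.le
  · push Not at hζ
    have h3 := @hball ((ζ, τ), (ρ τ, τ)) (by
      rw [Prod.dist_eq, Prod.dist_eq, Prod.dist_eq]
      simp only [dist_eq_norm, sub_zero, max_lt_iff]
      exact ⟨⟨hζ, hτ⟩, lt_of_lt_of_le hρ1 (min_le_left _ _), hτ⟩)
    simp only [hz', sub_zero, Prod.mk_sub_mk, sub_self, hD1] at h3
    have h4 : ‖((ζ - ρ τ, 0) : ℂ × ℂ)‖ = ‖ζ - ρ τ‖ := by simp [Prod.norm_def]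
    rw [h4] at h3
    have h5 : ‖(ζ - ρ τ) * d₁‖ - ‖P (ζ, τ)‖ ≤ ‖d₁‖ / 2 * ‖ζ - ρ τ‖ := by
      refine le_trans ?_ h3
      rw [norm_sub_rev]
      exact norm_sub_norm_le _ _
    rw [norm_mul] at h5
    calc min (‖d₁‖ / 2) (e / (b + ‖r‖ + 1)) * ‖ζ - ρ τ‖ ≤ ‖d₁‖ / 2 * ‖ζ - ρ τ‖ := by
          gcongr
          exact min_le_left _ _
      _ ≤ _ := by linarith

/-! ### Moving a circle across a simple pole -/

theorem circleIntegral_inv_sub_of_lt_norm {R : ℝ} (hR : 0 ≤ R) {p : ℂ} (hp : R < ‖p‖) :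
    ∮ z in C(0, R), (z - p)⁻¹ = 0 := by
  refine DiffContOnCl.circleIntegral_eq_zero hR (DifferentiableOn.diffContOnCl ?_)
  intro z hz
  have hz' : z ∈ Metric.closedBall (0 : ℂ) R := Metric.closure_ball_subset_closedBall hz
  have : z - p ≠ 0 := by
    intro h
    rw [sub_eq_zero.1 h] at hz'
    rw [mem_closedBall_zero_iff] at hz'
    linarith
  exact (((differentiableAt_id).sub_const p).inv this).differentiableWithinAt

theorem circleIntegral_inv_sub_of_norm_lt {R : ℝ} {p : ℂ} (hp : ‖p‖ < R) :
    ∮ z in C(0, R), (z - p)⁻¹ = 2 * Real.pi * Complex.I :=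
  circleIntegral.integral_sub_inv_of_mem_ball (by simpa using hp)

/-- The integrals over two circles of a function holomorphic in between are equal. -/
theorem circleIntegral_eq_of_differentiableOn {U : Set ℂ} (hU : IsOpen U) {g : ℂ → ℂ}
    (hg : DifferentiableOn ℂ g U) {R₁ R₂ : ℝ} (h0 : 0 < R₁) (h12 : R₁ ≤ R₂)
    (hsub : ∀ z : ℂ, R₁ ≤ ‖z‖ → ‖z‖ ≤ R₂ → z ∈ U) :
    ∮ z in C(0, R₂), g z = ∮ z in C(0, R₁), g z := by
  refine Complex.circleIntegral_eq_of_differentiable_on_annulus_off_countable h0 h12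
    Set.countable_empty ?_ ?_
  · refine hg.continuousOn.mono fun z hz => ?_
    have h1 : ‖z‖ ≤ R₂ := by simpa using hz.1
    have h2 : R₁ ≤ ‖z‖ := by simpa using hz.2
    exact hsub z h2 h1
  · intro z hz
    have h1 : ‖z‖ < R₂ := by simpa using hz.1.1
    have h2 : R₁ < ‖z‖ := by simpa using hz.1.2
    exact hg.differentiableAt (hU.mem_nhds (hsub z h2.le h1.le))

section Pole

variable {U : Set ℂ} {g : ℂ → ℂ} {p : ℂ} {R₁ R₂ : ℝ}

/-- Writing `g z = g p + (z - p) * dslope g p z` isolates the pole; the rest is holomorphic on `U`,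
so its integral does not change with the circle. -/
theorem circleIntegral_inv_sub_mul (hU : IsOpen U) (hg : DifferentiableOn ℂ g U) (hp : p ∈ U)
    {R : ℝ} (h0 : 0 < R) (hR : ∀ z : ℂ, ‖z‖ = R → z ∈ U) (hpR : ‖p‖ ≠ R) :
    ∮ z in C(0, R), (z - p)⁻¹ * g z =
      (∮ z in C(0, R), dslope g p z) + g p * ∮ z in C(0, R), (z - p)⁻¹ := by
  have hds : DifferentiableOn ℂ (dslope g p) U :=
    (Complex.differentiableOn_dslope (hU.mem_nhds hp)).2 hg
  have h1 : CircleIntegrable (dslope g p) 0 R :=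
    (hds.continuousOn.mono fun z hz => hR z (by simpa using hz)).circleIntegrable h0.le
  have h2 : CircleIntegrable (fun z => g p * (z - p)⁻¹) 0 R := by
    have : CircleIntegrable (fun z => (z - p)⁻¹) 0 R := by
      rw [circleIntegrable_sub_inv_iff]
      right
      rw [abs_of_pos h0]
      simpa using hpR
    exact this.const_smul (a := g p)
  rw [← circleIntegral.integral_const_mul, ← circleIntegral.integral_add h1 h2]
  refine circleIntegral.integral_congr h0.le fun z hz => ?_
  have hz' : ‖z‖ = R := by simpa using hz
  have hzp : z ≠ p := fun h => hpR (by rw [← h, hz'])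
  have := sub_ne_zero.2 hzp
  simp only [dslope_of_ne _ hzp, slope_def_field]
  field_simp
  ring

variable (hU : IsOpen U) (hg : DifferentiableOn ℂ g U) (h0 : 0 < R₁) (h1 : R₁ < 1) (h2 : 1 < R₂)
  (hsub : ∀ z : ℂ, R₁ ≤ ‖z‖ → ‖z‖ ≤ R₂ → z ∈ U) (hp1 : R₁ < ‖p‖) (hp2 : ‖p‖ < R₂)

include hU hg h0 h1 h2 hsub hp1 hp2

/-- Both displacements of the circle are recorded, because the factor `z^(-Y)` is small on the outer
circle for `Y > 0` and on the inner one for `Y < 0`. -/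
theorem circleIntegral_pole_inside (hp : ‖p‖ < 1) :
    (∮ z in C(0, 1), (z - p)⁻¹ * g z = ∮ z in C(0, R₂), (z - p)⁻¹ * g z) ∧
    (∮ z in C(0, 1), (z - p)⁻¹ * g z =
      (∮ z in C(0, R₁), (z - p)⁻¹ * g z) + 2 * Real.pi * Complex.I * g p) := by
  have hpU : p ∈ U := hsub p hp1.le hp2.le
  have hds : DifferentiableOn ℂ (dslope g p) U :=
    (Complex.differentiableOn_dslope (hU.mem_nhds hpU)).2 hg
  rw [circleIntegral_inv_sub_mul hU hg hpU one_pos (fun z hz => hsub z (by linarith) (by linarith))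
      hp.ne, circleIntegral_inv_sub_mul hU hg hpU (by linarith)
      (fun z hz => hsub z (by linarith) (by linarith)) hp2.ne,
    circleIntegral_inv_sub_mul hU hg hpU h0 (fun z hz => hsub z (by linarith) (by linarith)) hp1.ne',
    circleIntegral_inv_sub_of_norm_lt hp, circleIntegral_inv_sub_of_norm_lt hp2,
    circleIntegral_inv_sub_of_lt_norm h0.le hp1,
    circleIntegral_eq_of_differentiableOn hU hds one_pos h2.le
      fun z hz hz' => hsub z (by linarith) (by linarith),
    circleIntegral_eq_of_differentiableOn hU hds h0 h1.le
      fun z hz hz' => hsub z (by linarith) (by linarith)]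
  exact ⟨rfl, by ring⟩

theorem circleIntegral_pole_outside (hp : 1 < ‖p‖) :
    (∮ z in C(0, 1), (z - p)⁻¹ * g z = ∮ z in C(0, R₁), (z - p)⁻¹ * g z) ∧
    (∮ z in C(0, 1), (z - p)⁻¹ * g z =
      (∮ z in C(0, R₂), (z - p)⁻¹ * g z) - 2 * Real.pi * Complex.I * g p) := by
  have hpU : p ∈ U := hsub p hp1.le hp2.le
  have hds : DifferentiableOn ℂ (dslope g p) U :=
    (Complex.differentiableOn_dslope (hU.mem_nhds hpU)).2 hg
  rw [circleIntegral_inv_sub_mul hU hg hpU one_pos (fun z hz => hsub z (by linarith) (by linarith))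
      hp.ne', circleIntegral_inv_sub_mul hU hg hpU (by linarith)
      (fun z hz => hsub z (by linarith) (by linarith)) hp2.ne,
    circleIntegral_inv_sub_mul hU hg hpU h0 (fun z hz => hsub z (by linarith) (by linarith)) hp1.ne',
    circleIntegral_inv_sub_of_lt_norm zero_le_one hp, circleIntegral_inv_sub_of_norm_lt hp2,
    circleIntegral_inv_sub_of_lt_norm h0.le hp1,
    circleIntegral_eq_of_differentiableOn hU hds one_pos h2.le
      fun z hz hz' => hsub z (by linarith) (by linarith),
    circleIntegral_eq_of_differentiableOn hU hds h0 h1.le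
      fun z hz hz' => hsub z (by linarith) (by linarith)]
  exact ⟨rfl, by ring⟩

/-- When the pole is on the circle, the integral is either undefined or that of a holomorphic
function. -/
theorem circleIntegral_pole_on (hp : ‖p‖ = 1) :
    ∮ z in C(0, 1), (z - p)⁻¹ * g z = 0 ∨
    ((∮ z in C(0, 1), (z - p)⁻¹ * g z = ∮ z in C(0, R₁), (z - p)⁻¹ * g z) ∧
      ∮ z in C(0, 1), (z - p)⁻¹ * g z = ∮ z in C(0, R₂), (z - p)⁻¹ * g z) := by
  have hpU : p ∈ U := hsub p hp1.le hp2.le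
  have hds : DifferentiableOn ℂ (dslope g p) U :=
    (Complex.differentiableOn_dslope (hU.mem_nhds hpU)).2 hg
  have hcont : ContinuousOn (dslope g p) (Metric.sphere 0 1) :=
    hds.continuousOn.mono fun z hz => by
      have : ‖z‖ = 1 := by simpa using hz
      exact hsub z (by linarith) (by linarith)
  have hci : CircleIntegrable (dslope g p) 0 1 := hcont.circleIntegrable zero_le_one
  have hfin : ({p} : Set ℂ)ᶜ ∈ codiscreteWithin (Metric.sphere (0 : ℂ) |1|) :=
    codiscreteWithin_iff_locallyFiniteComplementWithin.2 fun z _ =>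
      ⟨Set.univ, univ_mem, (Set.finite_singleton p).subset fun x hx => by simpa using hx.2.2⟩
  have hoff : ∀ z, z ≠ p → (z - p)⁻¹ * g z = dslope g p z + g p * (z - p)⁻¹ := fun z hz => by
    have := sub_ne_zero.2 hz
    simp only [dslope_of_ne _ hz, slope_def_field]
    field_simp
    ring
  have hcongr : (fun z => (z - p)⁻¹ * g z) =ᶠ[codiscreteWithin (Metric.sphere (0 : ℂ) |1|)]
      fun z => dslope g p z + g p * (z - p)⁻¹ := by
    filter_upwards [hfin] with z hz
    exact hoff z hz
  -- If `g p = 0` the singularity is removable. Otherwise `(z - p)⁻¹` is not integrable on a circle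
  -- through `p`, and the integral takes its default value zero.
  by_cases hgp : g p = 0
  · right
    rw [circleIntegral.circleIntegral_congr_codiscreteWithin hcongr one_ne_zero,
      circleIntegral_inv_sub_mul hU hg hpU (by linarith)
      (fun z hz => hsub z (by linarith) (by linarith)) hp2.ne,
      circleIntegral_inv_sub_mul hU hg hpU h0
      (fun z hz => hsub z (by linarith) (by linarith)) hp1.ne', hgp]
    simp only [zero_mul, add_zero]
    exact ⟨circleIntegral_eq_of_differentiableOn hU hds h0 h1.le
      fun z hz hz' => hsub z (by linarith) (by linarith),
      (circleIntegral_eq_of_differentiableOn hU hds one_pos h2.le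
      fun z hz hz' => hsub z (by linarith) (by linarith)).symm⟩
  · left
    refine circleIntegral.integral_undef fun hF => ?_
    rw [circleIntegrable_congr_codiscreteWithin hcongr] at hF
    have h3 := (hF.sub hci).const_smul (a := (g p)⁻¹)
    have h4 : CircleIntegrable (fun z => (z - p)⁻¹) 0 1 := by
      refine (circleIntegrable_congr fun z _ => ?_).1 h3
      simp only [Pi.smul_apply, Pi.sub_apply, add_sub_cancel_left, smul_eq_mul]
      rw [← mul_assoc, inv_mul_cancel₀ hgp, one_mul]
    rw [circleIntegrable_sub_inv_iff] at h4
    rcases h4 with h4 | h4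
    · exact one_ne_zero h4
    · apply h4
      simpa using hp

end Pole

end BeadDimer

end

/-! ### The integral over `z` for small `t`: one pole in an annulus. -/

noncomputable section

namespace BeadDimer

variable {n m : ℕ} [NeZero n] [NeZero m]

/-! ### The integral over `z` -/

theorem contDiff_matrix_det {𝕜 E ι : Type*} [NontriviallyNormedField 𝕜] [NormedAddCommGroup E]
    [NormedSpace 𝕜 E] [Fintype ι] [DecidableEq ι] {k : WithTop ℕ∞} {M : E → Matrix ι ι 𝕜}
    (hM : ∀ i j, ContDiff 𝕜 k fun x => M x i j) : ContDiff 𝕜 k fun x => (M x).det := by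
  simp only [Matrix.det_apply']
  refine ContDiff.sum fun σ _ => contDiff_const.mul (contDiff_prod fun i _ => hM _ _)

theorem Weights.contDiff_kasteleyn (W : Weights n m) {k : WithTop ℕ∞} (v u : ZMod m × ZMod n) :
    ContDiff ℂ k fun p : ℂ × ℂ => W.kasteleyn p.1 p.2 v u := by
  simp only [Weights.kasteleyn, Matrix.of_apply]
  refine ContDiff.add (ContDiff.add contDiff_const ?_) ?_
  · split_ifs
    · exact contDiff_const.mul contDiff_snd
    · exact contDiff_const
    · exact contDiff_const
  · split_ifs
    · exact contDiff_const.mul contDiff_fst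
    · exact contDiff_const
    · exact contDiff_const

theorem Weights.contDiff_det (W : Weights n m) {k : WithTop ℕ∞} :
    ContDiff ℂ k fun p : ℂ × ℂ => (W.kasteleyn p.1 p.2).det :=
  contDiff_matrix_det fun v u => W.contDiff_kasteleyn v u

theorem Weights.contDiff_adjugate (W : Weights n m) {k : WithTop ℕ∞} (u v : ZMod m × ZMod n) :
    ContDiff ℂ k fun p : ℂ × ℂ => (W.kasteleyn p.1 p.2).adjugate u v := by
  simp only [Matrix.adjugate_apply]
  refine contDiff_matrix_det fun i j => ?_
  simp only [Matrix.updateRow_apply]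
  split_ifs
  · exact contDiff_const
  · exact W.contDiff_kasteleyn i j

theorem Weights.kasteleyn_inv_apply (W : Weights n m) (z w : ℂ) (u v : ZMod m × ZMod n) :
    (W.kasteleyn z w)⁻¹ u v = ((W.kasteleyn z w).det)⁻¹ * (W.kasteleyn z w).adjugate u v := by
  rw [Matrix.inv_def, Ring.inverse_eq_inv', Matrix.smul_apply, smul_eq_mul]

/-- The root of `P (·, τ)` near the root of the tentacle, in an annulus where it is the only one. -/
structure PoleData (W : Weights n m) (j₀ : ZMod n) where
  ρ : ℂ → ℂ
  ρ_zero : ρ 0 = W.root j₀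
  ρ_deriv : HasDerivAt ρ (W.root j₀ * W.beta j₀) 0
  R : ℝ
  one_lt_R : 1 < R
  c : ℝ
  c_pos : 0 < c
  bound : ∀ᶠ τ in 𝓝 (0 : ℂ), (W.kasteleyn (ρ τ) τ).det = 0 ∧
    ∀ ζ : ℂ, |W.root j₀| / R ^ 2 ≤ ‖ζ‖ → ‖ζ‖ ≤ |W.root j₀| * R ^ 2 →
      c * ‖ζ - ρ τ‖ ≤ ‖(W.kasteleyn ζ τ).det‖
  far : ∀ j, j ≠ j₀ → |W.root j| < |W.root j₀| / R ^ 2 ∨ |W.root j₀| * R ^ 2 < |W.root j|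

theorem Weights.nonempty_poleData (W : Weights n m) {j₀ : ZMod n}
    (hgen : ∀ j, j ≠ j₀ → W.abscissa j ≠ W.abscissa j₀) : Nonempty (PoleData W j₀) := by
  -- A common lower bound for the finitely many gaps between the abscissas.
  obtain ⟨δ, hδ, hδj⟩ : ∃ δ > 0, ∀ j, j ≠ j₀ → δ < |W.abscissa j - W.abscissa j₀| := by
    have h1 : ∀ j ∈ (Finset.univ.erase j₀ : Finset (ZMod n)),
        ∀ᶠ δ in 𝓝[>] (0 : ℝ), δ < |W.abscissa j - W.abscissa j₀| := fun j hj =>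
      nhdsWithin_le_nhds (gt_mem_nhds (abs_pos.2 (sub_ne_zero.2 (hgen j (Finset.ne_of_mem_erase hj)))))
    have h2 := (Filter.eventually_all_finset _).2 h1
    obtain ⟨δ, h3, h4⟩ := (h2.and self_mem_nhdsWithin).exists
    exact ⟨δ, h4, fun j hj => h3 j (by simp [hj])⟩
  -- `R ^ 2 = e^δ` separates `|r|` from the moduli of the other roots. One factor `R` is used by
  -- `|z|` in `[R⁻¹, R]`, the other by the distance of `e^fieldX` to `|r|`.
  set R := Real.exp (δ / 2) with hRdef
  have hR : 1 < R := Real.one_lt_exp_iff.2 (by linarith)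
  have hR2 : R ^ 2 = Real.exp δ := by
    rw [hRdef, ← Real.exp_nat_mul]
    congr 1
    push_cast
    ring
  have hr0 : 0 < |W.root j₀| := abs_pos.2 (W.root_ne_zero j₀)
  have hfar : ∀ j, j ≠ j₀ →
      |W.root j| < |W.root j₀| / R ^ 2 ∨ |W.root j₀| * R ^ 2 < |W.root j| := by
    intro j hj
    rw [W.abs_root, W.abs_root, hR2, ← Real.exp_sub, ← Real.exp_add, Real.exp_lt_exp,
      Real.exp_lt_exp]
    rcases lt_abs.1 (hδj j hj) with h | h
    · right; linarith
    · left; linarith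
  have hnorm : ‖(W.root j₀ : ℂ)‖ = |W.root j₀| := by simp
  have hR2' : 1 < R ^ 2 := one_lt_pow₀ hR two_ne_zero
  obtain ⟨ρ, h1, h2, c, hc, h3⟩ := exists_root_family (P := fun p => (W.kasteleyn p.1 p.2).det)
    (a := |W.root j₀| / R ^ 2) (b := |W.root j₀| * R ^ 2) (r := (W.root j₀ : ℂ)) W.contDiff_det
    (by
      change (W.kasteleyn (W.root j₀ : ℂ) 0).det = 0
      rw [W.det_kasteleyn_zero_eq j₀]
      simp)
    (W.hasDerivAt_dz_complex j₀) (W.hasDerivAt_dw_complex j₀)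
    (Complex.ofReal_ne_zero.2 (W.dz_ne_zero hgen)) (by rw [hnorm]; exact lt_mul_of_one_lt_right hr0 hR2')
    (by
      intro ζ ha hb hζ
      change (W.kasteleyn ζ 0).det ≠ 0
      rw [W.det_kasteleyn_zero]
      refine Finset.prod_ne_zero_iff.2 fun j _ => W.columnDet_ne_zero fun h => ?_
      by_cases hj : j = j₀
      · exact hζ (by rw [h, hj])
      · have h4 : ‖ζ‖ = |W.root j| := by rw [h]; simp
        rcases hfar j hj with h5 | h5 <;> linarith)
  refine ⟨⟨ρ, h1, h2.congr_deriv ?_, R, hR, c, hc, h3, hfar⟩⟩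
  rw [W.beta_eq]
  have h5 := W.root_ne_zero j₀
  have h6 := W.dz_ne_zero hgen
  push_cast
  have h7 : (W.root j₀ : ℂ) ≠ 0 := Complex.ofReal_ne_zero.2 h5
  have h8 : (W.dz j₀ : ℂ) ≠ 0 := Complex.ofReal_ne_zero.2 h6
  field_simp

/-- The integral over `z` in the inverse Kasteleyn operator. -/
def Weights.innerInt (W : Weights n m) (j₀ : ZMod n) (γ t : ℝ) (Y : ℤ) (u v : ZMod m × ZMod n)
    (w : ℂ) (R : ℝ) : ℂ :=
  ∮ z in C(0, R), z ^ (-Y - 1) *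
    (W.kasteleyn (Complex.exp (W.fieldX j₀ γ t) * z) (t * w))⁻¹ u v

namespace PoleData

variable {W : Weights n m} {j₀ : ZMod n} (D : PoleData W j₀) (γ t : ℝ) (w : ℂ)

/-- The pole of the integrand, as a function of `z`. -/
def pole : ℂ := Complex.exp (-W.fieldX j₀ γ t) * D.ρ (t * w)

/-- The derivative of `P (·, τ)` at its root. -/
def dP (τ : ℂ) : ℂ := deriv (fun ζ => (W.kasteleyn ζ τ).det) (D.ρ τ)

/-- The residue of the integrand. -/
def residue (Y : ℤ) (u v : ZMod m × ZMod n) : ℂ :=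
  D.pole γ t w ^ (-Y) * ((W.kasteleyn (D.ρ (t * w)) (t * w)).adjugate u v /
    (D.ρ (t * w) * D.dP (t * w)))

theorem R_pos : 0 < D.R := zero_lt_one.trans D.one_lt_R

theorem root_pos : 0 < |W.root j₀| := abs_pos.2 (W.root_ne_zero j₀)

theorem tendsto_ρ : Tendsto D.ρ (𝓝 0) (𝓝 (W.root j₀ : ℂ)) := by
  have := D.ρ_deriv.continuousAt.tendsto
  rwa [D.ρ_zero] at this

theorem eventually_ρ_mem : ∀ᶠ τ in 𝓝 (0 : ℂ), |W.root j₀| / D.R ^ 2 < ‖D.ρ τ‖ ∧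
    ‖D.ρ τ‖ < |W.root j₀| * D.R ^ 2 := by
  have h1 := D.tendsto_ρ.norm
  have hR2 : 1 < D.R ^ 2 := one_lt_pow₀ D.one_lt_R two_ne_zero
  have e : ‖(W.root j₀ : ℂ)‖ = |W.root j₀| := by simp
  rw [e] at h1
  exact (h1.eventually (lt_mem_nhds (div_lt_self root_pos hR2))).and
    (h1.eventually (gt_mem_nhds (lt_mul_of_one_lt_right root_pos hR2)))

theorem hasDerivAt_det (ζ τ : ℂ) :
    HasDerivAt (fun ζ => (W.kasteleyn ζ τ).det)
      (fderiv ℂ (fun p : ℂ × ℂ => (W.kasteleyn p.1 p.2).det) (ζ, τ) (1, 0)) ζ := by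
  have h1 := ((W.contDiff_det (k := 1)).differentiable (by simp) (ζ, τ)).hasFDerivAt
  exact h1.comp_hasDerivAt (x := ζ) (f := fun z : ℂ => (z, τ)) (f' := (1, 0))
    ((hasDerivAt_id ζ).prodMk (hasDerivAt_const ζ τ))

theorem tendsto_dP : Tendsto D.dP (𝓝 0) (𝓝 (W.dz j₀ : ℂ)) := by
  have h1 : ∀ τ, D.dP τ = fderiv ℂ (fun p : ℂ × ℂ => (W.kasteleyn p.1 p.2).det) (D.ρ τ, τ) (1, 0) :=
    fun τ => (hasDerivAt_det (D.ρ τ) τ).deriv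
  have h2 : (W.dz j₀ : ℂ) =
      fderiv ℂ (fun p : ℂ × ℂ => (W.kasteleyn p.1 p.2).det) (W.root j₀, 0) (1, 0) :=
    (W.hasDerivAt_dz_complex j₀).unique (hasDerivAt_det _ _)
  rw [funext h1, h2]
  have h3 : Continuous fun p : ℂ × ℂ =>
      fderiv ℂ (fun p : ℂ × ℂ => (W.kasteleyn p.1 p.2).det) p (1, 0) :=
    ((W.contDiff_det (k := 1)).continuous_fderiv (by simp)).clm_apply continuous_const
  exact h3.continuousAt.tendsto.comp (D.tendsto_ρ.prodMk_nhds tendsto_id)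

/-- The perturbed root is still simple: the difference quotients at the root are at least `c` in
modulus by the linear lower bound, and so is their limit. -/
theorem eventually_dP_ne : ∀ᶠ τ in 𝓝 (0 : ℂ), D.dP τ ≠ 0 := by
  filter_upwards [D.bound, D.eventually_ρ_mem] with τ h1 h2 h3
  have h4 : HasDerivAt (fun ζ => (W.kasteleyn ζ τ).det) (D.dP τ) (D.ρ τ) :=
    (hasDerivAt_det (D.ρ τ) τ).differentiableAt.hasDerivAt
  rw [h3, hasDerivAt_iff_tendsto_slope] at h4
  have h5 := h4.norm
  rw [norm_zero] at h5
  have h6 : ∀ᶠ ζ in 𝓝[≠] (D.ρ τ), D.c ≤ ‖slope (fun ζ => (W.kasteleyn ζ τ).det) (D.ρ τ) ζ‖ := by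
    have h7 : ∀ᶠ ζ in 𝓝 (D.ρ τ), |W.root j₀| / D.R ^ 2 < ‖ζ‖ ∧ ‖ζ‖ < |W.root j₀| * D.R ^ 2 :=
      (continuous_norm.continuousAt.eventually (lt_mem_nhds h2.1)).and
        (continuous_norm.continuousAt.eventually (gt_mem_nhds h2.2))
    filter_upwards [nhdsWithin_le_nhds h7, self_mem_nhdsWithin] with ζ h8 h9
    have h10 := h1.2 ζ h8.1.le h8.2.le
    have h11 : 0 < ‖ζ - D.ρ τ‖ := norm_pos_iff.2 (sub_ne_zero.2 h9)
    rw [slope_def_field, h1.1, sub_zero, norm_div, le_div_iff₀ h11]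
    exact h10
  exact absurd (ge_of_tendsto h5 h6) (not_le.2 D.c_pos)

end PoleData

end BeadDimer

end

noncomputable section

namespace BeadDimer

variable {n m : ℕ} [NeZero n] [NeZero m]

/-- As `‖t * w‖ ≤ t`, what holds for `(t, τ)` near the origin holds at `τ = t * w` uniformly over
the closed unit disc. -/
theorem eventually_forall_norm_le_one {p : ℝ → ℂ → Prop}
    (h : ∀ᶠ q : ℝ × ℂ in 𝓝 0 ×ˢ 𝓝 0, p q.1 q.2) :
    ∀ᶠ t in 𝓝[>] (0 : ℝ), ∀ w : ℂ, ‖w‖ ≤ 1 → p t (t * w) := by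
  rw [← nhds_prod_eq] at h
  obtain ⟨ε, hε, hb⟩ := Metric.eventually_nhds_iff.1 h
  have h1 : ∀ᶠ t in 𝓝[>] (0 : ℝ), t < ε := nhdsWithin_le_nhds (gt_mem_nhds hε)
  filter_upwards [h1, self_mem_nhdsWithin] with t ht ht0 w hw
  refine @hb (t, t * w) ?_
  have ht0' : 0 < t := ht0
  rw [Prod.dist_eq, max_lt_iff]
  simp only [dist_zero_right, norm_mul, Complex.norm_real, Real.norm_eq_abs, abs_of_pos ht0']
  refine ⟨ht, ?_⟩
  nlinarith

theorem Weights.tendsto_fieldX (W : Weights n m) (j₀ : ZMod n) (γ : ℝ) :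
    Tendsto (fun t : ℝ => W.fieldX j₀ γ t) (𝓝 0) (𝓝 (W.abscissa j₀)) := by
  have : Continuous fun t : ℝ => W.fieldX j₀ γ t := by
    unfold Weights.fieldX
    fun_prop
  have h := this.tendsto 0
  simpa [Weights.fieldX] using h

namespace PoleData

variable {W : Weights n m} {j₀ : ZMod n} (D : PoleData W j₀) (γ t : ℝ) (w : ℂ)

/-- The conditions, true for small `t`, under which the integral over `z` is computed. -/
structure Good : Prop where
  zero : (W.kasteleyn (D.ρ (t * w)) (t * w)).det = 0
  bound : ∀ ζ : ℂ, |W.root j₀| / D.R ^ 2 ≤ ‖ζ‖ → ‖ζ‖ ≤ |W.root j₀| * D.R ^ 2 →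
    D.c * ‖ζ - D.ρ (t * w)‖ ≤ ‖(W.kasteleyn ζ (t * w)).det‖
  dP_ne : D.dP (t * w) ≠ 0
  le_exp : |W.root j₀| / D.R ≤ Real.exp (W.fieldX j₀ γ t)
  exp_le : Real.exp (W.fieldX j₀ γ t) ≤ |W.root j₀| * D.R
  lt_pole : 2 / (1 + D.R) < ‖D.pole γ t w‖
  pole_lt : ‖D.pole γ t w‖ < (1 + D.R) / 2

theorem eventually_good : ∀ᶠ t in 𝓝[>] (0 : ℝ), ∀ w : ℂ, ‖w‖ ≤ 1 → D.Good γ t w := by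
  have hR := D.one_lt_R
  have hr : 0 < |W.root j₀| := root_pos
  have h1 : ∀ᶠ q : ℝ × ℂ in 𝓝 0 ×ˢ 𝓝 0, (W.kasteleyn (D.ρ q.2) q.2).det = 0 ∧
      ∀ ζ : ℂ, |W.root j₀| / D.R ^ 2 ≤ ‖ζ‖ → ‖ζ‖ ≤ |W.root j₀| * D.R ^ 2 →
      D.c * ‖ζ - D.ρ q.2‖ ≤ ‖(W.kasteleyn ζ q.2).det‖ := tendsto_snd.eventually D.bound
  have h2 : ∀ᶠ q : ℝ × ℂ in 𝓝 0 ×ˢ 𝓝 0, D.dP q.2 ≠ 0 := tendsto_snd.eventually D.eventually_dP_ne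
  have h3 : Tendsto (fun q : ℝ × ℂ => Real.exp (W.fieldX j₀ γ q.1)) (𝓝 0 ×ˢ 𝓝 0)
      (𝓝 |W.root j₀|) := by
    rw [W.abs_root]
    exact (Real.continuous_exp.tendsto _).comp ((W.tendsto_fieldX j₀ γ).comp tendsto_fst)
  have h4 : Tendsto (fun q : ℝ × ℂ => ‖Complex.exp (-W.fieldX j₀ γ q.1) * D.ρ q.2‖) (𝓝 0 ×ˢ 𝓝 0)
      (𝓝 1) := by
    have e : (1 : ℝ) = ‖Complex.exp (-W.abscissa j₀) * W.root j₀‖ := by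
      rw [norm_mul, Complex.norm_real, Real.norm_eq_abs, W.abs_root, Complex.norm_exp]
      simp [← Real.exp_add]
    rw [e]
    refine (Tendsto.mul ?_ (D.tendsto_ρ.comp tendsto_snd)).norm
    refine (Complex.continuous_exp.tendsto _).comp ?_
    refine Tendsto.neg ?_
    exact (Complex.continuous_ofReal.tendsto _).comp ((W.tendsto_fieldX j₀ γ).comp tendsto_fst)
  have h5 := eventually_forall_norm_le_one
    (p := fun t τ => ((W.kasteleyn (D.ρ τ) τ).det = 0 ∧
      ∀ ζ : ℂ, |W.root j₀| / D.R ^ 2 ≤ ‖ζ‖ → ‖ζ‖ ≤ |W.root j₀| * D.R ^ 2 →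
      D.c * ‖ζ - D.ρ τ‖ ≤ ‖(W.kasteleyn ζ τ).det‖) ∧ D.dP τ ≠ 0 ∧
      |W.root j₀| / D.R < Real.exp (W.fieldX j₀ γ t) ∧
      Real.exp (W.fieldX j₀ γ t) < |W.root j₀| * D.R ∧
      2 / (1 + D.R) < ‖Complex.exp (-W.fieldX j₀ γ t) * D.ρ τ‖ ∧
      ‖Complex.exp (-W.fieldX j₀ γ t) * D.ρ τ‖ < (1 + D.R) / 2)
    (h1.and (h2.and ((h3.eventually (lt_mem_nhds (div_lt_self hr hR))).and
      ((h3.eventually (gt_mem_nhds (lt_mul_of_one_lt_right hr hR))).and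
      ((h4.eventually (lt_mem_nhds (by rw [div_lt_one (by linarith)]; linarith))).and
        (h4.eventually (gt_mem_nhds (by linarith))))))))
  filter_upwards [h5] with t ht w hw
  obtain ⟨⟨a1, a2⟩, a3, a4, a5, a6, a7⟩ := ht w hw
  exact ⟨a1, a2, a3, a4.le, a5.le, a6, a7⟩

variable {D γ t w}

theorem exp_mul_pole : Complex.exp (W.fieldX j₀ γ t) * D.pole γ t w = D.ρ (t * w) := by
  rw [pole, ← mul_assoc, ← Complex.exp_add]
  simp

theorem norm_exp_fieldX : ‖Complex.exp (W.fieldX j₀ γ t)‖ = Real.exp (W.fieldX j₀ γ t) := by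
  rw [Complex.norm_exp, Complex.ofReal_re]

namespace Good

variable (h : D.Good γ t w)
include h

theorem mem_annulus {z : ℂ} (h1 : D.R⁻¹ ≤ ‖z‖) (h2 : ‖z‖ ≤ D.R) :
    |W.root j₀| / D.R ^ 2 ≤ ‖Complex.exp (W.fieldX j₀ γ t) * z‖ ∧
      ‖Complex.exp (W.fieldX j₀ γ t) * z‖ ≤ |W.root j₀| * D.R ^ 2 := by
  have hR := D.R_pos
  have hr : 0 < |W.root j₀| := root_pos
  rw [norm_mul, norm_exp_fieldX]
  constructor
  · calc |W.root j₀| / D.R ^ 2 = |W.root j₀| / D.R * D.R⁻¹ := by field_simp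
      _ ≤ _ := mul_le_mul h.le_exp h1 (by positivity) (Real.exp_pos _).le
  · calc _ ≤ |W.root j₀| * D.R * D.R := mul_le_mul h.exp_le h2 (norm_nonneg _) (by positivity)
      _ = _ := by ring

theorem lower {z : ℂ} (h1 : D.R⁻¹ ≤ ‖z‖) (h2 : ‖z‖ ≤ D.R) :
    D.c * (|W.root j₀| / D.R) * ‖z - D.pole γ t w‖ ≤
      ‖(W.kasteleyn (Complex.exp (W.fieldX j₀ γ t) * z) (t * w)).det‖ := by
  refine le_trans ?_ (h.bound _ (h.mem_annulus h1 h2).1 (h.mem_annulus h1 h2).2)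
  rw [← exp_mul_pole (γ := γ), ← mul_sub, norm_mul, norm_exp_fieldX, mul_assoc]
  have := h.le_exp
  have := D.c_pos
  gcongr

theorem inv_R_lt_pole : D.R⁻¹ < ‖D.pole γ t w‖ := by
  refine lt_trans ?_ h.lt_pole
  have := D.one_lt_R
  rw [inv_eq_one_div, div_lt_div_iff₀ D.R_pos (by linarith)]
  linarith

theorem pole_lt_R : ‖D.pole γ t w‖ < D.R := by
  have := h.pole_lt
  have := D.one_lt_R
  linarith

theorem ρ_ne_zero : D.ρ (t * w) ≠ 0 := by
  rw [← exp_mul_pole (γ := γ)]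
  refine mul_ne_zero (Complex.exp_ne_zero _) fun h0 => ?_
  have h1 := h.inv_R_lt_pole
  rw [h0, norm_zero] at h1
  exact absurd h1 (not_lt.2 (inv_nonneg.2 D.R_pos.le))

theorem pole_ne_zero : D.pole γ t w ≠ 0 := fun h0 => by
  have := exp_mul_pole (D := D) (γ := γ) (t := t) (w := w)
  rw [h0, mul_zero] at this
  exact h.ρ_ne_zero this.symm

/-- The integrand is a holomorphic function divided by `z - pole`. -/
theorem exists_factor (Y : ℤ) (u v : ZMod m × ZMod n) :
    ∃ (U : Set ℂ) (g : ℂ → ℂ), IsOpen U ∧ DifferentiableOn ℂ g U ∧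
      (∀ z : ℂ, D.R⁻¹ ≤ ‖z‖ → ‖z‖ ≤ D.R → z ∈ U) ∧
      (∀ z, z ^ (-Y - 1) * (W.kasteleyn (Complex.exp (W.fieldX j₀ γ t) * z) (t * w))⁻¹ u v =
        (z - D.pole γ t w)⁻¹ * g z) ∧ g (D.pole γ t w) = D.residue γ t w Y u v := by
  set e := Complex.exp (W.fieldX j₀ γ t) with he
  have he0 : e ≠ 0 := Complex.exp_ne_zero _
  set p := D.pole γ t w with hp
  set τ : ℂ := t * w with hτ
  have hep : e * p = D.ρ τ := exp_mul_pole
  -- `Q` is the entire function `P(·, τ) / (· - ρ τ)`. It has no zero in the annulus: at the root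
  -- its value is `dP`, elsewhere the lower bound of `P` applies.
  set Q : ℂ → ℂ := dslope (fun ζ => (W.kasteleyn ζ τ).det) (D.ρ τ) with hQ
  have hdiff : Differentiable ℂ fun ζ => (W.kasteleyn ζ τ).det := fun ζ =>
    (hasDerivAt_det ζ τ).differentiableAt
  have hQd : Differentiable ℂ Q := by
    rw [← differentiableOn_univ]
    exact (Complex.differentiableOn_dslope univ_mem).2 hdiff.differentiableOn
  have hPQ : ∀ ζ, (W.kasteleyn ζ τ).det = (ζ - D.ρ τ) * Q ζ := fun ζ => by
    by_cases hζ : ζ = D.ρ τ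
    · rw [hζ, sub_self, zero_mul]
      exact h.zero
    · rw [hQ, dslope_of_ne _ hζ, slope_def_field, h.zero, sub_zero,
        mul_div_cancel₀ _ (sub_ne_zero.2 hζ)]
  have hQρ : Q (D.ρ τ) = D.dP τ := by
    rw [hQ, dslope_same]
    rfl
  have hadj : Differentiable ℂ fun ζ => (W.kasteleyn ζ τ).adjugate u v := by
    have h1 : ContDiff ℂ 1 ((fun p : ℂ × ℂ => (W.kasteleyn p.1 p.2).adjugate u v) ∘
        fun ζ : ℂ => (ζ, τ)) := (W.contDiff_adjugate u v).comp (contDiff_prodMk_left τ)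
    exact h1.differentiable one_ne_zero
  clear_value Q
  obtain ⟨A, hA⟩ : ∃ A : ℂ → ℂ, A = fun ζ => (W.kasteleyn ζ τ).adjugate u v := ⟨_, rfl⟩
  rw [← hA] at hadj
  have hlin : Differentiable ℂ fun z : ℂ => e * z := differentiable_id.const_mul e
  have hAe : Differentiable ℂ fun z => A (e * z) := hadj.comp hlin
  have hQe : Differentiable ℂ fun z => Q (e * z) := hQd.comp hlin
  refine ⟨{z | z ≠ 0 ∧ Q (e * z) ≠ 0},
    fun z => z ^ (-Y - 1) * (A (e * z) / (e * Q (e * z))), ?_, ?_, ?_, ?_, ?_⟩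
  · exact isOpen_ne.inter (isOpen_ne.preimage hQe.continuous)
  · intro z hz
    refine DifferentiableAt.differentiableWithinAt ?_
    refine DifferentiableAt.mul (differentiableAt_zpow.2 (Or.inl hz.1)) ?_
    exact (hAe z).fun_div ((hQe z).const_mul e) (mul_ne_zero he0 hz.2)
  · intro z h1 h2
    refine ⟨fun h0 => ?_, ?_⟩
    · rw [h0, norm_zero] at h1
      exact absurd h1 (not_le.2 (inv_pos.2 D.R_pos))
    · by_cases hz : e * z = D.ρ τ
      · rw [hz, hQρ]
        exact h.dP_ne
      · intro h0
        have h3 := h.bound _ (h.mem_annulus h1 h2).1 (h.mem_annulus h1 h2).2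
        rw [← he, ← hτ, hPQ, h0, mul_zero, norm_zero] at h3
        exact absurd h3 (not_le.2 (mul_pos D.c_pos (norm_pos_iff.2 (sub_ne_zero.2 hz))))
  · intro z
    have hAz : (W.kasteleyn (e * z) τ).adjugate u v = A (e * z) := by rw [hA]
    simp only [W.kasteleyn_inv_apply, hPQ, ← hep, ← mul_sub, mul_inv, div_eq_mul_inv, hAz]
    ring
  · have hp0 : p ≠ 0 := h.pole_ne_zero
    have hd := h.dP_ne
    rw [← hτ] at hd
    simp only [hep, hQρ, residue, ← hp, ← hτ, hA]
    rw [zpow_sub_one₀ hp0]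
    have hρ0 : D.ρ τ ≠ 0 := h.ρ_ne_zero
    generalize (W.kasteleyn (D.ρ τ) τ).adjugate u v = N
    rw [← hep] at hρ0 ⊢
    field_simp

theorem inner_of_lt (Y : ℤ) (u v : ZMod m × ZMod n) (hp : ‖D.pole γ t w‖ < 1) :
    W.innerInt j₀ γ t Y u v w 1 = W.innerInt j₀ γ t Y u v w D.R ∧
    W.innerInt j₀ γ t Y u v w 1 = W.innerInt j₀ γ t Y u v w D.R⁻¹ +
      2 * Real.pi * Complex.I * D.residue γ t w Y u v := by
  obtain ⟨U, g, hU, hg, hsub, hF, hres⟩ := h.exists_factor Y u v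
  simp only [Weights.innerInt, hF, ← hres]
  exact circleIntegral_pole_inside hU hg (inv_pos.2 D.R_pos) (inv_lt_one_of_one_lt₀ D.one_lt_R)
    D.one_lt_R hsub h.inv_R_lt_pole h.pole_lt_R hp

theorem inner_of_gt (Y : ℤ) (u v : ZMod m × ZMod n) (hp : 1 < ‖D.pole γ t w‖) :
    W.innerInt j₀ γ t Y u v w 1 = W.innerInt j₀ γ t Y u v w D.R⁻¹ ∧
    W.innerInt j₀ γ t Y u v w 1 = W.innerInt j₀ γ t Y u v w D.R -
      2 * Real.pi * Complex.I * D.residue γ t w Y u v := by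
  obtain ⟨U, g, hU, hg, hsub, hF, hres⟩ := h.exists_factor Y u v
  simp only [Weights.innerInt, hF, ← hres]
  exact circleIntegral_pole_outside hU hg (inv_pos.2 D.R_pos) (inv_lt_one_of_one_lt₀ D.one_lt_R)
    D.one_lt_R hsub h.inv_R_lt_pole h.pole_lt_R hp

theorem inner_of_eq (Y : ℤ) (u v : ZMod m × ZMod n) (hp : ‖D.pole γ t w‖ = 1) :
    W.innerInt j₀ γ t Y u v w 1 = 0 ∨
    (W.innerInt j₀ γ t Y u v w 1 = W.innerInt j₀ γ t Y u v w D.R⁻¹ ∧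
      W.innerInt j₀ γ t Y u v w 1 = W.innerInt j₀ γ t Y u v w D.R) := by
  obtain ⟨U, g, hU, hg, hsub, hF, hres⟩ := h.exists_factor Y u v
  simp only [Weights.innerInt, hF]
  exact circleIntegral_pole_on hU hg (inv_pos.2 D.R_pos) (inv_lt_one_of_one_lt₀ D.one_lt_R)
    D.one_lt_R hsub h.inv_R_lt_pole h.pole_lt_R hp

/-- The modulus of the pole lies between `2 / (1 + R)` and `(1 + R) / 2`. These are at distance `(R
- 1) / (R (R + 1))` from `R⁻¹` and `(R - 1) / 2` from `R`, and the former is the smaller. -/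
theorem norm_sub_pole {z : ℂ} (hz : ‖z‖ = D.R ∨ ‖z‖ = D.R⁻¹) :
    (D.R - 1) / (D.R * (D.R + 1)) ≤ ‖z - D.pole γ t w‖ := by
  have hR := D.one_lt_R
  rcases hz with hz | hz
  · have h1 := norm_sub_norm_le z (D.pole γ t w)
    have h2 := h.pole_lt
    rw [hz] at h1
    have h3 : (D.R - 1) / (D.R * (D.R + 1)) ≤ (D.R - 1) / 2 := by
      apply div_le_div_of_nonneg_left <;> nlinarith
    linarith
  · have h1 := norm_sub_norm_le (D.pole γ t w) z
    rw [norm_sub_rev, hz] at h1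
    have h2 := h.lt_pole
    have h3 : (D.R - 1) / (D.R * (D.R + 1)) = 2 / (1 + D.R) - D.R⁻¹ := by
      have : D.R ≠ 0 := D.R_pos.ne'
      have : D.R + 1 ≠ 0 := by linarith
      have : 1 + D.R ≠ 0 := by linarith
      field_simp
      ring
    linarith

end Good

variable (D γ)

/-- On the two circles the inverse matrix is bounded. -/
theorem exists_inv_bound : ∃ M : ℝ, 0 ≤ M ∧ ∀ᶠ t in 𝓝[>] (0 : ℝ), ∀ w : ℂ, ‖w‖ ≤ 1 → ∀ z : ℂ,
    (‖z‖ = D.R ∨ ‖z‖ = D.R⁻¹) → ∀ u v,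
      ‖(W.kasteleyn (Complex.exp (W.fieldX j₀ γ t) * z) (t * w))⁻¹ u v‖ ≤ M := by
  have hR := D.one_lt_R
  have hR0 := D.R_pos
  have hr : 0 < |W.root j₀| := root_pos
  have hcpt : IsCompact ((Metric.closedBall (0 : ℂ) (|W.root j₀| * D.R ^ 2)) ×ˢ
      (Metric.closedBall (0 : ℂ) 1)) := (isCompact_closedBall _ _).prod (isCompact_closedBall _ _)
  obtain ⟨B, hB⟩ := hcpt.exists_bound_of_continuousOn
    (f := fun p : ℂ × ℂ => ∑ u, ∑ v, ‖(W.kasteleyn p.1 p.2).adjugate u v‖)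
    (continuous_finsetSum _ fun u _ => continuous_finsetSum _ fun v _ =>
      (W.contDiff_adjugate (k := 1) u v).continuous.norm).continuousOn
  set q := D.c * (|W.root j₀| / D.R) * ((D.R - 1) / (D.R * (D.R + 1))) with hq
  have hq0 : 0 < q := by
    have := D.c_pos
    have : 0 < D.R - 1 := by linarith
    positivity
  have ht1 : ∀ᶠ t in 𝓝[>] (0 : ℝ), t < 1 := nhdsWithin_le_nhds (gt_mem_nhds one_pos)
  have hB0 : 0 ≤ B := (norm_nonneg _).trans (hB (0, 0) ⟨by simp; positivity, by simp⟩)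
  refine ⟨q⁻¹ * B, by positivity, ?_⟩
  filter_upwards [D.eventually_good γ, ht1, self_mem_nhdsWithin] with t hgood ht1 ht0 w hw z hz u v
  have ht0' : 0 < t := ht0
  have h := hgood w hw
  have hz1 : D.R⁻¹ ≤ ‖z‖ ∧ ‖z‖ ≤ D.R := by
    have : D.R⁻¹ ≤ D.R := (inv_le_one_of_one_le₀ hR.le).trans hR.le
    rcases hz with hz | hz <;> rw [hz] <;> exact ⟨by linarith, by linarith⟩
  rw [W.kasteleyn_inv_apply, norm_mul, norm_inv]
  have h1 : q ≤ ‖(W.kasteleyn (Complex.exp (W.fieldX j₀ γ t) * z) (t * w)).det‖ := by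
    refine le_trans ?_ (h.lower hz1.1 hz1.2)
    have hc := D.c_pos
    exact mul_le_mul_of_nonneg_left (h.norm_sub_pole hz) (by positivity)
  have h2 := hB (Complex.exp (W.fieldX j₀ γ t) * z, t * w) ⟨by
    simpa using (h.mem_annulus hz1.1 hz1.2).2, by
    rw [mem_closedBall_zero_iff, norm_mul, Complex.norm_real, Real.norm_eq_abs, abs_of_pos ht0']
    nlinarith⟩
  rw [Real.norm_eq_abs, abs_of_nonneg (by positivity)] at h2
  have h3 : ‖(W.kasteleyn (Complex.exp (W.fieldX j₀ γ t) * z) (t * w)).adjugate u v‖ ≤ B := by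
    refine le_trans ?_ h2
    refine le_trans ?_ (Finset.single_le_sum (f := fun u => ∑ v, ‖(W.kasteleyn
      (Complex.exp (W.fieldX j₀ γ t) * z) (t * w)).adjugate u v‖)
      (fun u _ => Finset.sum_nonneg fun v _ => norm_nonneg _) (Finset.mem_univ u))
    exact Finset.single_le_sum (f := fun v => ‖(W.kasteleyn
      (Complex.exp (W.fieldX j₀ γ t) * z) (t * w)).adjugate u v‖) (fun v _ => norm_nonneg _)
      (Finset.mem_univ v)
  gcongr

end PoleData

end BeadDimer

end

/-! ### Uniform bounds and limits of the integral over `z`. -/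

noncomputable section

namespace BeadDimer

variable {n m : ℕ} [NeZero n] [NeZero m]

namespace PoleData

variable {W : Weights n m} {j₀ : ZMod n} (D : PoleData W j₀) (γ : ℝ)

theorem norm_innerInt_le {t M : ℝ} {w : ℂ} {u v : ZMod m × ZMod n} {R : ℝ} (hR : 0 < R)
    (hM : ∀ z : ℂ, ‖z‖ = R →
      ‖(W.kasteleyn (Complex.exp (W.fieldX j₀ γ t) * z) (t * w))⁻¹ u v‖ ≤ M) (Y : ℤ) :
    ‖W.innerInt j₀ γ t Y u v w R‖ ≤ 2 * Real.pi * M * R ^ (-Y) := by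
  have h1 : ‖W.innerInt j₀ γ t Y u v w R‖ ≤ 2 * Real.pi * R * (R ^ (-Y - 1) * M) := by
    refine circleIntegral.norm_integral_le_of_norm_le_const hR.le fun z hz => ?_
    have hz' : ‖z‖ = R := by simpa using hz
    rw [norm_mul, norm_zpow, hz']
    exact mul_le_mul_of_nonneg_left (hM z hz') (by positivity)
  refine h1.trans (le_of_eq ?_)
  rw [zpow_sub_one₀ hR.ne']
  field_simp

/-- The residue of the inverse Kasteleyn matrix at the root, divided by the root. -/
def coeff (u v : ZMod m × ZMod n) (τ : ℂ) : ℂ :=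
  (W.kasteleyn (D.ρ τ) τ).adjugate u v / (D.ρ τ * D.dP τ)

theorem tendsto_coeff (hgen : ∀ j, j ≠ j₀ → W.abscissa j ≠ W.abscissa j₀)
    (u v : ZMod m × ZMod n) : Tendsto (D.coeff u v) (𝓝 0)
      (𝓝 ((W.rootAdj j₀ u v / (W.root j₀ * W.dz j₀) : ℝ) : ℂ)) := by
  have h1 : Tendsto (fun τ => (W.kasteleyn (D.ρ τ) τ).adjugate u v) (𝓝 0)
      (𝓝 (W.rootAdj j₀ u v : ℂ)) := by
    rw [← W.adjugate_ofReal]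
    have hF := (W.contDiff_adjugate (k := 1) u v).continuous
    have h3 := D.tendsto_ρ.prodMk_nhds (tendsto_id (x := 𝓝 (0 : ℂ)))
    have h4 : Tendsto ((fun p : ℂ × ℂ => (W.kasteleyn p.1 p.2).adjugate u v) ∘
      fun τ => (D.ρ τ, id τ)) (𝓝 0) (𝓝 ((fun p : ℂ × ℂ => (W.kasteleyn p.1 p.2).adjugate u v)
        ((W.root j₀ : ℂ), 0))) := (hF.tendsto _).comp h3
    exact h4
  have h2 := h1.div (D.tendsto_ρ.mul D.tendsto_dP) (mul_ne_zero
    (Complex.ofReal_ne_zero.2 (W.root_ne_zero j₀)) (Complex.ofReal_ne_zero.2 (W.dz_ne_zero hgen)))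
  push_cast
  exact h2

theorem tendsto_mul_const (w : ℂ) : Tendsto (fun t : ℝ => (t : ℂ) * w) (𝓝[>] 0) (𝓝 0) := by
  have h : Continuous fun t : ℝ => (t : ℂ) * w := by fun_prop
  have := h.tendsto 0
  simp only [Complex.ofReal_zero, zero_mul] at this
  exact this.mono_left nhdsWithin_le_nhds

/-- The bound is uniform in `w` and `Y`: the circle is moved to the side where `‖z^(-Y)‖ ≤ 1`. A
residue is met on the way only if the pole lies on that side, where `‖pole^(-Y)‖ ≤ 1` too. If the
pole is on the unit circle, the integral is zero by default or no residue appears. -/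
theorem exists_innerInt_bound (D : PoleData W j₀) (γ : ℝ)
    (hgen : ∀ j, j ≠ j₀ → W.abscissa j ≠ W.abscissa j₀) :
    ∃ C : ℝ, ∀ᶠ t in 𝓝[>] (0 : ℝ), ∀ w : ℂ, ‖w‖ ≤ 1 → ∀ Y u v,
      ‖W.innerInt j₀ γ t Y u v w 1‖ ≤ C := by
  obtain ⟨M, hM0, hM⟩ := D.exists_inv_bound γ
  obtain ⟨B, hB⟩ : ∃ B : ℝ, ∀ᶠ τ in 𝓝 (0 : ℂ), ∀ u v, ‖D.coeff u v τ‖ ≤ B := by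
    refine ⟨1 + ∑ u, ∑ v, |W.rootAdj j₀ u v / (W.root j₀ * W.dz j₀)|, ?_⟩
    refine (eventually_all.2 fun u => eventually_all.2 fun v => ?_)
    have h1 := (D.tendsto_coeff hgen u v).norm
    rw [Complex.norm_real, Real.norm_eq_abs] at h1
    refine (h1.eventually (gt_mem_nhds (lt_add_one _))).mono fun τ hτ => hτ.le.trans ?_
    rw [add_comm]
    gcongr
    refine le_trans ?_ (Finset.single_le_sum (f := fun u => ∑ v,
      |W.rootAdj j₀ u v / (W.root j₀ * W.dz j₀)|)
      (fun u _ => Finset.sum_nonneg fun v _ => abs_nonneg _) (Finset.mem_univ u))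
    exact Finset.single_le_sum (f := fun v =>
      |W.rootAdj j₀ u v / (W.root j₀ * W.dz j₀)|) (fun v _ => abs_nonneg _) (Finset.mem_univ v)
  have hB' := eventually_forall_norm_le_one (p := fun t τ => ∀ u v, ‖D.coeff u v τ‖ ≤ B)
    (tendsto_snd.eventually hB)
  refine ⟨2 * Real.pi * M + 2 * Real.pi * B, ?_⟩
  filter_upwards [hM, hB', D.eventually_good γ] with t h1 h2 h3 w hw Y u v
  have hB0 : 0 ≤ B := (norm_nonneg _).trans (h2 w hw u v)
  have hgood := h3 w hw
  have hpi := Real.pi_pos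
  have hp0 : 0 < ‖D.pole γ t w‖ := norm_pos_iff.2 hgood.pole_ne_zero
  have hout : 0 ≤ Y → ‖W.innerInt j₀ γ t Y u v w D.R‖ ≤ 2 * Real.pi * M := fun hY => by
    refine (norm_innerInt_le γ D.R_pos (fun z hz => h1 w hw z (Or.inl hz) u v) Y).trans ?_
    have : D.R ^ (-Y) ≤ 1 := zpow_le_one_of_nonpos₀ D.one_lt_R.le (by omega)
    exact mul_le_of_le_one_right (by positivity) this
  have hin : Y ≤ 0 → ‖W.innerInt j₀ γ t Y u v w D.R⁻¹‖ ≤ 2 * Real.pi * M := fun hY => by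
    refine (norm_innerInt_le γ (inv_pos.2 D.R_pos)
      (fun z hz => h1 w hw z (Or.inr hz) u v) Y).trans ?_
    have : D.R⁻¹ ^ (-Y) ≤ 1 := by
      rw [inv_zpow', neg_neg]
      exact zpow_le_one_of_nonpos₀ D.one_lt_R.le hY
    exact mul_le_of_le_one_right (by positivity) this
  have hres : ‖D.pole γ t w‖ ^ (-Y) ≤ 1 →
      ‖2 * Real.pi * Complex.I * D.residue γ t w Y u v‖ ≤ 2 * Real.pi * B := fun hle => by
    have : ‖D.residue γ t w Y u v‖ ≤ 1 * B := by
      rw [residue, norm_mul, norm_zpow]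
      exact mul_le_mul hle (h2 w hw u v) (norm_nonneg _) zero_le_one
    rw [norm_mul, norm_mul, norm_mul, Complex.norm_I, Complex.norm_real, Real.norm_eq_abs,
      abs_of_pos hpi, RCLike.norm_ofNat, mul_one]
    nlinarith
  have hPB : 0 ≤ 2 * Real.pi * B := by positivity
  have hPM : 0 ≤ 2 * Real.pi * M := by positivity
  rcases lt_trichotomy ‖D.pole γ t w‖ 1 with hp | hp | hp
  · rcases le_total 0 Y with hY | hY
    · rw [(hgood.inner_of_lt Y u v hp).1]
      linarith [hout hY]
    · rw [(hgood.inner_of_lt Y u v hp).2]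
      refine (norm_add_le _ _).trans (add_le_add (hin hY) (hres ?_))
      obtain ⟨k, hk⟩ := Int.eq_ofNat_of_zero_le (show 0 ≤ -Y by omega)
      rw [hk, zpow_natCast]
      exact pow_le_one₀ hp0.le hp.le
  · rcases hgood.inner_of_eq Y u v hp with h | ⟨h, h'⟩
    · rw [h, norm_zero]
      linarith
    · rcases le_total 0 Y with hY | hY
      · rw [h']
        linarith [hout hY]
      · rw [h]
        linarith [hin hY]
  · rcases le_total 0 Y with hY | hY
    · rw [(hgood.inner_of_gt Y u v hp).2]
      refine (norm_sub_le _ _).trans (add_le_add (hout hY) (hres ?_))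
      exact zpow_le_one_of_nonpos₀ hp.le (by omega)
    · rw [(hgood.inner_of_gt Y u v hp).1]
      linarith [hin hY]

/-! ### Asymptotics of the pole -/

theorem root_mul_exp : (-1 : ℂ) ^ m * (Complex.exp (-W.abscissa j₀) * W.root j₀) = 1 := by
  rw [Weights.root]
  push_cast
  rw [show (-1 : ℂ) ^ m * (Complex.exp (-W.abscissa j₀) * ((-1) ^ m * Complex.exp (W.abscissa j₀))) =
    ((-1 : ℂ) ^ m * (-1) ^ m) * (Complex.exp (-W.abscissa j₀) * Complex.exp (W.abscissa j₀)) by ring,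
    ← mul_pow, ← Complex.exp_add]
  simp

/-- The pole leaves `(-1)^m` with velocity `β (w - γ)`, up to this sign: `β w` comes from the root
of `P(·, t w)`, and `-γ β` from the shift of the horizontal field. -/
theorem hasDerivAt_pole (w : ℂ) :
    HasDerivAt (fun t : ℝ => (-1 : ℂ) ^ m * D.pole γ t w) (W.beta j₀ * (w - γ)) 0 := by
  have h1 : HasDerivAt (fun t : ℝ => (t : ℂ) * w) w 0 := by
    simpa using (Complex.ofRealCLM.hasDerivAt (x := (0 : ℝ))).mul_const w
  have h2 : HasDerivAt (fun t : ℝ => D.ρ (t * w)) (W.root j₀ * W.beta j₀ * w) 0 := by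
    have h3 : HasDerivAt D.ρ (W.root j₀ * W.beta j₀) (((0 : ℝ) : ℂ) * w) := by
      simpa using D.ρ_deriv
    exact h3.comp (0 : ℝ) h1
  have h4 : HasDerivAt (fun t : ℝ => (W.fieldX j₀ γ t : ℂ)) (γ * W.beta j₀) 0 := by
    have : HasDerivAt (fun t : ℝ => W.fieldX j₀ γ t) (γ * W.beta j₀) 0 := by
      simpa [Weights.fieldX] using ((hasDerivAt_id (0 : ℝ)).const_mul (γ * W.beta j₀)).const_add
        (W.abscissa j₀)
    exact_mod_cast this.ofReal_comp
  have h4' : HasDerivAt (fun t : ℝ => -(W.fieldX j₀ γ t : ℂ)) (-(γ * W.beta j₀)) 0 := h4.neg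
  have h5 := (h4'.cexp.mul h2).const_mul ((-1 : ℂ) ^ m)
  refine h5.congr_deriv ?_
  have e0 : W.fieldX j₀ γ 0 = W.abscissa j₀ := by simp [Weights.fieldX]
  simp only [e0, Complex.ofReal_zero, zero_mul, D.ρ_zero]
  have h6 := root_mul_exp (W := W) (j₀ := j₀)
  linear_combination (W.beta j₀ * (w - γ)) * h6

theorem pole_zero (w : ℂ) : (-1 : ℂ) ^ m * D.pole γ 0 w = 1 := by
  have e0 : W.fieldX j₀ γ 0 = W.abscissa j₀ := by simp [Weights.fieldX]
  rw [pole, e0]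
  simp only [Complex.ofReal_zero, zero_mul, D.ρ_zero]
  exact root_mul_exp

theorem tendsto_log_pole (w : ℂ) : Tendsto
    (fun t : ℝ => Complex.log ((-1 : ℂ) ^ m * D.pole γ t w) / t) (𝓝[>] 0)
    (𝓝 (W.beta j₀ * (w - γ))) := by
  have h1 := (D.hasDerivAt_pole γ w).clog_real (by rw [pole_zero]; exact Complex.one_mem_slitPlane)
  rw [pole_zero, div_one, hasDerivAt_iff_tendsto_slope_zero] at h1
  refine (h1.mono_left (nhdsWithin_mono _ fun t ht => ne_of_gt ht)).congr fun t => ?_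
  simp only [zero_add, pole_zero, Complex.log_one, sub_zero]
  rw [Complex.real_smul, Complex.ofReal_inv, div_eq_inv_mul]

theorem eventually_pole_gt {w : ℂ} (h : 0 < W.beta j₀ * (w.re - γ)) :
    ∀ᶠ t in 𝓝[>] (0 : ℝ), 1 < ‖D.pole γ t w‖ := by
  have h1 := (Complex.continuous_re.tendsto _).comp (D.tendsto_log_pole γ w)
  have e : (W.beta j₀ * (w - γ) : ℂ).re = W.beta j₀ * (w.re - γ) := by simp
  rw [e] at h1
  filter_upwards [h1.eventually (lt_mem_nhds h), self_mem_nhdsWithin] with t h2 ht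
  have ht' : (0 : ℝ) < t := ht
  simp only [Function.comp_apply, Complex.div_ofReal_re, Complex.log_re, norm_mul, norm_pow,
    norm_neg, norm_one, one_pow, one_mul] at h2
  have h3 := (div_pos_iff_of_pos_right ht').1 h2
  by_contra h4
  push Not at h4
  exact absurd (Real.log_nonpos (norm_nonneg _) h4) (not_le.2 h3)

theorem eventually_pole_lt {w : ℂ} (h : W.beta j₀ * (w.re - γ) < 0) :
    ∀ᶠ t in 𝓝[>] (0 : ℝ), ‖D.pole γ t w‖ < 1 := by
  have h1 := (Complex.continuous_re.tendsto _).comp (D.tendsto_log_pole γ w)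
  have e : (W.beta j₀ * (w - γ) : ℂ).re = W.beta j₀ * (w.re - γ) := by simp
  rw [e] at h1
  filter_upwards [h1.eventually (gt_mem_nhds h), self_mem_nhdsWithin] with t h2 ht
  have ht' : (0 : ℝ) < t := ht
  simp only [Function.comp_apply, Complex.div_ofReal_re, Complex.log_re, norm_mul, norm_pow,
    norm_neg, norm_one, one_pow, one_mul] at h2
  by_contra h4
  push Not at h4
  exact absurd (div_nonneg (Real.log_nonneg h4) ht'.le) (not_le.2 h2)

theorem tendsto_pole_zpow (w : ℂ) {Y : ℝ → ℤ} {η : ℝ}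
    (hY : Tendsto (fun t : ℝ => t * Y t) (𝓝[>] 0) (𝓝 η)) :
    Tendsto (fun t : ℝ => ((-1 : ℂ) ^ m) ^ (Y t) * D.pole γ t w ^ (-Y t)) (𝓝[>] 0)
      (𝓝 (Complex.exp (-(η * (W.beta j₀ * (w - γ)))))) := by
  have h1 : Tendsto (fun t : ℝ => ((t * Y t : ℝ) : ℂ)) (𝓝[>] 0) (𝓝 (η : ℂ)) :=
    (Complex.continuous_ofReal.tendsto _).comp hY
  have h2 := (Complex.continuous_exp.tendsto _).comp (h1.mul (D.tendsto_log_pole γ w)).neg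
  have h3 : ContinuousAt (fun t : ℝ => (-1 : ℂ) ^ m * D.pole γ t w) 0 :=
    (D.hasDerivAt_pole γ w).continuousAt
  have h4 : ∀ᶠ t in 𝓝[>] (0 : ℝ), (-1 : ℂ) ^ m * D.pole γ t w ≠ 0 :=
    nhdsWithin_le_nhds (h3.eventually_ne (by rw [pole_zero]; exact one_ne_zero))
  refine h2.congr' ?_
  filter_upwards [h4, self_mem_nhdsWithin] with t ht ht0
  have ht' : (t : ℂ) ≠ 0 := Complex.ofReal_ne_zero.2 (ne_of_gt ht0)
  have e1 : ((-1 : ℂ) ^ m) ^ (Y t) = ((-1 : ℂ) ^ m) ^ (-Y t) := by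
    rcases neg_one_pow_eq_or ℂ m with h | h <;> rw [h]
    · simp
    · rw [zpow_neg, ← inv_zpow, inv_neg_one]
  rw [e1, ← mul_zpow]
  simp only [Function.comp_apply]
  have e2 : -(((t * Y t : ℝ) : ℂ) * (Complex.log ((-1 : ℂ) ^ m * D.pole γ t w) / t)) =
      ((-Y t : ℤ) : ℂ) * Complex.log ((-1 : ℂ) ^ m * D.pole γ t w) := by
    push_cast
    field_simp
  rw [e2, Complex.exp_int_mul, Complex.exp_log ht]

theorem tendsto_residue (hgen : ∀ j, j ≠ j₀ → W.abscissa j ≠ W.abscissa j₀) (w : ℂ) {Y : ℝ → ℤ}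
    {η : ℝ} (hY : Tendsto (fun t : ℝ => t * Y t) (𝓝[>] 0) (𝓝 η)) (u v : ZMod m × ZMod n) :
    Tendsto (fun t : ℝ => ((-1 : ℂ) ^ m) ^ (Y t) * D.residue γ t w (Y t) u v) (𝓝[>] 0)
      (𝓝 (Complex.exp (-(η * (W.beta j₀ * (w - γ)))) *
        ((W.rootAdj j₀ u v / (W.root j₀ * W.dz j₀) : ℝ) : ℂ))) := by
  have h1 := (D.tendsto_pole_zpow γ w hY).mul ((D.tendsto_coeff hgen u v).comp (tendsto_mul_const w))
  refine h1.congr fun t => ?_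
  rw [residue, mul_assoc]
  rfl

theorem norm_sign_zpow (k : ℤ) : ‖((-1 : ℂ) ^ m) ^ k‖ = 1 := by
  rw [norm_zpow, norm_pow, norm_neg, norm_one, one_pow, one_zpow]

theorem tendsto_zpow_neg {R : ℝ} (hR : 1 < R) {Y : ℝ → ℤ} (hY : Tendsto Y (𝓝[>] 0) atTop) :
    Tendsto (fun t => R ^ (-Y t)) (𝓝[>] 0) (𝓝 0) := by
  have h1 : Tendsto (fun t => (Y t).toNat) (𝓝[>] 0) atTop := by
    refine tendsto_atTop.2 fun k => ?_
    filter_upwards [hY.eventually_ge_atTop (k : ℤ)] with t ht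
    omega
  refine ((tendsto_pow_atTop_nhds_zero_of_lt_one (inv_nonneg.2 (zero_lt_one.trans hR).le)
    (inv_lt_one_of_one_lt₀ hR)).comp h1).congr' ?_
  filter_upwards [hY.eventually_ge_atTop 0] with t ht
  rw [Function.comp_apply, ← zpow_natCast, Int.toNat_of_nonneg ht, inv_zpow']

theorem tendsto_innerInt_outer {w : ℂ} (hw : ‖w‖ ≤ 1) {Y : ℝ → ℤ} (hY : Tendsto Y (𝓝[>] 0) atTop)
    (u v : ZMod m × ZMod n) :
    Tendsto (fun t : ℝ => ((-1 : ℂ) ^ m) ^ (Y t) * W.innerInt j₀ γ t (Y t) u v w D.R) (𝓝[>] 0)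
      (𝓝 0) := by
  obtain ⟨M, hM0, hM⟩ := D.exists_inv_bound γ
  have h2 := (tendsto_zpow_neg D.one_lt_R hY).const_mul (2 * Real.pi * M)
  rw [mul_zero] at h2
  refine squeeze_zero_norm' ?_ h2
  filter_upwards [hM] with t h1
  rw [norm_mul, norm_sign_zpow, one_mul]
  exact norm_innerInt_le γ D.R_pos (fun z hz => h1 w hw z (Or.inl hz) u v) (Y t)

theorem tendsto_innerInt_inner {w : ℂ} (hw : ‖w‖ ≤ 1) {Y : ℝ → ℤ} (hY : Tendsto Y (𝓝[>] 0) atBot)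
    (u v : ZMod m × ZMod n) :
    Tendsto (fun t : ℝ => ((-1 : ℂ) ^ m) ^ (Y t) * W.innerInt j₀ γ t (Y t) u v w D.R⁻¹) (𝓝[>] 0)
      (𝓝 0) := by
  obtain ⟨M, hM0, hM⟩ := D.exists_inv_bound γ
  have h2 := tendsto_zpow_neg D.one_lt_R (Y := fun t => -Y t) (tendsto_neg_atBot_atTop.comp hY)
  replace h2 := h2.const_mul (2 * Real.pi * M)
  rw [mul_zero] at h2
  refine squeeze_zero_norm' ?_ h2
  filter_upwards [hM] with t h1
  rw [norm_mul, norm_sign_zpow, one_mul]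
  refine (norm_innerInt_le γ (inv_pos.2 D.R_pos)
    (fun z hz => h1 w hw z (Or.inr hz) u v) (Y t)).trans (le_of_eq ?_)
  rw [inv_zpow', neg_neg]

/-- The limit of the integral over `z`, for a positive separation. -/
theorem tendsto_innerInt_atTop (D : PoleData W j₀) (γ : ℝ)
    (hgen : ∀ j, j ≠ j₀ → W.abscissa j ≠ W.abscissa j₀) {w : ℂ}
    (hw : ‖w‖ ≤ 1) (hre : w.re ≠ γ) {Y : ℝ → ℤ} {η : ℝ}
    (hY : Tendsto (fun t : ℝ => t * Y t) (𝓝[>] 0) (𝓝 η)) (hY' : Tendsto Y (𝓝[>] 0) atTop)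
    (u v : ZMod m × ZMod n) :
    Tendsto (fun t : ℝ => ((-1 : ℂ) ^ m) ^ (Y t) * W.innerInt j₀ γ t (Y t) u v w 1) (𝓝[>] 0)
      (𝓝 (if 0 < W.beta j₀ * (w.re - γ) then -(2 * Real.pi * Complex.I *
        (Complex.exp (-(η * (W.beta j₀ * (w - γ)))) *
        ((W.rootAdj j₀ u v / (W.root j₀ * W.dz j₀) : ℝ) : ℂ))) else 0)) := by
  have hout := D.tendsto_innerInt_outer γ hw hY' u v
  split_ifs with h
  · have h1 := hout.sub ((D.tendsto_residue γ hgen w hY u v).const_mul (2 * Real.pi * Complex.I))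
    rw [zero_sub] at h1
    refine h1.congr' ?_
    filter_upwards [D.eventually_good γ, D.eventually_pole_gt γ h] with t h2 h3
    rw [((h2 w hw).inner_of_gt (Y t) u v h3).2]
    ring
  · have hneg : W.beta j₀ * (w.re - γ) < 0 := lt_of_le_of_ne (not_lt.1 h)
      (mul_ne_zero (W.beta_ne_zero hgen) (sub_ne_zero.2 hre))
    refine hout.congr' ?_
    filter_upwards [D.eventually_good γ, D.eventually_pole_lt γ hneg] with t h2 h3
    rw [((h2 w hw).inner_of_lt (Y t) u v h3).1]

/-- The limit of the integral over `z`, for a negative separation. -/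
theorem tendsto_innerInt_atBot (D : PoleData W j₀) (γ : ℝ)
    (hgen : ∀ j, j ≠ j₀ → W.abscissa j ≠ W.abscissa j₀) {w : ℂ}
    (hw : ‖w‖ ≤ 1) (hre : w.re ≠ γ) {Y : ℝ → ℤ} {η : ℝ}
    (hY : Tendsto (fun t : ℝ => t * Y t) (𝓝[>] 0) (𝓝 η)) (hY' : Tendsto Y (𝓝[>] 0) atBot)
    (u v : ZMod m × ZMod n) :
    Tendsto (fun t : ℝ => ((-1 : ℂ) ^ m) ^ (Y t) * W.innerInt j₀ γ t (Y t) u v w 1) (𝓝[>] 0)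
      (𝓝 (if W.beta j₀ * (w.re - γ) < 0 then 2 * Real.pi * Complex.I *
        (Complex.exp (-(η * (W.beta j₀ * (w - γ)))) *
        ((W.rootAdj j₀ u v / (W.root j₀ * W.dz j₀) : ℝ) : ℂ)) else 0)) := by
  have hin := D.tendsto_innerInt_inner γ hw hY' u v
  split_ifs with h
  · have h1 := hin.add ((D.tendsto_residue γ hgen w hY u v).const_mul (2 * Real.pi * Complex.I))
    rw [zero_add] at h1
    refine h1.congr' ?_
    filter_upwards [D.eventually_good γ, D.eventually_pole_lt γ h] with t h2 h3
    rw [((h2 w hw).inner_of_lt (Y t) u v h3).2]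
    ring
  · have hpos : 0 < W.beta j₀ * (w.re - γ) := lt_of_le_of_ne (not_lt.1 h)
      (mul_ne_zero (W.beta_ne_zero hgen) (sub_ne_zero.2 hre)).symm
    refine hin.congr' ?_
    filter_upwards [D.eventually_good γ, D.eventually_pole_gt γ hpos] with t h2 h3
    rw [((h2 w hw).inner_of_gt (Y t) u v h3).1]

/-! ### The diagonal in a frozen column -/

theorem det_ne_zero_of_norm {ζ : ℂ} (h1 : |W.root j₀| / D.R ^ 2 ≤ ‖ζ‖)
    (h2 : ‖ζ‖ ≤ |W.root j₀| * D.R ^ 2) (h3 : ‖ζ‖ ≠ |W.root j₀|) : (W.kasteleyn ζ 0).det ≠ 0 := by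
  rw [W.det_kasteleyn_zero]
  refine Finset.prod_ne_zero_iff.2 fun j _ => W.columnDet_ne_zero fun h => ?_
  have h4 : ‖ζ‖ = |W.root j| := by rw [h]; simp
  by_cases hj : j = j₀
  · exact h3 (by rw [h4, hj])
  · rcases D.far j hj with h5 | h5 <;> linarith

/-- The circles of radii `R` and `R⁻¹` stay away from the pole, so the inverse matrix is bounded
there uniformly in small `t`, and dominated convergence applies. -/
theorem tendsto_innerInt_circle {w : ℂ} (hw : ‖w‖ ≤ 1) (u v : ZMod m × ZMod n) {R : ℝ}
    (hR : R = D.R ∨ R = D.R⁻¹) :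
    Tendsto (fun t : ℝ => W.innerInt j₀ γ t 0 u v w R) (𝓝[>] 0)
      (𝓝 (∮ z in C(0, R), z⁻¹ *
        (W.kasteleyn (Complex.exp (W.abscissa j₀) * z) (0 : ℂ))⁻¹ u v)) := by
  obtain ⟨M, hM0, hM⟩ := D.exists_inv_bound γ
  have hR0 : 0 < R := by
    rcases hR with rfl | rfl
    · exact D.R_pos
    · exact inv_pos.2 D.R_pos
  have hRz : ∀ z : ℂ, ‖z‖ = R → ‖z‖ = D.R ∨ ‖z‖ = D.R⁻¹ := fun z hz => by rwa [hz]
  have hmeas : ∀ t : ℝ, Measurable fun z : ℂ =>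
      (W.kasteleyn (Complex.exp (W.fieldX j₀ γ t) * z) (t * w))⁻¹ u v := fun t => by
    simp only [W.kasteleyn_inv_apply]
    have hc : Continuous fun z : ℂ => (Complex.exp (W.fieldX j₀ γ t) * z, (t : ℂ) * w) := by fun_prop
    exact ((W.contDiff_det (k := 1)).continuous.comp hc).measurable.inv.mul
      ((W.contDiff_adjugate (k := 1) u v).continuous.comp hc).measurable
  unfold Weights.innerInt circleIntegral
  refine intervalIntegral.tendsto_integral_filter_of_dominated_convergence (fun _ => M) ?_ ?_ ?_ ?_
  · refine Eventually.of_forall fun t => Measurable.aestronglyMeasurable ?_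
    have h1 : Measurable fun θ : ℝ => circleMap 0 R θ := (continuous_circleMap 0 R).measurable
    have h2 : Measurable fun θ : ℝ => deriv (circleMap 0 R) θ := by
      simp only [deriv_circleMap]
      exact h1.mul_const _
    refine h2.smul (Measurable.mul ?_ ((hmeas t).comp h1))
    have h3 : Measurable fun z : ℂ => z ^ (-(0 : ℤ) - 1) := by
      simp only [neg_zero, zero_sub, zpow_neg_one]
      exact measurable_inv
    exact h3.comp h1
  · filter_upwards [hM] with t h1
    refine Eventually.of_forall fun θ _ => ?_
    have hz : ‖circleMap 0 R θ‖ = R := by simp [abs_of_pos hR0]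
    rw [deriv_circleMap, norm_smul, norm_mul, norm_mul, Complex.norm_I, norm_zpow, hz, neg_zero,
      zero_sub, zpow_neg_one, mul_one, ← mul_assoc, mul_inv_cancel₀ hR0.ne', one_mul]
    exact h1 w hw _ (hRz _ hz) u v
  · exact intervalIntegrable_const
  · refine Eventually.of_forall fun θ _ => ?_
    have hz : ‖circleMap 0 R θ‖ = R := by simp [abs_of_pos hR0]
    generalize circleMap 0 R θ = z at hz
    have hR1 := D.one_lt_R
    have hr : 0 < |W.root j₀| := root_pos
    have hne : (W.kasteleyn (Complex.exp (W.abscissa j₀) * z) (0 : ℂ)).det ≠ 0 := by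
      have e : ‖Complex.exp (W.abscissa j₀) * z‖ = |W.root j₀| * R := by
        rw [norm_mul, Complex.norm_exp, Complex.ofReal_re, hz, W.abs_root]
      have h3 : D.R⁻¹ < 1 := inv_lt_one_of_one_lt₀ hR1
      have h4 : D.R < D.R ^ 2 := by nlinarith
      have h5 : (D.R ^ 2)⁻¹ < D.R⁻¹ := (inv_lt_inv₀ (by positivity) D.R_pos).2 h4
      refine D.det_ne_zero_of_norm ?_ ?_ ?_ <;> rw [e]
      · rw [div_eq_mul_inv]
        rcases hR with rfl | rfl <;> gcongr
        linarith
      · rcases hR with rfl | rfl <;> gcongr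
        linarith
      · rcases hR with h | h
        · exact (lt_mul_of_one_lt_right hr (h ▸ hR1)).ne'
        · exact (mul_lt_of_lt_one_right hr (h ▸ h3)).ne
    have hlim : Tendsto (fun t : ℝ => (Complex.exp (W.fieldX j₀ γ t) * z, (t : ℂ) * w)) (𝓝[>] 0)
        (𝓝 (Complex.exp (W.abscissa j₀) * z, 0)) := by
      refine Tendsto.prodMk_nhds (Tendsto.mul_const _ ?_) (tendsto_mul_const w)
      refine (Complex.continuous_exp.tendsto _).comp ((Complex.continuous_ofReal.tendsto _).comp ?_)
      exact (W.tendsto_fieldX j₀ γ).mono_left nhdsWithin_le_nhds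
    have h1 := ((W.contDiff_det (k := 1)).continuous.tendsto _).comp hlim
    have h2 := ((W.contDiff_adjugate (k := 1) u v).continuous.tendsto _).comp hlim
    simp only [W.kasteleyn_inv_apply, neg_zero, zero_sub, zpow_neg_one]
    exact (((h1.inv₀ hne).mul h2).const_mul _).const_smul _

/-- By `adjugate_diag` the integrand is `z⁻¹ - (z - p)⁻¹` with `p` the root of the column `j`
divided by `e^κ`, `κ` the abscissa of `j₀`. If `|p| > 1` the inner circle surrounds only `0`;
otherwise the outer circle surrounds both poles, whose residues cancel. -/
theorem circleIntegral_diag {j : ZMod n} (i : ZMod m) {R : ℝ} (hR : if W.abscissa j₀ < W.abscissa j then R = D.R⁻¹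
      else R = D.R) :
    (W.a i j : ℂ) * ∮ z in C(0, R), z⁻¹ *
        (W.kasteleyn (Complex.exp (W.abscissa j₀) * z) (0 : ℂ))⁻¹ (i, j) (i, j) =
      if W.abscissa j₀ < W.abscissa j then 2 * Real.pi * Complex.I else 0 := by
  have hR1 := D.one_lt_R
  have hinv : D.R⁻¹ < 1 := inv_lt_one_of_one_lt₀ hR1
  have hR0 : 0 < R := by
    split_ifs at hR with h
    · rw [hR]; exact inv_pos.2 D.R_pos
    · rw [hR]; exact D.R_pos
  have hr : 0 < |W.root j₀| := root_pos
  set e := Complex.exp (W.abscissa j₀) with he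
  have he0 : e ≠ 0 := Complex.exp_ne_zero _
  have hen : ‖e‖ = |W.root j₀| := by rw [he, Complex.norm_exp, Complex.ofReal_re, W.abs_root]
  set p : ℂ := W.root j / e with hp
  have hpn : ‖p‖ = |W.root j| / |W.root j₀| := by
    rw [hp, norm_div, hen, Complex.norm_real, Real.norm_eq_abs]
  have hp1 : W.abscissa j₀ < W.abscissa j ↔ 1 < ‖p‖ := by
    rw [hpn, one_lt_div hr, W.abs_root, W.abs_root, Real.exp_lt_exp]
  have hRp : if W.abscissa j₀ < W.abscissa j then R < ‖p‖ else ‖p‖ < R := by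
    split_ifs at hR ⊢ with h
    · rw [hR]
      linarith [hp1.1 h]
    · have : ‖p‖ ≤ 1 := not_lt.1 fun h1 => h (hp1.2 h1)
      rw [hR]
      linarith
  have hpR : ‖p‖ ≠ R := by
    split_ifs at hRp
    · exact hRp.ne'
    · exact hRp.ne
  have hdet : ∀ z : ℂ, ‖z‖ = R → (W.kasteleyn (e * z) (0 : ℂ)).det ≠ 0 := fun z hz => by
    have h4 : D.R < D.R ^ 2 := by nlinarith
    have h5 : (D.R ^ 2)⁻¹ < D.R⁻¹ := (inv_lt_inv₀ (by positivity) D.R_pos).2 h4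
    have hR' : R = D.R ∨ R = D.R⁻¹ := by
      split_ifs at hR
      · exact Or.inr hR
      · exact Or.inl hR
    refine D.det_ne_zero_of_norm ?_ ?_ ?_ <;> rw [norm_mul, hen, hz]
    · rw [div_eq_mul_inv]
      rcases hR' with h | h <;> rw [h] <;> gcongr
      linarith
    · rcases hR' with h | h <;> rw [h] <;> gcongr
      linarith
    · rcases hR' with h | h
      · exact (lt_mul_of_one_lt_right hr (h ▸ hR1)).ne'
      · exact (mul_lt_of_lt_one_right hr (h ▸ hinv)).ne
  have hpt : ∀ z : ℂ, ‖z‖ = R → (W.a i j : ℂ) * (z⁻¹ *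
      (W.kasteleyn (e * z) (0 : ℂ))⁻¹ (i, j) (i, j)) = (z - 0)⁻¹ - (z - p)⁻¹ := fun z hz => by
    have h1 := W.adjugate_diag (e * z) i j
    have hz0 : z ≠ 0 := by
      rintro rfl
      rw [norm_zero] at hz
      exact hR0.ne hz
    have hzp : z - p ≠ 0 := sub_ne_zero.2 fun h => hpR (by rw [← h, hz])
    have hc : (∏ i, (W.a i j : ℂ)) = ((-1) ^ m * ∏ i, W.c i j : ℝ) * W.root j := by
      have h2 := W.columnDet_eq j (0 : ℂ)
      simpa [Weights.columnDet] using h2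
    rw [hc, W.columnDet_eq] at h1
    have hC : (((-1) ^ m * ∏ i, W.c i j : ℝ) : ℂ) ≠ 0 :=
      Complex.ofReal_ne_zero.2 (mul_ne_zero (by simp) (W.prod_c_pos j).ne')
    have hrz : (W.root j : ℂ) - e * z = -(e * (z - p)) := by
      rw [hp]
      field_simp
      ring
    simp only [Complex.coe_algebraMap] at h1
    rw [hrz] at h1
    have h3 : (W.a i j : ℂ) * (W.kasteleyn (e * z) (0 : ℂ)).adjugate (i, j) (i, j) * (-(z - p)) =
        (W.kasteleyn (e * z) (0 : ℂ)).det * p := by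
      have h4 : (W.root j : ℂ) = e * p := by rw [hp]; field_simp
      rw [h4] at h1
      have h5 : (((-1) ^ m * ∏ i, W.c i j : ℝ) : ℂ) * e ≠ 0 := mul_ne_zero hC he0
      apply mul_left_cancel₀ h5
      linear_combination h1
    rw [W.kasteleyn_inv_apply]
    have hd := hdet z hz
    have hz0' : z - 0 ≠ 0 := by simpa using hz0
    generalize (W.kasteleyn (e * z) (0 : ℂ)).det = d at *
    generalize (W.kasteleyn (e * z) (0 : ℂ)).adjugate (i, j) (i, j) = N at *
    clear_value p
    rw [inv_sub_inv hz0' hzp]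
    simp only [sub_zero]
    field_simp
    linear_combination -h3
  rw [← circleIntegral.integral_const_mul,
    circleIntegral.integral_congr hR0.le fun z hz => hpt z (by simpa using hz),
    circleIntegral.integral_sub]
  · rw [circleIntegral_inv_sub_of_norm_lt (by simpa using hR0)]
    split_ifs at hRp ⊢ with h
    · rw [circleIntegral_inv_sub_of_lt_norm hR0.le hRp, sub_zero]
    · rw [circleIntegral_inv_sub_of_norm_lt hRp, sub_self]
  · rw [circleIntegrable_sub_inv_iff]
    right
    simpa [abs_of_pos hR0] using hR0.ne
  · rw [circleIntegrable_sub_inv_iff]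
    right
    simpa [abs_of_pos hR0] using hpR

/-- In a frozen column the diagonal of the inverse tends to that of a dimer configuration made of
typical edges. -/
theorem tendsto_innerInt_diag (D : PoleData W j₀) (γ : ℝ)
    (hgen : ∀ j, j ≠ j₀ → W.abscissa j ≠ W.abscissa j₀) {j : ZMod n}
    (hj : j ≠ j₀) (i : ZMod m) {w : ℂ} (hw : ‖w‖ ≤ 1) (hre : w.re ≠ γ) :
    Tendsto (fun t : ℝ => (W.a i j : ℂ) * W.innerInt j₀ γ t 0 (i, j) (i, j) w 1) (𝓝[>] 0)
      (𝓝 (if W.abscissa j₀ < W.abscissa j then 2 * Real.pi * Complex.I else 0)) := by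
  have hne : W.beta j₀ * (w.re - γ) ≠ 0 :=
    mul_ne_zero (W.beta_ne_zero hgen) (sub_ne_zero.2 hre)
  -- The adjugate at the root vanishes on the diagonal of a frozen column. So the residue is
  -- negligible and the side on which the pole lies does not matter.
  have hres : Tendsto (fun t : ℝ => 2 * Real.pi * Complex.I * D.residue γ t w 0 (i, j) (i, j))
      (𝓝[>] 0) (𝓝 0) := by
    have h1 := (D.tendsto_residue γ hgen w (Y := fun _ => 0) (η := 0) (by simp) (i, j)
      (i, j)).const_mul (2 * Real.pi * Complex.I)
    rw [W.rootAdj_eq_zero hgen hj] at h1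
    simpa using h1
  by_cases hlt : W.abscissa j₀ < W.abscissa j
  · have h0 := D.circleIntegral_diag i (R := D.R⁻¹) (by rw [if_pos hlt])
    rw [← h0]
    refine Tendsto.const_mul _ ?_
    have h1 := D.tendsto_innerInt_circle γ hw (i, j) (i, j) (Or.inr rfl)
    rcases lt_or_gt_of_ne hne with h | h
    · have h2 := h1.add hres
      rw [add_zero] at h2
      refine h2.congr' ?_
      filter_upwards [D.eventually_good γ, D.eventually_pole_lt γ h] with t h3 h4
      rw [((h3 w hw).inner_of_lt 0 (i, j) (i, j) h4).2]
    · refine h1.congr' ?_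
      filter_upwards [D.eventually_good γ, D.eventually_pole_gt γ h] with t h3 h4
      rw [((h3 w hw).inner_of_gt 0 (i, j) (i, j) h4).1]
  · have h0 := D.circleIntegral_diag i (R := D.R) (by rw [if_neg hlt])
    rw [← h0]
    refine Tendsto.const_mul _ ?_
    have h1 := D.tendsto_innerInt_circle γ hw (i, j) (i, j) (Or.inl rfl)
    rcases lt_or_gt_of_ne hne with h | h
    · refine h1.congr' ?_
      filter_upwards [D.eventually_good γ, D.eventually_pole_lt γ h] with t h3 h4
      rw [((h3 w hw).inner_of_lt 0 (i, j) (i, j) h4).1]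
    · have h2 := h1.sub hres
      rw [sub_zero] at h2
      refine h2.congr' ?_
      filter_upwards [D.eventually_good γ, D.eventually_pole_gt γ h] with t h3 h4
      rw [((h3 w hw).inner_of_gt 0 (i, j) (i, j) h4).2]

end PoleData

end BeadDimer

end

/-! ### Absolute convergence on the torus and exchange of the two integrals. -/

noncomputable section

namespace BeadDimer

variable {n m : ℕ} [NeZero n] [NeZero m]

/-! ### Integrability of the inverse of the characteristic polynomial on the torus -/

/-- In dimension two the radial measure has density proportional to the radius, which compensates
the singularity. -/
theorem integrableAtFilter_inv_norm_sub (p : ℝ × ℝ) :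
    IntegrableAtFilter (fun x : ℝ × ℝ => ‖x - p‖⁻¹) (𝓝 p) := by
  have h1 : IntegrableOn (fun x : ℝ × ℝ => ‖x‖⁻¹) (Metric.ball 0 1) := by
    refine (integrableOn_fun_norm_addHaar (volume : Measure (ℝ × ℝ)) (f := fun y => y⁻¹)).2 ?_
    have e : Module.finrank ℝ (ℝ × ℝ) - 1 = 1 := by simp
    rw [e]
    refine (integrableOn_const (C := (1 : ℝ)) (by simp)).congr_fun (fun y hy => ?_)
      measurableSet_Ioo
    have : y ≠ 0 := hy.1.ne'
    simp [this]
  refine ⟨Metric.ball p 1, Metric.ball_mem_nhds p one_pos, ?_⟩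
  rw [← integrable_indicator_iff measurableSet_ball] at h1 ⊢
  refine (h1.comp_sub_right p).congr (Eventually.of_forall fun x => ?_)
  by_cases hx : x ∈ Metric.ball p 1
  · have hx' : x - p ∈ Metric.ball (0 : ℝ × ℝ) 1 := by
      rw [mem_ball_zero_iff]; exact mem_ball_iff_norm.1 hx
    simp [Set.indicator_of_mem hx, Set.indicator_of_mem hx']
  · have hx' : x - p ∉ Metric.ball (0 : ℝ × ℝ) 1 := by
      rw [mem_ball_zero_iff]; exact fun h => hx (mem_ball_iff_norm.2 h)
    simp [Set.indicator_of_notMem hx, Set.indicator_of_notMem hx']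

/-- Near a zero `p` with injective differential `L`, `‖L (x - p)‖` dominates a multiple of `‖x - p‖`
and the remainder is at most half of it, so `‖Φ x‖⁻¹` is at most a multiple of `‖x - p‖⁻¹`. -/
theorem integrableOn_inv_norm {Φ : ℝ × ℝ → ℂ} (hΦ : Continuous Φ) {K : Set (ℝ × ℝ)}
    (hK : IsCompact K) (h : ∀ p ∈ K, Φ p = 0 → ∃ L : ℝ × ℝ →L[ℝ] ℂ, HasFDerivAt Φ L p ∧
      ∀ x, L x = 0 → x = 0) :
    IntegrableOn (fun x => ‖Φ x‖⁻¹) K := by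
  have hmeas : Measurable fun x => ‖Φ x‖⁻¹ := hΦ.norm.measurable.inv
  refine LocallyIntegrableOn.integrableOn_isCompact (fun p hp => ?_) hK
  refine IntegrableAtFilter.filter_mono (nhdsWithin_le_nhds (a := p)) ?_
  by_cases hp0 : Φ p = 0
  · obtain ⟨L, hL, hinj⟩ := h p hp hp0
    obtain ⟨c, hc, hcL⟩ := L.toLinearMap.exists_antilipschitzWith
      (LinearMap.ker_eq_bot'.2 hinj)
    have hlow : ∀ x, ‖x‖ ≤ c * ‖L x‖ := fun x => by
      simpa using hcL.le_mul_norm (map_zero L.toLinearMap) x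
    have hc' : (0 : ℝ) < c := by exact_mod_cast hc
    have h1 := (hasFDerivAt_iff_isLittleO.1 hL).def (show (0 : ℝ) < (2 * c)⁻¹ by positivity)
    obtain ⟨s, hs, hsi⟩ := integrableAtFilter_inv_norm_sub p
    refine ⟨s ∩ {x | ‖Φ x - Φ p - L (x - p)‖ ≤ (2 * (c : ℝ))⁻¹ * ‖x - p‖}, inter_mem hs h1, ?_⟩
    refine Integrable.mono' ((hsi.mono_set Set.inter_subset_left).const_mul (2 * (c : ℝ)))
      hmeas.aestronglyMeasurable.restrict ?_
    have hmset : MeasurableSet {x | ‖Φ x - Φ p - L (x - p)‖ ≤ (2 * (c : ℝ))⁻¹ * ‖x - p‖} := by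
      refine measurableSet_le ?_ ?_
      · exact (((hΦ.sub continuous_const).sub (L.continuous.comp
          (continuous_id.sub continuous_const))).norm).measurable
      · exact ((continuous_id.sub continuous_const).norm.const_mul _ |>.measurable)
    rw [Set.inter_comm, ← Measure.restrict_restrict hmset]
    refine (ae_restrict_mem hmset).mono fun x hx => ?_
    simp only [Set.mem_ofPred_eq, hp0, sub_zero] at hx
    rw [Real.norm_eq_abs, abs_of_nonneg (by positivity)]
    by_cases hxp : x = p
    · simp [hxp, hp0]
    have h2 := hlow (x - p)
    have h3 : 0 < ‖x - p‖ := norm_pos_iff.2 (sub_ne_zero.2 hxp)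
    have h4 : ‖L (x - p)‖ ≤ ‖Φ x‖ + ‖Φ x - L (x - p)‖ := by
      have := norm_sub_le (Φ x) (Φ x - L (x - p))
      simpa using this
    have h5 : (2 * (c : ℝ))⁻¹ * ‖x - p‖ ≤ ‖Φ x‖ := by
      have h6 : ‖x - p‖ ≤ c * (‖Φ x‖ + (2 * (c : ℝ))⁻¹ * ‖x - p‖) :=
        h2.trans (mul_le_mul_of_nonneg_left (by linarith) hc'.le)
      have h7 : (c : ℝ) * ((2 * (c : ℝ))⁻¹ * ‖x - p‖) = ‖x - p‖ / 2 := by field_simp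
      rw [mul_add, h7] at h6
      rw [inv_mul_le_iff₀ (by positivity)]
      linarith
    calc ‖Φ x‖⁻¹ ≤ ((2 * (c : ℝ))⁻¹ * ‖x - p‖)⁻¹ := inv_anti₀ (by positivity) h5
      _ = 2 * (c : ℝ) * ‖x - p‖⁻¹ := by rw [mul_inv, inv_inv]
  · have h1 : ContinuousAt (fun x => ‖Φ x‖⁻¹) p :=
      hΦ.norm.continuousAt.inv₀ (norm_ne_zero_iff.2 hp0)
    exact h1.integrableAtFilter hmeas.stronglyMeasurable.stronglyMeasurableAtFilter
      (Measure.finiteAt_nhds _ p)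

namespace PoleData

variable {W : Weights n m} {j₀ : ZMod n} (D : PoleData W j₀) (γ : ℝ)

theorem tendsto_mul_prod (w₀ : ℂ) :
    Tendsto (fun q : ℝ × ℂ => (q.1 : ℂ) * q.2) (𝓝[>] 0 ×ˢ 𝓝 w₀) (𝓝 0) := by
  have h : Continuous fun q : ℝ × ℂ => (q.1 : ℂ) * q.2 := by fun_prop
  have := h.tendsto (0, w₀)
  simp only [Complex.ofReal_zero, zero_mul, nhds_prod_eq] at this
  exact this.mono_left (Filter.prod_mono nhdsWithin_le_nhds le_rfl)

/-- The expansion of the pole jointly in `(t, w)`; this makes statements on the whole circle `‖w‖ =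
1` available by compactness. -/
theorem tendsto_pole_slope (w₀ : ℂ) :
    Tendsto (fun q : ℝ × ℂ => ((-1 : ℂ) ^ m * D.pole γ q.1 q.2 - 1) / q.1) (𝓝[>] 0 ×ˢ 𝓝 w₀)
      (𝓝 (W.beta j₀ * (w₀ - γ))) := by
  have h1 : Tendsto (dslope D.ρ 0) (𝓝 0) (𝓝 (W.root j₀ * W.beta j₀)) := by
    have := (continuousAt_dslope_same.2 D.ρ_deriv.differentiableAt).tendsto
    rwa [dslope_same, D.ρ_deriv.deriv] at this
  have h2 := h1.comp (tendsto_mul_prod w₀)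
  have h3 : Tendsto (fun q : ℝ × ℂ => (W.fieldX j₀ γ q.1 : ℂ)) (𝓝[>] 0 ×ˢ 𝓝 w₀)
      (𝓝 (W.abscissa j₀ : ℂ)) :=
    (Complex.continuous_ofReal.tendsto _).comp
      (((W.tendsto_fieldX j₀ γ).mono_left nhdsWithin_le_nhds).comp tendsto_fst)
  have h4 := (Complex.continuous_exp.tendsto _).comp h3.neg
  have h5 : Tendsto (fun q : ℝ × ℂ => (Complex.exp (-(γ * W.beta j₀ * q.1 : ℂ)) - 1) / q.1)
      (𝓝[>] 0 ×ˢ 𝓝 w₀) (𝓝 (-(γ * W.beta j₀))) := by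
    have h6 : HasDerivAt (fun t : ℝ => Complex.exp (-(γ * W.beta j₀ * t : ℂ)))
        (-(γ * W.beta j₀)) 0 := by
      have h7 := ((Complex.ofRealCLM.hasDerivAt (x := (0 : ℝ))).const_mul
        (γ * W.beta j₀ : ℂ)).neg.cexp
      simpa using h7
    rw [hasDerivAt_iff_tendsto_slope_zero] at h6
    have h8 := h6.mono_left (nhdsWithin_mono (0 : ℝ) fun t (ht : t ∈ Set.Ioi (0 : ℝ)) => ne_of_gt ht)
    refine (h8.comp tendsto_fst).congr fun q => ?_
    simp only [Function.comp_apply, zero_add, Complex.ofReal_zero, mul_zero, neg_zero,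
      Complex.exp_zero]
    rw [Complex.real_smul, Complex.ofReal_inv, div_eq_inv_mul]
  have h9 := (((tendsto_const_nhds (x := (-1 : ℂ) ^ m)).mul h4).mul
    (tendsto_snd.mul h2)).add h5
  have e : (-1 : ℂ) ^ m * Complex.exp (-(W.abscissa j₀ : ℂ)) * (w₀ * (W.root j₀ * W.beta j₀)) +
      -(γ * W.beta j₀) = W.beta j₀ * (w₀ - γ) := by
    linear_combination (W.beta j₀ * w₀) * root_mul_exp (W := W) (j₀ := j₀)
  rw [e] at h9
  refine h9.congr' ?_
  have hpos : ∀ᶠ q : ℝ × ℂ in 𝓝[>] 0 ×ˢ 𝓝 w₀, (0 : ℝ) < q.1 :=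
    tendsto_fst.eventually self_mem_nhdsWithin
  filter_upwards [hpos] with q hq
  have hq' : (q.1 : ℂ) ≠ 0 := Complex.ofReal_ne_zero.2 hq.ne'
  have hd : q.1 * q.2 * dslope D.ρ 0 (q.1 * q.2) = D.ρ (q.1 * q.2) - W.root j₀ := by
    have := sub_smul_dslope D.ρ 0 ((q.1 : ℂ) * q.2)
    rwa [sub_zero, smul_eq_mul, D.ρ_zero] at this
  have he : Complex.exp (-(W.fieldX j₀ γ q.1 : ℂ)) =
      Complex.exp (-(W.abscissa j₀ : ℂ)) * Complex.exp (-(γ * W.beta j₀ * q.1 : ℂ)) := by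
    rw [← Complex.exp_add, Weights.fieldX]
    push_cast
    ring_nf
  have hr := root_mul_exp (W := W) (j₀ := j₀)
  simp only [Function.comp_apply, pole]
  rw [eq_div_iff hq', add_mul, div_mul_cancel₀ _ hq', he]
  linear_combination (-1) ^ m * Complex.exp (-(W.abscissa j₀ : ℂ)) *
    Complex.exp (-(γ * W.beta j₀ * q.1 : ℂ)) * hd -
    Complex.exp (-(γ * W.beta j₀ * q.1 : ℂ)) * hr

/-- The zeros of the characteristic polynomial on the torus are transverse. -/
theorem eventually_transverse (hgen : ∀ j, j ≠ j₀ → W.abscissa j ≠ W.abscissa j₀)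
    (hγ : γ ∈ Set.Ioo (-1 : ℝ) 1) :
    ∀ᶠ t in 𝓝[>] (0 : ℝ), ∀ w : ℂ, ‖w‖ = 1 → ‖D.pole γ t w‖ = 1 →
      (w * (fderiv ℂ (fun p : ℂ × ℂ => (W.kasteleyn p.1 p.2).det) (D.ρ (t * w), t * w) (0, 1) /
        (D.ρ (t * w) * D.dP (t * w)))).im ≠ 0 := by
  have hcpt : IsCompact (Metric.sphere (0 : ℂ) 1) := isCompact_sphere _ _
  have hmain : ∀ w₀ ∈ Metric.sphere (0 : ℂ) 1, ∀ᶠ q : ℝ × ℂ in 𝓝[>] 0 ×ˢ 𝓝 w₀,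
      ‖D.pole γ q.1 q.2‖ = 1 → (q.2 * (fderiv ℂ (fun p : ℂ × ℂ => (W.kasteleyn p.1 p.2).det)
        (D.ρ (q.1 * q.2), q.1 * q.2) (0, 1) /
        (D.ρ (q.1 * q.2) * D.dP (q.1 * q.2)))).im ≠ 0 := by
    intro w₀ hw₀
    have hw₀' : ‖w₀‖ = 1 := by simpa using hw₀
    have hpos : ∀ᶠ q : ℝ × ℂ in 𝓝[>] 0 ×ˢ 𝓝 w₀, (0 : ℝ) < q.1 :=
      tendsto_fst.eventually self_mem_nhdsWithin
    -- If `re w₀ = γ`, then `im w₀ ≠ 0` because `|γ| < 1`, and the imaginary part tends to `-β im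
    -- w₀`. If `re w₀ ≠ γ`, the pole is off the unit circle for `(t, w)` near `(0, w₀)`.
    by_cases hre : w₀.re = γ
    · have him : w₀.im ≠ 0 := by
        intro him
        have := Complex.sq_norm w₀
        rw [hw₀', Complex.normSq_apply, him, hre] at this
        nlinarith [hγ.1, hγ.2]
      have h3 : Continuous fun p : ℂ × ℂ =>
          fderiv ℂ (fun p : ℂ × ℂ => (W.kasteleyn p.1 p.2).det) p (0, 1) :=
        ((W.contDiff_det (k := 1)).continuous_fderiv (by simp)).clm_apply continuous_const
      have h4 : Tendsto (fun τ => fderiv ℂ (fun p : ℂ × ℂ => (W.kasteleyn p.1 p.2).det)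
          (D.ρ τ, τ) (0, 1)) (𝓝 0) (𝓝 (W.dw j₀ : ℂ)) := by
        have h5 : (W.dw j₀ : ℂ) =
            fderiv ℂ (fun p : ℂ × ℂ => (W.kasteleyn p.1 p.2).det) (W.root j₀, 0) (0, 1) := by
          refine (W.hasDerivAt_dw_complex j₀).unique ?_
          have h6 := ((W.contDiff_det (k := 1)).differentiable (by simp)
            ((W.root j₀ : ℂ), 0)).hasFDerivAt
          exact h6.comp_hasDerivAt (x := (0 : ℂ)) (f := fun z : ℂ => ((W.root j₀ : ℂ), z))
            (f' := (0, 1)) ((hasDerivAt_const _ _).prodMk (hasDerivAt_id _))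
        rw [h5]
        exact h3.continuousAt.tendsto.comp (D.tendsto_ρ.prodMk_nhds tendsto_id)
      have h7 := (h4.div (D.tendsto_ρ.mul D.tendsto_dP) (mul_ne_zero
        (Complex.ofReal_ne_zero.2 (W.root_ne_zero j₀))
        (Complex.ofReal_ne_zero.2 (W.dz_ne_zero hgen)))).comp (tendsto_mul_prod w₀)
      have h8 := (Complex.continuous_im.tendsto _).comp
        ((tendsto_snd (f := 𝓝[>] (0 : ℝ)) (g := 𝓝 w₀)).mul h7)
      have e : (w₀ * ((W.dw j₀ : ℂ) / (W.root j₀ * W.dz j₀))).im = -(w₀.im * W.beta j₀) := by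
        rw [W.beta_eq, ← Complex.ofReal_mul, ← Complex.ofReal_div, Complex.im_mul_ofReal]
        ring
      rw [e] at h8
      refine (h8.eventually_ne (neg_ne_zero.2 (mul_ne_zero him (W.beta_ne_zero hgen)))).mono
        fun q hq _ => hq
    · have h1 := D.tendsto_pole_slope γ w₀
      have h2 : Tendsto (fun q : ℝ × ℂ => 2 * (((-1 : ℂ) ^ m * D.pole γ q.1 q.2 - 1) / q.1).re +
          q.1 * ‖((-1 : ℂ) ^ m * D.pole γ q.1 q.2 - 1) / q.1‖ ^ 2) (𝓝[>] 0 ×ˢ 𝓝 w₀)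
          (𝓝 (2 * (W.beta j₀ * (w₀.re - γ)))) := by
        have h3 := ((Complex.continuous_re.tendsto _).comp h1).const_mul 2
        have h4 : Tendsto (fun q : ℝ × ℂ => q.1) (𝓝[>] 0 ×ˢ 𝓝 w₀) (𝓝 0) :=
          (tendsto_id.mono_left nhdsWithin_le_nhds).comp tendsto_fst
        have h5 := h3.add (h4.mul (h1.norm.pow 2))
        have e : (W.beta j₀ * (w₀ - γ) : ℂ).re = W.beta j₀ * (w₀.re - γ) := by simp
        rw [e, zero_mul, add_zero] at h5
        exact h5
      filter_upwards [hpos, h2.eventually_ne (mul_ne_zero two_ne_zero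
        (mul_ne_zero (W.beta_ne_zero hgen) (sub_ne_zero.2 hre)))] with q hq h3 h4
      refine absurd ?_ h3
      set g := ((-1 : ℂ) ^ m * D.pole γ q.1 q.2 - 1) / q.1 with hg
      have hq' : (q.1 : ℂ) ≠ 0 := Complex.ofReal_ne_zero.2 hq.ne'
      have h5 : (-1 : ℂ) ^ m * D.pole γ q.1 q.2 = 1 + q.1 * g := by
        rw [hg]; field_simp; ring
      have h6 : ‖(1 : ℂ) + q.1 * g‖ = 1 := by
        rw [← h5, norm_mul, h4]; simp
      have h7 := Complex.sq_norm ((1 : ℂ) + q.1 * g)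
      rw [h6, Complex.normSq_apply] at h7
      have h8 := Complex.sq_norm g
      rw [Complex.normSq_apply] at h8
      simp only [Complex.add_re, Complex.one_re, Complex.mul_re, Complex.ofReal_re,
        Complex.ofReal_im, zero_mul, sub_zero, Complex.add_im, Complex.one_im, Complex.mul_im,
        add_zero, zero_add] at h7
      rw [h8]
      have h9 : q.1 * (2 * g.re + q.1 * (g.re * g.re + g.im * g.im)) = 0 := by linarith
      exact (mul_eq_zero.1 h9).resolve_left hq.ne'
  -- Compactness of the circle gives one interval of values of `t` for all `w`.
  have := hcpt.mem_prod_nhdsSet_of_forall (l := 𝓝[>] (0 : ℝ)) hmain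
  obtain ⟨s, hs, V, hV, hsV⟩ := Filter.mem_prod_iff.1 this
  filter_upwards [hs] with t ht w hw h
  exact @hsV (t, w) ⟨ht, subset_of_mem_nhdsSet hV (by simpa using hw)⟩ h

end PoleData

end BeadDimer

end

noncomputable section

namespace BeadDimer

variable {n m : ℕ} [NeZero n] [NeZero m]

/-! ### The inverse Kasteleyn operator as an iterated integral -/

/-- The inverse Kasteleyn operator, with the integral over `w` outside. -/
def Weights.kerInt (W : Weights n m) (j₀ : ZMod n) (γ t : ℝ) (k Y : ℤ) (u v : ZMod m × ZMod n) : ℂ :=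
  ((2 * Real.pi * Complex.I)⁻¹) ^ 2 *
    ∮ w in C(0, 1), w ^ k * W.innerInt j₀ γ t Y u v w 1

/-- The two-dimensional integrand in angular coordinates. -/
def Weights.torusIntegrand (W : Weights n m) (j₀ : ZMod n) (γ t : ℝ) (k Y : ℤ)
    (u v : ZMod m × ZMod n) (x y : ℝ) : ℂ :=
  deriv (circleMap 0 1) x * (deriv (circleMap 0 1) y *
    (circleMap 0 1 x ^ (-Y - 1) * circleMap 0 1 y ^ k *
      (W.kasteleyn (Complex.exp (W.fieldX j₀ γ t) * circleMap 0 1 x) (t * circleMap 0 1 y))⁻¹ u v))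

namespace PoleData

variable {W : Weights n m} {j₀ : ZMod n} (D : PoleData W j₀) (γ : ℝ)

/-- In angular coordinates the differential at a zero is a nonzero multiple of `x₁ + x₂ t q'`, where
`q'` is the quotient whose imaginary part is assumed nonzero. So it is injective over the reals. -/
theorem integrableOn_inv_norm_det {t : ℝ} (h : ∀ w : ℂ, ‖w‖ ≤ 1 → D.Good γ t w)
    (htr : ∀ w : ℂ, ‖w‖ = 1 → ‖D.pole γ t w‖ = 1 →
      (w * (fderiv ℂ (fun p : ℂ × ℂ => (W.kasteleyn p.1 p.2).det) (D.ρ (t * w), t * w) (0, 1) /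
        (D.ρ (t * w) * D.dP (t * w)))).im ≠ 0) (ht : t ≠ 0) {K : Set (ℝ × ℝ)} (hK : IsCompact K) :
    IntegrableOn (fun q : ℝ × ℝ => ‖(W.kasteleyn (Complex.exp (W.fieldX j₀ γ t) *
      circleMap 0 1 q.1) (t * circleMap 0 1 q.2)).det‖⁻¹) K := by
  obtain ⟨P, hP⟩ : ∃ P : ℂ × ℂ → ℂ, P = fun p => (W.kasteleyn p.1 p.2).det := ⟨_, rfl⟩
  have hPc : ContDiff ℂ 1 P := hP ▸ W.contDiff_det
  rw [← hP] at htr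
  set e := Complex.exp (W.fieldX j₀ γ t) with he
  have key := integrableOn_inv_norm
    (Φ := fun q : ℝ × ℝ => P (e * circleMap 0 1 q.1, t * circleMap 0 1 q.2)) ?_ hK ?_
  · simpa only [hP] using key
  · refine hPc.continuous.comp ?_
    have := continuous_circleMap 0 1
    fun_prop
  · intro q _ hq
    set z := circleMap 0 1 q.1 with hz
    set w := circleMap 0 1 q.2 with hw
    have hzn : ‖z‖ = 1 := by simp [hz]
    have hwn : ‖w‖ = 1 := by simp [hw]
    have hgood := h w hwn.le
    have hR := D.one_lt_R
    -- By the linear lower bound, the zeros of the determinant on the torus are the points where `z`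
    -- is the pole.
    have hzp : z = D.pole γ t w := by
      have h1 := hgood.lower (z := z) (by rw [hzn]; exact (inv_lt_one_of_one_lt₀ hR).le)
        (by rw [hzn]; exact hR.le)
      have h2 : (W.kasteleyn (Complex.exp (W.fieldX j₀ γ t) * z) (t * w)).det = 0 := by
        have : P (e * z, t * w) = 0 := hq
        rwa [hP] at this
      rw [h2, norm_zero] at h1
      have h3 : 0 < D.c * (|W.root j₀| / D.R) :=
        mul_pos D.c_pos (div_pos root_pos D.R_pos)
      have h4 : ‖z - D.pole γ t w‖ ≤ 0 := by
        by_contra h5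
        exact absurd h1 (not_le.2 (mul_pos h3 (not_le.1 h5)))
      exact sub_eq_zero.1 (norm_le_zero_iff.1 h4)
    have hez : e * z = D.ρ (t * w) := by rw [hzp, he, exp_mul_pole]
    have him := htr w hwn (hzp ▸ hzn)
    have hdP : D.dP (t * w) = fderiv ℂ P (D.ρ (t * w), t * w) (1, 0) := by
      have := (hasDerivAt_det (W := W) (D.ρ (t * w)) (t * w)).deriv
      rw [← hP] at this
      exact this
    rw [hdP, ← hez] at him
    have hd : HasFDerivAt P (fderiv ℂ P (e * z, t * w)) (e * z, t * w) :=
      (hPc.differentiable (by simp) _).hasFDerivAt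
    have hg1 : HasDerivAt (fun x => e * circleMap 0 1 x) (e * (z * Complex.I)) q.1 :=
      (hasDerivAt_circleMap 0 1 q.1).const_mul e
    have hg2 : HasDerivAt (fun x => (t : ℂ) * circleMap 0 1 x) (t * (w * Complex.I)) q.2 :=
      (hasDerivAt_circleMap 0 1 q.2).const_mul (t : ℂ)
    have hg := ((hg1.hasFDerivAt (𝕜 := ℝ)).comp q (hasFDerivAt_fst (𝕜 := ℝ))).prodMk
      ((hg2.hasFDerivAt (𝕜 := ℝ)).comp q (hasFDerivAt_snd (𝕜 := ℝ)))
    refine ⟨_, (hd.restrictScalars ℝ).comp q hg, fun x hx => ?_⟩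
    set L := fderiv ℂ P (e * z, t * w) with hL
    have hx' : L (x.1 • (e * (z * Complex.I)), x.2 • ((t : ℂ) * (w * Complex.I))) = 0 := hx
    have hsplit : ∀ a b : ℂ, L (a, b) = a * L (1, 0) + b * L (0, 1) := fun a b => by
      have : ((a, b) : ℂ × ℂ) = a • (1, 0) + b • (0, 1) := by simp
      rw [this, map_add, map_smul, map_smul, smul_eq_mul, smul_eq_mul]
    rw [hsplit, Complex.real_smul, Complex.real_smul] at hx'
    have hPz : e * z * L (1, 0) ≠ 0 := fun h0 => by
      rw [h0, div_zero, mul_zero, Complex.zero_im] at him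
      exact him rfl
    set q' := w * (L (0, 1) / (e * z * L (1, 0))) with hq'
    have h5 : (x.1 : ℂ) + x.2 * t * q' = 0 := by
      have h6 : ((x.1 : ℂ) + x.2 * t * q') * (Complex.I * (e * z * L (1, 0))) = 0 := by
        have h7 : q' * (e * z * L (1, 0)) = w * L (0, 1) := by
          rw [hq', mul_assoc, div_mul_cancel₀ _ hPz]
        linear_combination hx' + x.2 * t * Complex.I * h7
      exact (mul_eq_zero.1 h6).resolve_right (mul_ne_zero Complex.I_ne_zero hPz)
    have h8 := congrArg Complex.im h5
    rw [← Complex.ofReal_mul, Complex.add_im, Complex.ofReal_im, Complex.im_ofReal_mul, zero_add,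
      Complex.zero_im] at h8
    have h9 : x.2 = 0 := by
      have := (mul_eq_zero.1 h8).resolve_right him
      exact (mul_eq_zero.1 this).resolve_right ht
    rw [h9] at h5
    have h10 : x.1 = 0 := by simpa using h5
    exact Prod.ext h10 h9

/-- This justifies the exchange of the integrals over `z` and `w`, and gives the measurability of
the integral over `z` as a function of `w`. -/
theorem eventually_integrableOn (D : PoleData W j₀) (γ : ℝ)
    (hgen : ∀ j, j ≠ j₀ → W.abscissa j ≠ W.abscissa j₀)
    (hγ : γ ∈ Set.Ioo (-1 : ℝ) 1) :
    ∀ᶠ t in 𝓝[>] (0 : ℝ), ∀ k Y u v, IntegrableOn (Function.uncurry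
      (W.torusIntegrand j₀ γ t k Y u v)) (Set.uIoc 0 (2 * Real.pi) ×ˢ Set.uIoc 0 (2 * Real.pi)) := by
  filter_upwards [D.eventually_good γ, D.eventually_transverse γ hgen hγ, self_mem_nhdsWithin]
    with t h1 h2 h3 k Y u v
  have hK : IsCompact (Set.uIcc 0 (2 * Real.pi) ×ˢ Set.uIcc 0 (2 * Real.pi)) :=
    isCompact_uIcc.prod isCompact_uIcc
  have hint := D.integrableOn_inv_norm_det γ h1 h2 (ne_of_gt h3) hK
  have hc := continuous_circleMap 0 1
  have hdet : Continuous fun q : ℝ × ℝ => (W.kasteleyn (Complex.exp (W.fieldX j₀ γ t) *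
      circleMap 0 1 q.1) (t * circleMap 0 1 q.2)).det := by
    have h4 : Continuous ((fun p : ℂ × ℂ => (W.kasteleyn p.1 p.2).det) ∘
        fun q : ℝ × ℝ => (Complex.exp (W.fieldX j₀ γ t) * circleMap 0 1 q.1,
          t * circleMap 0 1 q.2)) := (W.contDiff_det (k := 1)).continuous.comp (by fun_prop)
    exact h4
  have hadj : Continuous fun q : ℝ × ℝ => (W.kasteleyn (Complex.exp (W.fieldX j₀ γ t) *
      circleMap 0 1 q.1) (t * circleMap 0 1 q.2)).adjugate u v := by
    have h4 : Continuous ((fun p : ℂ × ℂ => (W.kasteleyn p.1 p.2).adjugate u v) ∘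
        fun q : ℝ × ℝ => (Complex.exp (W.fieldX j₀ γ t) * circleMap 0 1 q.1,
          t * circleMap 0 1 q.2)) := (W.contDiff_adjugate (k := 1) u v).continuous.comp (by fun_prop)
    exact h4
  have hne : ∀ x, circleMap 0 1 x ≠ 0 := fun x => circleMap_ne_center one_ne_zero
  obtain ⟨g, hg⟩ : ∃ g : ℝ × ℝ → ℂ, g = fun q => circleMap 0 1 q.1 * Complex.I *
      (circleMap 0 1 q.2 * Complex.I * (circleMap 0 1 q.1 ^ (-Y - 1) * circleMap 0 1 q.2 ^ k *
      (W.kasteleyn (Complex.exp (W.fieldX j₀ γ t) * circleMap 0 1 q.1)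
        (t * circleMap 0 1 q.2)).adjugate u v)) := ⟨_, rfl⟩
  have hgc : Continuous g := by
    have e1 : Continuous fun q : ℝ × ℝ => circleMap 0 1 q.1 ^ (-Y - 1) :=
      (hc.comp continuous_fst).zpow₀ _ fun q => Or.inl (hne _)
    have e2 : Continuous fun q : ℝ × ℝ => circleMap 0 1 q.2 ^ k :=
      (hc.comp continuous_snd).zpow₀ _ fun q => Or.inl (hne _)
    rw [hg]
    exact ((hc.comp continuous_fst).mul continuous_const).mul
      (((hc.comp continuous_snd).mul continuous_const).mul ((e1.mul e2).mul hadj))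
  have heq : Function.uncurry (W.torusIntegrand j₀ γ t k Y u v) = fun q =>
      g q * ((W.kasteleyn (Complex.exp (W.fieldX j₀ γ t) *
        circleMap 0 1 q.1) (t * circleMap 0 1 q.2)).det)⁻¹ := by
    funext q
    rw [Function.uncurry_def]
    simp only [Weights.torusIntegrand, W.kasteleyn_inv_apply, deriv_circleMap, hg]
    ring
  obtain ⟨B, hB⟩ := hK.exists_bound_of_continuousOn hgc.continuousOn
  rw [heq]
  refine IntegrableOn.mono_set ?_ (Set.prod_mono Set.uIoc_subset_uIcc Set.uIoc_subset_uIcc)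
  refine Integrable.mono' (hint.const_mul B)
    (hgc.measurable.mul hdet.measurable.inv).aestronglyMeasurable.restrict ?_
  refine (ae_restrict_mem hK.measurableSet).mono fun q hq => ?_
  rw [norm_mul, norm_inv]
  exact mul_le_mul_of_nonneg_right (hB q hq) (by positivity)

end PoleData

theorem Weights.integral_torusIntegrand (W : Weights n m) (j₀ : ZMod n) (γ t : ℝ) (k Y : ℤ)
    (u v : ZMod m × ZMod n) (y : ℝ) :
    ∫ x in (0)..2 * Real.pi, W.torusIntegrand j₀ γ t k Y u v x y =
      deriv (circleMap 0 1) y • (circleMap 0 1 y ^ k *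
        W.innerInt j₀ γ t Y u v (circleMap 0 1 y) 1) := by
  rw [Weights.innerInt, circleIntegral, smul_eq_mul, ← mul_assoc,
    ← intervalIntegral.integral_const_mul]
  refine intervalIntegral.integral_congr fun x _ => ?_
  simp only [Weights.torusIntegrand, smul_eq_mul]
  ring

/-- Fubini's theorem: in the definition of the operator the integral over `w` is the inner one,
whereas residues are taken in `z` at fixed `w`. -/
theorem Weights.invKasteleyn_eq_kerInt (W : Weights n m) {j₀ : ZMod n} {γ t : ℝ} (ht : 0 < t)
    (hint : ∀ k Y u v, IntegrableOn (Function.uncurry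
      (W.torusIntegrand j₀ γ t k Y u v)) (Set.uIoc 0 (2 * Real.pi) ×ˢ Set.uIoc 0 (2 * Real.pi)))
    (u v : ℤ × ℤ) :
    W.invKasteleyn (W.fieldX j₀ γ t) (Real.log t) u v =
      W.kerInt j₀ γ t (u.1 / (n : ℤ) - v.1 / (n : ℤ) - 1) (u.2 / (m : ℤ) - v.2 / (m : ℤ))
        (proj n m u) (proj n m v) := by
  have hlog : Complex.exp (Real.log t : ℂ) = t := by
    rw [← Complex.ofReal_exp, Real.exp_log ht]
  rw [Weights.invKasteleyn, Weights.kerInt, hlog]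
  congr 1
  set k := u.1 / (n : ℤ) - v.1 / (n : ℤ) - 1
  set Y := u.2 / (m : ℤ) - v.2 / (m : ℤ)
  have h1 := intervalIntegral_intervalIntegral_swap (hint k Y (proj n m u) (proj n m v))
  simp only [W.integral_torusIntegrand] at h1
  rw [circleIntegral, circleIntegral, ← h1]
  refine intervalIntegral.integral_congr fun x _ => ?_
  simp only [circleIntegral, smul_eq_mul]
  rw [← intervalIntegral.integral_const_mul]
  rfl

/-- At `re w = γ` the first order expansion does not decide on which side of the unit circle the
pole is; these `w` are negligible. -/
theorem ae_circleMap_re_ne (γ : ℝ) : ∀ᵐ θ : ℝ, (circleMap 0 1 θ).re ≠ γ := by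
  have hre : ∀ θ, (circleMap 0 1 θ).re = Real.cos θ := fun θ => by
    simp [circleMap, Complex.exp_ofReal_mul_I_re]
  have hc : {θ : ℝ | Real.cos θ = γ}.Countable := by
    by_cases hne : ∃ θ₀, Real.cos θ₀ = γ
    · obtain ⟨θ₀, h0⟩ := hne
      refine Set.Countable.mono ?_ (Set.countable_iUnion fun k : ℤ =>
        (Set.countable_singleton (θ₀ - 2 * k * Real.pi)).union
          (Set.countable_singleton (2 * k * Real.pi - θ₀)))
      intro θ hθ
      have hθ' : Real.cos θ = Real.cos θ₀ := by rw [h0]; exact hθ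
      obtain ⟨k, h | h⟩ := Real.cos_eq_cos_iff.1 hθ'
      · exact Set.mem_iUnion.2 ⟨k, Or.inl (by rw [Set.mem_singleton_iff]; linarith)⟩
      · exact Set.mem_iUnion.2 ⟨k, Or.inr (by rw [Set.mem_singleton_iff]; linarith)⟩
    · push Not at hne
      convert Set.countable_empty using 1
      ext θ
      simpa using hne θ
  refine measure_mono_null (fun θ hθ => ?_) (hc.measure_zero volume)
  simpa [hre] using hθ

theorem Weights.norm_kerInt_le (W : Weights n m) {j₀ : ZMod n} {γ t C : ℝ} {Y : ℤ}
    {u v : ZMod m × ZMod n} (h : ∀ w : ℂ, ‖w‖ ≤ 1 → ‖W.innerInt j₀ γ t Y u v w 1‖ ≤ C) (k : ℤ) :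
    ‖W.kerInt j₀ γ t k Y u v‖ ≤ C := by
  have hC : 0 ≤ C := (norm_nonneg _).trans (h 0 (by simp))
  have hpi := Real.pi_gt_three
  have h1 : ‖∮ w in C(0, 1), w ^ k * W.innerInt j₀ γ t Y u v w 1‖ ≤ 2 * Real.pi * 1 * C := by
    refine circleIntegral.norm_integral_le_of_norm_le_const zero_le_one fun w hw => ?_
    have hw' : ‖w‖ = 1 := by simpa using hw
    rw [norm_mul, norm_zpow, hw', one_zpow, one_mul]
    exact h w hw'.le
  have h2 : ‖((2 * Real.pi * Complex.I : ℂ)⁻¹)‖ = (2 * Real.pi)⁻¹ := by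
    rw [norm_inv, norm_mul, norm_mul, Complex.norm_I, Complex.norm_real, Real.norm_eq_abs,
      abs_of_pos Real.pi_pos, RCLike.norm_ofNat, mul_one]
  rw [Weights.kerInt, norm_mul, norm_pow, h2]
  calc _ ≤ (2 * Real.pi)⁻¹ ^ 2 * (2 * Real.pi * 1 * C) := by gcongr
    _ = (2 * Real.pi)⁻¹ * C := by field_simp
    _ ≤ 1 * C := by
      gcongr
      exact inv_le_one_of_one_le₀ (by linarith)
    _ = C := one_mul C

/-- Dominated convergence on the circle. -/
theorem tendsto_circleIntegral_of_bound {F : ℝ → ℂ → ℂ} {f : ℂ → ℂ} {C : ℝ} (γ : ℝ)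
    (hF : ∀ᶠ t in 𝓝[>] (0 : ℝ), AEStronglyMeasurable (fun θ => deriv (circleMap 0 1) θ •
      F t (circleMap 0 1 θ)) (volume.restrict (Set.uIoc 0 (2 * Real.pi))))
    (hC : ∀ᶠ t in 𝓝[>] (0 : ℝ), ∀ w : ℂ, ‖w‖ = 1 → ‖F t w‖ ≤ C)
    (hlim : ∀ w : ℂ, ‖w‖ = 1 → w.re ≠ γ → Tendsto (fun t => F t w) (𝓝[>] 0) (𝓝 (f w))) :
    Tendsto (fun t => ∮ w in C(0, 1), F t w) (𝓝[>] 0) (𝓝 (∮ w in C(0, 1), f w)) := by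
  refine intervalIntegral.tendsto_integral_filter_of_dominated_convergence (fun _ => C) hF ?_
    intervalIntegrable_const ?_
  · filter_upwards [hC] with t ht
    refine Eventually.of_forall fun θ _ => ?_
    rw [norm_smul, deriv_circleMap, norm_mul, Complex.norm_I, mul_one]
    simpa using ht (circleMap 0 1 θ) (by simp)
  · filter_upwards [ae_circleMap_re_ne γ] with θ hθ _
    exact (hlim _ (by simp) hθ).const_smul _

theorem Weights.aestronglyMeasurable_innerInt (W : Weights n m) {j₀ : ZMod n} {γ t : ℝ} (k Y : ℤ)
    (u v : ZMod m × ZMod n) (hint : IntegrableOn (Function.uncurry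
      (W.torusIntegrand j₀ γ t k Y u v)) (Set.uIoc 0 (2 * Real.pi) ×ˢ Set.uIoc 0 (2 * Real.pi))) :
    AEStronglyMeasurable (fun θ => deriv (circleMap 0 1) θ • (circleMap 0 1 θ ^ k *
      W.innerInt j₀ γ t Y u v (circleMap 0 1 θ) 1))
      (volume.restrict (Set.uIoc 0 (2 * Real.pi))) := by
  simp only [← W.integral_torusIntegrand]
  rw [IntegrableOn, Measure.volume_eq_prod, ← Measure.prod_restrict] at hint
  have h1 := hint.integral_prod_right.aestronglyMeasurable
  simp only [intervalIntegral.integral_of_le Real.two_pi_pos.le]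
  rwa [Set.uIoc_of_le Real.two_pi_pos.le] at h1 ⊢

end BeadDimer

end

/-! ### Limits of the inverse Kasteleyn operator. -/

noncomputable section

namespace BeadDimer

variable {n m : ℕ} [NeZero n] [NeZero m]

/-! ### The limit of the inverse Kasteleyn operator -/

/-- The integral of `w ^ k exp (-x (w - γ)) / 2πi` along the arc of the unit circle to the right of
the abscissa `γ` if `0 < x`, minus the same integral along the arc to the left otherwise. -/
def arcInt (γ : ℝ) (k : ℤ) (x : ℝ) : ℂ :=
  if 0 < x then (2 * Real.pi * Complex.I)⁻¹ * ∮ w in C(0, 1), (if γ < w.re then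
    w ^ k * Complex.exp (-(x * (w - γ))) else 0)
  else -((2 * Real.pi * Complex.I)⁻¹ * ∮ w in C(0, 1), (if w.re < γ then
    w ^ k * Complex.exp (-(x * (w - γ))) else 0))

/-- For `η > 0` a residue survives where the pole is outside the unit circle, for `η < 0` where it
is inside. With the sign of `β`, this is the right arc exactly when `η * β > 0`, as in `arcInt`; the
four cases differ by signs only. -/
theorem Weights.tendsto_kerInt (W : Weights n m) {j₀ : ZMod n}
    (hgen : ∀ j, j ≠ j₀ → W.abscissa j ≠ W.abscissa j₀) {γ : ℝ} (hγ : γ ∈ Set.Ioo (-1 : ℝ) 1)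
    {Y : ℝ → ℤ} {η : ℝ} (hη : η ≠ 0)
    (hY : Tendsto (fun t : ℝ => t * Y t) (𝓝[>] 0) (𝓝 η)) (k : ℤ) (u v : ZMod m × ZMod n) :
    Tendsto (fun t : ℝ => ((-1 : ℂ) ^ m) ^ (Y t) * W.kerInt j₀ γ t k (Y t) u v) (𝓝[>] 0)
      (𝓝 (-((SignType.sign (W.beta j₀) : ℤ) *
        ((W.rootAdj j₀ u v / (W.root j₀ * W.dz j₀) : ℝ) : ℂ) * arcInt γ k (η * W.beta j₀)))) := by
  obtain ⟨D⟩ := W.nonempty_poleData hgen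
  obtain ⟨C, hC⟩ := D.exists_innerInt_bound γ hgen
  have hβ := W.beta_ne_zero hgen
  set A : ℂ := ((W.rootAdj j₀ u v / (W.root j₀ * W.dz j₀) : ℝ) : ℂ) with hA
  have hpiI : (2 * Real.pi * Complex.I : ℂ) ≠ 0 := Complex.two_pi_I_ne_zero
  have hmeas : ∀ᶠ t in 𝓝[>] (0 : ℝ), AEStronglyMeasurable (fun θ => deriv (circleMap 0 1) θ •
      (fun w => ((-1 : ℂ) ^ m) ^ (Y t) * (w ^ k * W.innerInt j₀ γ t (Y t) u v w 1))
        (circleMap 0 1 θ)) (volume.restrict (Set.uIoc 0 (2 * Real.pi))) := by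
    filter_upwards [D.eventually_integrableOn γ hgen hγ] with t ht
    have h1 := (W.aestronglyMeasurable_innerInt k (Y t) u v (ht k (Y t) u v)).const_mul
      (((-1 : ℂ) ^ m) ^ (Y t))
    refine h1.congr (Eventually.of_forall fun θ => ?_)
    simp only [smul_eq_mul]
    ring
  have hbound : ∀ᶠ t in 𝓝[>] (0 : ℝ), ∀ w : ℂ, ‖w‖ = 1 →
      ‖((-1 : ℂ) ^ m) ^ (Y t) * (w ^ k * W.innerInt j₀ γ t (Y t) u v w 1)‖ ≤ C := by
    filter_upwards [hC] with t ht w hw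
    rw [norm_mul, PoleData.norm_sign_zpow, one_mul, norm_mul, norm_zpow, hw, one_zpow, one_mul]
    exact ht w hw.le _ _ _
  have hgoal : ∀ f : ℂ → ℂ, (∀ w : ℂ, ‖w‖ = 1 → w.re ≠ γ → Tendsto (fun t : ℝ =>
      ((-1 : ℂ) ^ m) ^ (Y t) * W.innerInt j₀ γ t (Y t) u v w 1) (𝓝[>] 0) (𝓝 (f w))) →
      Tendsto (fun t : ℝ => ((-1 : ℂ) ^ m) ^ (Y t) * W.kerInt j₀ γ t k (Y t) u v) (𝓝[>] 0)
        (𝓝 ((2 * Real.pi * Complex.I : ℂ)⁻¹ ^ 2 * ∮ w in C(0, 1), w ^ k * f w)) := by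
    intro f hf
    have h1 := tendsto_circleIntegral_of_bound γ
      (F := fun t w => ((-1 : ℂ) ^ m) ^ (Y t) * (w ^ k * W.innerInt j₀ γ t (Y t) u v w 1))
      hmeas hbound (f := fun w => w ^ k * f w)
      (fun w hw hre => by
        refine ((hf w hw hre).const_mul (w ^ k)).congr fun t => ?_
        ring)
    refine (h1.const_mul ((2 * Real.pi * Complex.I : ℂ)⁻¹ ^ 2)).congr fun t => ?_
    rw [Weights.kerInt, circleIntegral.integral_const_mul]
    ring
  have hfin : ∀ (c : ℂ) (p : ℂ → Prop) [DecidablePred p],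
      ((2 * Real.pi * Complex.I : ℂ)⁻¹ ^ 2 * ∮ w in C(0, 1), w ^ k * (if p w then
        c * (2 * Real.pi * Complex.I * (Complex.exp (-(η * (W.beta j₀ * (w - γ)))) * A)) else 0)) =
      c * A * ((2 * Real.pi * Complex.I)⁻¹ * ∮ w in C(0, 1), (if p w then
        w ^ k * Complex.exp (-(((η * W.beta j₀ : ℝ) : ℂ) * (w - γ))) else 0)) := by
    intro c p _
    have e : ∀ w : ℂ, w ^ k * (if p w then
        c * (2 * Real.pi * Complex.I * (Complex.exp (-(η * (W.beta j₀ * (w - γ)))) * A)) else 0) =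
        (c * A * (2 * Real.pi * Complex.I)) * (if p w then
        w ^ k * Complex.exp (-(((η * W.beta j₀ : ℝ) : ℂ) * (w - γ))) else 0) := fun w => by
      split_ifs
      · push_cast
        rw [mul_assoc (η : ℂ)]
        ring
      · simp
    simp only [e]
    rw [circleIntegral.integral_const_mul]
    field_simp
  have hinv : Tendsto (fun t : ℝ => t⁻¹) (𝓝[>] 0) atTop := tendsto_inv_nhdsGT_zero
  have hYeq : ∀ᶠ t in 𝓝[>] (0 : ℝ), t⁻¹ * (t * Y t) = (Y t : ℝ) := by
    filter_upwards [self_mem_nhdsWithin] with t ht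
    have : t ≠ 0 := ne_of_gt ht
    field_simp
  rcases lt_or_gt_of_ne hη with hη | hη
  · have hY' : Tendsto Y (𝓝[>] 0) atBot := by
      have h1 := (hinv.atTop_mul_neg hη hY).congr' hYeq
      exact tendsto_intCast_atBot_iff.1 h1
    have hlim := hgoal _ fun w hw hre => D.tendsto_innerInt_atBot γ hgen hw.le hre hY hY' u v
    clear hgoal hmeas hbound hC
    rcases lt_or_gt_of_ne hβ with hb | hb
    · have hpos : 0 < η * W.beta j₀ := mul_pos_of_neg_of_neg hη hb
      have e : ∀ w : ℂ, (W.beta j₀ * (w.re - γ) < 0) ↔ γ < w.re := fun w => by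
        rw [mul_neg_iff]
        constructor
        · rintro (h | h) <;> linarith
        · exact fun h => Or.inr ⟨hb, by linarith⟩
      have := hfin 1 (fun w => γ < w.re)
      simp only [one_mul] at this
      simp only [e, ← hA, this] at hlim
      convert hlim using 2
      simp only [arcInt, if_pos hpos, sign_neg hb, SignType.coe_neg_one, Int.cast_one, Int.cast_neg]
      ring
    · have hpos : ¬ 0 < η * W.beta j₀ := not_lt.2 (mul_neg_of_neg_of_pos hη hb).le
      have e : ∀ w : ℂ, (W.beta j₀ * (w.re - γ) < 0) ↔ w.re < γ := fun w => by
        rw [mul_neg_iff]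
        constructor
        · rintro (h | h) <;> linarith
        · exact fun h => Or.inl ⟨hb, by linarith⟩
      have := hfin 1 (fun w => w.re < γ)
      simp only [one_mul] at this
      simp only [e, ← hA, this] at hlim
      convert hlim using 2
      simp only [arcInt, if_neg hpos, sign_pos hb, SignType.coe_one, Int.cast_one]
      ring
  · have hY' : Tendsto Y (𝓝[>] 0) atTop := by
      have h1 := (hinv.atTop_mul_pos hη hY).congr' hYeq
      exact tendsto_intCast_atTop_iff.1 h1
    have hlim := hgoal _ fun w hw hre => D.tendsto_innerInt_atTop γ hgen hw.le hre hY hY' u v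
    clear hgoal hmeas hbound hC
    rcases lt_or_gt_of_ne hβ with hb | hb
    · have hpos : ¬ 0 < η * W.beta j₀ := not_lt.2 (mul_neg_of_pos_of_neg hη hb).le
      have e : ∀ w : ℂ, (0 < W.beta j₀ * (w.re - γ)) ↔ w.re < γ := fun w => by
        rw [mul_pos_iff]
        constructor
        · rintro (h | h) <;> linarith
        · exact fun h => Or.inr ⟨hb, by linarith⟩
      have := hfin (-1) (fun w => w.re < γ)
      simp only [neg_one_mul] at this
      simp only [e, ← hA, this] at hlim
      convert hlim using 2
      simp only [arcInt, if_neg hpos, sign_neg hb, SignType.coe_neg_one, Int.cast_one, Int.cast_neg]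
      ring
    · have hpos : 0 < η * W.beta j₀ := mul_pos hη hb
      have e : ∀ w : ℂ, (0 < W.beta j₀ * (w.re - γ)) ↔ γ < w.re := fun w => by
        rw [mul_pos_iff]
        constructor
        · rintro (h | h) <;> linarith
        · exact fun h => Or.inl ⟨hb, by linarith⟩
      have := hfin (-1) (fun w => γ < w.re)
      simp only [neg_one_mul] at this
      simp only [e, ← hA, this] at hlim
      convert hlim using 2
      simp only [arcInt, if_pos hpos, sign_pos hb, SignType.coe_one, Int.cast_one]
      ring

theorem Weights.exists_kerInt_bound (W : Weights n m) {j₀ : ZMod n}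
    (hgen : ∀ j, j ≠ j₀ → W.abscissa j ≠ W.abscissa j₀) (γ : ℝ) :
    ∃ C : ℝ, ∀ᶠ t in 𝓝[>] (0 : ℝ), ∀ k Y u v, ‖W.kerInt j₀ γ t k Y u v‖ ≤ C := by
  obtain ⟨D⟩ := W.nonempty_poleData hgen
  obtain ⟨C, hC⟩ := D.exists_innerInt_bound γ hgen
  refine ⟨C, ?_⟩
  filter_upwards [hC] with t ht k Y u v
  exact W.norm_kerInt_le (fun w hw => ht w hw Y u v) k

/-- With the exponents `-1` and `0` this is the entry for the two ends of an `a`-edge, so the limit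
is that of its probability in a frozen column. -/
theorem Weights.tendsto_kerInt_diag (W : Weights n m) {j₀ : ZMod n}
    (hgen : ∀ j, j ≠ j₀ → W.abscissa j ≠ W.abscissa j₀) {γ : ℝ} (hγ : γ ∈ Set.Ioo (-1 : ℝ) 1)
    {j : ZMod n} (hj : j ≠ j₀) (i : ZMod m) :
    Tendsto (fun t : ℝ => (W.a i j : ℂ) * W.kerInt j₀ γ t (-1) 0 (i, j) (i, j)) (𝓝[>] 0)
      (𝓝 (if W.abscissa j₀ < W.abscissa j then 1 else 0)) := by
  obtain ⟨D⟩ := W.nonempty_poleData hgen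
  obtain ⟨C, hC⟩ := D.exists_innerInt_bound γ hgen
  have hpiI : (2 * Real.pi * Complex.I : ℂ) ≠ 0 := Complex.two_pi_I_ne_zero
  have h1 := tendsto_circleIntegral_of_bound (C := W.a i j * C) γ
    (F := fun t w => (W.a i j : ℂ) * (w ^ (-1 : ℤ) * W.innerInt j₀ γ t 0 (i, j) (i, j) w 1))
    (f := fun w => w ^ (-1 : ℤ) * (if W.abscissa j₀ < W.abscissa j then 2 * Real.pi * Complex.I
      else 0)) ?_ ?_ ?_
  · have h2 := h1.const_mul ((2 * Real.pi * Complex.I : ℂ)⁻¹ ^ 2)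
    have e1 : ∀ c : ℂ, ∮ w in C(0, 1), w ^ (-1 : ℤ) * c = 2 * Real.pi * Complex.I * c := fun c => by
      have h3 := circleIntegral_inv_sub_of_norm_lt (p := 0) (R := 1) (by simp)
      simp only [sub_zero] at h3
      have e2 : ∀ w : ℂ, w ^ (-1 : ℤ) * c = c * w⁻¹ := fun w => by rw [zpow_neg_one, mul_comm]
      simp only [e2]
      rw [circleIntegral.integral_const_mul, h3, mul_comm]
    rw [e1] at h2
    have e3 : (2 * Real.pi * Complex.I : ℂ)⁻¹ ^ 2 * (2 * Real.pi * Complex.I *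
        (if W.abscissa j₀ < W.abscissa j then 2 * Real.pi * Complex.I else 0)) =
        if W.abscissa j₀ < W.abscissa j then 1 else 0 := by
      split_ifs
      · field_simp
      · simp
    rw [e3] at h2
    refine h2.congr fun t => ?_
    rw [Weights.kerInt, circleIntegral.integral_const_mul]
    ring
  · filter_upwards [D.eventually_integrableOn γ hgen hγ] with t ht
    have h2 := (W.aestronglyMeasurable_innerInt (-1) 0 (i, j) (i, j)
      (ht (-1) 0 (i, j) (i, j))).const_mul (W.a i j : ℂ)
    refine h2.congr (Eventually.of_forall fun θ => ?_)
    simp only [smul_eq_mul]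
    ring
  · filter_upwards [hC] with t ht w hw
    rw [norm_mul, norm_mul, norm_zpow, hw, one_zpow, one_mul, Complex.norm_real, Real.norm_eq_abs,
      abs_of_pos (W.a_pos i j)]
    exact mul_le_mul_of_nonneg_left (ht w hw.le _ _ _) (W.a_pos i j).le
  · intro w hw hre
    refine ((D.tendsto_innerInt_diag γ hgen hj i hw.le hre).const_mul (w ^ (-1 : ℤ))).congr
      fun t => ?_
    ring

end BeadDimer

end

/-! ### Identification of the limit with the kernel of the bead model. -/

noncomputable section

namespace BeadDimer

/-! ### The kernel of the bead model as an integral along an arc -/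

/-- Horizontal rays to the right, started near a point of the slit plane, stay in it and at a
uniform distance from the origin. This allows differentiation under the integral along such rays. -/
theorem exists_lower_slitPlane {w₀ : ℂ} (hw : w₀ ∈ Complex.slitPlane) :
    ∃ δ > 0, ∀ w ∈ Metric.ball w₀ δ, ∀ s : ℝ, 0 ≤ s → δ ≤ ‖w + s‖ ∧ w + s ∈ Complex.slitPlane := by
  rcases Complex.mem_slitPlane_iff.1 hw with h | h
  · refine ⟨w₀.re / 2, half_pos h, fun w hw s hs => ?_⟩
    have h1 : |(w - w₀).re| < w₀.re / 2 :=
      (Complex.abs_re_le_norm _).trans_lt (mem_ball_iff_norm.1 hw)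
    have h2 := (abs_lt.1 h1).1
    rw [Complex.sub_re] at h2
    have h3 : w₀.re / 2 ≤ (w + s).re := by
      rw [Complex.add_re, Complex.ofReal_re]; linarith
    exact ⟨h3.trans (Complex.re_le_norm _), Complex.mem_slitPlane_iff.2 (Or.inl (by linarith))⟩
  · have h0 := abs_pos.2 h
    refine ⟨|w₀.im| / 2, half_pos h0, fun w hw s hs => ?_⟩
    have h1 : |(w - w₀).im| < |w₀.im| / 2 :=
      (Complex.abs_im_le_norm _).trans_lt (mem_ball_iff_norm.1 hw)
    have h3 : |w₀.im| / 2 ≤ |(w + s).im| := by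
      rw [Complex.sub_im] at h1
      rw [Complex.add_im, Complex.ofReal_im, add_zero]
      have := abs_sub_abs_le_abs_sub w₀.im w.im
      rw [abs_sub_comm] at this
      linarith
    refine ⟨h3.trans (Complex.abs_im_le_norm _), Complex.mem_slitPlane_iff.2 (Or.inr ?_)⟩
    intro h4
    rw [h4, abs_zero] at h3
    linarith

theorem norm_zpow_mul_exp_le {x δ : ℝ} {w : ℂ} {k : ℤ} (hk : k ≤ 0) (hδ : 0 < δ) (hw : δ ≤ ‖w‖) :
    ‖w ^ k * Complex.exp (-(x * w))‖ ≤ δ ^ k * Real.exp (-(x * w.re)) := by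
  rw [norm_mul, norm_zpow, Complex.norm_exp]
  have e : (-(x * w) : ℂ).re = -(x * w.re) := by simp
  rw [e]
  gcongr
  obtain ⟨p, hp⟩ := Int.eq_ofNat_of_zero_le (show 0 ≤ -k by omega)
  have hk' : k = -(p : ℤ) := by omega
  rw [hk', zpow_neg, zpow_neg, zpow_natCast, zpow_natCast]
  gcongr

/-- For negative `k`, a primitive on the slit plane of `w ^ k exp (-x w)`. -/
theorem exists_primitive_slitPlane {x : ℝ} (hx : 0 < x) {k : ℤ} (hk : k < 0) :
    ∃ F : ℂ → ℂ, (∀ w ∈ Complex.slitPlane, HasDerivAt F (w ^ k * Complex.exp (-(x * w))) w) ∧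
      ∀ w : ℂ, w.im ≠ 0 → ‖F w‖ ≤ |w.im| ^ k * (Real.exp (-(x * w.re)) / x) := by
  set f : ℂ → ℂ := fun w => w ^ k * Complex.exp (-(x * w)) with hf
  set f' : ℂ → ℂ := fun w => k * w ^ (k - 1) * Complex.exp (-(x * w)) +
    w ^ k * (Complex.exp (-(x * w)) * (-x)) with hf'
  have hder : ∀ w : ℂ, w ≠ 0 → HasDerivAt f (f' w) w := fun w hw => by
    have h1 : HasDerivAt (fun w : ℂ => -(x * w : ℂ)) (-x) w := by
      have h2 := ((hasDerivAt_id w).const_mul (x : ℂ)).neg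
      rw [mul_one] at h2
      exact h2
    exact (hasDerivAt_zpow k w (Or.inl hw)).mul h1.cexp
  have hexp : ∀ a : ℝ, IntegrableOn (fun s : ℝ => Real.exp (-(x * (a + s)))) (Set.Ioi 0) := fun a => by
    have h1 := (integrableOn_exp_mul_Ioi (neg_neg_of_pos hx) 0).const_mul (Real.exp (-(x * a)))
    refine h1.congr (Eventually.of_forall fun s => ?_)
    simp only [← Real.exp_add]
    congr 1
    ring
  have hmeas : ∀ w, AEStronglyMeasurable (fun s : ℝ => f (w + s)) (volume.restrict (Set.Ioi 0)) :=
    fun w => by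
      refine Measurable.aestronglyMeasurable ?_
      simp only [hf]
      fun_prop
  -- The primitive is the integral from infinity along a horizontal ray, where the exponential
  -- decays. Its derivative is minus the integral of `f'` along the ray, that is `f w`.
  refine ⟨fun w => -∫ s in Set.Ioi (0 : ℝ), f (w + s), fun w₀ hw₀ => ?_, fun w hw => ?_⟩
  · obtain ⟨δ, hδ, hball⟩ := exists_lower_slitPlane hw₀
    have hfb : ∀ w ∈ Metric.ball w₀ δ, ∀ s : ℝ, 0 ≤ s →
        ‖f (w + s)‖ ≤ δ ^ k * Real.exp (-(x * (w.re + s))) := fun w hw s hs => by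
      refine (norm_zpow_mul_exp_le hk.le hδ (hball w hw s hs).1).trans_eq ?_
      simp
    have hf'b : ∀ w ∈ Metric.ball w₀ δ, ∀ s : ℝ, 0 ≤ s →
        ‖f' (w + s)‖ ≤ (|(k : ℝ)| * δ ^ (k - 1) + x * δ ^ k) * Real.exp (-(x * (w₀.re - δ + s))) := by
      intro w hw s hs
      have h1 := norm_zpow_mul_exp_le (x := x) (k := k - 1) (by omega) hδ (hball w hw s hs).1
      have h2 := norm_zpow_mul_exp_le (x := x) (k := k) (by omega) hδ (hball w hw s hs).1
      have h3 : Real.exp (-(x * (w + s : ℂ).re)) ≤ Real.exp (-(x * (w₀.re - δ + s))) := by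
        have h4 : |(w - w₀).re| < δ := (Complex.abs_re_le_norm _).trans_lt (mem_ball_iff_norm.1 hw)
        have h5 := (abs_lt.1 h4).1
        rw [Complex.sub_re] at h5
        rw [Complex.add_re, Complex.ofReal_re, Real.exp_le_exp]
        nlinarith
      have e : f' (w + s) = k * ((w + s) ^ (k - 1) * Complex.exp (-(x * (w + s)))) +
          (-x) * ((w + s) ^ k * Complex.exp (-(x * (w + s)))) := by
        simp only [hf']; ring
      rw [e]
      refine (norm_add_le _ _).trans ?_
      rw [norm_mul (k : ℂ), norm_mul (-x : ℂ), norm_neg, Complex.norm_real, Real.norm_eq_abs,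
        abs_of_pos hx, add_mul, Complex.norm_intCast, mul_assoc, mul_assoc]
      have hd1 : 0 < δ ^ (k - 1) := by positivity
      have hd2 : 0 < δ ^ k := by positivity
      gcongr
      · exact h1.trans (by gcongr)
      · exact h2.trans (by gcongr)
    have key := hasDerivAt_integral_of_dominated_loc_of_deriv_le (𝕜 := ℂ)
      (μ := volume.restrict (Set.Ioi (0 : ℝ))) (F := fun w (s : ℝ) => f (w + s))
      (F' := fun w (s : ℝ) => f' (w + s)) (Metric.ball_mem_nhds w₀ hδ)
      (bound := fun s => (|(k : ℝ)| * δ ^ (k - 1) + x * δ ^ k) * Real.exp (-(x * (w₀.re - δ + s))))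
      (Eventually.of_forall hmeas) ?_ ?_ ?_ ((hexp _).const_mul _) ?_
    · have h1 : ∫ s in Set.Ioi (0 : ℝ), f' (w₀ + s) = 0 - f (w₀ + (0 : ℝ)) := by
        refine integral_Ioi_of_hasDerivAt_of_tendsto' (f := fun s : ℝ => f (w₀ + s)) (fun s hs => ?_)
          key.1 ?_
        · have h2 := hder (w₀ + s) (Complex.slitPlane_ne_zero
            (hball w₀ (Metric.mem_ball_self hδ) s hs).2)
          have h3 : HasDerivAt (fun s : ℝ => w₀ + (s : ℂ)) 1 s :=
            (Complex.ofRealCLM.hasDerivAt (x := s)).const_add w₀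
          have h4 := h2.comp s h3
          rw [mul_one] at h4
          exact h4
        · refine squeeze_zero_norm' (a := fun s : ℝ => δ ^ k * Real.exp (-(x * (w₀.re + s)))) ?_ ?_
          · filter_upwards [eventually_ge_atTop 0] with s hs
            exact hfb w₀ (Metric.mem_ball_self hδ) s hs
          · have h4 : Tendsto (fun s : ℝ => x * (w₀.re + s)) atTop atTop :=
              (tendsto_atTop_add_const_left _ _ tendsto_id).const_mul_atTop hx
            have h5 := (Real.tendsto_exp_neg_atTop_nhds_zero.comp h4).const_mul (δ ^ k)
            rw [mul_zero] at h5
            exact h5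
      have h2 := key.2.neg
      rw [h1, zero_sub, neg_neg, Complex.ofReal_zero, add_zero] at h2
      exact h2
    · refine Integrable.mono' ((hexp w₀.re).const_mul (δ ^ k)) (hmeas w₀) ?_
      refine (ae_restrict_mem measurableSet_Ioi).mono fun s hs => ?_
      exact hfb w₀ (Metric.mem_ball_self hδ) s (le_of_lt hs)
    · refine Measurable.aestronglyMeasurable ?_
      simp only [hf']
      fun_prop
    · refine (ae_restrict_mem measurableSet_Ioi).mono fun s hs w hw => ?_
      exact hf'b w hw s (le_of_lt hs)
    · refine (ae_restrict_mem measurableSet_Ioi).mono fun s hs w hw => ?_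
      have h2 := hder (w + s) (Complex.slitPlane_ne_zero (hball w hw s (le_of_lt hs)).2)
      simpa using h2.comp_add_const w (s : ℂ)
  · rw [norm_neg]
    have h1 : ∫ s in Set.Ioi (0 : ℝ), Real.exp (-(x * (w.re + s))) = Real.exp (-(x * w.re)) / x := by
      have e : ∀ s : ℝ, Real.exp (-(x * (w.re + s))) = Real.exp (-(x * w.re)) * Real.exp (-x * s) :=
        fun s => by rw [← Real.exp_add]; ring_nf
      simp only [e]
      rw [integral_const_mul, integral_exp_mul_Ioi (neg_neg_of_pos hx) 0]
      simp [div_eq_mul_inv]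
    rw [← h1, ← integral_const_mul]
    refine norm_integral_le_of_norm_le ((hexp w.re).const_mul _)
      (Eventually.of_forall fun s => ?_)
    have h2 : |w.im| ≤ ‖w + s‖ := by
      have := Complex.abs_im_le_norm (w + s)
      simpa using this
    refine (norm_zpow_mul_exp_le hk.le (abs_pos.2 hw) h2).trans_eq ?_
    simp

/-- For negative `k`, a primitive of `w ^ k exp (-x w)` on the plane minus a half-line. -/
theorem exists_primitive_neg {x : ℝ} (hx : x ≠ 0) {k : ℤ} (hk : k < 0) :
    ∃ F : ℂ → ℂ, (∀ w : ℂ, (w.im ≠ 0 ∨ 0 < x * w.re) →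
      HasDerivAt F (w ^ k * Complex.exp (-(x * w))) w) ∧
      ∀ w : ℂ, w.im ≠ 0 → ‖F w‖ ≤ |w.im| ^ k * (Real.exp (-(x * w.re)) / |x|) := by
  -- For `x < 0` the exponential decays to the left, and `w ↦ -w` reduces to the other case; the cut
  -- becomes the positive half-line.
  rcases lt_or_gt_of_ne hx with hx | hx
  · obtain ⟨F, hF, hb⟩ := exists_primitive_slitPlane (neg_pos.2 hx) hk
    refine ⟨fun w => -(-1) ^ k * F (-w), fun w hw => ?_, fun w hw => ?_⟩
    · have hs : -w ∈ Complex.slitPlane := by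
        rw [Complex.mem_slitPlane_iff, Complex.neg_re, Complex.neg_im]
        rcases hw with h | h
        · exact Or.inr (neg_ne_zero.2 h)
        · exact Or.inl (by nlinarith)
      have h1 := ((hF _ hs).comp w (hasDerivAt_neg w)).const_mul (-(-1 : ℂ) ^ k)
      refine h1.congr_deriv ?_
      have e : (-w) ^ k = (-1) ^ k * w ^ k := by rw [← mul_zpow, neg_one_mul]
      have e2 : (-1 : ℂ) ^ k * (-1) ^ k = 1 := by rw [← mul_zpow]; simp
      rw [e]
      push_cast
      rw [neg_mul_neg]
      linear_combination (w ^ k * Complex.exp (-(x * w))) * e2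
    · have h1 := hb (-w) (by simpa using hw)
      rw [norm_mul, norm_neg, norm_zpow, norm_neg, norm_one, one_zpow, one_mul]
      simpa [abs_of_neg hx] using h1
  · obtain ⟨F, hF, hb⟩ := exists_primitive_slitPlane hx hk
    refine ⟨F, fun w hw => hF w ?_, fun w hw => ?_⟩
    · rw [Complex.mem_slitPlane_iff]
      rcases hw with h | h
      · exact Or.inr h
      · exact Or.inl (by nlinarith)
    · rw [abs_of_pos hx]
      exact hb w hw

section Arc

variable {γ : ℝ}

theorem circleMap_one_eq (θ : ℝ) : circleMap 0 1 θ = ⟨Real.cos θ, Real.sin θ⟩ := by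
  apply Complex.ext <;> simp [circleMap, Complex.exp_ofReal_mul_I_re, Complex.exp_ofReal_mul_I_im]

theorem circleMap_arccos (hγ : γ ∈ Set.Ioo (-1 : ℝ) 1) :
    circleMap 0 1 (Real.arccos γ) = ⟨γ, √(1 - γ ^ 2)⟩ := by
  rw [circleMap_one_eq, Real.cos_arccos hγ.1.le hγ.2.le, Real.sin_arccos]

theorem circleMap_neg_arccos (hγ : γ ∈ Set.Ioo (-1 : ℝ) 1) :
    circleMap 0 1 (-Real.arccos γ) = ⟨γ, -√(1 - γ ^ 2)⟩ := by
  rw [circleMap_one_eq, Real.cos_neg, Real.sin_neg, Real.cos_arccos hγ.1.le hγ.2.le,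
    Real.sin_arccos]

theorem integral_circleMap_of_hasDerivAt {f F : ℂ → ℂ} {a b : ℝ} (hab : a ≤ b)
    (hF : ∀ θ ∈ Set.Icc a b, HasDerivAt F (f (circleMap 0 1 θ)) (circleMap 0 1 θ))
    (hf : ContinuousOn f {w | w ≠ 0}) :
    ∫ θ in a..b, deriv (circleMap 0 1) θ • f (circleMap 0 1 θ) =
      F (circleMap 0 1 b) - F (circleMap 0 1 a) := by
  refine intervalIntegral.integral_eq_sub_of_hasDerivAt (f := fun θ => F (circleMap 0 1 θ))
    (fun θ hθ => ?_) ?_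
  · rw [Set.uIcc_of_le hab] at hθ
    have h1 := (hF θ hθ).comp θ (hasDerivAt_circleMap 0 1 θ)
    rw [smul_eq_mul, deriv_circleMap, mul_comm]
    exact h1
  · refine Continuous.intervalIntegrable ?_ _ _
    simp only [deriv_circleMap]
    have hc := continuous_circleMap 0 1
    refine (hc.mul continuous_const).smul ?_
    exact hf.comp_continuous hc fun θ => circleMap_ne_center one_ne_zero

theorem integral_ite_of_Ioo {g : ℝ → ℂ} {p : ℝ → Prop} [DecidablePred p] {A B a b : ℝ} (hAa : A ≤ a)
    (hab : a ≤ b) (hbB : b ≤ B) (hp : ∀ θ ∈ Set.Ioc A B, p θ ↔ θ ∈ Set.Ioo a b) :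
    ∫ θ in A..B, (if p θ then g θ else 0) = ∫ θ in a..b, g θ := by
  rw [intervalIntegral.integral_of_le (hAa.trans (hab.trans hbB)), intervalIntegral.integral_of_le hab]
  have h1 : ∀ θ ∈ Set.Ioc A B, (if p θ then g θ else 0) = (Set.Ioo a b).indicator g θ :=
    fun θ hθ => by
      by_cases h : p θ
      · rw [if_pos h, Set.indicator_of_mem ((hp θ hθ).1 h)]
      · rw [if_neg h, Set.indicator_of_notMem fun h2 => h ((hp θ hθ).2 h2)]
  rw [setIntegral_congr_fun measurableSet_Ioc h1, setIntegral_indicator measurableSet_Ioo,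
    Set.inter_eq_self_of_subset_right, integral_Ioc_eq_integral_Ioo]
  exact fun θ hθ => ⟨hAa.trans_lt hθ.1, hθ.2.le.trans hbB⟩

theorem circleIntegral_right_arc (hγ : γ ∈ Set.Ioo (-1 : ℝ) 1) {f F : ℂ → ℂ}
    (hF : ∀ w : ℂ, ‖w‖ = 1 → γ ≤ w.re → HasDerivAt F (f w) w) (hf : ContinuousOn f {w | w ≠ 0}) :
    ∮ w in C(0, 1), (if γ < w.re then f w else 0) =
      F ⟨γ, √(1 - γ ^ 2)⟩ - F ⟨γ, -√(1 - γ ^ 2)⟩ := by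
  have hper : Function.Periodic (fun θ : ℝ => deriv (circleMap 0 1) θ •
      (if γ < (circleMap 0 1 θ).re then f (circleMap 0 1 θ) else 0)) (2 * Real.pi) := fun θ => by
    simp only [deriv_circleMap, periodic_circleMap 0 1 θ]
  have h0 := Real.arccos_nonneg γ
  have hpi := Real.arccos_le_pi γ
  -- On `(-π, π]` the right arc is the single interval `|θ| < arccos γ`, whereas on `(0, 2π]` it
  -- would be cut in two.
  have h1 := hper.intervalIntegral_add_eq 0 (-Real.pi)
  rw [zero_add, show -Real.pi + 2 * Real.pi = Real.pi by ring] at h1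
  rw [circleIntegral, h1]
  simp only [smul_ite, smul_zero]
  rw [integral_ite_of_Ioo (a := -Real.arccos γ) (b := Real.arccos γ) (by linarith) (by linarith) hpi,
    integral_circleMap_of_hasDerivAt (F := F) (by linarith) _ hf, circleMap_arccos hγ,
    circleMap_neg_arccos hγ]
  · intro θ hθ
    refine hF _ (by simp) ?_
    rw [circleMap_one_eq, ← Real.cos_abs]
    change γ ≤ Real.cos |θ|
    rw [← Real.cos_arccos hγ.1.le hγ.2.le]
    exact Real.cos_le_cos_of_nonneg_of_le_pi (abs_nonneg _) hpi (abs_le.2 hθ)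
  · intro θ hθ
    rw [circleMap_one_eq]
    change γ < Real.cos θ ↔ _
    rw [← Real.cos_abs]
    nth_rw 1 [← Real.cos_arccos hγ.1.le hγ.2.le]
    have h3 : |θ| ≤ Real.pi := abs_le.2 ⟨hθ.1.le, hθ.2⟩
    rw [Real.strictAntiOn_cos.lt_iff_gt ⟨h0, hpi⟩ ⟨abs_nonneg _, h3⟩, abs_lt]
    rfl

theorem circleIntegral_left_arc (hγ : γ ∈ Set.Ioo (-1 : ℝ) 1) {f F : ℂ → ℂ}
    (hF : ∀ w : ℂ, ‖w‖ = 1 → w.re ≤ γ → HasDerivAt F (f w) w) (hf : ContinuousOn f {w | w ≠ 0}) :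
    ∮ w in C(0, 1), (if w.re < γ then f w else 0) =
      -(F ⟨γ, √(1 - γ ^ 2)⟩ - F ⟨γ, -√(1 - γ ^ 2)⟩) := by
  have h0 := Real.arccos_nonneg γ
  have hpi := Real.arccos_le_pi γ
  have hcos : ∀ θ, Real.cos θ = Real.cos |Real.pi - (Real.pi - θ)| := fun θ => by
    rw [Real.cos_abs]; congr 1; ring
  have hcos' : ∀ θ, Real.cos θ = -Real.cos |θ - Real.pi| := fun θ => by
    rw [Real.cos_abs, Real.cos_sub_pi, neg_neg]
  have hg : Real.cos (Real.pi - Real.arccos γ) = -γ := by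
    rw [Real.cos_pi_sub, Real.cos_arccos hγ.1.le hγ.2.le]
  have e2 : circleMap 0 1 (2 * Real.pi - Real.arccos γ) = ⟨γ, -√(1 - γ ^ 2)⟩ := by
    rw [← circleMap_neg_arccos hγ, show 2 * Real.pi - Real.arccos γ =
      -Real.arccos γ + 2 * Real.pi by ring]
    exact periodic_circleMap 0 1 _
  rw [circleIntegral]
  simp only [smul_ite, smul_zero]
  rw [integral_ite_of_Ioo (a := Real.arccos γ) (b := 2 * Real.pi - Real.arccos γ) h0 (by linarith)
    (by linarith), integral_circleMap_of_hasDerivAt (F := F) (by linarith) _ hf, circleMap_arccos hγ,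
    e2, neg_sub]
  · intro θ hθ
    refine hF _ (by simp) ?_
    rw [circleMap_one_eq]
    change Real.cos θ ≤ γ
    rw [hcos', neg_le, ← hg]
    refine Real.cos_le_cos_of_nonneg_of_le_pi (abs_nonneg _) (by linarith) (abs_le.2 ⟨?_, ?_⟩)
    · linarith [hθ.1]
    · linarith [hθ.2]
  · intro θ hθ
    rw [circleMap_one_eq]
    change Real.cos θ < γ ↔ _
    have h3 : |θ - Real.pi| ≤ Real.pi := abs_le.2 ⟨by linarith [hθ.1], by linarith [hθ.2]⟩
    rw [hcos', neg_lt, ← hg, Real.strictAntiOn_cos.lt_iff_gt ⟨by linarith, by linarith⟩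
      ⟨abs_nonneg _, h3⟩, abs_lt]
    constructor
    · rintro ⟨h4, h5⟩; exact ⟨by linarith, by linarith⟩
    · rintro ⟨h4, h5⟩; exact ⟨by linarith, by linarith⟩

/-- The integral along an arc in terms of a primitive. -/
theorem arcInt_eq (hγ : γ ∈ Set.Ioo (-1 : ℝ) 1) {x : ℝ} (hx : x ≠ 0) {k : ℤ} {F : ℂ → ℂ}
    (hF : ∀ w : ℂ, ‖w‖ = 1 → (w.im ≠ 0 ∨ 0 < x * w.re) →
      HasDerivAt F (w ^ k * Complex.exp (-(x * w))) w) :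
    arcInt γ k x = (2 * Real.pi * Complex.I)⁻¹ * (Complex.exp (x * γ) *
      (F ⟨γ, √(1 - γ ^ 2)⟩ - F ⟨γ, -√(1 - γ ^ 2)⟩)) := by
  -- On the unit circle the primitive can only fail at a real point: `-1` if `x > 0` and `1` if `x <
  -- 0`. In both cases this point is not on the arc in question.
  have him : ∀ w : ℂ, ‖w‖ = 1 → w.im = 0 → w.re = 1 ∨ w.re = -1 := fun w hw h => by
    have := Complex.sq_norm w
    rw [hw, Complex.normSq_apply, h] at this
    have h2 : (w.re - 1) * (w.re + 1) = 0 := by linarith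
    rcases mul_eq_zero.1 h2 with h3 | h3
    · left; linarith
    · right; linarith
  have e : ∀ w : ℂ, w ^ k * Complex.exp (-(x * (w - γ))) =
      Complex.exp (x * γ) * (w ^ k * Complex.exp (-(x * w))) := fun w => by
    rw [mul_left_comm, ← Complex.exp_add]
    ring_nf
  have hcont : ContinuousOn (fun w : ℂ => w ^ k * Complex.exp (-(x * (w - γ)))) {w | w ≠ 0} := by
    refine ContinuousOn.mul (fun w hw => (continuousAt_zpow₀ w k (Or.inl hw)).continuousWithinAt) ?_
    exact Continuous.continuousOn (by fun_prop)
  rw [arcInt]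
  split_ifs with h
  · rw [circleIntegral_right_arc hγ (F := fun w => Complex.exp (x * γ) * F w) _ hcont]
    · ring
    · intro w hw hre
      rw [e]
      refine (hF w hw ?_).const_mul _
      by_contra h1
      push Not at h1
      rcases him w hw h1.1 with h2 | h2
      · rw [h2] at h1; linarith [h1.2]
      · linarith [hγ.1]
  · have hx' : x < 0 := lt_of_le_of_ne (not_lt.1 h) hx
    rw [circleIntegral_left_arc hγ (F := fun w => Complex.exp (x * γ) * F w) _ hcont]
    · ring
    · intro w hw hre
      rw [e]
      refine (hF w hw ?_).const_mul _
      by_contra h1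
      push Not at h1
      rcases him w hw h1.1 with h2 | h2
      · linarith [hγ.2]
      · rw [h2] at h1; linarith [h1.2]

theorem sqrt_pos_of_mem (hγ : γ ∈ Set.Ioo (-1 : ℝ) 1) : 0 < √(1 - γ ^ 2) :=
  Real.sqrt_pos.2 (by nlinarith [hγ.1, hγ.2])

/-- The substitution `w = γ + i φ √(1 - γ²)` turns the integral into one of `w^k exp (-x (w - γ))`
along the vertical line `re w = γ`; the values `φ = ±1` are the ends of the arcs. -/
theorem integral_beadIntegrand (hγ : γ ∈ Set.Ioo (-1 : ℝ) 1) {x : ℝ} {k : ℤ} {F : ℂ → ℂ} {a b : ℝ}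
    (hF : ∀ φ ∈ Set.uIcc a b, HasDerivAt F ((⟨γ, φ * √(1 - γ ^ 2)⟩ : ℂ) ^ k *
      Complex.exp (-(x * ⟨γ, φ * √(1 - γ ^ 2)⟩))) ⟨γ, φ * √(1 - γ ^ 2)⟩)
    (h0 : 0 ≤ k ∨ (0 : ℝ) ∉ Set.uIcc a b) :
    ∫ φ in a..b, beadIntegrand γ k (x * √(1 - γ ^ 2)) φ = (Complex.I * √(1 - γ ^ 2))⁻¹ *
      (Complex.exp (x * γ) * (F ⟨γ, b * √(1 - γ ^ 2)⟩ - F ⟨γ, a * √(1 - γ ^ 2)⟩)) := by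
  set s := √(1 - γ ^ 2) with hs
  have hs0 : 0 < s := sqrt_pos_of_mem hγ
  have hIs : (Complex.I * s : ℂ) ≠ 0 :=
    mul_ne_zero Complex.I_ne_zero (Complex.ofReal_ne_zero.2 hs0.ne')
  have hmk : ∀ φ : ℝ, (⟨γ, φ * s⟩ : ℂ) = γ + Complex.I * φ * s := fun φ => by
    apply Complex.ext <;> simp
  have key := intervalIntegral.integral_eq_sub_of_hasDerivAt
    (f := fun φ : ℝ => (Complex.I * s : ℂ)⁻¹ * (Complex.exp (x * γ) * F ⟨γ, φ * s⟩))
    (f' := fun φ => beadIntegrand γ k (x * s) φ) (a := a) (b := b) ?_ ?_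
  · rw [key]
    ring
  · intro φ hφ
    have h1 : HasDerivAt (fun φ : ℝ => (⟨γ, φ * s⟩ : ℂ)) (Complex.I * s) φ := by
      simp only [hmk]
      simpa using (((Complex.ofRealCLM.hasDerivAt (x := φ)).const_mul Complex.I).mul_const
        (s : ℂ)).const_add (γ : ℂ)
    have h2 := (((hF φ hφ).comp φ h1).const_mul (Complex.exp (x * γ))).const_mul
      (Complex.I * s : ℂ)⁻¹
    refine h2.congr_deriv ?_
    rw [beadIntegrand, hmk]
    have e : Complex.exp (-(Complex.I * (x * s : ℝ) * φ)) =
        Complex.exp (x * γ) * Complex.exp (-(x * (γ + Complex.I * φ * s))) := by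
      rw [← Complex.exp_add]
      push_cast
      ring_nf
    rw [← hs, e]
    have h3 := mul_inv_cancel₀ hIs
    linear_combination (Complex.exp (x * γ) * ((γ + Complex.I * φ * s) ^ k *
      Complex.exp (-(x * (γ + Complex.I * φ * s))))) * h3
  · refine ContinuousOn.intervalIntegrable fun φ hφ => ContinuousAt.continuousWithinAt ?_
    have h1 : (γ + Complex.I * φ * s : ℂ) ≠ 0 ∨ 0 ≤ k := by
      rcases h0 with h | h
      · exact Or.inr h
      · left
        intro h2
        have h3 := congrArg Complex.im h2
        rw [← hmk] at h3
        rcases mul_eq_zero.1 h3 with h4 | h4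
        · rw [h4] at hφ
          exact h hφ
        · exact hs0.ne' h4
    have h2 : ContinuousAt (fun φ : ℝ => (γ + Complex.I * φ * s : ℂ)) φ :=
      Continuous.continuousAt (by fun_prop)
    have h3 : ContinuousAt (fun φ : ℝ => Complex.exp (-(Complex.I * (x * s : ℝ) * φ))) φ :=
      Continuous.continuousAt (by fun_prop)
    exact h3.mul (h2.zpow₀ k h1)

/-- Off the diagonal, the kernel of the bead model is an integral along an arc of the unit circle. -/
theorem beadKernel_eq (hγ : γ ∈ Set.Ioo (-1 : ℝ) 1) {x : ℝ} (hx : x ≠ 0) (k : ℤ) :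
    beadKernel γ k (x * √(1 - γ ^ 2)) = arcInt γ k x / √(1 - γ ^ 2) := by
  set s := √(1 - γ ^ 2) with hs
  have hs0 : 0 < s := sqrt_pos_of_mem hγ
  have hs0' : (s : ℂ) ≠ 0 := Complex.ofReal_ne_zero.2 hs0.ne'
  have hpi : (Real.pi : ℂ) ≠ 0 := Complex.ofReal_ne_zero.2 Real.pi_ne_zero
  rw [beadKernel]
  split_ifs with hk
  -- For `k ≥ 0` the integrand is holomorphic on a disc containing the arc and its chord, so both
  -- integrals are the same difference of values of a primitive.
  · have hd : DifferentiableOn ℂ (fun w : ℂ => w ^ k * Complex.exp (-(x * w))) (Metric.ball 0 2) := by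
      intro w _
      refine DifferentiableAt.differentiableWithinAt ?_
      refine (differentiableAt_zpow.2 (Or.inr hk)).mul ?_
      fun_prop
    obtain ⟨F, hF⟩ := hd.isExactOn_ball
    have hball : ∀ φ ∈ Set.uIcc (-1 : ℝ) 1, (⟨γ, φ * s⟩ : ℂ) ∈ Metric.ball (0 : ℂ) 2 := fun φ hφ => by
      rw [Set.uIcc_of_le (by norm_num)] at hφ
      rw [mem_ball_zero_iff]
      have h1 := Complex.norm_le_abs_re_add_abs_im (⟨γ, φ * s⟩ : ℂ)
      refine h1.trans_lt ?_
      have h2 : |γ| < 1 := abs_lt.2 hγ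
      have h3 : s ≤ 1 := Real.sqrt_le_one.2 (by nlinarith)
      have h4 : |φ * s| ≤ 1 := by
        rw [abs_mul, abs_of_pos hs0]
        exact mul_le_one₀ (abs_le.2 hφ) hs0.le h3
      change |γ| + |φ * s| < 2
      linarith
    rw [integral_beadIntegrand hγ (F := F) (fun φ hφ => hF _ (hball φ hφ)) (Or.inl hk),
      arcInt_eq hγ hx (F := F) fun w hw _ => hF w (by rw [mem_ball_zero_iff, hw]; norm_num)]
    rw [← hs, one_mul, neg_one_mul, mul_inv, mul_inv, mul_inv, mul_inv]
    ring
  · have hk' : k < 0 := not_le.1 hk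
    -- For `k < 0` the primitive tends to zero at both ends of the vertical line, so the two
    -- half-lines contribute its values at `φ = ±1` only, with the sign opposite to the chord.
    obtain ⟨F, hF, hb⟩ := exists_primitive_neg hx hk'
    have hF0 : ∀ σ : ℝ, σ ≠ 0 → Tendsto (fun R : ℝ => F ⟨γ, σ * R * s⟩) atTop (𝓝 0) := fun σ hσ => by
      have h1 : Tendsto (fun R : ℝ => |σ * R * s|) atTop atTop := by
        have h2 : ∀ R : ℝ, |σ * R * s| = (|σ| * s) * |R| := fun R => by
          rw [abs_mul, abs_mul, abs_of_pos hs0]; ring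
        simp only [h2]
        exact tendsto_abs_atTop_atTop.const_mul_atTop (mul_pos (abs_pos.2 hσ) hs0)
      have h3 : Tendsto (fun R : ℝ => |σ * R * s| ^ k * (Real.exp (-(x * γ)) / |x|)) atTop (𝓝 0) := by
        have h4 := ((tendsto_const_nhds (x := (1 : ℝ))).mul
          ((tendsto_zpow_atTop_zero hk').comp h1)).mul_const (Real.exp (-(x * γ)) / |x|)
        simpa using h4
      refine squeeze_zero_norm' ?_ h3
      filter_upwards [eventually_gt_atTop 0] with R hR
      exact hb ⟨γ, σ * R * s⟩ (mul_ne_zero (mul_ne_zero hσ hR.ne') hs0.ne')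
    have hlim : Tendsto (fun R : ℝ => (∫ φ in (-R)..(-1 : ℝ), beadIntegrand γ k (x * s) φ) +
        ∫ φ in (1 : ℝ)..R, beadIntegrand γ k (x * s) φ) atTop
        (𝓝 (-((Complex.I * s)⁻¹ * (Complex.exp (x * γ) *
          (F ⟨γ, s⟩ - F ⟨γ, -s⟩))))) := by
      have h1 := (((hF0 1 one_ne_zero).sub_const (F ⟨γ, s⟩)).add
        ((hF0 (-1) (by norm_num)).const_sub (F ⟨γ, -s⟩))).const_mul
          ((Complex.I * s)⁻¹ * Complex.exp (x * γ))
      have e : (Complex.I * s : ℂ)⁻¹ * Complex.exp (x * γ) * (0 - F ⟨γ, s⟩ + (F ⟨γ, -s⟩ - 0)) =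
          -((Complex.I * s)⁻¹ * (Complex.exp (x * γ) * (F ⟨γ, s⟩ - F ⟨γ, -s⟩))) := by ring
      rw [e] at h1
      refine h1.congr' ?_
      filter_upwards [eventually_gt_atTop 1] with R hR
      have hd : ∀ φ : ℝ, φ ≠ 0 → HasDerivAt F ((⟨γ, φ * s⟩ : ℂ) ^ k *
          Complex.exp (-(x * ⟨γ, φ * s⟩))) ⟨γ, φ * s⟩ := fun φ hφ =>
        hF _ (Or.inl (mul_ne_zero hφ hs0.ne'))
      have hn1 : (0 : ℝ) ∉ Set.uIcc (-R) (-1) := fun h => by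
        rw [Set.uIcc_of_le (by linarith)] at h
        linarith [h.2]
      have hn2 : (0 : ℝ) ∉ Set.uIcc 1 R := fun h => by
        rw [Set.uIcc_of_le hR.le] at h
        linarith [h.1]
      rw [integral_beadIntegrand hγ (F := F) (fun φ hφ => hd φ fun h => hn1 (h ▸ hφ)) (Or.inr hn1),
        integral_beadIntegrand hγ (F := F) (fun φ hφ => hd φ fun h => hn2 (h ▸ hφ)) (Or.inr hn2)]
      simp only [one_mul, neg_one_mul, ← hs]
      ring
    rw [hlim.limUnder_eq, arcInt_eq hγ hx (F := F) fun w _ h => hF w h]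
    rw [← hs, mul_inv, mul_inv, mul_inv, mul_inv]
    ring

end Arc

end BeadDimer

end

noncomputable section

namespace BeadDimer

variable {n m : ℕ} [NeZero n] [NeZero m]

theorem beadKernel_zero (γ : ℝ) : beadKernel γ 0 0 = (Real.pi : ℂ)⁻¹ := by
  rw [beadKernel, if_pos le_rfl]
  have e : ∀ φ : ℝ, beadIntegrand γ 0 0 φ = 1 := fun φ => by simp [beadIntegrand]
  simp only [e, intervalIntegral.integral_const, Complex.real_smul]
  have hpi : (Real.pi : ℂ) ≠ 0 := Complex.ofReal_ne_zero.2 Real.pi_ne_zero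
  push_cast
  field_simp
  norm_num

/-- The limit of the inverse Kasteleyn operator on the diagonal. -/
theorem Weights.tendsto_kerInt_zero (W : Weights n m) {j₀ : ZMod n}
    (hgen : ∀ j, j ≠ j₀ → W.abscissa j ≠ W.abscissa j₀) {γ : ℝ} (hγ : γ ∈ Set.Ioo (-1 : ℝ) 1)
    (u v : ZMod m × ZMod n) :
    Tendsto (fun t : ℝ => W.kerInt j₀ γ t 0 0 u v) (𝓝[>] 0)
      (𝓝 (-((SignType.sign (W.beta j₀) : ℤ) *
        ((W.rootAdj j₀ u v / (W.root j₀ * W.dz j₀) : ℝ) : ℂ) * (√(1 - γ ^ 2) / Real.pi)))) := by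
  obtain ⟨D⟩ := W.nonempty_poleData hgen
  obtain ⟨C, hC⟩ := D.exists_innerInt_bound γ hgen
  have hβ := W.beta_ne_zero hgen
  have hpi : (Real.pi : ℂ) ≠ 0 := Complex.ofReal_ne_zero.2 Real.pi_ne_zero
  set A : ℂ := ((W.rootAdj j₀ u v / (W.root j₀ * W.dz j₀) : ℝ) : ℂ) with hA
  obtain ⟨Lin, hLin⟩ : ∃ L, L = ∮ z in C(0, D.R⁻¹), z⁻¹ *
      (W.kasteleyn (Complex.exp (W.abscissa j₀) * z) (0 : ℂ))⁻¹ u v := ⟨_, rfl⟩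
  have hlim : ∀ w : ℂ, ‖w‖ = 1 → w.re ≠ γ → Tendsto (fun t => W.innerInt j₀ γ t 0 u v w 1) (𝓝[>] 0)
      (𝓝 (Lin + if W.beta j₀ * (w.re - γ) < 0 then 2 * Real.pi * Complex.I * A else 0)) := by
    intro w hw hre
    have h1 := D.tendsto_innerInt_circle γ hw.le u v (Or.inr rfl)
    rw [← hLin] at h1
    split_ifs with h
    · have h2 := (D.tendsto_residue γ hgen w (Y := fun _ => 0) (η := 0) (by simp) u v).const_mul
        (2 * Real.pi * Complex.I)
      simp only [zpow_zero, one_mul, Complex.ofReal_zero, zero_mul, neg_zero, Complex.exp_zero] at h2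
      refine (h1.add h2).congr' ?_
      filter_upwards [D.eventually_good γ, D.eventually_pole_lt γ h] with t h3 h4
      rw [((h3 w hw.le).inner_of_lt 0 u v h4).2]
    · have h' : 0 < W.beta j₀ * (w.re - γ) := lt_of_le_of_ne (not_lt.1 h)
        (mul_ne_zero hβ (sub_ne_zero.2 hre)).symm
      rw [add_zero]
      refine h1.congr' ?_
      filter_upwards [D.eventually_good γ, D.eventually_pole_gt γ h'] with t h3 h4
      rw [((h3 w hw.le).inner_of_gt 0 u v h4).1]
  have h1 := tendsto_circleIntegral_of_bound (C := C) γ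
    (F := fun t w => w ^ (0 : ℤ) * W.innerInt j₀ γ t 0 u v w 1)
    (f := fun w => Lin + if W.beta j₀ * (w.re - γ) < 0 then 2 * Real.pi * Complex.I * A else 0)
    (by
      filter_upwards [D.eventually_integrableOn γ hgen hγ] with t ht
      exact W.aestronglyMeasurable_innerInt 0 0 u v (ht 0 0 u v))
    (by
      filter_upwards [hC] with t ht w hw
      rw [zpow_zero, one_mul]
      exact ht w hw.le _ _ _)
    (fun w hw hre => by
      simp only [zpow_zero, one_mul]
      exact hlim w hw hre)
  have h2 := h1.const_mul ((2 * Real.pi * Complex.I : ℂ)⁻¹ ^ 2)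
  refine Tendsto.congr_dist (h2.trans (le_of_eq ?_)) (by simp [Weights.kerInt])
  congr 1
  -- At zero separation no circle makes the integral small, but the contribution `Lin` of the inner
  -- circle does not depend on `w`, and a constant integrates to zero over the circle.
  have hconst : ∮ _w in C(0, 1), Lin = 0 := by
    have := Complex.circleIntegral_eq_zero_of_differentiable_on_off_countable (E := ℂ)
      (f := fun _ => Lin) (c := 0) (R := 1) zero_le_one Set.countable_empty continuousOn_const
      (fun z _ => differentiableAt_const _)
    exact this
  have hcont : ContinuousOn (fun _ : ℂ => 2 * Real.pi * Complex.I * A) {w | w ≠ 0} :=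
    continuousOn_const
  have hder : ∀ w : ℂ, HasDerivAt (fun w => 2 * Real.pi * Complex.I * A * w)
      (2 * Real.pi * Complex.I * A) w := fun w => by
    simpa using (hasDerivAt_id w).const_mul (2 * Real.pi * Complex.I * A)
  have hs : (⟨γ, √(1 - γ ^ 2)⟩ : ℂ) - ⟨γ, -√(1 - γ ^ 2)⟩ = 2 * Complex.I * √(1 - γ ^ 2) := by
    apply Complex.ext <;> simp
    ring
  -- A circle integral that is not zero is that of an integrable function, since the default value
  -- is zero.
  have hadd : ∀ (p : ℂ → Prop) [DecidablePred p] (L : ℂ), (∮ w in C(0, 1), if p w then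
      2 * Real.pi * Complex.I * A else 0) = L → L ≠ 0 → ∮ w in C(0, 1), (Lin + if p w then
      2 * Real.pi * Complex.I * A else 0) = L := by
    intro p _ L hL hL0
    have hint : CircleIntegrable (fun w => if p w then 2 * Real.pi * Complex.I * A else 0) 0 1 := by
      by_contra h
      rw [circleIntegral.integral_undef h] at hL
      exact hL0 hL.symm
    rw [circleIntegral.integral_add (continuous_const.continuousOn.circleIntegrable zero_le_one) hint,
      hconst, hL, zero_add]
  have hs0 : (√(1 - γ ^ 2) : ℂ) ≠ 0 := Complex.ofReal_ne_zero.2 (sqrt_pos_of_mem hγ).ne'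
  by_cases hA0 : A = 0
  · simp [hA0, hconst]
  rcases lt_or_gt_of_ne hβ with hb | hb
  · have e : ∀ w : ℂ, (W.beta j₀ * (w.re - γ) < 0) ↔ γ < w.re := fun w => by
      rw [mul_neg_iff]
      constructor
      · rintro (h | h) <;> linarith
      · exact fun h => Or.inr ⟨hb, by linarith⟩
    have h3 := circleIntegral_right_arc hγ (F := fun w => 2 * Real.pi * Complex.I * A * w)
      (fun w _ _ => hder w) hcont
    rw [← mul_sub, hs] at h3
    simp only [e, sign_neg hb, SignType.coe_neg_one, Int.cast_neg, Int.cast_one]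
    rw [hadd _ _ h3 (by simp [hA0, hs0])]
    field_simp
  · have e : ∀ w : ℂ, (W.beta j₀ * (w.re - γ) < 0) ↔ w.re < γ := fun w => by
      rw [mul_neg_iff]
      constructor
      · rintro (h | h) <;> linarith
      · exact fun h => Or.inl ⟨hb, by linarith⟩
    have h3 := circleIntegral_left_arc hγ (F := fun w => 2 * Real.pi * Complex.I * A * w)
      (fun w _ _ => hder w) hcont
    rw [← mul_sub, hs] at h3
    simp only [e, sign_pos hb, SignType.coe_one, Int.cast_one]
    rw [hadd _ _ h3 (by simp [hA0, hs0])]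
    field_simp

/-! ### The kernel of the beads on the threads crossing the boundary of the fundamental domains -/

/-- The thread of the bundle `k` between two columns of fundamental domains. -/
def repThread (n : ℕ) (k : ℤ) : ℤ := (k + 1) * n - 1

/-- The kernel of the beads on the threads `repThread n k`. -/
def Weights.beadEntry (W : Weights n m) (j₀ : ZMod n) (γ t : ℝ) (k y y' : ℤ) : ℂ :=
  (W.b y (-1) * t) * W.kerInt j₀ γ t k (y / (m : ℤ) - y' / (m : ℤ)) (y, 0) (y', -1)

/-- The `b`-edges on these threads all leave a fundamental domain. This gives the weight `b * t`
since `By = log t`, and a horizontal shift by one domain that cancels the `-1` in the exponent of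
`w`. -/
theorem eventually_beadEntry (W : Weights n m) {j₀ : ZMod n}
    (hgen : ∀ j, j ≠ j₀ → W.abscissa j ≠ W.abscissa j₀) {γ : ℝ} (hγ : γ ∈ Set.Ioo (-1 : ℝ) 1) :
    ∀ᶠ t in 𝓝[>] (0 : ℝ), ∀ k k' y y' : ℤ,
      (W.edgeWeight (W.fieldX j₀ γ t) (Real.log t) ((repThread n k, y), EdgeType.b) : ℂ) *
        W.invKasteleyn (W.fieldX j₀ γ t) (Real.log t)
          (blackEnd ((repThread n k, y), EdgeType.b))
          (whiteEnd ((repThread n k', y'), EdgeType.b)) = W.beadEntry j₀ γ t (k - k') y y' := by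
  obtain ⟨D⟩ := W.nonempty_poleData hgen
  filter_upwards [D.eventually_integrableOn γ hgen hγ, self_mem_nhdsWithin] with t h1 h2 k k' y y'
  have h3 : (0 : ℝ) < t := h2
  have hn : (0 : ℤ) < n := by exact_mod_cast NeZero.pos n
  have e1 : ((repThread n k : ℤ) : ZMod n) = -1 := by simp [repThread]
  have e1' : ((repThread n k' : ℤ) : ZMod n) = -1 := by simp [repThread]
  have e2 : (repThread n k + 1) / (n : ℤ) = k + 1 := by
    rw [repThread, sub_add_cancel, Int.mul_ediv_cancel _ hn.ne']
  have e3 : repThread n k' / (n : ℤ) = k' := by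
    rw [repThread]
    refine Int.ediv_eq_iff_of_pos hn |>.2 ⟨?_, ?_⟩ <;> nlinarith
  rw [W.invKasteleyn_eq_kerInt h3 h1]
  simp only [Weights.edgeWeight, blackEnd, whiteEnd, Weights.beadEntry, proj, e1, e1', e2, e3,
    neg_add_cancel, if_true, Real.exp_log h3, Int.cast_add, Int.cast_one]
  rw [show k + 1 - k' - 1 = k - k' by ring]
  push_cast
  ring

theorem Weights.exists_beadEntry_bound (W : Weights n m) {j₀ : ZMod n}
    (hgen : ∀ j, j ≠ j₀ → W.abscissa j ≠ W.abscissa j₀) (γ : ℝ) :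
    ∃ C : ℝ, 0 ≤ C ∧ ∀ᶠ t in 𝓝[>] (0 : ℝ), ∀ k y y', ‖W.beadEntry j₀ γ t k y y'‖ ≤ C * t := by
  obtain ⟨C, hC⟩ := W.exists_kerInt_bound hgen γ
  have hC0 : 0 ≤ C := by
    obtain ⟨t, ht⟩ := hC.exists
    exact (norm_nonneg _).trans (ht 0 0 0 0)
  refine ⟨(∑ i, W.b i (-1)) * C, mul_nonneg (Finset.sum_nonneg fun i _ => (W.b_pos _ _).le) hC0, ?_⟩
  filter_upwards [hC, self_mem_nhdsWithin] with t h1 h2 k y y'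
  have h3 : (0 : ℝ) < t := h2
  have hb := W.b_pos y (-1)
  rw [Weights.beadEntry, norm_mul, norm_mul, Complex.norm_real, Complex.norm_real, Real.norm_eq_abs,
    Real.norm_eq_abs, abs_of_pos hb, abs_of_pos h3]
  have h4 : W.b y (-1) ≤ ∑ i, W.b i (-1) :=
    Finset.single_le_sum (f := fun i => W.b i (-1)) (fun i _ => (W.b_pos i _).le) (Finset.mem_univ _)
  calc _ ≤ (∑ i, W.b i (-1)) * t * C := by
        exact mul_le_mul (mul_le_mul_of_nonneg_right h4 h3.le) (h1 _ _ _ _) (norm_nonneg _)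
          (mul_nonneg (hb.le.trans h4) h3.le)
    _ = _ := by ring

/-- The weights of the rows of a fundamental domain in the limit: the `b`-edges of a row carry the
fraction `rowWeight` of the beads. -/
theorem Weights.exists_rowWeight (W : Weights n m) {j₀ : ZMod n}
    (hgen : ∀ j, j ≠ j₀ → W.abscissa j ≠ W.abscissa j₀) {γ : ℝ} (hγ : γ ∈ Set.Ioo (-1 : ℝ) 1) :
    ∃ ψ φ : ZMod m → ℝ, ∑ i, ψ i * φ i = 1 ∧
      ∀ (k : ℤ) (i i' : ZMod m) (Y Y' : ℝ → ℤ) (η : ℝ),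
        (η ≠ 0 ∨ (k = 0 ∧ η = 0 ∧ ∀ t, Y t = Y' t)) →
        Tendsto (fun t : ℝ => t * (Y t - Y' t)) (𝓝[>] 0) (𝓝 η) →
        Tendsto (fun t : ℝ => ((-1 : ℂ) ^ m) ^ (Y t - Y' t) *
          W.beadEntry j₀ γ t k (m * Y t + i.val) (m * Y' t + i'.val) /
            (t * |W.beta j₀| * √(1 - γ ^ 2))) (𝓝[>] 0)
          (𝓝 (ψ i * φ i' * beadKernel γ k (η * W.beta j₀ * √(1 - γ ^ 2)))) := by
  obtain ⟨ψ, φ, h1, -⟩ := W.rootAdj_rank_one hgen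
  have hβ := W.beta_ne_zero hgen
  have hr := W.root_ne_zero j₀
  have hd := W.dz_ne_zero hgen
  -- The normalisation is dictated by `∂₂P = ∑ b ψ φ` and `∂₂P = -r ∂₁P β`, which make the shares of
  -- the rows sum to one.
  refine ⟨fun i => -(W.b i (-1) * ψ i) / (W.root j₀ * W.dz j₀ * W.beta j₀), φ, ?_, ?_⟩
  · have h2 := W.dw_eq j₀
    simp only [h1] at h2
    have h3 := W.beta_eq j₀
    have h4 : W.dw j₀ = -(W.root j₀ * W.dz j₀ * W.beta j₀) := by
      rw [h3]; field_simp
    have h5 : ∀ i, -(W.b i (-1) * ψ i) / (W.root j₀ * W.dz j₀ * W.beta j₀) * φ i =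
        -(W.root j₀ * W.dz j₀ * W.beta j₀)⁻¹ * (W.b i (-1) * (ψ i * φ i)) := fun i => by
      field_simp
    simp only [h5]
    rw [← Finset.mul_sum, ← h2, h4]
    field_simp
  · intro k i i' Y Y' η hη hY
    have hm : (0 : ℤ) < m := by exact_mod_cast NeZero.pos m
    have hdiv : ∀ (Z : ℤ) (i : ZMod m), (m * Z + i.val) / (m : ℤ) = Z := fun Z i => by
      have := ZMod.val_lt i
      refine Int.ediv_eq_iff_of_pos hm |>.2 ⟨?_, ?_⟩
      · nlinarith
      · have h3 : (i.val : ℤ) < m := by exact_mod_cast this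
        nlinarith
    have hcast : ∀ (Z : ℤ) (i : ZMod m), ((m * Z + i.val : ℤ) : ZMod m) = i := fun Z i => by
      push_cast
      simp
    have hs0 : (√(1 - γ ^ 2) : ℂ) ≠ 0 := Complex.ofReal_ne_zero.2 (sqrt_pos_of_mem hγ).ne'
    have hβa : ((|W.beta j₀| : ℝ) : ℂ) ≠ 0 := Complex.ofReal_ne_zero.2 (abs_ne_zero.2 hβ)
    have hβc : (W.beta j₀ : ℂ) ≠ 0 := Complex.ofReal_ne_zero.2 hβ
    have hsgn : ((SignType.sign (W.beta j₀) : ℤ) : ℂ) * W.beta j₀ = (|W.beta j₀| : ℝ) := by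
      rcases lt_or_gt_of_ne hβ with hb | hb
      · simp [sign_neg hb, abs_of_neg hb]
      · simp [sign_pos hb, abs_of_pos hb]
    have hsgn2 : ((SignType.sign (W.beta j₀) : ℤ) : ℂ) * (SignType.sign (W.beta j₀) : ℤ) = 1 := by
      rcases lt_or_gt_of_ne hβ with hb | hb
      · simp [sign_neg hb]
      · simp [sign_pos hb]
    have key : Tendsto (fun t : ℝ => ((-1 : ℂ) ^ m) ^ (Y t - Y' t) *
        W.kerInt j₀ γ t k (Y t - Y' t) (i, 0) (i', -1)) (𝓝[>] 0)
        (𝓝 (-((SignType.sign (W.beta j₀) : ℤ) * ((ψ i * φ i' / (W.root j₀ * W.dz j₀) : ℝ) : ℂ) *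
          (√(1 - γ ^ 2) * beadKernel γ k (η * W.beta j₀ * √(1 - γ ^ 2)))))) := by
      -- The value `η = 0` is allowed only for one and the same cell on one thread; this is the
      -- diagonal of the determinants.
      by_cases h0 : η = 0
      · obtain ⟨rfl, -, h3⟩ := hη.resolve_left (not_not.2 h0)
        have h4 := W.tendsto_kerInt_zero hgen hγ (i, 0) (i', -1)
        rw [h1] at h4
        rw [h0, zero_mul, zero_mul, beadKernel_zero, ← div_eq_mul_inv]
        refine h4.congr fun t => ?_
        rw [h3, sub_self, zpow_zero, one_mul]
      · have h4 := W.tendsto_kerInt hgen hγ h0 (Y := fun t => Y t - Y' t) (by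
          push_cast; exact hY) k (i, 0) (i', -1)
        rw [h1] at h4
        rw [beadKernel_eq hγ (mul_ne_zero h0 hβ), mul_div_cancel₀ _ hs0]
        exact h4
    have h5 := key.const_mul (W.b i (-1) / (|W.beta j₀| * √(1 - γ ^ 2)) : ℂ)
    have e : (W.b i (-1) / (|W.beta j₀| * √(1 - γ ^ 2)) : ℂ) * (-((SignType.sign (W.beta j₀) : ℤ) *
        ((ψ i * φ i' / (W.root j₀ * W.dz j₀) : ℝ) : ℂ) *
          (√(1 - γ ^ 2) * beadKernel γ k (η * W.beta j₀ * √(1 - γ ^ 2))))) =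
        ((-(W.b i (-1) * ψ i) / (W.root j₀ * W.dz j₀ * W.beta j₀) : ℝ) : ℂ) * φ i' *
          beadKernel γ k (η * W.beta j₀ * √(1 - γ ^ 2)) := by
      have hr' : (W.root j₀ : ℂ) ≠ 0 := Complex.ofReal_ne_zero.2 hr
      have hd' : (W.dz j₀ : ℂ) ≠ 0 := Complex.ofReal_ne_zero.2 hd
      rw [← hsgn]
      have hs1 : ((SignType.sign (W.beta j₀) : ℤ) : ℂ) ≠ 0 := left_ne_zero_of_mul_eq_one hsgn2
      generalize ((SignType.sign (W.beta j₀) : ℤ) : ℂ) = σ at hs1 ⊢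
      push_cast
      field_simp
    rw [e] at h5
    refine h5.congr' ?_
    filter_upwards [self_mem_nhdsWithin] with t ht
    have ht' : (t : ℂ) ≠ 0 := Complex.ofReal_ne_zero.2 (ne_of_gt ht)
    simp only [Weights.beadEntry, hdiv, hcast]
    field_simp

end BeadDimer

end

/-! ### Correlation sums of beads and their limits. -/

noncomputable section

namespace BeadDimer

/-! ### Tuples of points -/

open Classical in
/-- The number of tuples of distinct labels `(k q, f q)`, with `k` prescribed, whose positions form an
element of `B`; a label of position `⊤` stands for no point. -/
def tupleCount {ι L : Type*} (k : ι → ℤ) (B : Set (ι → ℝ)) (e : ℤ × L → EReal) : ENNReal :=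
  ∑' f : ι → L, if Function.Injective (fun q => (k q, f q)) ∧
    ∃ ξ ∈ B, ∀ q, e (k q, f q) = (ξ q : EReal) then 1 else 0

/-! ### Hadamard's inequality -/

-- The eigenvalues of `A Aᴴ` have product `|det A|²` and sum at most `N² b²`; the inequality of
-- arithmetic and geometric means concludes. The growth `N^(N/2)`, instead of `N!`, is what makes
-- the moment series converge.
open scoped ComplexOrder in
theorem norm_det_le_of_norm_le {ι : Type*} [Fintype ι] [DecidableEq ι] {A : Matrix ι ι ℂ} {b : ℝ}
    (hA : ∀ i j, ‖A i j‖ ≤ b) :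
    ‖A.det‖ ≤ (b * √(Fintype.card ι)) ^ Fintype.card ι := by
  rcases isEmpty_or_nonempty ι with h | h
  · simp
  have hb : 0 ≤ b := (norm_nonneg _).trans (hA h.some h.some)
  set N := Fintype.card ι with hN
  have hN0 : (0 : ℝ) < N := by exact_mod_cast Fintype.card_pos
  have hP := Matrix.posSemidef_self_mul_conjTranspose A
  have hH := hP.isHermitian
  have h1 : ‖A.det‖ ^ 2 = ∏ i, hH.eigenvalues i := by
    have h2 := hH.det_eq_prod_eigenvalues
    rw [Matrix.det_mul, Matrix.det_conjTranspose, Complex.star_def, Complex.mul_conj',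
      ← Complex.ofReal_pow] at h2
    have h3 : ((‖A.det‖ ^ 2 : ℝ) : ℂ) = ((∏ i, hH.eigenvalues i : ℝ) : ℂ) := by
      rw [h2]; push_cast; rfl
    exact_mod_cast h3
  have h4 : ∑ i, hH.eigenvalues i ≤ N * (N * b ^ 2) := by
    have h5 := hH.trace_eq_sum_eigenvalues
    have h6 : (A * A.conjTranspose).trace = ((∑ i, ∑ j, ‖A i j‖ ^ 2 : ℝ) : ℂ) := by
      rw [Matrix.trace]
      push_cast
      refine Finset.sum_congr rfl fun i _ => ?_
      rw [Matrix.diag_apply, Matrix.mul_apply]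
      refine Finset.sum_congr rfl fun j _ => ?_
      rw [Matrix.conjTranspose_apply, Complex.star_def, Complex.mul_conj']
    rw [h6] at h5
    have h7 : ∑ i, hH.eigenvalues i = ∑ i, ∑ j, ‖A i j‖ ^ 2 := by
      have : ((∑ i, hH.eigenvalues i : ℝ) : ℂ) = ((∑ i, ∑ j, ‖A i j‖ ^ 2 : ℝ) : ℂ) := by
        rw [h5]; push_cast; rfl
      exact_mod_cast this
    rw [h7]
    calc ∑ i, ∑ j, ‖A i j‖ ^ 2 ≤ ∑ _i : ι, ∑ _j : ι, b ^ 2 := by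
          refine Finset.sum_le_sum fun i _ => Finset.sum_le_sum fun j _ => ?_
          exact pow_le_pow_left₀ (norm_nonneg _) (hA i j) 2
      _ = N * (N * b ^ 2) := by simp [hN]
  have h9 : ∏ i, hH.eigenvalues i ≤ (N * b ^ 2) ^ N := by
    have h10 := Real.geom_mean_le_arith_mean_weighted Finset.univ (fun _ : ι => (N : ℝ)⁻¹)
      hH.eigenvalues (fun _ _ => by positivity) (by simp [hN])
      (fun i _ => hP.eigenvalues_nonneg i)
    rw [← Finset.mul_sum] at h10
    have h11 : ∏ i, hH.eigenvalues i ^ (N : ℝ)⁻¹ ≤ N * b ^ 2 := by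
      refine h10.trans ?_
      rw [inv_mul_le_iff₀ hN0]
      exact h4
    have h12 : ∏ i, hH.eigenvalues i = (∏ i, hH.eigenvalues i ^ (N : ℝ)⁻¹) ^ N := by
      rw [← Finset.prod_pow]
      refine Finset.prod_congr rfl fun i _ => ?_
      rw [← Real.rpow_natCast, ← Real.rpow_mul (hP.eigenvalues_nonneg i),
        inv_mul_cancel₀ hN0.ne', Real.rpow_one]
    rw [h12]
    exact pow_le_pow_left₀ (Finset.prod_nonneg fun i _ =>
      Real.rpow_nonneg (hP.eigenvalues_nonneg i) _) h11 N
  have h13 : ‖A.det‖ ^ 2 ≤ ((b * √N) ^ N) ^ 2 := by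
    rw [h1, ← pow_mul, mul_comm N 2, pow_mul, mul_pow, Real.sq_sqrt hN0.le, mul_comm (b ^ 2)]
    exact h9
  exact (sq_le_sq₀ (norm_nonneg _) (by positivity)).1 h13

/-! ### Sums over rows as integrals of step functions -/

theorem volume_floor_div_eq {ι : Type*} [Fintype ι] {c : ℝ} (hc : c ≠ 0) (Y : ι → ℤ) :
    volume {ξ : ι → ℝ | ∀ q, ⌊ξ q / c⌋ = Y q} = ENNReal.ofReal (|c| ^ Fintype.card ι) ∧
      MeasurableSet {ξ : ι → ℝ | ∀ q, ⌊ξ q / c⌋ = Y q} := by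
  have h1 : {ξ : ι → ℝ | ∀ q, ⌊ξ q / c⌋ = Y q} =
      Set.pi Set.univ fun q => (fun x => x * c⁻¹) ⁻¹' Set.Ico (Y q : ℝ) (Y q + 1) := by
    ext ξ
    simp [Set.mem_pi, Int.floor_eq_iff, div_eq_mul_inv]
  rw [h1]
  constructor
  · rw [volume_pi_pi]
    simp only [Real.volume_preimage_mul_right (inv_ne_zero hc), inv_inv, Real.volume_Ico,
      add_sub_cancel_left, ENNReal.ofReal_one, mul_one, Finset.prod_const, Finset.card_univ]
    rw [ENNReal.ofReal_pow (abs_nonneg c)]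
  · exact MeasurableSet.univ_pi fun q => (measurable_mul_const _) measurableSet_Ico

/-- A sum over cells of side `|c|` becomes the integral of a step function on a fixed space, so that
dominated convergence applies as the cells shrink. -/
theorem integral_floor_div {ι : Type*} [Fintype ι] {c : ℝ} (hc : c ≠ 0) {F : (ι → ℤ) → ℂ}
    {s : Finset (ι → ℤ)} (hF : ∀ Y, Y ∉ s → F Y = 0) :
    ∫ ξ : ι → ℝ, F (fun q => ⌊ξ q / c⌋) = |c| ^ Fintype.card ι * ∑' Y, F Y := by
  classical
  have h1 : ∀ ξ : ι → ℝ, F (fun q => ⌊ξ q / c⌋) = ∑ Y ∈ s,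
      {ξ : ι → ℝ | ∀ q, ⌊ξ q / c⌋ = Y q}.indicator (fun _ => F Y) ξ := fun ξ => by
    simp only [Set.indicator_apply, Set.mem_ofPred_eq, ← funext_iff (f := fun q => ⌊ξ q / c⌋)]
    rw [Finset.sum_ite_eq]
    split_ifs with h
    · rfl
    · exact hF _ h
  simp only [h1]
  rw [integral_finsetSum _ fun Y _ => ?_, tsum_eq_sum hF, Finset.mul_sum]
  · refine Finset.sum_congr rfl fun Y _ => ?_
    rw [integral_indicator (volume_floor_div_eq hc Y).2, setIntegral_const, Measure.real,
      (volume_floor_div_eq hc Y).1, ENNReal.toReal_ofReal (by positivity), Complex.real_smul]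
    push_cast
    rfl
  · refine (integrable_indicator_iff (volume_floor_div_eq hc Y).2).2 ?_
    refine integrableOn_const ?_
    rw [(volume_floor_div_eq hc Y).1]
    exact ENNReal.ofReal_ne_top

/-- Division with remainder. -/
def divModEquiv (m : ℕ) [NeZero m] : ℤ ≃ ZMod m × ℤ where
  toFun y := ((y : ZMod m), y / m)
  invFun p := m * p.2 + p.1.val
  left_inv y := by
    have := Int.mul_ediv_add_emod y m
    simp only [ZMod.val_intCast]
    exact this
  right_inv p := by
    have h2 : (p.1.val : ℤ) < m := by exact_mod_cast ZMod.val_lt p.1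
    have hm : (0 : ℤ) < m := by exact_mod_cast NeZero.pos m
    refine Prod.ext ?_ ?_
    · push_cast; simp
    · refine Int.ediv_eq_iff_of_pos hm |>.2 ⟨?_, ?_⟩ <;> nlinarith

theorem tsum_divMod {ι : Type*} [Fintype ι] [DecidableEq ι] (m : ℕ) [NeZero m] {F : (ι → ℤ) → ℂ}
    (hF : (Function.support F).Finite) :
    ∑' y, F y = ∑ i : ι → ZMod m, ∑' Y : ι → ℤ, F (fun q => m * Y q + (i q).val) := by
  let E : (ι → ZMod m) × (ι → ℤ) ≃ (ι → ℤ) :=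
    (Equiv.arrowProdEquivProdArrow ι (fun _ => ZMod m) (fun _ => ℤ)).symm.trans
      (Equiv.arrowCongr (Equiv.refl ι) (divModEquiv m).symm)
  rw [← E.tsum_eq, Summable.tsum_prod, tsum_fintype]
  · rfl
  · refine (summable_of_hasFiniteSupport ?_ : Summable fun p => F (E p))
    exact hF.preimage E.injective.injOn

end BeadDimer

end

noncomputable section

namespace BeadDimer

variable {n m : ℕ} [NeZero n] [NeZero m]

/-! ### The rescaled beads on the threads `repThread n k` -/

open Classical in
/-- The rescaled positions of the beads on the threads `repThread n k`, labelled by their rows. -/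
def Weights.beadPos (W : Weights n m) (j₀ : ZMod n) (γ t : ℝ) (M : DimerConfig) : ℤ × ℤ → EReal :=
  fun p => if IsBead M (repThread n p.1) p.2 then (W.height j₀ γ t p.2 : EReal) else ⊤

/-- What is needed of a Gibbs measure: its bead correlations are determinants. -/
structure Weights.HasBeadKernel (W : Weights n m) (j₀ : ZMod n) (γ t : ℝ) (μ : Measure DimerConfig) :
    Prop where
  isProbabilityMeasure : IsProbabilityMeasure μ
  real_eq : ∀ {ι : Type} [Fintype ι] [DecidableEq ι] (k y : ι → ℤ),
    Function.Injective (fun q => (k q, y q)) →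
    ((μ.real {M | ∀ q, IsBead M (repThread n (k q)) (y q)} : ℝ) : ℂ) =
      (Matrix.of fun q r => W.beadEntry j₀ γ t (k q - k r) (y q) (y r)).det

theorem repThread_injective : Function.Injective (repThread n) := fun k k' h => by
  have hn : (n : ℤ) ≠ 0 := by exact_mod_cast NeZero.ne n
  simp only [repThread, sub_left_inj, mul_eq_mul_right_iff, hn, or_false] at h
  linarith

theorem Weights.eventually_hasBeadKernel (W : Weights n m) {j₀ : ZMod n}
    (hgen : ∀ j, j ≠ j₀ → W.abscissa j ≠ W.abscissa j₀) {γ : ℝ} (hγ : γ ∈ Set.Ioo (-1 : ℝ) 1)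
    {μ : ℝ → Measure DimerConfig}
    (hμ : ∀ᶠ t in 𝓝[>] (0 : ℝ), IsGibbsMeasure W (W.fieldX j₀ γ t) (Real.log t) (μ t)) :
    ∀ᶠ t in 𝓝[>] (0 : ℝ), W.HasBeadKernel j₀ γ t (μ t) := by
  filter_upwards [hμ, eventually_beadEntry W hgen hγ] with t h1 h2
  refine ⟨h1.isProbabilityMeasure, fun {ι} _ _ k y hinj => ?_⟩
  let E := (Fintype.equivFin ι).symm
  have h3 := h1.localStatistics (Fintype.card ι)
    (fun l => ((repThread n (k (E l)), y (E l)), EdgeType.b)) (fun l l' h => by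
      simp only [Prod.mk.injEq, and_true] at h
      exact E.injective (hinj (Prod.ext (repThread_injective h.1) h.2)))
  rw [← Matrix.det_mul_column] at h3
  simp only [Matrix.of_apply, h2] at h3
  have h4 : {M : DimerConfig | ∀ q, IsBead M (repThread n (k q)) (y q)} =
      {M | ∀ l, ((repThread n (k (E l)), y (E l)), EdgeType.b) ∈ M.1} := by
    ext M
    exact (E.forall_congr_left (p := fun l => IsBead M (repThread n (k (E l))) (y (E l)))).trans
      (by simp) |>.symm
  rw [h4, h3, ← Matrix.det_submatrix_equiv_self E]
  rfl

theorem measurableSet_mem_edge (e : Edge) : MeasurableSet {M : DimerConfig | e ∈ M.1} :=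
  MeasurableSpace.measurableSet_generateFrom ⟨e, rfl⟩

theorem measurableSet_isBead (x y : ℤ) : MeasurableSet {M : DimerConfig | IsBead M x y} :=
  measurableSet_mem_edge _

theorem Weights.beadPos_eq_coe (W : Weights n m) (j₀ : ZMod n) (γ t : ℝ) (M : DimerConfig)
    (p : ℤ × ℤ) (x : ℝ) : W.beadPos j₀ γ t M p = (x : EReal) ↔
      IsBead M (repThread n p.1) p.2 ∧ W.height j₀ γ t p.2 = x := by
  rw [Weights.beadPos]
  split_ifs with h
  · simp [h]
  · simp [h]

open Classical in
theorem Weights.tupleCount_beadPos (W : Weights n m) (j₀ : ZMod n) (γ t : ℝ) (M : DimerConfig)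
    {ι : Type} (k : ι → ℤ) (B : Set (ι → ℝ)) :
    tupleCount k B (W.beadPos j₀ γ t M) = ∑' y : ι → ℤ,
      {M : DimerConfig | ∀ q, IsBead M (repThread n (k q)) (y q)}.indicator
        (fun _ => if Function.Injective (fun q => (k q, y q)) ∧
          (fun q => W.height j₀ γ t (y q)) ∈ B then (1 : ENNReal) else 0) M := by
  refine tsum_congr fun y => ?_
  simp only [W.beadPos_eq_coe, Set.indicator_apply, Set.mem_ofPred_eq]
  by_cases h : ∀ q, IsBead M (repThread n (k q)) (y q)
  · rw [if_pos h]
    congr 1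
    rw [eq_iff_iff]
    refine and_congr_right fun _ => ⟨?_, fun hB => ⟨_, hB, fun q => ⟨h q, rfl⟩⟩⟩
    rintro ⟨ξ, hξ, h1⟩
    rwa [show (fun q => W.height j₀ γ t (y q)) = ξ from funext fun q => (h1 q).2]
  · rw [if_neg h, if_neg]
    rintro ⟨-, ξ, -, h1⟩
    exact h fun q => (h1 q).1

namespace Weights.HasBeadKernel

variable {W : Weights n m} {j₀ : ZMod n} {γ t : ℝ} {μ : Measure DimerConfig}
  (h : W.HasBeadKernel j₀ γ t μ)
include h

-- The condition of injectivity can be dropped from the sum, since for a repeated bead the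
-- determinant has two equal rows.
open Classical in
theorem lintegral_tupleCount {ι : Type} [Fintype ι] [DecidableEq ι] (k : ι → ℤ) (B : Set (ι → ℝ)) :
    ∫⁻ M, tupleCount k B (W.beadPos j₀ γ t M) ∂μ = ∑' y : ι → ℤ,
      if (fun q => W.height j₀ γ t (y q)) ∈ B then ENNReal.ofReal
        ‖(Matrix.of fun q r => W.beadEntry j₀ γ t (k q - k r) (y q) (y r)).det‖ else 0 := by
  have := h.isProbabilityMeasure
  simp only [W.tupleCount_beadPos]
  have hmeas : ∀ y : ι → ℤ, MeasurableSet {M : DimerConfig |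
      ∀ q, IsBead M (repThread n (k q)) (y q)} := fun y => by
    simp only [Set.ofPred_forall]
    exact MeasurableSet.iInter fun q => measurableSet_isBead _ _
  rw [lintegral_tsum fun y => (measurable_const.indicator (hmeas y)).aemeasurable]
  refine tsum_congr fun y => ?_
  rw [lintegral_indicator_const (hmeas y)]
  by_cases hB : (fun q => W.height j₀ γ t (y q)) ∈ B
  · by_cases hinj : Function.Injective (fun q => (k q, y q))
    · rw [if_pos ⟨hinj, hB⟩, if_pos hB, one_mul, ← h.real_eq k y hinj, Complex.norm_real,
        Real.norm_eq_abs, abs_of_nonneg measureReal_nonneg, ofReal_measureReal]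
    · rw [if_neg fun h1 => hinj h1.1, if_pos hB, zero_mul]
      simp only [Function.Injective] at hinj
      push Not at hinj
      obtain ⟨a, b, hab, hne⟩ := hinj
      rw [Matrix.det_zero_of_row_eq hne, norm_zero, ENNReal.ofReal_zero]
      funext r
      simp only [Prod.mk.injEq] at hab
      simp only [Matrix.of_apply, hab.1, hab.2]
  · rw [if_neg fun h1 => hB h1.2, if_neg hB, zero_mul]

/-- The determinant is a probability if the beads are distinct, and zero otherwise. -/
theorem norm_det_eq {ι : Type} [Fintype ι] [DecidableEq ι] (k y : ι → ℤ) :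
    ((‖(Matrix.of fun q r => W.beadEntry j₀ γ t (k q - k r) (y q) (y r)).det‖ : ℝ) : ℂ) =
      (Matrix.of fun q r => W.beadEntry j₀ γ t (k q - k r) (y q) (y r)).det := by
  by_cases hinj : Function.Injective (fun q => (k q, y q))
  · rw [← h.real_eq k y hinj, Complex.norm_real, Real.norm_eq_abs, abs_of_nonneg measureReal_nonneg]
  · simp only [Function.Injective] at hinj
    push Not at hinj
    obtain ⟨a, b, hab, hne⟩ := hinj
    rw [Matrix.det_zero_of_row_eq hne, norm_zero, Complex.ofReal_zero]
    funext r
    simp only [Prod.mk.injEq] at hab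
    simp only [Matrix.of_apply, hab.1, hab.2]

end Weights.HasBeadKernel

/-- The rescaled height of a fundamental domain. -/
def Weights.cellHeight (W : Weights n m) (j₀ : ZMod n) (γ t : ℝ) : ℝ :=
  t * W.beta j₀ * √(1 - γ ^ 2)

theorem Weights.cellHeight_ne_zero (W : Weights n m) {j₀ : ZMod n}
    (hgen : ∀ j, j ≠ j₀ → W.abscissa j ≠ W.abscissa j₀) {γ : ℝ} (hγ : γ ∈ Set.Ioo (-1 : ℝ) 1)
    {t : ℝ} (ht : 0 < t) : W.cellHeight j₀ γ t ≠ 0 :=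
  mul_ne_zero (mul_ne_zero ht.ne' (W.beta_ne_zero hgen)) (sqrt_pos_of_mem hγ).ne'

theorem Weights.height_eq (W : Weights n m) (j₀ : ZMod n) (γ t : ℝ) (y : ℤ) :
    W.height j₀ γ t y = W.cellHeight j₀ γ t * (y / m) := rfl

/-- The rows whose rescaled height is at most `r`. -/
theorem Weights.abs_height_le_iff (W : Weights n m) {j₀ : ZMod n} {γ t : ℝ}
    (hc : W.cellHeight j₀ γ t ≠ 0) (r : ℝ) (y : ℤ) : |W.height j₀ γ t y| ≤ r ↔
      y ∈ Finset.Icc (-⌊r * m / |W.cellHeight j₀ γ t|⌋) ⌊r * m / |W.cellHeight j₀ γ t|⌋ := by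
  have hm : (0 : ℝ) < m := by exact_mod_cast NeZero.pos m
  have hc' := abs_pos.2 hc
  rw [W.height_eq, abs_mul, abs_div, abs_of_pos hm, ← mul_div_assoc, div_le_iff₀ hm, mul_comm,
    ← le_div_iff₀ hc', abs_le, Finset.mem_Icc, Int.le_floor]
  refine and_congr_left fun _ => ?_
  rw [neg_le, neg_le (a := ⌊_⌋), Int.le_floor]
  push_cast
  rfl

theorem Weights.finite_support (W : Weights n m) {j₀ : ZMod n} {γ t : ℝ}
    (hc : W.cellHeight j₀ γ t ≠ 0) {ι : Type} [Fintype ι] [DecidableEq ι] {B : Set (ι → ℝ)}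
    {r : ℝ}
    (hB : ∀ ξ ∈ B, ∀ q, |ξ q| ≤ r) {y : ι → ℤ} (hy : (fun q => W.height j₀ γ t (y q)) ∈ B) :
    y ∈ Fintype.piFinset fun _ : ι =>
      Finset.Icc (-⌊r * m / |W.cellHeight j₀ γ t|⌋) ⌊r * m / |W.cellHeight j₀ γ t|⌋ :=
  Fintype.mem_piFinset.2 fun q => (W.abs_height_le_iff hc r _).1 (hB _ hy q)

/-- A bound of the number of tuples of beads in a window, uniform in `t`. -/
theorem Weights.exists_lintegral_tupleCount_le (W : Weights n m) {j₀ : ZMod n}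
    (hgen : ∀ j, j ≠ j₀ → W.abscissa j ≠ W.abscissa j₀) {γ : ℝ} (hγ : γ ∈ Set.Ioo (-1 : ℝ) 1)
    {μ : ℝ → Measure DimerConfig}
    (hμ : ∀ᶠ t in 𝓝[>] (0 : ℝ), W.HasBeadKernel j₀ γ t (μ t)) {r : ℝ} (hr : 0 ≤ r) :
    ∃ D : ℝ, 0 ≤ D ∧ ∀ᶠ t in 𝓝[>] (0 : ℝ), ∀ (ι : Type) [Fintype ι] (k : ι → ℤ) (B : Set (ι → ℝ)),
      (∀ ξ ∈ B, ∀ q, |ξ q| ≤ r) → ∫⁻ M, tupleCount k B (W.beadPos j₀ γ t M) ∂(μ t) ≤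
        ENNReal.ofReal ((D * √(Fintype.card ι)) ^ Fintype.card ι) := by
  classical
  obtain ⟨C, hC0, hC⟩ := W.exists_beadEntry_bound hgen γ
  have hm : (0 : ℝ) < m := by exact_mod_cast NeZero.pos m
  set a := |W.beta j₀ * √(1 - γ ^ 2)| with ha
  have ha0 : 0 < a := abs_pos.2 (mul_ne_zero (W.beta_ne_zero hgen) (sqrt_pos_of_mem hγ).ne')
  -- The window contains at most `(2 r m / a + 1) / t` rows of a thread, and each entry of the
  -- determinant is at most `C t`: the powers of `t` cancel.
  refine ⟨(2 * (r * m / a) + 1) * C, by positivity, ?_⟩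
  have ht1 : ∀ᶠ t in 𝓝[>] (0 : ℝ), t < 1 := nhdsWithin_le_nhds (gt_mem_nhds one_pos)
  filter_upwards [hμ, hC, ht1, self_mem_nhdsWithin] with t h1 h2 ht1 ht0 ι _ k B hB
  have ht0' : (0 : ℝ) < t := ht0
  have hc := W.cellHeight_ne_zero hgen hγ ht0'
  have hca : |W.cellHeight j₀ γ t| = t * a := by
    rw [Weights.cellHeight, mul_assoc, abs_mul, abs_of_pos ht0']
  rw [h1.lintegral_tupleCount]
  set s := Fintype.piFinset fun _ : ι =>
      Finset.Icc (-⌊r * m / |W.cellHeight j₀ γ t|⌋) ⌊r * m / |W.cellHeight j₀ γ t|⌋ with hs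
  set N := Fintype.card ι with hN
  have hle : ∀ y : ι → ℤ, (if (fun q => W.height j₀ γ t (y q)) ∈ B then ENNReal.ofReal
      ‖(Matrix.of fun q r => W.beadEntry j₀ γ t (k q - k r) (y q) (y r)).det‖ else 0) ≤
      if y ∈ s then ENNReal.ofReal ((C * t * √N) ^ N) else 0 := fun y => by
    split_ifs with h3 h4
    · exact ENNReal.ofReal_le_ofReal (norm_det_le_of_norm_le fun _ _ => h2 _ _ _)
    · exact absurd (W.finite_support hc hB h3) h4
    · positivity
    · exact le_rfl
  refine (ENNReal.tsum_le_tsum hle).trans ?_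
  rw [tsum_eq_sum (s := s) fun y hy => if_neg hy, Finset.sum_congr rfl fun y hy => if_pos hy,
    Finset.sum_const, nsmul_eq_mul, ← ENNReal.ofReal_natCast, ← ENNReal.ofReal_mul (by positivity)]
  refine ENNReal.ofReal_le_ofReal ?_
  rw [hs, Fintype.card_piFinset, Finset.prod_const, Finset.card_univ, ← hN, Int.card_Icc]
  push_cast
  rw [← mul_pow]
  have hf0 : 0 ≤ ⌊r * m / |W.cellHeight j₀ γ t|⌋ := Int.floor_nonneg.2 (by positivity)
  have hf : ((⌊r * m / |W.cellHeight j₀ γ t|⌋ + 1 - -⌊r * m / |W.cellHeight j₀ γ t|⌋).toNat : ℝ) ≤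
      (2 * (r * m / a) + 1) / t := by
    have h5 := Int.floor_le (r * m / |W.cellHeight j₀ γ t|)
    have h6 : ((⌊r * m / |W.cellHeight j₀ γ t|⌋ + 1 - -⌊r * m / |W.cellHeight j₀ γ t|⌋).toNat : ℝ) =
        2 * (⌊r * m / |W.cellHeight j₀ γ t|⌋ : ℝ) + 1 := by
      rw [← Int.cast_natCast, Int.toNat_of_nonneg (by omega)]
      push_cast
      ring
    rw [h6, le_div_iff₀ ht0', hca] at *
    have h7 : r * m / (t * a) * t = r * m / a := by field_simp
    nlinarith
  refine pow_le_pow_left₀ (by positivity) ?_ _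
  calc _ ≤ (2 * (r * m / a) + 1) / t * (C * t * √N) := mul_le_mul_of_nonneg_right hf (by positivity)
    _ = _ := by field_simp

end BeadDimer

end

noncomputable section

namespace BeadDimer

variable {n m : ℕ} [NeZero n] [NeZero m]

/-- The correlation functions of the bead model. -/
def beadDet {ι : Type*} [Fintype ι] [DecidableEq ι] (γ : ℝ) (k : ι → ℤ) (ξ : ι → ℝ) : ℂ :=
  (Matrix.of fun q r => beadKernel γ (k q - k r) (ξ q - ξ r)).det

theorem volume_coord_eq {ι : Type*} [Fintype ι] [DecidableEq ι] {q r : ι} (h : q ≠ r) :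
    volume {ξ : ι → ℝ | ξ q = ξ r} = 0 := by
  have h1 := Measure.addHaar_submodule (volume : Measure (ι → ℝ))
    (LinearMap.ker (LinearMap.proj (R := ℝ) (φ := fun _ : ι => ℝ) q - LinearMap.proj r)) (by
      intro h2
      have h3 : (Pi.single q (1 : ℝ) : ι → ℝ) ∈ LinearMap.ker
          (LinearMap.proj (R := ℝ) (φ := fun _ : ι => ℝ) q - LinearMap.proj r) := by
        rw [h2]; trivial
      simp [h.symm] at h3)
  convert h1 using 2
  ext ξ
  simp [sub_eq_zero]

/-- Tuples with two equal coordinates, for which the limit of an off-diagonal entry is not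
available, are negligible. -/
theorem ae_injective {ι : Type*} [Fintype ι] [DecidableEq ι] :
    ∀ᵐ ξ : ι → ℝ, Function.Injective ξ := by
  have h1 : ∀ q r : ι, ∀ᵐ ξ : ι → ℝ, q ≠ r → ξ q ≠ ξ r := fun q r => by
    by_cases h : q = r
    · exact Eventually.of_forall fun ξ h1 => absurd h h1
    · refine (measure_eq_zero_iff_ae_notMem.1 (volume_coord_eq h)).mono fun ξ h1 _ => h1
  filter_upwards [ae_all_iff.2 fun q => ae_all_iff.2 (h1 q)] with ξ h2 q r h3
  by_contra h4
  exact h2 q r h4 h3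

theorem abs_floor_height_sub_le {c x y : ℝ} (hc : c ≠ 0) (hy0 : 0 ≤ y) (hy : y < 1) :
    |c * (⌊x / c⌋ + y) - x| ≤ |c| := by
  have h1 := Int.floor_le (x / c)
  have h2 := Int.lt_floor_add_one (x / c)
  have e : c * (⌊x / c⌋ + y) - x = c * (⌊x / c⌋ + y - x / c) := by field_simp
  rw [e, abs_mul]
  refine mul_le_of_le_one_right (abs_nonneg c) (abs_le.2 ⟨by linarith, by linarith⟩)

section

variable (W : Weights n m) {j₀ : ZMod n}

theorem Weights.height_divMod (j₀ : ZMod n) (γ t x : ℝ) (i : ZMod m) :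
    W.height j₀ γ t (m * ⌊x / W.cellHeight j₀ γ t⌋ + i.val) =
      W.cellHeight j₀ γ t * (⌊x / W.cellHeight j₀ γ t⌋ + (i.val : ℝ) / m) := by
  have hm : (m : ℝ) ≠ 0 := by exact_mod_cast NeZero.ne m
  rw [W.height_eq]
  push_cast
  field_simp

theorem Weights.abs_height_divMod_sub_le {γ t : ℝ} (hc : W.cellHeight j₀ γ t ≠ 0) (x : ℝ)
    (i : ZMod m) : |W.height j₀ γ t (m * ⌊x / W.cellHeight j₀ γ t⌋ + i.val) - x| ≤
      |W.cellHeight j₀ γ t| := by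
  have hm : (0 : ℝ) < m := by exact_mod_cast NeZero.pos m
  rw [W.height_divMod]
  refine abs_floor_height_sub_le hc (by positivity) ?_
  rw [div_lt_one hm]
  exact_mod_cast ZMod.val_lt i

theorem Weights.tendsto_cellHeight (γ : ℝ) :
    Tendsto (W.cellHeight j₀ γ) (𝓝[>] 0) (𝓝 0) := by
  have h : Continuous (W.cellHeight j₀ γ) := by
    unfold Weights.cellHeight
    fun_prop
  have h1 := h.tendsto 0
  rw [show W.cellHeight j₀ γ 0 = 0 by simp [Weights.cellHeight]] at h1
  exact h1.mono_left nhdsWithin_le_nhds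

/-- Convergence of the normalized determinants. -/
theorem Weights.exists_tendsto_det (hgen : ∀ j, j ≠ j₀ → W.abscissa j ≠ W.abscissa j₀) {γ : ℝ}
    (hγ : γ ∈ Set.Ioo (-1 : ℝ) 1) :
    ∃ p : ZMod m → ℝ, ∑ i, p i = 1 ∧ ∀ {ι : Type} [Fintype ι] [DecidableEq ι] (k : ι → ℤ)
      (i : ι → ZMod m) (ξ : ι → ℝ), Function.Injective ξ →
      Tendsto (fun t : ℝ => ((|W.cellHeight j₀ γ t| : ℝ) : ℂ)⁻¹ ^ Fintype.card ι *
        (Matrix.of fun q r => W.beadEntry j₀ γ t (k q - k r)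
          (m * ⌊ξ q / W.cellHeight j₀ γ t⌋ + (i q).val)
          (m * ⌊ξ r / W.cellHeight j₀ γ t⌋ + (i r).val)).det) (𝓝[>] 0)
        (𝓝 (((∏ q, p (i q) : ℝ) : ℂ) * beadDet γ k ξ)) := by
  obtain ⟨ψ, φ, hsum, hlim⟩ := W.exists_rowWeight hgen hγ
  refine ⟨fun i => ψ i * φ i, hsum, fun {ι} _ _ k i ξ hξ => ?_⟩
  have hs := sqrt_pos_of_mem hγ
  have hb := W.beta_ne_zero hgen
  set Y : ι → ℝ → ℤ := fun q t => ⌊ξ q / W.cellHeight j₀ γ t⌋ with hYdef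
  have hY : ∀ q, Tendsto (fun t : ℝ => t * (Y q t : ℝ)) (𝓝[>] 0)
      (𝓝 (ξ q / (W.beta j₀ * √(1 - γ ^ 2)))) := fun q => by
    have h1 : Tendsto (fun t : ℝ => t * (ξ q / W.cellHeight j₀ γ t) -
        t * Int.fract (ξ q / W.cellHeight j₀ γ t)) (𝓝[>] 0)
        (𝓝 (ξ q / (W.beta j₀ * √(1 - γ ^ 2)) - 0)) := by
      refine Tendsto.sub ?_ ?_
      · refine tendsto_const_nhds.congr' ?_
        filter_upwards [self_mem_nhdsWithin] with t ht
        have ht' : t ≠ 0 := ne_of_gt ht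
        rw [Weights.cellHeight, mul_assoc t]
        have := mul_ne_zero hb hs.ne'
        field_simp
      · refine squeeze_zero_norm' (a := fun t : ℝ => t) ?_
          (tendsto_id.mono_left nhdsWithin_le_nhds)
        filter_upwards [self_mem_nhdsWithin] with t ht
        have ht' : (0 : ℝ) < t := ht
        rw [Real.norm_eq_abs, abs_mul, abs_of_pos ht', abs_of_nonneg (Int.fract_nonneg _)]
        exact mul_le_of_le_one_right ht'.le (Int.fract_lt_one _).le
    rw [sub_zero] at h1
    refine h1.congr fun t => ?_
    rw [← mul_sub, Int.self_sub_fract]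
  have hentry : ∀ q r, Tendsto (fun t : ℝ => ((-1 : ℂ) ^ m) ^ (Y q t - Y r t) *
      W.beadEntry j₀ γ t (k q - k r) (m * Y q t + (i q).val) (m * Y r t + (i r).val) /
        (t * |W.beta j₀| * √(1 - γ ^ 2))) (𝓝[>] 0)
      (𝓝 (ψ (i q) * (φ (i r) * beadKernel γ (k q - k r) (ξ q - ξ r)))) := fun q r => by
    have h2 := hlim (k q - k r) (i q) (i r) (Y q) (Y r) ((ξ q - ξ r) / (W.beta j₀ * √(1 - γ ^ 2))) ?_ ?_
    · have e : (ξ q - ξ r) / (W.beta j₀ * √(1 - γ ^ 2)) * W.beta j₀ * √(1 - γ ^ 2) = ξ q - ξ r := by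
        have := hs.ne'
        field_simp
      rwa [e, mul_assoc] at h2
    · by_cases hqr : q = r
      · right; subst hqr; simp
      · left
        exact div_ne_zero (sub_ne_zero.2 fun h => hqr (hξ h)) (mul_ne_zero hb hs.ne')
    · rw [sub_div]
      refine ((hY q).sub (hY r)).congr fun t => ?_
      ring
  have hdet : Tendsto (fun t : ℝ => (Matrix.of fun q r => ((-1 : ℂ) ^ m) ^ (Y q t - Y r t) *
      W.beadEntry j₀ γ t (k q - k r) (m * Y q t + (i q).val) (m * Y r t + (i r).val) /
        (t * |W.beta j₀| * √(1 - γ ^ 2))).det) (𝓝[>] 0)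
      (𝓝 (Matrix.of fun q r => (ψ (i q) : ℂ) * (φ (i r) *
        beadKernel γ (k q - k r) (ξ q - ξ r))).det) := by
    have hc : Continuous fun A : Matrix ι ι ℂ => A.det := Continuous.matrix_det continuous_id
    refine (hc.tendsto _).comp ?_
    exact tendsto_pi_nhds.2 fun q => tendsto_pi_nhds.2 fun r => hentry q r
  have e1 : (Matrix.of fun q r => (ψ (i q) : ℂ) * (φ (i r) *
        beadKernel γ (k q - k r) (ξ q - ξ r))).det = ((∏ q, ψ (i q) * φ (i q) : ℝ) : ℂ) *
        beadDet γ k ξ := by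
    have h3 := Matrix.det_mul_column (fun q => (ψ (i q) : ℂ)) (Matrix.of fun q r => (φ (i r) : ℂ) *
        beadKernel γ (k q - k r) (ξ q - ξ r))
    have h4 := Matrix.det_mul_row (fun q => (φ (i q) : ℂ)) (Matrix.of fun q r =>
        beadKernel γ (k q - k r) (ξ q - ξ r))
    simp only [Matrix.of_apply] at h3 h4
    rw [h3, h4, ← mul_assoc, ← Finset.prod_mul_distrib, beadDet]
    push_cast
    rfl
  rw [e1] at hdet
  refine hdet.congr' ?_
  filter_upwards [self_mem_nhdsWithin] with t ht
  have ht' : (0 : ℝ) < t := ht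
  have hca : ((|W.cellHeight j₀ γ t| : ℝ) : ℂ) = t * |W.beta j₀| * √(1 - γ ^ 2) := by
    rw [Weights.cellHeight, abs_mul, abs_mul, abs_of_pos ht', abs_of_pos hs]
    push_cast
    rfl
  have hsg : ((-1 : ℂ) ^ m) ≠ 0 := by simp
  -- The signs `(-1)^(m Y)` amount to conjugation by a diagonal matrix, so they do not affect the
  -- determinant.
  have e2 : ∀ q r, ((-1 : ℂ) ^ m) ^ (Y q t - Y r t) *
      W.beadEntry j₀ γ t (k q - k r) (m * Y q t + (i q).val) (m * Y r t + (i r).val) /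
        (t * |W.beta j₀| * √(1 - γ ^ 2)) = (((-1 : ℂ) ^ m) ^ (Y q t) *
        ((|W.cellHeight j₀ γ t| : ℝ) : ℂ)⁻¹) * ((((-1 : ℂ) ^ m) ^ (Y r t))⁻¹ *
        W.beadEntry j₀ γ t (k q - k r) (m * Y q t + (i q).val) (m * Y r t + (i r).val)) := fun q r => by
    rw [hca, zpow_sub₀ hsg]
    ring
  simp only [e2]
  have h3 := Matrix.det_mul_column (fun q => (((-1 : ℂ) ^ m) ^ (Y q t) *
        ((|W.cellHeight j₀ γ t| : ℝ) : ℂ)⁻¹)) (Matrix.of fun q r => (((-1 : ℂ) ^ m) ^ (Y r t))⁻¹ *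
        W.beadEntry j₀ γ t (k q - k r) (m * Y q t + (i q).val) (m * Y r t + (i r).val))
  have h4 := Matrix.det_mul_row (fun r => (((-1 : ℂ) ^ m) ^ (Y r t))⁻¹) (Matrix.of fun q r =>
        W.beadEntry j₀ γ t (k q - k r) (m * Y q t + (i q).val) (m * Y r t + (i r).val))
  simp only [Matrix.of_apply] at h3 h4
  rw [h3, h4, ← mul_assoc, ← Finset.prod_mul_distrib]
  congr 1
  have e3 : ∀ q, ((-1 : ℂ) ^ m) ^ (Y q t) * ((|W.cellHeight j₀ γ t| : ℝ) : ℂ)⁻¹ *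
      (((-1 : ℂ) ^ m) ^ (Y q t))⁻¹ = ((|W.cellHeight j₀ γ t| : ℝ) : ℂ)⁻¹ := fun q => by
    have := zpow_ne_zero (Y q t) hsg
    field_simp
  simp only [e3, Finset.prod_const, Finset.card_univ]

/-- The numbers of tuples of beads converge in mean. -/
theorem Weights.tendsto_tupleCount (hgen : ∀ j, j ≠ j₀ → W.abscissa j ≠ W.abscissa j₀) {γ : ℝ}
    (hγ : γ ∈ Set.Ioo (-1 : ℝ) 1) {μ : ℝ → Measure DimerConfig}
    (hμ : ∀ᶠ t in 𝓝[>] (0 : ℝ), W.HasBeadKernel j₀ γ t (μ t)) {ι : Type} [Fintype ι] [DecidableEq ι]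
    (k : ι → ℤ) {B : Set (ι → ℝ)} (hBm : MeasurableSet B) {r : ℝ} (hr : 0 ≤ r)
    (hB : ∀ ξ ∈ B, ∀ q, |ξ q| ≤ r) (hfr : volume (frontier B) = 0) :
    Tendsto (fun t => (((∫⁻ M, tupleCount k B (W.beadPos j₀ γ t M) ∂(μ t)).toReal : ℝ) : ℂ))
      (𝓝[>] 0) (𝓝 (∫ ξ in B, beadDet γ k ξ)) := by
  classical
  obtain ⟨p, hp, hlim⟩ := W.exists_tendsto_det hgen hγ
  obtain ⟨C, hC0, hC⟩ := W.exists_beadEntry_bound hgen γ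
  set N := Fintype.card ι with hN
  set F : ℝ → (ι → ℤ) → ℂ := fun t y => if (fun q => W.height j₀ γ t (y q)) ∈ B then
    (Matrix.of fun q r => W.beadEntry j₀ γ t (k q - k r) (y q) (y r)).det else 0 with hF
  -- For given residues `i` of the rows, the normalised correlations as a step function; its
  -- integral is the corresponding part of the sum over rows.
  set G : (ι → ZMod m) → ℝ → (ι → ℝ) → ℂ := fun i t ξ =>
    ((|W.cellHeight j₀ γ t| : ℝ) : ℂ)⁻¹ ^ N *
      F t (fun q => m * ⌊ξ q / W.cellHeight j₀ γ t⌋ + (i q).val) with hG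
  have hmain : ∀ i, Tendsto (fun t => ∫ ξ, G i t ξ) (𝓝[>] 0)
      (𝓝 (∫ ξ, B.indicator (fun ξ => ((∏ q, p (i q) : ℝ) : ℂ) * beadDet γ k ξ) ξ)) := by
    intro i
    set a := |W.beta j₀ * √(1 - γ ^ 2)| with ha
    have ha0 : 0 < a := abs_pos.2 (mul_ne_zero (W.beta_ne_zero hgen) (sqrt_pos_of_mem hγ).ne')
    have hsmall : ∀ᶠ t in 𝓝[>] (0 : ℝ), |W.cellHeight j₀ γ t| < 1 := by
      have h1 := (W.tendsto_cellHeight (j₀ := j₀) γ).abs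
      rw [abs_zero] at h1
      exact h1.eventually (gt_mem_nhds one_pos)
    -- The window is enlarged to `r + 1` because rounding moves a position by at most one cell, of
    -- height less than one. The bound is Hadamard's.
    refine tendsto_integral_filter_of_dominated_convergence
      ((Metric.closedBall (0 : ι → ℝ) (r + 1)).indicator fun _ => (C / a * √N) ^ N) ?_ ?_ ?_ ?_
    · refine Eventually.of_forall fun t => Measurable.aestronglyMeasurable ?_
      have h1 : Measurable fun ξ : ι → ℝ => (fun q => ⌊ξ q / W.cellHeight j₀ γ t⌋ : ι → ℤ) :=
        measurable_pi_lambda _ fun q => Int.measurable_floor.comp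
          ((measurable_pi_apply q).div_const _)
      have h2 : Measurable fun Y : ι → ℤ => F t (fun q => m * Y q + (i q).val) :=
        measurable_of_countable _
      exact (h2.comp h1).const_mul _
    · filter_upwards [hC, hsmall, self_mem_nhdsWithin] with t h1 h2 ht
      have ht' : (0 : ℝ) < t := ht
      have hc := W.cellHeight_ne_zero hgen hγ ht'
      refine Eventually.of_forall fun ξ => ?_
      simp only [hG, hF]
      split_ifs with h3
      · have hξ : ξ ∈ Metric.closedBall (0 : ι → ℝ) (r + 1) := by
          rw [mem_closedBall_zero_iff, pi_norm_le_iff_of_nonneg (by linarith)]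
          intro q
          have h4 := hB _ h3 q
          have h5 := W.abs_height_divMod_sub_le hc (ξ q) (i q)
          rw [abs_sub_comm] at h5
          have h6 := abs_sub_abs_le_abs_sub (ξ q)
            (W.height j₀ γ t (m * ⌊ξ q / W.cellHeight j₀ γ t⌋ + (i q).val))
          rw [Real.norm_eq_abs]
          linarith
        rw [Set.indicator_of_mem hξ, norm_mul, norm_pow, norm_inv, Complex.norm_real,
          Real.norm_eq_abs, abs_abs]
        have hca : |W.cellHeight j₀ γ t| = t * a := by
          rw [Weights.cellHeight, mul_assoc, abs_mul, abs_of_pos ht']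
        calc _ ≤ |W.cellHeight j₀ γ t|⁻¹ ^ N * (C * t * √N) ^ N := by
              gcongr
              exact norm_det_le_of_norm_le fun _ _ => h1 _ _ _
          _ = (C / a * √N) ^ N := by
              rw [← mul_pow, hca]
              congr 1
              field_simp
      · rw [mul_zero, norm_zero]
        refine Set.indicator_nonneg (fun _ _ => by positivity) _
    · exact (integrable_indicator_iff measurableSet_closedBall).2
        (integrableOn_const (measure_closedBall_lt_top).ne)
    · filter_upwards [ae_injective, measure_eq_zero_iff_ae_notMem.1 hfr] with ξ hinj hξ
      have hpos : Tendsto (fun t => fun q => W.height j₀ γ t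
          (m * ⌊ξ q / W.cellHeight j₀ γ t⌋ + (i q).val)) (𝓝[>] 0) (𝓝 ξ) := by
        refine tendsto_pi_nhds.2 fun q => ?_
        rw [tendsto_iff_norm_sub_tendsto_zero]
        have h1 := (W.tendsto_cellHeight (j₀ := j₀) γ).abs
        rw [abs_zero] at h1
        refine squeeze_zero' (Eventually.of_forall fun _ => norm_nonneg _) ?_ h1
        filter_upwards [self_mem_nhdsWithin] with t ht
        exact W.abs_height_divMod_sub_le (W.cellHeight_ne_zero hgen hγ ht) (ξ q) (i q)
      -- Off the boundary of `B`, which is negligible, the rounded positions are eventually on the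
      -- same side as `ξ`.
      by_cases hξB : ξ ∈ B
      · rw [Set.indicator_of_mem hξB]
        have hint : ξ ∈ interior B := by
          by_contra h
          exact hξ ⟨subset_closure hξB, h⟩
        refine (hlim k i ξ hinj).congr' ?_
        filter_upwards [hpos.eventually (isOpen_interior.mem_nhds hint)] with t ht
        simp only [hG, hF]
        rw [if_pos (interior_subset ht)]
      · rw [Set.indicator_of_notMem hξB]
        have hext : ξ ∈ (closure B)ᶜ := fun h => hξ ⟨h, fun h1 => hξB (interior_subset h1)⟩
        refine tendsto_const_nhds.congr' ?_
        filter_upwards [hpos.eventually (isClosed_closure.isOpen_compl.mem_nhds hext)] with t ht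
        simp only [hG, hF]
        rw [if_neg fun h => ht (subset_closure h), mul_zero]
  -- Summing over the residues of all the rows gives a power of `∑ p = 1`: the weights of the rows
  -- disappear.
  have hsum : ∑ i : ι → ZMod m, ∏ q, p (i q) = 1 := by
    have := (Finset.prod_univ_sum (fun _ : ι => (Finset.univ : Finset (ZMod m)))
      fun _ i => p i).symm
    simpa [Fintype.piFinset_univ, hp] using this
  have h1 := tendsto_finsetSum Finset.univ fun i _ => hmain i
  simp only [integral_indicator hBm, integral_const_mul] at h1
  rw [← Finset.sum_mul, ← Complex.ofReal_sum, hsum, Complex.ofReal_one, one_mul] at h1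
  refine h1.congr' ?_
  filter_upwards [hμ, self_mem_nhdsWithin] with t h2 ht
  have hc := W.cellHeight_ne_zero hgen hγ ht
  have hsupp : (Function.support (F t)).Finite := by
    refine (Finset.finite_toSet (Fintype.piFinset fun _ : ι =>
      Finset.Icc (-⌊r * m / |W.cellHeight j₀ γ t|⌋) ⌊r * m / |W.cellHeight j₀ γ t|⌋)).subset ?_
    intro y hy
    by_contra h3
    refine hy ?_
    simp only [hF]
    rw [if_neg fun h4 => h3 (W.finite_support hc hB h4)]
  have h3 : (((∫⁻ M, tupleCount k B (W.beadPos j₀ γ t M) ∂(μ t)).toReal : ℝ) : ℂ) = ∑' y, F t y := by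
    rw [h2.lintegral_tupleCount, ENNReal.tsum_toReal_eq fun y => by split_ifs <;> simp,
      Complex.ofReal_tsum]
    refine tsum_congr fun y => ?_
    simp only [hF]
    split_ifs
    · rw [ENNReal.toReal_ofReal (norm_nonneg _)]
      exact h2.norm_det_eq k y
    · simp
  rw [h3, tsum_divMod m hsupp]
  refine Finset.sum_congr rfl fun i _ => ?_
  simp only [hG]
  have hinj : Function.Injective fun (Y : ι → ℤ) (q : ι) => (m : ℤ) * Y q + (i q).val := by
    intro Y Y' h
    funext q
    have hm : (m : ℤ) ≠ 0 := by exact_mod_cast NeZero.ne m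
    have := congrFun h q
    simp only [add_left_inj] at this
    exact mul_left_cancel₀ hm this
  have hfin : (Function.support fun Y : ι → ℤ => F t (fun q => m * Y q + (i q).val)).Finite :=
    hsupp.preimage hinj.injOn
  rw [integral_const_mul, integral_floor_div hc
    (F := fun Y : ι → ℤ => F t (fun q => m * Y q + (i q).val)) (s := hfin.toFinset) fun Y hY => by
      simpa using hY]
  have hc' : ((|W.cellHeight j₀ γ t| : ℝ) : ℂ) ≠ 0 := Complex.ofReal_ne_zero.2 (abs_ne_zero.2 hc)
  rw [← mul_assoc, ← mul_pow, inv_mul_cancel₀ hc', one_pow, one_mul]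

end

end BeadDimer

end

/-! ### Tuple counts, labelled beads and existence of the bead model. -/

noncomputable section

namespace BeadDimer

/-! ### Counting tuples -/

/-- The tuples counted by `tupleCount`. -/
def tupleSet {ι L : Type*} (k : ι → ℤ) (B : Set (ι → ℝ)) (e : ℤ × L → EReal) : Set (ι → L) :=
  {f | Function.Injective (fun q => (k q, f q)) ∧ ∃ ξ ∈ B, ∀ q, e (k q, f q) = (ξ q : EReal)}

theorem tupleCount_eq_tsum {ι L : Type*} (k : ι → ℤ) (B : Set (ι → ℝ)) (e : ℤ × L → EReal) :
    tupleCount k B e = ∑' f : ι → L, (tupleSet k B e).indicator 1 f := by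
  classical
  refine tsum_congr fun f => ?_
  rw [Set.indicator_apply]
  exact if_congr Iff.rfl rfl rfl

theorem tupleCount_eq_encard {ι L : Type*} (k : ι → ℤ) (B : Set (ι → ℝ)) (e : ℤ × L → EReal) :
    tupleCount k B e = ((tupleSet k B e).encard : ENNReal) := by
  rw [tupleCount_eq_tsum, ← ENNReal.tsum_set_one, ← tsum_subtype]
  rfl

theorem tupleCount_mono {ι L : Type*} (k : ι → ℤ) {B B' : Set (ι → ℝ)} (h : B ⊆ B')
    (e : ℤ × L → EReal) : tupleCount k B e ≤ tupleCount k B' e := by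
  rw [tupleCount_eq_encard, tupleCount_eq_encard]
  have : tupleSet k B e ⊆ tupleSet k B' e := fun f hf =>
    ⟨hf.1, hf.2.choose, h hf.2.choose_spec.1, hf.2.choose_spec.2⟩
  exact_mod_cast Set.encard_le_encard this

/-- Only the positions matter, not the labels. -/
theorem tupleCount_relabel {ι L L' : Type*} {e : ℤ × L → EReal} {e' : ℤ × L' → EReal}
    (ρ : ℤ → L → L') (h1 : ∀ k l (ξ : ℝ), e (k, l) = ξ → e' (k, ρ k l) = ξ)
    (h2 : ∀ k l l' (ξ ξ' : ℝ), e (k, l) = ξ → e (k, l') = ξ' → ρ k l = ρ k l' → l = l')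
    (h3 : ∀ k l' (ξ : ℝ), e' (k, l') = ξ → ∃ l, e (k, l) = ξ ∧ ρ k l = l')
    (k : ι → ℤ) (B : Set (ι → ℝ)) : tupleCount k B e' = tupleCount k B e := by
  rw [tupleCount_eq_encard, tupleCount_eq_encard]
  have : tupleSet k B e' = (fun (f : ι → L) q => ρ (k q) (f q)) '' tupleSet k B e := by
    ext f'
    constructor
    · rintro ⟨hinj, ξ, hξ, hf⟩
      choose f hf1 hf2 using fun q => h3 _ _ _ (hf q)
      refine ⟨f, ⟨fun q r hqr => hinj ?_, ξ, hξ, hf1⟩, funext hf2⟩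
      simp only [Prod.mk.injEq] at hqr ⊢
      exact ⟨hqr.1, by rw [← hf2, ← hf2, hqr.1, hqr.2]⟩
    · rintro ⟨f, ⟨hinj, ξ, hξ, hf⟩, rfl⟩
      refine ⟨fun q r hqr => hinj ?_, ξ, hξ, fun q => h1 _ _ _ (hf q)⟩
      simp only [Prod.mk.injEq] at hqr ⊢
      refine ⟨hqr.1, h2 (k r) _ _ (ξ q) (ξ r) ?_ (hf r) ?_⟩
      · rw [← hqr.1, hf]
      · rw [← hqr.2, hqr.1]
  rw [this, Set.InjOn.encard_image]
  rintro f ⟨-, ξ, -, hf⟩ f' ⟨-, ξ', -, hf'⟩ h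
  exact funext fun q => h2 _ _ _ _ _ (hf q) (hf' q) (congrFun h q)

/-- The labels on the thread `k` with position in `A`. -/
def labelSet {L : Type*} (k : ℤ) (A : Set ℝ) (e : ℤ × L → EReal) : Set L :=
  {l | ∃ ξ ∈ A, e (k, l) = (ξ : EReal)}

/-- The numbers of tuples are the joint factorial moments of the numbers of points. -/
theorem tupleCount_sigma {α L : Type} [Fintype α] (e : ℤ × L → EReal) (k : α → ℤ)
    (A : α → Set ℝ) (N : α → ℕ) (hA : ∀ a a', a ≠ a' → k a = k a' → Disjoint (A a) (A a'))
    (hfin : ∀ a, (labelSet (k a) (A a) e).Finite) :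
    tupleCount (fun q : Σ a, Fin (N a) => k q.1) {ξ | ∀ q, ξ q ∈ A q.1} e =
      ((∏ a, (labelSet (k a) (A a) e).ncard.descFactorial (N a) : ℕ) : ENNReal) := by
  classical
  have hF : ∀ a, Fintype (labelSet (k a) (A a) e) := fun a => (hfin a).fintype
  have hmem : ∀ f : (Σ a, Fin (N a)) → L,
      f ∈ tupleSet (fun q : Σ a, Fin (N a) => k q.1) {ξ | ∀ q, ξ q ∈ A q.1} e ↔
        (∀ q, f q ∈ labelSet (k q.1) (A q.1) e) ∧ ∀ a, Function.Injective fun i => f ⟨a, i⟩ := by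
    intro f
    constructor
    · rintro ⟨hinj, ξ, hξ, hf⟩
      refine ⟨fun q => ⟨ξ q, hξ q, hf q⟩, fun a i i' h => ?_⟩
      have := @hinj ⟨a, i⟩ ⟨a, i'⟩ (by simp only [Prod.mk.injEq, true_and]; exact h)
      simpa using this
    · rintro ⟨h1, h2⟩
      choose ξ hξ hf using h1
      refine ⟨fun q r h => ?_, ξ, hξ, hf⟩
      simp only [Prod.mk.injEq] at h
      by_cases hqr : q.1 = r.1
      · obtain ⟨a, i⟩ := q
        obtain ⟨a', i'⟩ := r
        simp only at hqr
        subst hqr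
        rw [h2 a h.2]
      · refine absurd (hξ r) (Set.disjoint_left.1 (hA _ _ hqr h.1) ?_)
        have h3 := hf q
        rw [h.1, h.2, hf r, EReal.coe_eq_coe_iff] at h3
        rw [h3]
        exact hξ q
  let E : tupleSet (fun q : Σ a, Fin (N a) => k q.1) {ξ | ∀ q, ξ q ∈ A q.1} e ≃
      ∀ a, Fin (N a) ↪ labelSet (k a) (A a) e :=
    { toFun := fun f a => ⟨fun i => ⟨f.1 ⟨a, i⟩, ((hmem _).1 f.2).1 ⟨a, i⟩⟩, fun i i' h =>
        ((hmem _).1 f.2).2 a (congrArg Subtype.val h)⟩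
      invFun := fun g => ⟨fun q => (g q.1 q.2).1, (hmem _).2 ⟨fun q => (g q.1 q.2).2,
        fun a i i' h => (g a).injective (Subtype.ext h)⟩⟩
      left_inv := fun f => rfl
      right_inv := fun g => rfl }
  have hT := Fintype.ofEquiv _ E.symm
  rw [tupleCount_eq_encard, ← Set.coe_fintypeCard, Fintype.card_congr E, Fintype.card_pi]
  rw [ENat.toENNReal_coe]
  congr 1
  refine Finset.prod_congr rfl fun a _ => ?_
  rw [Fintype.card_embedding_eq, Fintype.card_fin, ← Nat.card_eq_fintype_card,
    Nat.card_coe_set_eq]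

/-- The position of the points in terms of `EReal.toReal`. -/
theorem mem_tupleSet_iff {ι L : Type*} (k : ι → ℤ) (B : Set (ι → ℝ)) (e : ℤ × L → EReal)
    (f : ι → L) : f ∈ tupleSet k B e ↔ Function.Injective (fun q => (k q, f q)) ∧
      (∀ q, e (k q, f q) ≠ ⊤ ∧ e (k q, f q) ≠ ⊥) ∧ (fun q => (e (k q, f q)).toReal) ∈ B := by
  refine and_congr_right fun _ => ⟨?_, fun h => ⟨_, h.2, fun q =>
    (EReal.coe_toReal (h.1 q).1 (h.1 q).2).symm⟩⟩
  rintro ⟨ξ, hξ, h⟩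
  refine ⟨fun q => by simp [h], ?_⟩
  simpa only [h, EReal.toReal_coe] using hξ

theorem measurableSet_mem_tupleSet {ι L : Type*} [Finite ι] (k : ι → ℤ) {B : Set (ι → ℝ)}
    (hB : MeasurableSet B) (f : ι → L) :
    MeasurableSet {e : ℤ × L → EReal | f ∈ tupleSet k B e} := by
  have := Fintype.ofFinite ι
  simp only [mem_tupleSet_iff]
  have h1 : Measurable fun (e : ℤ × L → EReal) q => e (k q, f q) :=
    measurable_pi_lambda _ fun q => measurable_pi_apply _
  refine MeasurableSet.inter (MeasurableSet.const _) (MeasurableSet.inter ?_ ?_)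
  · have : MeasurableSet {x : ι → EReal | ∀ q, x q ≠ ⊤ ∧ x q ≠ ⊥} := by
      simp only [Set.ofPred_forall]
      refine MeasurableSet.iInter fun q => ?_
      have h2 : ∀ c : EReal, MeasurableSet {x : ι → EReal | x q ≠ c} := fun c =>
        (measurable_pi_apply q : Measurable fun x : ι → EReal => x q)
          (measurableSet_singleton c).compl
      exact (h2 ⊤).inter (h2 ⊥)
    exact h1 this
  · have h2 : Measurable fun (e : ℤ × L → EReal) q => (e (k q, f q)).toReal :=
      measurable_pi_lambda _ fun q => (measurable_pi_apply _).ereal_toReal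
    exact h2 hB

theorem measurable_tupleCount {ι L : Type*} [Finite ι] [Countable L] (k : ι → ℤ)
    {B : Set (ι → ℝ)} (hB : MeasurableSet B) :
    Measurable fun e : ℤ × L → EReal => tupleCount k B e := by
  simp only [tupleCount_eq_tsum]
  refine Measurable.tsum fun f => ?_
  exact measurable_one.indicator (measurableSet_mem_tupleSet k hB f)

theorem lintegral_tupleCount_eq_tsum {ι L : Type*} [Finite ι] [Countable L] (k : ι → ℤ)
    {B : Set (ι → ℝ)} (hB : MeasurableSet B) (Q : Measure (ℤ × L → EReal)) :
    ∫⁻ e, tupleCount k B e ∂Q = ∑' f : ι → L, Q {e | f ∈ tupleSet k B e} := by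
  have : ∀ e : ℤ × L → EReal, tupleCount k B e =
      ∑' f : ι → L, {e | f ∈ tupleSet k B e}.indicator 1 e := tupleCount_eq_tsum k B
  simp only [this]
  rw [lintegral_tsum fun f =>
    (measurable_one.indicator (measurableSet_mem_tupleSet k hB f)).aemeasurable]
  exact tsum_congr fun f => lintegral_indicator_one (measurableSet_mem_tupleSet k hB f)

end BeadDimer

end

noncomputable section

namespace BeadDimer

variable {n m : ℕ} [NeZero n] [NeZero m]

/-! ### The correlation functions of the bead model are nonnegative -/

theorem volume_ne_top_of_abs_le {ι : Type*} [Fintype ι] {B : Set (ι → ℝ)} {r : ℝ}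
    (hB : ∀ ξ ∈ B, ∀ q, |ξ q| ≤ r) :
    volume B ≠ ⊤ := by
  refine ((measure_mono fun ξ hξ => ?_).trans_lt
    (isCompact_univ_pi (X := fun _ => ℝ) fun _ : ι =>
      (isCompact_Icc : IsCompact (Set.Icc (-r) r))).measure_lt_top).ne
  exact fun q _ => abs_le.1 (hB ξ hξ q)

section

variable (W : Weights n m) {j₀ : ZMod n}
  (hgen : ∀ j, j ≠ j₀ → W.abscissa j ≠ W.abscissa j₀) {γ : ℝ} (hγ : γ ∈ Set.Ioo (-1 : ℝ) 1)
  {μ : ℝ → Measure DimerConfig}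
  (hμ : ∀ᶠ t in 𝓝[>] (0 : ℝ), W.HasBeadKernel j₀ γ t (μ t))
  {ι : Type} [Fintype ι] [DecidableEq ι] (k : ι → ℤ)
include hgen hγ hμ

/-- The correlation functions are limits of normalised probabilities of beads. They are therefore
nonnegative, measurable and bounded almost everywhere, without any direct estimate of `beadKernel`.
-/
theorem Weights.exists_beadDet_approx : ∃ (G : ℝ → (ι → ℝ) → ℝ) (C : ℝ),
    (∀ t, Measurable (G t)) ∧ (∀ᶠ t in 𝓝[>] (0 : ℝ), ∀ ξ, 0 ≤ G t ξ ∧ G t ξ ≤ C) ∧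
    ∀ ξ, Function.Injective ξ →
      Tendsto (fun t => ((G t ξ : ℝ) : ℂ)) (𝓝[>] 0) (𝓝 (beadDet γ k ξ)) := by
  obtain ⟨p, hp, hlim⟩ := W.exists_tendsto_det hgen hγ
  obtain ⟨C, hC0, hC⟩ := W.exists_beadEntry_bound hgen γ
  -- A single residue with a positive share suffices: all the beads are taken in rows of this
  -- residue, and the share is divided out.
  obtain ⟨i, hi⟩ : ∃ i, 0 < p i := by
    by_contra! h
    have := Finset.sum_nonpos fun i (_ : i ∈ Finset.univ) => h i
    rw [hp] at this
    exact absurd this (by norm_num)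
  set N := Fintype.card ι with hN
  have hm : (0 : ℝ) < m := by exact_mod_cast NeZero.pos m
  set a := |W.beta j₀ * √(1 - γ ^ 2)| with ha
  have ha0 : 0 < a := abs_pos.2 (mul_ne_zero (W.beta_ne_zero hgen) (sqrt_pos_of_mem hγ).ne')
  set D : ℝ → (ι → ℤ) → ℂ := fun t Y =>
    (Matrix.of fun q r => W.beadEntry j₀ γ t (k q - k r) (m * Y q + i.val) (m * Y r + i.val)).det
    with hD
  set H : ℝ → (ι → ℝ) → (ι → ℤ) := fun t ξ q => ⌊ξ q / W.cellHeight j₀ γ t⌋ with hH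
  refine ⟨fun t ξ => (p i ^ N)⁻¹ * (|W.cellHeight j₀ γ t|⁻¹ ^ N * ‖D t (H t ξ)‖),
    (p i ^ N)⁻¹ * (C / a * √N) ^ N, fun t => ?_, ?_, fun ξ hξ => ?_⟩
  · have h1 : Measurable (H t) := measurable_pi_lambda _ fun q => Int.measurable_floor.comp
      ((measurable_pi_apply q).div_const _)
    exact (((measurable_of_countable fun Y => ‖D t Y‖).comp h1).const_mul _).const_mul _
  · filter_upwards [hC, self_mem_nhdsWithin] with t h1 ht ξ
    have ht' : (0 : ℝ) < t := ht
    refine ⟨by positivity, ?_⟩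
    have hca : |W.cellHeight j₀ γ t| = t * a := by
      rw [Weights.cellHeight, mul_assoc, abs_mul, abs_of_pos ht']
    gcongr
    calc _ ≤ |W.cellHeight j₀ γ t|⁻¹ ^ N * (C * t * √N) ^ N := by
          gcongr
          exact norm_det_le_of_norm_le fun _ _ => h1 _ _ _
      _ = (C / a * √N) ^ N := by
          rw [← mul_pow, hca]
          congr 1
          field_simp
  · have h1 := hlim k (fun _ => i) ξ hξ
    have hprod : ∏ _q : ι, p i = p i ^ N := by rw [Finset.prod_const, Finset.card_univ]
    rw [hprod] at h1
    have hpN : ((p i ^ N : ℝ) : ℂ) ≠ 0 := Complex.ofReal_ne_zero.2 (pow_pos hi _).ne'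
    have h2 := h1.const_mul ((p i ^ N : ℝ) : ℂ)⁻¹
    rw [inv_mul_cancel_left₀ hpN] at h2
    refine h2.congr' ?_
    filter_upwards [hμ] with t ht
    rw [Complex.ofReal_mul, Complex.ofReal_mul, Complex.ofReal_inv, Complex.ofReal_pow (_⁻¹),
      Complex.ofReal_inv (|_|)]
    congr 2
    exact (ht.norm_det_eq k _).symm

theorem Weights.ae_beadDet_eq_norm :
    ∀ᵐ ξ : ι → ℝ, beadDet γ k ξ = ((‖beadDet γ k ξ‖ : ℝ) : ℂ) := by
  obtain ⟨G, C, -, h2, h3⟩ := W.exists_beadDet_approx hgen hγ hμ k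
  filter_upwards [ae_injective] with ξ hξ
  have h4 := h3 ξ hξ
  refine tendsto_nhds_unique h4 (((Complex.continuous_ofReal.tendsto _).comp h4.norm).congr' ?_)
  filter_upwards [h2] with t ht
  rw [Function.comp_apply, Complex.norm_real, Real.norm_of_nonneg (ht ξ).1]

theorem Weights.aestronglyMeasurable_beadDet : AEStronglyMeasurable (beadDet γ k) := by
  obtain ⟨G, C, h1, -, h3⟩ := W.exists_beadDet_approx hgen hγ hμ k
  refine aestronglyMeasurable_of_tendsto_ae (𝓝[>] (0 : ℝ))
    (f := fun t ξ => ((G t ξ : ℝ) : ℂ)) (fun t => ?_) ?_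
  · exact (Complex.measurable_ofReal.comp (h1 t)).aestronglyMeasurable
  · filter_upwards [ae_injective] with ξ hξ using h3 ξ hξ

theorem Weights.integrableOn_beadDet {B : Set (ι → ℝ)} (hB : volume B ≠ ⊤) :
    IntegrableOn (beadDet γ k) B := by
  obtain ⟨G, C, -, h2, h3⟩ := W.exists_beadDet_approx hgen hγ hμ k
  refine Measure.integrableOn_of_bounded (M := C) hB
    (W.aestronglyMeasurable_beadDet hgen hγ hμ k) ?_
  filter_upwards [ae_restrict_of_ae ae_injective] with ξ hξ
  refine le_of_tendsto (h3 ξ hξ).norm ?_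
  filter_upwards [h2] with t ht
  rw [Complex.norm_real, Real.norm_of_nonneg (ht ξ).1]
  exact (ht ξ).2

theorem Weights.setIntegral_beadDet (B : Set (ι → ℝ)) :
    ∫ ξ in B, beadDet γ k ξ = (((∫⁻ ξ in B, ‖beadDet γ k ξ‖ₑ).toReal : ℝ) : ℂ) := by
  rw [integral_congr_ae (ae_restrict_of_ae (W.ae_beadDet_eq_norm hgen hγ hμ k)),
    integral_complex_ofReal, integral_norm_eq_lintegral_enorm
      (W.aestronglyMeasurable_beadDet hgen hγ hμ k).restrict]

theorem Weights.tendsto_lintegral_tupleCount {B : Set (ι → ℝ)} (hBm : MeasurableSet B) {r : ℝ}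
    (hr : 0 ≤ r) (hB : ∀ ξ ∈ B, ∀ q, |ξ q| ≤ r) (hfr : volume (frontier B) = 0) :
    Tendsto (fun t => ∫⁻ M, tupleCount k B (W.beadPos j₀ γ t M) ∂(μ t)) (𝓝[>] 0)
      (𝓝 (∫⁻ ξ in B, ‖beadDet γ k ξ‖ₑ)) := by
  have h1 := W.tendsto_tupleCount hgen hγ hμ k hBm hr hB hfr
  rw [W.setIntegral_beadDet hgen hγ hμ k] at h1
  have h2 := (Complex.continuous_re.tendsto _).comp h1
  simp only [Function.comp_def, Complex.ofReal_re] at h2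
  have h3 : ∫⁻ ξ in B, ‖beadDet γ k ξ‖ₑ ≠ ⊤ :=
    (W.integrableOn_beadDet hgen hγ hμ k (volume_ne_top_of_abs_le hB)).2.ne
  have h4 := (ENNReal.continuous_ofReal.tendsto _).comp h2
  rw [ENNReal.ofReal_toReal h3] at h4
  refine h4.congr' ?_
  obtain ⟨D, -, hD⟩ := W.exists_lintegral_tupleCount_le hgen hγ hμ hr
  filter_upwards [hD] with t ht
  exact ENNReal.ofReal_toReal ((ht ι k B hB).trans_lt ENNReal.ofReal_lt_top).ne

end

end BeadDimer

end

noncomputable section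

namespace BeadDimer

variable {n m : ℕ} [NeZero n] [NeZero m]

/-! ### Labelling the beads by natural numbers -/

/-- The enumeration `0, -1, 1, -2, …` of the rows never decreases the distance to the origin; hence
the beads in a symmetric window have the first labels. -/
theorem abs_le_of_intEquivNat_lt {y y' : ℤ} (h : Equiv.intEquivNat y' < Equiv.intEquivNat y) :
    |y'| ≤ |y| := by
  simp only [Equiv.intEquivNat, Equiv.trans_apply, Equiv.intEquivNatSumNat,
    Equiv.natSumNatEquivNat_apply, Equiv.coe_fn_mk] at h
  rcases y with y | y <;> rcases y' with y' | y' <;>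
    simp [abs_eq_max_neg, Int.negSucc_eq] at h ⊢ <;> omega

theorem exists_lt_count_eq {p : ℕ → Prop} [DecidablePred p] {N i : ℕ} (h : i < Nat.count p N) :
    ∃ l < N, p l ∧ Nat.count p l = i := by
  induction N with
  | zero => simp at h
  | succ N ih =>
    rw [Nat.count_succ] at h
    by_cases h1 : i < Nat.count p N
    · obtain ⟨l, hl, h2⟩ := ih h1
      exact ⟨l, by omega, h2⟩
    · split_ifs at h with h2
      · exact ⟨N, by omega, h2, by omega⟩
      · omega

open Classical in
/-- The number of beads of the thread `repThread n k` that precede the row `y`, in the order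
`0, -1, 1, -2, 2, …` of the rows. -/
def beadLabel (n : ℕ) (M : DimerConfig) (k y : ℤ) : ℕ :=
  Nat.count (fun l => IsBead M (repThread n k) (Equiv.intEquivNat.symm l)) (Equiv.intEquivNat y)

open Classical in
/-- The rescaled positions of the beads on the threads `repThread n k`, labelled by their order. -/
def Weights.beadEnc (W : Weights n m) (j₀ : ZMod n) (γ t : ℝ) (M : DimerConfig) : ℤ × ℕ → EReal :=
  fun p => ⨅ y : ℤ, if IsBead M (repThread n p.1) y ∧ beadLabel n M p.1 y = p.2 then
    (W.height j₀ γ t y : EReal) else ⊤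

theorem beadLabel_inj {M : DimerConfig} {k y y' : ℤ} (h : IsBead M (repThread n k) y)
    (h' : IsBead M (repThread n k) y') (he : beadLabel n M k y = beadLabel n M k y') : y = y' := by
  classical
  exact Equiv.intEquivNat.injective
    (Nat.count_injective (by simpa using h) (by simpa using h') he)

theorem Weights.beadEnc_eq_coe (W : Weights n m) (j₀ : ZMod n) (γ t : ℝ) (M : DimerConfig)
    (k : ℤ) (i : ℕ) (x : ℝ) : W.beadEnc j₀ γ t M (k, i) = (x : EReal) ↔
      ∃ y, IsBead M (repThread n k) y ∧ beadLabel n M k y = i ∧ W.height j₀ γ t y = x := by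
  classical
  rw [Weights.beadEnc]
  by_cases h : ∃ y, IsBead M (repThread n k) y ∧ beadLabel n M k y = i
  · obtain ⟨y, hy, hi⟩ := h
    have h1 : (⨅ y : ℤ, if IsBead M (repThread n k) y ∧ beadLabel n M k y = i then
        (W.height j₀ γ t y : EReal) else ⊤) = W.height j₀ γ t y := by
      refine le_antisymm (iInf_le_of_le y (by rw [if_pos ⟨hy, hi⟩])) (le_iInf fun y' => ?_)
      split_ifs with h2
      · rw [beadLabel_inj h2.1 hy (h2.2.trans hi.symm)]
      · exact le_top
    simp only [h1, EReal.coe_eq_coe_iff]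
    refine ⟨fun h2 => ⟨y, hy, hi, h2⟩, ?_⟩
    rintro ⟨y', hy', hi', h2⟩
    rwa [beadLabel_inj hy hy' (hi.trans hi'.symm)]
  · push Not at h
    have h1 : (⨅ y : ℤ, if IsBead M (repThread n k) y ∧ beadLabel n M k y = i then
        (W.height j₀ γ t y : EReal) else ⊤) = ⊤ :=
      iInf_eq_top.2 fun y => if_neg fun h2 => h y h2.1 h2.2
    simp only [h1]
    refine ⟨fun h2 => absurd h2.symm (EReal.coe_ne_top x), ?_⟩
    rintro ⟨y, hy, hi, -⟩
    exact absurd hi (h y hy)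

theorem Weights.tupleCount_beadEnc (W : Weights n m) (j₀ : ZMod n) (γ t : ℝ) (M : DimerConfig)
    {ι : Type} (k : ι → ℤ) (B : Set (ι → ℝ)) :
    tupleCount k B (W.beadEnc j₀ γ t M) = tupleCount k B (W.beadPos j₀ γ t M) := by
  refine tupleCount_relabel (beadLabel n M) (fun k y ξ h => ?_) (fun k y y' ξ ξ' h h' he => ?_)
    (fun k i ξ h => ?_) k B
  · rw [W.beadPos_eq_coe] at h
    exact (W.beadEnc_eq_coe ..).2 ⟨y, h.1, rfl, h.2⟩
  · rw [W.beadPos_eq_coe] at h h'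
    exact beadLabel_inj h.1 h'.1 he
  · obtain ⟨y, hy, hi, h1⟩ := (W.beadEnc_eq_coe ..).1 h
    exact ⟨y, (W.beadPos_eq_coe ..).2 ⟨hy, h1⟩, hi⟩

theorem Weights.measurable_beadEnc (W : Weights n m) (j₀ : ZMod n) (γ t : ℝ) :
    Measurable (W.beadEnc j₀ γ t) := by
  classical
  refine measurable_pi_lambda _ fun p => Measurable.iInf fun y => ?_
  refine Measurable.ite ?_ measurable_const measurable_const
  refine (measurableSet_isBead _ _).inter ?_
  have : Measurable fun M => beadLabel n M p.1 y := by
    simp only [beadLabel, Nat.count_eq_card_filter_range, Finset.card_filter]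
    refine Finset.measurable_fun_sum _ fun l _ => ?_
    exact Measurable.ite (measurableSet_isBead _ _) measurable_const measurable_const
  exact this (measurableSet_singleton _)

/-- The labels of the points in the windows `[-r, r]` are the first ones. -/
def IsOrdered (e : ℤ × ℕ → EReal) : Prop :=
  ∀ (k : ℤ) (i : ℕ) (ξ : ℝ), e (k, i) = ξ → ∀ i' < i, ∃ ξ' : ℝ, |ξ'| ≤ |ξ| ∧ e (k, i') = ξ'

theorem Weights.isOrdered_beadEnc (W : Weights n m) (j₀ : ZMod n) (γ t : ℝ) (M : DimerConfig) :
    IsOrdered (W.beadEnc j₀ γ t M) := by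
  classical
  intro k i ξ h i' hi'
  obtain ⟨y, hy, rfl, rfl⟩ := (W.beadEnc_eq_coe ..).1 h
  obtain ⟨l, hl, hp, hi⟩ := exists_lt_count_eq hi'
  refine ⟨W.height j₀ γ t (Equiv.intEquivNat.symm l), ?_, (W.beadEnc_eq_coe ..).2
    ⟨Equiv.intEquivNat.symm l, hp, ?_, rfl⟩⟩
  · have h1 : |Equiv.intEquivNat.symm l| ≤ |y| := abs_le_of_intEquivNat_lt (by simpa using hl)
    have h2 : |((Equiv.intEquivNat.symm l : ℤ) : ℝ)| ≤ |(y : ℝ)| := by exact_mod_cast h1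
    simp only [W.height_eq, abs_mul, abs_div]
    gcongr
  · rw [← hi, beadLabel, Equiv.apply_symm_apply]

/-- Tuples with a large label come with many other points. -/
theorem IsOrdered.mul_tsum_le {e : ℤ × ℕ → EReal} (he : IsOrdered e) {ι : Type} [Fintype ι]
    (k : ι → ℤ) {B : Set (ι → ℝ)} {r : ℝ} (hB : ∀ ξ ∈ B, ∀ q, |ξ q| ≤ r) (q : ι) (S : ℕ) :
    S * ∑' f : ι → ℕ, {f ∈ tupleSet k B e | Fintype.card ι + S ≤ f q}.indicator
        (1 : (ι → ℕ) → ENNReal) f ≤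
      tupleCount (fun o : Option ι => o.elim (k q) k) {ξ | ∀ o, |ξ o| ≤ r} e := by
  classical
  rw [tupleCount_eq_tsum, ← (Equiv.piOptionEquivProd (β := fun _ : Option ι => ℕ)).symm.tsum_eq,
    ENNReal.tsum_prod', ENNReal.tsum_comm, ← ENNReal.tsum_mul_left]
  refine ENNReal.tsum_le_tsum fun f => ?_
  by_cases hf : f ∈ {f ∈ tupleSet k B e | Fintype.card ι + S ≤ f q}
  · rw [Set.indicator_of_mem hf]
    obtain ⟨⟨hinj, ξ, hξ, hfξ⟩, hS⟩ := hf
    -- At least `S` of the labels below `card ι + S` are not used by `f`. Being smaller than `f q`,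
    -- they belong to points of the window, and each can be added to the tuple.
    set s := Finset.range (Fintype.card ι + S) \ Finset.univ.image f with hs
    have hcard : S ≤ s.card := by
      have h1 := Finset.le_card_sdiff (Finset.univ.image f) (Finset.range (Fintype.card ι + S))
      have h2 : (Finset.univ.image f).card ≤ Fintype.card ι := Finset.card_image_le
      rw [Finset.card_range, ← hs] at h1
      omega
    refine le_trans ?_ (ENNReal.sum_le_tsum s)
    calc (S : ENNReal) * (1 : (ι → ℕ) → ENNReal) f ≤ ∑ i ∈ s, 1 := by
          simpa using hcard
      _ ≤ _ := by
          refine Finset.sum_le_sum fun i hi => ?_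
          rw [hs, Finset.mem_sdiff, Finset.mem_range, Finset.mem_image] at hi
          obtain ⟨ξ', hξ', he'⟩ := he (k q) (f q) (ξ q) (hfξ q) i (by omega)
          rw [Set.indicator_of_mem]
          · rfl
          refine ⟨?_, fun o => o.elim ξ' ξ, ?_, ?_⟩
          · rintro (_ | a) (_ | b) hab
            · rfl
            · simp only [Equiv.piOptionEquivProd_symm_apply, Prod.mk.injEq, Option.elim] at hab
              exact absurd ⟨b, Finset.mem_univ _, hab.2.symm⟩ hi.2
            · simp only [Equiv.piOptionEquivProd_symm_apply, Prod.mk.injEq, Option.elim] at hab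
              exact absurd ⟨a, Finset.mem_univ _, hab.2⟩ hi.2
            · simp only [Equiv.piOptionEquivProd_symm_apply, Option.elim] at hab
              rw [hinj hab]
          · rintro (_ | a)
            · exact hξ'.trans (hB ξ hξ q)
            · exact hB ξ hξ a
          · rintro (_ | a)
            · exact he'
            · exact hfξ a
  · rw [Set.indicator_of_notMem hf, mul_zero]
    exact zero_le

end BeadDimer

end

noncomputable section

namespace BeadDimer

variable {n m : ℕ} [NeZero n] [NeZero m]

/-! ### A limit of the bead processes -/

theorem mem_tupleSet_pi_iff {ι L : Type*} (k : ι → ℤ) (s : ι → Set ℝ) (e : ℤ × L → EReal)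
    (f : ι → L) : f ∈ tupleSet k (Set.univ.pi s) e ↔ Function.Injective (fun q => (k q, f q)) ∧
      ∀ q, e (k q, f q) ∈ Real.toEReal '' s q := by
  refine and_congr_right fun _ => ⟨?_, fun h => ?_⟩
  · rintro ⟨ξ, hξ, h⟩ q
    exact ⟨ξ q, hξ q trivial, (h q).symm⟩
  · choose ξ hξ h using h
    exact ⟨ξ, fun q _ => hξ q, fun q => (h q).symm⟩

theorem isOpen_mem_tupleSet {ι L : Type*} [Finite ι] (k : ι → ℤ) (a b : ι → ℝ) (f : ι → L) :
    IsOpen {e : ℤ × L → EReal | f ∈ tupleSet k (Set.univ.pi fun q => Set.Ioo (a q) (b q)) e} := by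
  simp only [mem_tupleSet_pi_iff, EReal.image_coe_Ioo]
  refine isOpen_const.and ?_
  rw [Set.ofPred_forall]
  exact isOpen_iInter_of_finite fun q => isOpen_Ioo.preimage (continuous_apply _)

theorem isClosed_mem_tupleSet {ι L : Type*} (k : ι → ℤ) (a b : ι → ℝ) (f : ι → L) :
    IsClosed {e : ℤ × L → EReal | f ∈ tupleSet k (Set.univ.pi fun q => Set.Icc (a q) (b q)) e} := by
  simp only [mem_tupleSet_pi_iff, EReal.image_coe_Icc]
  refine IsClosed.inter (s₁ := {_e | _}) (s₂ := {e | ∀ _, _}) isClosed_const ?_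
  rw [Set.ofPred_forall]
  exact isClosed_iInter fun q => isClosed_Icc.preimage (continuous_apply _)

/-- Compactness in place of subsequences; it is used for the probability measures on `ℤ × ℕ → EReal`
and for `[0, ∞]`. The value `⊤` in `EReal` receives the points that are absent or escape. -/
theorem exists_tendsto_ultrafilter {α X : Type*} [TopologicalSpace X] [CompactSpace X]
    (U : Ultrafilter α) (f : α → X) : ∃ l, Tendsto f U (𝓝 l) :=
  ⟨(U.map f).lim, (U.map f).le_nhds_lim⟩

theorem generateFrom_boxes (ι : Type*) [Fintype ι] :
    (inferInstance : MeasurableSpace (ι → ℝ)) = MeasurableSpace.generateFrom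
      (Set.range fun p : (ι → ℝ) × (ι → ℝ) => Set.univ.pi fun q => Set.Ioo (p.1 q) (p.2 q)) := by
  refine (BorelSpace.measurable_eq (α := ι → ℝ)).trans
    (TopologicalSpace.IsTopologicalBasis.borel_eq_generateFrom
      (TopologicalSpace.isTopologicalBasis_of_isOpen_of_nhds ?_ ?_))
  · rintro _ ⟨p, rfl⟩
    exact isOpen_set_pi Set.finite_univ fun q _ => isOpen_Ioo
  · intro x u hx hu
    obtain ⟨ε, hε, h⟩ := Metric.isOpen_iff.1 hu x hx
    refine ⟨Metric.ball x ε, ⟨(fun q => x q - ε, fun q => x q + ε), ?_⟩, Metric.mem_ball_self hε, h⟩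
    simp only [ball_pi x hε, Real.ball_eq_Ioo]

/-- Divided by `S`: a tuple uses only labels below `card ι + S`, or is among few exceptional ones,
controlled by the counts with one more point. So no mass escapes to large labels in the limit. -/
theorem IsOrdered.mul_tupleCount_le {e : ℤ × ℕ → EReal} (he : IsOrdered e) {ι : Type} [Fintype ι]
    [DecidableEq ι] (k : ι → ℤ) {B : Set (ι → ℝ)} {r : ℝ} (hB : ∀ ξ ∈ B, ∀ q, |ξ q| ≤ r) (S : ℕ) :
    S * tupleCount k B e ≤
      S * ∑ f ∈ Fintype.piFinset fun _ : ι => Finset.range (Fintype.card ι + S),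
        {e | f ∈ tupleSet k B e}.indicator 1 e +
      ∑ q, tupleCount (fun o : Option ι => o.elim (k q) k) {ξ | ∀ o, |ξ o| ≤ r} e := by
  refine le_trans ?_ (add_le_add le_rfl
    (Finset.sum_le_sum fun q _ => he.mul_tsum_le k hB q S))
  rw [← Finset.mul_sum, ← mul_add]
  refine mul_le_mul_right ?_ _
  set s := Fintype.piFinset fun _ : ι => Finset.range (Fintype.card ι + S) with hs
  rw [tupleCount_eq_tsum, ← tsum_fintype (L := .unconditional _), ENNReal.tsum_comm,
    sum_eq_tsum_indicator, ← ENNReal.tsum_add]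
  refine ENNReal.tsum_le_tsum fun f => ?_
  by_cases hf : f ∈ tupleSet k B e
  · by_cases hs' : f ∈ s
    · rw [Set.indicator_of_mem hf, Set.indicator_of_mem (Finset.mem_coe.2 hs'),
        Set.indicator_of_mem (show e ∈ {e | f ∈ tupleSet k B e} from hf)]
      exact le_self_add
    · simp only [hs, Fintype.mem_piFinset, Finset.mem_range, not_forall, not_lt] at hs'
      obtain ⟨q, hq⟩ := hs'
      refine le_trans ?_ (le_add_left (ENNReal.le_tsum q))
      rw [Set.indicator_of_mem hf, Set.indicator_of_mem (show f ∈
        {f | f ∈ tupleSet k B e ∧ Fintype.card ι + S ≤ f q} from ⟨hf, hq⟩)]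
  · rw [Set.indicator_of_notMem hf]
    exact zero_le

section

variable (W : Weights n m) {j₀ : ZMod n}
  (hgen : ∀ j, j ≠ j₀ → W.abscissa j ≠ W.abscissa j₀) {γ : ℝ} (hγ : γ ∈ Set.Ioo (-1 : ℝ) 1)
  {μ : ℝ → Measure DimerConfig}
  (hμ : ∀ᶠ t in 𝓝[>] (0 : ℝ), W.HasBeadKernel j₀ γ t (μ t))
include hμ

theorem Weights.exists_limit_law : ∃ (U : Ultrafilter ℝ)
    (P : ℝ → ProbabilityMeasure (ℤ × ℕ → EReal)) (Q : ProbabilityMeasure (ℤ × ℕ → EReal)),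
    (U : Filter ℝ) ≤ 𝓝[>] 0 ∧
    (∀ᶠ t in 𝓝[>] (0 : ℝ), (P t : Measure (ℤ × ℕ → EReal)) = (μ t).map (W.beadEnc j₀ γ t)) ∧
    Tendsto P U (𝓝 Q) := by
  classical
  let P : ℝ → ProbabilityMeasure (ℤ × ℕ → EReal) := fun t =>
    if h : IsProbabilityMeasure (μ t) then ⟨(μ t).map (W.beadEnc j₀ γ t),
      Measure.isProbabilityMeasure_map (W.measurable_beadEnc j₀ γ t).aemeasurable⟩
    else ⟨Measure.dirac 0, inferInstance⟩
  obtain ⟨Q, hQ⟩ := exists_tendsto_ultrafilter (Ultrafilter.of (𝓝[>] (0 : ℝ))) P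
  refine ⟨_, P, Q, Ultrafilter.of_le _, ?_, hQ⟩
  filter_upwards [hμ] with t ht
  have h1 : P t = ⟨(μ t).map (W.beadEnc j₀ γ t), _⟩ := dif_pos ht.isProbabilityMeasure
  rw [h1]
  rfl

include hgen hγ

/-- The events `f ∈ tupleSet k B e` are open for open boxes and closed for closed ones, so weak
convergence gives one inequality for each kind of box. Open boxes are exhausted by closed ones and
generate the Borel sets, whence equality for all `B`. -/
theorem Weights.exists_limit_moments : ∃ Q : Measure (ℤ × ℕ → EReal), IsProbabilityMeasure Q ∧
    ∀ (ι : Type) [Fintype ι] [DecidableEq ι] (k : ι → ℤ) (B : Set (ι → ℝ)), MeasurableSet B →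
      ∫⁻ e, tupleCount k B e ∂Q = ∫⁻ ξ in B, ‖beadDet γ k ξ‖ₑ := by
  obtain ⟨U, P, Q, hU, hP, hPQ⟩ := W.exists_limit_law hμ
  refine ⟨Q, inferInstance, fun ι _ _ k B hBm => ?_⟩
  have hbd : ∀ a b ξ : ι → ℝ, (ξ ∈ Set.univ.pi fun q => Set.Icc (a q) (b q)) →
      ∀ q, |ξ q| ≤ ‖a‖ + ‖b‖ := fun a b ξ hξ q => by
    have h1 := norm_le_pi_norm a q
    have h2 := norm_le_pi_norm b q
    rw [Real.norm_eq_abs, abs_le] at h1 h2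
    have h3 := hξ q trivial
    rw [abs_le]
    constructor <;> linarith [h3.1, h3.2, norm_nonneg a, norm_nonneg b]
  have hIoo : ∀ a b : ι → ℝ, (Set.univ.pi fun q => Set.Ioo (a q) (b q)) ⊆
      Set.univ.pi fun q => Set.Icc (a q) (b q) := fun a b =>
    Set.pi_mono fun q _ => Set.Ioo_subset_Icc_self
  have hmIoo : ∀ a b : ι → ℝ, MeasurableSet (Set.univ.pi fun q => Set.Ioo (a q) (b q)) :=
    fun a b => MeasurableSet.univ_pi fun q => measurableSet_Ioo
  have hmIcc : ∀ a b : ι → ℝ, MeasurableSet (Set.univ.pi fun q => Set.Icc (a q) (b q)) :=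
    fun a b => MeasurableSet.univ_pi fun q => measurableSet_Icc
  have hfr : ∀ s : ι → Set ℝ, (∀ q, Convex ℝ (s q)) → volume (frontier (Set.univ.pi s)) = 0 :=
    fun s hs => (convex_pi fun q _ => hs q).addHaar_frontier volume
  have hlaw : ∀ᶠ t in 𝓝[>] (0 : ℝ), ∀ B : Set (ι → ℝ), MeasurableSet B →
      ∫⁻ M, tupleCount k B (W.beadPos j₀ γ t M) ∂(μ t) =
        ∑' f : ι → ℕ, (P t : Measure (ℤ × ℕ → EReal)) {e | f ∈ tupleSet k B e} := by
    filter_upwards [hP] with t ht B hB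
    rw [← lintegral_tupleCount_eq_tsum k hB, ht,
      lintegral_map (measurable_tupleCount k hB) (W.measurable_beadEnc j₀ γ t)]
    simp only [W.tupleCount_beadEnc]
  -- For an upper bound finite partial sums over `f` suffice, as all terms are nonnegative.
  have hupper : ∀ a b : ι → ℝ,
      ∫⁻ e, tupleCount k (Set.univ.pi fun q => Set.Ioo (a q) (b q)) e ∂(Q : Measure (ℤ × ℕ → EReal)) ≤
        ∫⁻ ξ in Set.univ.pi fun q => Set.Ioo (a q) (b q), ‖beadDet γ k ξ‖ₑ := fun a b => by
    set B := Set.univ.pi fun q => Set.Ioo (a q) (b q) with hB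
    have h1 := (W.tendsto_lintegral_tupleCount hgen hγ hμ k (hmIoo a b)
      (add_nonneg (norm_nonneg a) (norm_nonneg b)) (fun ξ hξ => hbd a b ξ (hIoo a b hξ))
      (hfr _ fun q => convex_Ioo _ _)).mono_left hU
    rw [lintegral_tupleCount_eq_tsum k (hmIoo a b)]
    rw [ENNReal.tsum_eq_iSup_sum]
    refine iSup_le fun s => ?_
    choose l hl using fun f : ι → ℕ => exists_tendsto_ultrafilter U
      fun t => (P t : Measure (ℤ × ℕ → EReal)) {e | f ∈ tupleSet k B e}
    calc _ ≤ ∑ f ∈ s, l f := Finset.sum_le_sum fun f _ => by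
          rw [← (hl f).liminf_eq]
          exact ProbabilityMeasure.le_liminf_measure_open_of_tendsto hPQ
            (isOpen_mem_tupleSet k a b f)
      _ ≤ _ := by
          refine le_of_tendsto_of_tendsto (tendsto_finsetSum s fun f _ => hl f) h1 ?_
          filter_upwards [hU hlaw] with t ht
          rw [ht B (hmIoo a b)]
          exact ENNReal.sum_le_tsum s
  -- For a lower bound the sum over `f` has to be cut at finitely many tuples of labels, with an
  -- error uniform in `t`.
  have hlower : ∀ a b : ι → ℝ,
      ∫⁻ ξ in Set.univ.pi fun q => Set.Icc (a q) (b q), ‖beadDet γ k ξ‖ₑ ≤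
        ∫⁻ e, tupleCount k (Set.univ.pi fun q => Set.Icc (a q) (b q)) e ∂(Q : Measure (ℤ × ℕ → EReal)) :=
      fun a b => by
    set B := Set.univ.pi fun q => Set.Icc (a q) (b q) with hB
    set r := ‖a‖ + ‖b‖ with hr
    have hr0 : 0 ≤ r := add_nonneg (norm_nonneg a) (norm_nonneg b)
    have h1 := (W.tendsto_lintegral_tupleCount hgen hγ hμ k (hmIcc a b) hr0 (hbd a b)
      (hfr _ fun q => convex_Icc _ _)).mono_left hU
    obtain ⟨D, -, hD⟩ := W.exists_lintegral_tupleCount_le hgen hγ hμ hr0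
    set C := (D * √(Fintype.card (Option ι))) ^ Fintype.card (Option ι) with hC
    choose l hl using fun f : ι → ℕ => exists_tendsto_ultrafilter U
      fun t => (P t : Measure (ℤ × ℕ → EReal)) {e | f ∈ tupleSet k B e}
    have hfinite : ∫⁻ ξ in B, ‖beadDet γ k ξ‖ₑ ≠ ⊤ :=
      (W.integrableOn_beadDet hgen hγ hμ k (volume_ne_top_of_abs_le (hbd a b))).2.ne
    have hS : ∀ S : ℕ, S * ∫⁻ ξ in B, ‖beadDet γ k ξ‖ₑ ≤
        S * ∫⁻ e, tupleCount k B e ∂(Q : Measure (ℤ × ℕ → EReal)) + Fintype.card ι * ENNReal.ofReal C := by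
      intro S
      set s := Fintype.piFinset fun _ : ι => Finset.range (Fintype.card ι + S) with hs
      calc _ ≤ S * ∑ f ∈ s, l f + Fintype.card ι * ENNReal.ofReal C := by
            refine le_of_tendsto_of_tendsto
              (ENNReal.Tendsto.const_mul h1 (Or.inr (ENNReal.natCast_ne_top S)))
              ((ENNReal.Tendsto.const_mul (tendsto_finsetSum s fun f _ => hl f)
                (Or.inr (ENNReal.natCast_ne_top S))).add_const _) ?_
            filter_upwards [hU hP, hU hD] with t ht hDt
            have hmeas : ∀ f : ι → ℕ, MeasurableSet {M | f ∈ tupleSet k B (W.beadEnc j₀ γ t M)} :=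
              fun f => W.measurable_beadEnc j₀ γ t (measurableSet_mem_tupleSet k (hmIcc a b) f)
            have hind : ∀ f : ι → ℕ, Measurable fun M => {e | f ∈ tupleSet k B e}.indicator
                (1 : (ℤ × ℕ → EReal) → ENNReal) (W.beadEnc j₀ γ t M) := fun f =>
              (measurable_one.indicator (measurableSet_mem_tupleSet k (hmIcc a b) f)).comp
                (W.measurable_beadEnc j₀ γ t)
            have hwin : MeasurableSet {ξ : Option ι → ℝ | ∀ o, |ξ o| ≤ r} := by
              rw [Set.ofPred_forall]
              exact MeasurableSet.iInter fun o =>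
                measurableSet_le (measurable_pi_apply o).abs measurable_const
            have hopt : ∀ q : ι, Measurable fun M =>
                tupleCount (fun o : Option ι => o.elim (k q) k) {ξ | ∀ o, |ξ o| ≤ r}
                  (W.beadEnc j₀ γ t M) := fun q =>
              (measurable_tupleCount _ hwin).comp (W.measurable_beadEnc j₀ γ t)
            have hm2 := Finset.measurable_fun_sum s fun f _ => hind f
            rw [← lintegral_const_mul' _ _ (ENNReal.natCast_ne_top S)]
            simp only [← W.tupleCount_beadEnc]
            refine (lintegral_mono fun M => (W.isOrdered_beadEnc j₀ γ t M).mul_tupleCount_le k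
              (hbd a b) S).trans ?_
            rw [lintegral_add_left (hm2.const_mul _), lintegral_const_mul _ hm2,
              lintegral_finsetSum _ fun f _ => hind f,
              lintegral_finsetSum _ fun q _ => hopt q]
            · refine add_le_add (le_of_eq ?_) ?_
              · congr 1
                refine Finset.sum_congr rfl fun f _ => ?_
                rw [ht, Measure.map_apply (W.measurable_beadEnc j₀ γ t)
                  (measurableSet_mem_tupleSet k (hmIcc a b) f)]
                exact lintegral_indicator_one (hmeas f)
              · simp only [W.tupleCount_beadEnc]
                refine (Finset.sum_le_sum fun q _ => hDt (Option ι) _ _ fun ξ hξ => hξ).trans ?_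
                rw [Finset.sum_const, nsmul_eq_mul, Finset.card_univ]
        _ ≤ _ := by
            gcongr
            rw [lintegral_tupleCount_eq_tsum k (hmIcc a b)]
            refine le_trans (Finset.sum_le_sum fun f _ => ?_) (ENNReal.sum_le_tsum s)
            rw [← (hl f).limsup_eq]
            exact ProbabilityMeasure.limsup_measure_closed_le_of_tendsto hPQ
              (isClosed_mem_tupleSet k a b f)
    -- The error term does not depend on `S`, so dividing by a large `S` gives a contradiction.
    by_contra! h
    have hQf := (h.trans_le le_top).ne
    set x := ∫⁻ ξ in B, ‖beadDet γ k ξ‖ₑ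
    set y := ∫⁻ e, tupleCount k B e ∂(Q : Measure (ℤ × ℕ → EReal))
    have hxy : y.toReal < x.toReal := (ENNReal.toReal_lt_toReal hQf hfinite).2 h
    obtain ⟨S, hS'⟩ := exists_nat_gt ((Fintype.card ι * (ENNReal.ofReal C).toReal) /
      (x.toReal - y.toReal))
    rw [div_lt_iff₀ (by linarith)] at hS'
    have h2 := ENNReal.toReal_mono (by finiteness) (hS S)
    rw [ENNReal.toReal_add (by finiteness) (by finiteness), ENNReal.toReal_mul,
      ENNReal.toReal_mul, ENNReal.toReal_mul, ENNReal.toReal_natCast, ENNReal.toReal_natCast] at h2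
    nlinarith
  -- The intensity measure of the tuples of distinct labels under `Q`; the claim becomes an equality
  -- of two measures.
  set ρ : Measure (ι → ℝ) := Measure.sum fun f : ι → ℕ =>
    ((Q : Measure (ℤ × ℕ → EReal)).restrict {e | f ∈ tupleSet k Set.univ e}).map
      (fun e q => (e (k q, f q)).toReal) with hρdef
  have hρ : ∀ B, MeasurableSet B →
      ρ B = ∫⁻ e, tupleCount k B e ∂(Q : Measure (ℤ × ℕ → EReal)) := fun B hB => by
    rw [lintegral_tupleCount_eq_tsum k hB, hρdef, Measure.sum_apply _ hB]
    refine tsum_congr fun f => ?_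
    have h1 : Measurable fun (e : ℤ × ℕ → EReal) q => (e (k q, f q)).toReal :=
      measurable_pi_lambda _ fun q => (measurable_pi_apply _).ereal_toReal
    rw [Measure.map_apply h1 hB, Measure.restrict_apply (h1 hB)]
    congr 1
    ext e
    simp only [Set.mem_inter_iff, Set.mem_preimage, Set.mem_ofPred_eq, mem_tupleSet_iff,
      Set.mem_univ, and_true]
    tauto
  rw [← hρ B hBm, ← withDensity_apply _ hBm]
  congr 1
  refine Measure.ext_of_generateFrom_of_iUnion _
    (fun N : ℕ => Set.univ.pi fun _ : ι => Set.Ioo (-(N : ℝ)) N) (generateFrom_boxes ι)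
    ?_ ?_ (fun N => ⟨(fun _ => -(N : ℝ), fun _ => (N : ℝ)), rfl⟩) (fun N => ?_) ?_
  · rintro _ ⟨p, rfl⟩ _ ⟨p', rfl⟩ -
    refine ⟨(fun q => max (p.1 q) (p'.1 q), fun q => min (p.2 q) (p'.2 q)), ?_⟩
    simp only [← Set.Ioo_inter_Ioo, Set.pi_inter_distrib]
  · refine Set.eq_univ_of_forall fun ξ => Set.mem_iUnion.2 ?_
    obtain ⟨N, hN⟩ := exists_nat_gt ‖ξ‖
    exact ⟨N, fun q _ => abs_lt.1 ((norm_le_pi_norm ξ q).trans_lt hN)⟩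
  · rw [hρ _ (hmIoo _ _)]
    refine ((hupper (fun _ => -(N : ℝ)) fun _ => (N : ℝ)).trans_lt ?_).ne
    exact (W.integrableOn_beadDet hgen hγ hμ k (volume_ne_top_of_abs_le fun ξ hξ =>
      hbd _ _ ξ (hIoo _ _ hξ))).2
  · rintro _ ⟨⟨a, b⟩, rfl⟩
    simp only
    rw [hρ _ (hmIoo _ _), withDensity_apply _ (hmIoo _ _)]
    refine le_antisymm (hupper a b) ?_
    have hU1 : (Set.univ.pi fun q => Set.Ioo (a q) (b q)) = ⋃ N : ℕ, Set.univ.pi fun q =>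
        Set.Icc (a q + 1 / ((N : ℝ) + 1)) (b q - 1 / ((N : ℝ) + 1)) := by
      ext ξ
      simp only [Set.mem_iUnion, Set.mem_univ_pi]
      constructor
      · intro h
        have h1 : ∀ᶠ N : ℕ in atTop, ∀ q, ξ q ∈
            Set.Icc (a q + 1 / ((N : ℝ) + 1)) (b q - 1 / ((N : ℝ) + 1)) := by
          refine eventually_all.2 fun q => ?_
          have h2 := tendsto_one_div_add_atTop_nhds_zero_nat (𝕜 := ℝ)
          filter_upwards [h2.eventually (gt_mem_nhds (sub_pos.2 (h q).1)),
            h2.eventually (gt_mem_nhds (sub_pos.2 (h q).2))] with N h3 h4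
          constructor <;> linarith
        exact h1.exists
      · rintro ⟨N, h⟩ q
        have h1 : (0 : ℝ) < 1 / ((N : ℝ) + 1) := Nat.one_div_pos_of_nat
        constructor <;> linarith [(h q).1, (h q).2]
    rw [← withDensity_apply _ (hmIoo _ _), hU1, Monotone.measure_iUnion]
    · refine iSup_le fun N => ?_
      rw [withDensity_apply _ (hmIcc _ _)]
      refine (hlower _ _).trans (lintegral_mono fun e => tupleCount_mono k ?_ e)
      exact Set.subset_iUnion (fun N : ℕ => Set.univ.pi fun q =>
        Set.Icc (a q + 1 / ((N : ℝ) + 1)) (b q - 1 / ((N : ℝ) + 1))) N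
    · intro N N' h
      refine Set.pi_mono fun q _ => Set.Icc_subset_Icc ?_ ?_ <;>
      · have := Nat.one_div_le_one_div (α := ℝ) h
        linarith

end

end BeadDimer

end

noncomputable section

namespace BeadDimer

variable {n m : ℕ} [NeZero n] [NeZero m]

/-! ### Existence of the bead model -/

theorem tupleCount_unit {L : Type*} (k : ℤ) (A : Set ℝ) (e : ℤ × L → EReal) :
    tupleCount (fun _ : Unit => k) {ξ | ξ () ∈ A} e = ((labelSet k A e).encard : ENNReal) := by
  rw [tupleCount_eq_encard]
  have : tupleSet (fun _ : Unit => k) {ξ | ξ () ∈ A} e =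
      (fun l (_ : Unit) => l) '' labelSet k A e := by
    ext f
    constructor
    · rintro ⟨-, ξ, hξ, h⟩
      exact ⟨f (), ⟨ξ (), hξ, h ()⟩, rfl⟩
    · rintro ⟨l, ⟨ξ, hξ, h⟩, rfl⟩
      exact ⟨fun _ _ _ => rfl, fun _ => ξ, hξ, fun _ => h⟩
  rw [this, Set.InjOn.encard_image]
  exact fun l _ l' _ h => congrFun h ()

/-- In this form the measurability of the number of labels follows from that of `tupleCount`; for
infinitely many labels both sides are zero. -/
theorem ncard_labelSet {L : Type*} (k : ℤ) (A : Set ℝ) (e : ℤ × L → EReal) :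
    (labelSet k A e).ncard = ⌊(tupleCount (fun _ : Unit => k) {ξ | ξ () ∈ A} e).toReal⌋₊ := by
  rw [tupleCount_unit, Set.ncard]
  cases (labelSet k A e).encard <;> simp

/-- The labelled points are locally finite and distinct. -/
def IsSimpleLabelling (e : ℤ × ℕ → EReal) : Prop :=
  (∀ (k : ℤ) (N : ℕ), tupleCount (fun _ : Unit => k) {ξ | ξ () ∈ Set.Icc (-(N : ℝ)) N} e < ⊤) ∧
    ∀ k : ℤ, tupleCount (fun _ : Bool => k) {ξ | ξ true = ξ false} e = 0

theorem measurableSet_ofPred_unit {A : Set ℝ} (hA : MeasurableSet A) :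
    MeasurableSet {ξ : Unit → ℝ | ξ () ∈ A} := measurable_pi_apply () hA

theorem measurableSet_isSimpleLabelling : MeasurableSet {e | IsSimpleLabelling e} := by
  have h1 : ∀ (k : ℤ) (N : ℕ), MeasurableSet {e : ℤ × ℕ → EReal |
      tupleCount (fun _ : Unit => k) {ξ | ξ () ∈ Set.Icc (-(N : ℝ)) N} e < ⊤} := fun k N =>
    measurableSet_lt (measurable_tupleCount _ (measurableSet_ofPred_unit measurableSet_Icc))
      measurable_const
  have h2 : ∀ k : ℤ, MeasurableSet {e : ℤ × ℕ → EReal |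
      tupleCount (fun _ : Bool => k) {ξ | ξ true = ξ false} e = 0} := fun k =>
    measurable_tupleCount _ (measurableSet_eq_fun (measurable_pi_apply true)
      (measurable_pi_apply false)) (measurableSet_singleton 0)
  have h3 : {e | IsSimpleLabelling e} = (⋂ k, ⋂ N : ℕ, {e : ℤ × ℕ → EReal |
      tupleCount (fun _ : Unit => k) {ξ | ξ () ∈ Set.Icc (-(N : ℝ)) N} e < ⊤}) ∩
      ⋂ k, {e | tupleCount (fun _ : Bool => k) {ξ | ξ true = ξ false} e = 0} := by
    ext e
    simp [IsSimpleLabelling]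
  rw [h3]
  exact (MeasurableSet.iInter fun k => MeasurableSet.iInter (h1 k)).inter (MeasurableSet.iInter h2)

theorem IsSimpleLabelling.finite {e : ℤ × ℕ → EReal} (he : IsSimpleLabelling e) (k : ℤ)
    {A : Set ℝ} (hA : Bornology.IsBounded A) : (labelSet k A e).Finite := by
  obtain ⟨r, hr⟩ := hA.subset_closedBall 0
  obtain ⟨N, hN⟩ := exists_nat_ge r
  have h1 := he.1 k N
  rw [tupleCount_unit] at h1
  refine Set.Finite.subset (Set.encard_lt_top_iff.1 (by simpa using h1)) ?_
  rintro l ⟨ξ, hξ, h⟩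
  refine ⟨ξ, ?_, h⟩
  have := hr hξ
  rw [mem_closedBall_zero_iff, Real.norm_eq_abs] at this
  exact abs_le.1 (this.trans hN)

theorem IsSimpleLabelling.inj {e : ℤ × ℕ → EReal} (he : IsSimpleLabelling e) {k : ℤ} {l l' : ℕ}
    {ξ : ℝ} (h : e (k, l) = ξ) (h' : e (k, l') = ξ) : l = l' := by
  by_contra hne
  have h1 := he.2 k
  rw [tupleCount_eq_encard, ENat.toENNReal_eq_zero, Set.encard_eq_zero] at h1
  refine Set.eq_empty_iff_forall_notMem.1 h1 (fun b => if b then l else l')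
    ⟨?_, fun _ => ξ, rfl, ?_⟩
  · rintro (_ | _) (_ | _) hbc <;> simp_all
  · rintro (_ | _) <;> simp_all

theorem image_labelSet {L : Type*} (e : ℤ × L → EReal) (k : ℤ) (A : Set ℝ) :
    (fun l => (e (k, l)).toReal) '' labelSet k A e = {ξ : ℝ | (∃ l, e (k, l) = ξ) ∧ ξ ∈ A} := by
  ext ξ
  constructor
  · rintro ⟨l, ⟨ξ', hξ', h⟩, rfl⟩
    simp only [h, EReal.toReal_coe]
    exact ⟨⟨l, h⟩, hξ'⟩
  · rintro ⟨⟨l, h⟩, hξ⟩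
    exact ⟨l, ⟨ξ, hξ, h⟩, by simp only [h, EReal.toReal_coe]⟩

/-- The configuration of the points of a labelling. -/
def pointsOf (e : ℤ × ℕ → EReal) : PointConfig :=
  ⟨{p | IsSimpleLabelling e ∧ ∃ l, e (p.1, l) = (p.2 : EReal)}, fun k r => by
    by_cases he : IsSimpleLabelling e
    · have h1 := ((he.finite k (Metric.isBounded_Icc (-r) r)).image fun l => (e (k, l)).toReal)
      rw [image_labelSet] at h1
      refine h1.subset ?_
      rintro ξ ⟨h, hξ⟩
      exact ⟨h.2, abs_le.1 hξ⟩
    · simp [he]⟩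

theorem count_pointsOf {e : ℤ × ℕ → EReal} (he : IsSimpleLabelling e) (k : ℤ) (A : Set ℝ) :
    (pointsOf e).count k A = (labelSet k A e).ncard := by
  simp only [PointConfig.count, pointsOf, Set.mem_ofPred_eq, he, true_and]
  rw [← image_labelSet, Set.InjOn.ncard_image]
  rintro l ⟨ξ, hξ, h⟩ l' ⟨ξ', hξ', h'⟩ hl
  simp only [h, h', EReal.toReal_coe] at hl
  subst hl
  exact he.inj h h'

theorem measurable_count (k : ℤ) {A : Set ℝ} (hA : MeasurableSet A) (hb : Bornology.IsBounded A) :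
    Measurable fun S : PointConfig => S.count k A := by
  refine measurable_iff_comap_le.2 ?_
  exact le_iSup₂ (f := fun (k : ℤ) (A : {A : Set ℝ // MeasurableSet A ∧ Bornology.IsBounded A}) =>
    MeasurableSpace.comap (fun S : PointConfig => S.count k A.1) ⊤) k ⟨A, hA, hb⟩

theorem measurable_pointsOf : Measurable pointsOf := by
  classical
  refine measurable_iff_comap_le.2 ?_
  simp only [instMeasurableSpacePointConfig, MeasurableSpace.comap_iSup, MeasurableSpace.comap_comp]
  refine iSup₂_le fun k A => measurable_iff_comap_le.1 ?_
  have h1 : ((fun S : PointConfig => S.count k A.1) ∘ pointsOf) = fun e =>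
      if IsSimpleLabelling e then ⌊(tupleCount (fun _ : Unit => k) {ξ | ξ () ∈ A.1} e).toReal⌋₊
      else 0 := by
    funext e
    by_cases he : IsSimpleLabelling e
    · rw [if_pos he, Function.comp_apply, count_pointsOf he, ncard_labelSet]
    · rw [if_neg he, Function.comp_apply, PointConfig.count]
      simp [pointsOf, he]
  rw [h1]
  exact Measurable.ite measurableSet_isSimpleLabelling (Nat.measurable_floor.comp
    (measurable_tupleCount _ (measurableSet_ofPred_unit A.2.1)).ennreal_toReal) measurable_const

/-- The unlabelled points under the limit law: the integrals of `tupleCount` are their joint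
factorial moments, by `tupleCount_sigma`, provided the labels are almost surely locally finite and
the points distinct. -/
theorem Weights.exists_beadModel (W : Weights n m) {j₀ : ZMod n}
    (hgen : ∀ j, j ≠ j₀ → W.abscissa j ≠ W.abscissa j₀) {γ : ℝ} (hγ : γ ∈ Set.Ioo (-1 : ℝ) 1)
    {μ : ℝ → Measure DimerConfig}
    (hμ : ∀ᶠ t in 𝓝[>] (0 : ℝ), W.HasBeadKernel j₀ γ t (μ t)) : ∃ ν, IsBeadModel γ ν := by
  obtain ⟨Q, hQ, hQm⟩ := W.exists_limit_moments hgen hγ hμ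
  have hfin : ∀ {ι : Type} [Fintype ι] [DecidableEq ι] (k : ι → ℤ) {B : Set (ι → ℝ)} {r : ℝ},
      (∀ ξ ∈ B, ∀ q, |ξ q| ≤ r) → ∫⁻ ξ in B, ‖beadDet γ k ξ‖ₑ < ⊤ := fun k _ _ hB =>
    (W.integrableOn_beadDet hgen hγ hμ k (volume_ne_top_of_abs_le hB)).2
  -- The expected number of points in a bounded window is finite, and the expected number of pairs
  -- at the same place is an integral over the diagonal, a null set.
  have hsimple : ∀ᵐ e ∂Q, IsSimpleLabelling e := by
    refine (ae_all_iff.2 fun k => ae_all_iff.2 fun N => ?_).and (ae_all_iff.2 fun k => ?_)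
    · have hm := measurableSet_ofPred_unit (measurableSet_Icc (a := -(N : ℝ)) (b := N))
      refine ae_lt_top (measurable_tupleCount _ hm) ?_
      rw [hQm _ _ _ hm]
      exact (hfin _ fun ξ hξ _ => abs_le.2 hξ).ne
    · have hm : MeasurableSet {ξ : Bool → ℝ | ξ true = ξ false} :=
        measurableSet_eq_fun (measurable_pi_apply true) (measurable_pi_apply false)
      refine (lintegral_eq_zero_iff (measurable_tupleCount (fun _ : Bool => k) hm)).1 ?_
      rw [hQm _ _ _ hm, Measure.restrict_eq_zero.2 (volume_coord_eq (by simp)),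
        lintegral_zero_measure]
  refine ⟨Q.map pointsOf, Measure.isProbabilityMeasure_map measurable_pointsOf.aemeasurable,
    fun p k A N hA hb hdisj => ?_⟩
  set B : Set ((Σ l : Fin p, Fin (N l)) → ℝ) := {ξ | ∀ q, ξ q ∈ A q.1} with hBdef
  have hBm : MeasurableSet B := by
    rw [hBdef, Set.ofPred_forall]
    exact MeasurableSet.iInter fun q => measurable_pi_apply q (hA q.1)
  have hBfin : ∫⁻ ξ in B, ‖beadDet γ (fun q => k q.1) ξ‖ₑ < ⊤ := by
    choose r hr using fun l => (hb l).subset_closedBall (0 : ℝ)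
    refine hfin _ (r := ∑ l, |r l|) fun ξ hξ q => ?_
    have h1 := hr _ (hξ q)
    rw [mem_closedBall_zero_iff, Real.norm_eq_abs] at h1
    exact h1.trans ((le_abs_self _).trans (Finset.single_le_sum (f := fun l => |r l|)
      (fun _ _ => abs_nonneg _) (Finset.mem_univ _)))
  have hmeas : Measurable fun S : PointConfig =>
      ∏ l, ((S.count (k l) (A l)).descFactorial (N l) : ℝ) :=
    Finset.measurable_fun_prod _ fun l _ =>
      (measurable_of_countable fun i : ℕ => (i.descFactorial (N l) : ℝ)).comp
        (measurable_count (k l) (hA l) (hb l))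
  have hT := measurable_tupleCount (L := ℕ) (fun q : Σ l : Fin p, Fin (N l) => k q.1) hBm
  have heq : ((fun S : PointConfig => ∏ l, ((S.count (k l) (A l)).descFactorial (N l) : ℝ)) ∘
      pointsOf) =ᵐ[Q] fun e => (tupleCount (fun q : Σ l : Fin p, Fin (N l) => k q.1) B e).toReal := by
    filter_upwards [hsimple] with e he
    rw [tupleCount_sigma e k A N hdisj fun l => he.finite _ (hb l), ENNReal.toReal_natCast]
    push_cast
    exact Finset.prod_congr rfl fun l _ => by rw [count_pointsOf he]
  have hne : ∫⁻ e, tupleCount (fun q : Σ l : Fin p, Fin (N l) => k q.1) B e ∂Q ≠ ⊤ := by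
    rw [hQm _ _ _ hBm]
    exact hBfin.ne
  constructor
  · rw [integrable_map_measure hmeas.aestronglyMeasurable measurable_pointsOf.aemeasurable]
    exact (integrable_toReal_of_lintegral_ne_top hT.aemeasurable hne).congr heq.symm
  · rw [integral_map measurable_pointsOf.aemeasurable hmeas.aestronglyMeasurable]
    have h1 := integral_congr_ae heq
    simp only [Function.comp_def] at h1
    rw [h1, integral_toReal hT.aemeasurable (ae_lt_top hT hne), hQm _ _ _ hBm,
      ← W.setIntegral_beadDet hgen hγ hμ]
    rfl

end BeadDimer

end

/-! ### From factorial moments to the laws of the counts. -/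

noncomputable section

namespace BeadDimer

/-! ### The method of factorial moments -/

open scoped _root_.Nat

/-- Binomial inversion: with `d = x - v` the sum is a multiple of `∑ (-1)^i (d choose i) = (1 -
1)^d`. The terms with `i > d` would vanish. -/
theorem sum_factorial_descFactorial (x v : ℕ) :
    ∑ i ∈ Finset.range (x - v + 1), (-1 : ℝ) ^ i * ((v ! : ℝ)⁻¹ * (i ! : ℝ)⁻¹) *
      (x.descFactorial (v + i) : ℝ) = if x = v then 1 else 0 := by
  rcases lt_or_ge x v with h | h
  · rw [if_neg h.ne, show x - v = 0 by omega]
    simp [Nat.descFactorial_of_lt h]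
  obtain ⟨d, rfl⟩ := Nat.exists_eq_add_of_le h
  have h1 : ∀ i, (-1 : ℝ) ^ i * ((v ! : ℝ)⁻¹ * (i ! : ℝ)⁻¹) * ((v + d).descFactorial (v + i) : ℝ) =
      (((v + d).descFactorial v : ℝ) * (v ! : ℝ)⁻¹) * (((-1 : ℤ) ^ i * (d.choose i : ℤ) : ℤ) : ℝ) :=
    fun i => by
    have h2 : (v + d).descFactorial (v + i) = (v + d).descFactorial v * (i ! * d.choose i) := by
      rw [← Nat.descFactorial_eq_factorial_mul_choose, add_comm v i,
        ← Nat.descFactorial_mul_descFactorial (Nat.le_add_left v i)]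
      simp [mul_comm]
    rw [h2]
    push_cast
    field_simp
  simp only [h1, ← Finset.mul_sum, ← Int.cast_sum, Nat.add_sub_cancel_left,
    Int.alternating_sum_range_choose]
  rcases Nat.eq_zero_or_pos d with rfl | hd
  · simp [Nat.descFactorial_self, Nat.factorial_ne_zero]
  · rw [if_neg hd.ne', if_neg (by omega)]
    simp

theorem summable_prod_half_pow (α : Type*) [Fintype α] :
    Summable fun i : α → ℕ => ∏ a, (1 / 2 : ℝ) ^ i a := by
  classical
  refine summable_of_sum_le (c := ∏ _a : α, (2 : ℝ))
    (fun i => Finset.prod_nonneg fun _ _ => by positivity) fun u => ?_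
  set K := u.sup fun i => ∑ a, i a with hK
  have h1 : u ⊆ Fintype.piFinset fun _ : α => Finset.range (K + 1) := fun i hi => by
    refine Fintype.mem_piFinset.2 fun a => Finset.mem_range.2 (Nat.lt_succ_of_le ?_)
    exact (Finset.single_le_sum (f := i) (fun _ _ => Nat.zero_le _) (Finset.mem_univ a)).trans
      (Finset.le_sup (f := fun i : α → ℕ => ∑ a, i a) hi)
  refine (Finset.sum_le_sum_of_subset_of_nonneg h1 fun i _ _ =>
    Finset.prod_nonneg fun _ _ => by positivity).trans ?_
  rw [← Finset.prod_univ_sum]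
  refine Finset.prod_le_prod (fun _ _ => Finset.sum_nonneg fun _ _ => by positivity) fun a _ => ?_
  exact sum_le_hasSum _ (fun _ _ => by positivity) hasSum_geometric_two

/-- Moments that grow like those of a determinantal process determine the law. -/
theorem summable_factorial_bound {α : Type*} [Fintype α] (v : α → ℕ) {D : ℝ} (hD : 0 ≤ D) :
    Summable fun i : α → ℕ => (∏ a, ((i a) ! : ℝ)⁻¹) *
      (D * √((∑ a, (v a + i a) : ℕ) : ℝ)) ^ (∑ a, (v a + i a)) := by
  set p := Fintype.card α with hp
  set V := ∑ a, v a with hV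
  -- With `N` the total degree, `∏ 1 / i!` times `N^N` is at most `V! e^((p+1)N)`. There remains `(D
  -- e^(p+1))^N N^(-N/2)`, which is `c^N N^(-N/2)` times `2^(-N)`; the first factor is bounded and
  -- the second summable.
  obtain ⟨c, hc⟩ : ∃ c, c = 2 * D * Real.exp (p + 1) := ⟨_, rfl⟩
  refine Summable.of_nonneg_of_le (fun i => by positivity) (fun i => ?_)
    ((summable_prod_half_pow α).mul_left (V ! * √(Real.exp (c ^ 2))))
  set N := ∑ a, (v a + i a) with hN
  set s := ∑ a, i a with hs
  have hNs : N = V + s := Finset.sum_add_distrib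
  set Z := √(N : ℝ) ^ N with hZ
  have hZ0 : 0 < Z := by
    rcases Nat.eq_zero_or_pos N with h | h
    · rw [hZ, h]; simp
    · have : (0 : ℝ) < N := by exact_mod_cast h
      positivity
  have hZZ : Z * Z = (N : ℝ) ^ N := by
    rw [hZ, ← mul_pow, Real.mul_self_sqrt (by positivity)]
  have h1 : (∏ a, ((i a) ! : ℝ)⁻¹) * (N : ℝ) ^ s ≤ Real.exp (p * N) := by
    rw [hs, ← Finset.prod_pow_eq_pow_sum, ← Finset.prod_mul_distrib]
    calc _ ≤ ∏ _a : α, Real.exp N := Finset.prod_le_prod (fun _ _ => by positivity) fun a _ => by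
          rw [mul_comm, ← div_eq_mul_inv]
          exact Real.pow_div_factorial_le_exp _ (by positivity) _
      _ = _ := by rw [Finset.prod_const, Finset.card_univ, ← Real.exp_nat_mul]
  have h2 : (N : ℝ) ^ V ≤ V ! * Real.exp N := by
    have := Real.pow_div_factorial_le_exp (N : ℝ) (by positivity) V
    rwa [div_le_iff₀' (by positivity)] at this
  have h3 : c ^ N ≤ √(Real.exp (c ^ 2)) * Z := by
    refine le_of_sq_le_sq ?_ (by positivity)
    rw [mul_pow (√_), Real.sq_sqrt (by positivity), sq Z, hZZ]
    have h4 := Real.pow_div_factorial_le_exp (c ^ 2) (by positivity) N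
    rw [div_le_iff₀ (by positivity)] at h4
    have h5 : (N ! : ℝ) ≤ (N : ℝ) ^ N := by exact_mod_cast Nat.factorial_le_pow N
    calc _ = (c ^ 2) ^ N := by ring
      _ ≤ _ := h4.trans (by gcongr)
  have h6 : (∏ a, ((i a) ! : ℝ)⁻¹) * (Z * Z) ≤ V ! * Real.exp ((p + 1) * N) := by
    rw [hZZ]
    calc _ = ((∏ a, ((i a) ! : ℝ)⁻¹) * (N : ℝ) ^ s) * (N : ℝ) ^ V := by
          rw [mul_assoc, ← pow_add, add_comm s V, ← hNs]
      _ ≤ Real.exp (p * N) * (V ! * Real.exp N) := by gcongr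
      _ = _ := by rw [mul_left_comm, ← Real.exp_add]; ring_nf
  have h7 : (∏ a, (1 / 2 : ℝ) ^ i a) = (1 / 2) ^ s := by rw [Finset.prod_pow_eq_pow_sum]
  have h8 : (1 / 2 : ℝ) ^ N ≤ (1 / 2) ^ s :=
    pow_le_pow_of_le_one (by norm_num) (by norm_num) (by omega)
  rw [h7, mul_pow, ← hZ]
  refine le_trans ?_ (mul_le_mul_of_nonneg_left h8 (by positivity))
  refine le_of_mul_le_mul_right ?_ hZ0
  have h9 : c ^ N * (1 / 2) ^ N = D ^ N * Real.exp ((p + 1) * N) := by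
    rw [mul_comm ((p : ℝ) + 1), Real.exp_nat_mul, ← mul_pow, ← mul_pow, hc]
    congr 1
    ring
  calc _ = D ^ N * ((∏ a, ((i a) ! : ℝ)⁻¹) * (Z * Z)) := by ring
    _ ≤ D ^ N * (V ! * Real.exp ((p + 1) * N)) := by gcongr
    _ = V ! * (c ^ N * (1 / 2) ^ N) := by rw [h9]; ring
    _ ≤ V ! * ((√(Real.exp (c ^ 2)) * Z) * (1 / 2) ^ N) := by gcongr
    _ = _ := by ring

/-- The inversion formula for the indicator of the event, which is a finite sum at each `ω`, is
integrated term by term; the hypothesis on the moments is absolute summability. -/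
theorem hasSum_measureReal_of_factorialMoments {Ω α : Type*} [MeasurableSpace Ω] {P : Measure Ω}
    [Fintype α] {X : α → Ω → ℕ} {v : α → ℕ} {m : (α → ℕ) → ℝ}
    (hint : ∀ j : α → ℕ, Integrable (fun ω => ∏ a, ((X a ω).descFactorial (j a) : ℝ)) P)
    (hm : ∀ j : α → ℕ, ∫ ω, ∏ a, ((X a ω).descFactorial (j a) : ℝ) ∂P = m j)
    (hsum : Summable fun i : α → ℕ => (∏ a, ((i a) ! : ℝ)⁻¹) * m (v + i))
    (hmeas : MeasurableSet {ω | ∀ a, X a ω = v a}) :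
    HasSum (fun i : α → ℕ => (∏ a, (-1 : ℝ) ^ i a * (((v a) ! : ℝ)⁻¹ * ((i a) ! : ℝ)⁻¹)) *
      m (v + i)) (P.real {ω | ∀ a, X a ω = v a}) := by
  classical
  set F : (α → ℕ) → Ω → ℝ := fun i ω => (∏ a, (-1 : ℝ) ^ i a * (((v a) ! : ℝ)⁻¹ * ((i a) ! : ℝ)⁻¹)) *
    ∏ a, ((X a ω).descFactorial ((v + i) a) : ℝ) with hF
  have hFint : ∀ i, Integrable (F i) P := fun i => (hint (v + i)).const_mul _
  have h1 := hasSum_integral_of_summable_integral_norm hFint ?_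
  · have h2 : ∀ ω, ∑' i, F i ω = {ω | ∀ a, X a ω = v a}.indicator 1 ω := fun ω => by
      rw [tsum_eq_sum (s := Fintype.piFinset fun a => Finset.range (X a ω - v a + 1))]
      · simp only [hF, ← Finset.prod_mul_distrib, Pi.add_apply]
        rw [← Finset.prod_univ_sum (fun a => Finset.range (X a ω - v a + 1)) fun a i =>
          (-1 : ℝ) ^ i * (((v a) ! : ℝ)⁻¹ * (i ! : ℝ)⁻¹) * ((X a ω).descFactorial (v a + i) : ℝ)]
        simp only [sum_factorial_descFactorial]
        rw [Set.indicator_apply, Fintype.prod_boole]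
        rfl
      · intro i hi
        simp only [Fintype.mem_piFinset, Finset.mem_range, not_forall, not_lt] at hi
        obtain ⟨a, ha⟩ := hi
        refine mul_eq_zero_of_right _ (Finset.prod_eq_zero (Finset.mem_univ a) ?_)
        rw [Pi.add_apply, Nat.descFactorial_of_lt (by omega), Nat.cast_zero]
    simp only [h2, integral_indicator_one hmeas] at h1
    refine h1.congr_fun fun i => ?_
    rw [← hm, ← integral_const_mul]
  · refine (hsum.mul_left (∏ a, ((v a) ! : ℝ)⁻¹)).congr fun i => ?_
    have h3 : ∀ ω, ‖F i ω‖ = (∏ a, (((v a) ! : ℝ)⁻¹ * ((i a) ! : ℝ)⁻¹)) *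
        ∏ a, ((X a ω).descFactorial ((v + i) a) : ℝ) := fun ω => by
      simp only [hF, norm_mul, norm_prod, norm_pow, norm_neg, norm_one, one_pow, one_mul, norm_inv,
        Real.norm_natCast]
    simp only [h3]
    rw [integral_const_mul, hm, Finset.prod_mul_distrib]
    ring

end BeadDimer

end

noncomputable section

namespace BeadDimer

variable {n m : ℕ} [NeZero n] [NeZero m]

/-! ### Convergence of the numbers of beads on the threads `repThread n k` -/

theorem volume_frontier_pi {ι : Type*} [Fintype ι] {A : ι → Set ℝ}
    (hA : ∀ q, volume (frontier (A q)) = 0) : volume (frontier (Set.univ.pi A)) = 0 := by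
  have h1 : frontier (Set.univ.pi A) ⊆ ⋃ q, Function.eval q ⁻¹' frontier (A q) := by
    intro ξ hξ
    by_contra h
    simp only [Set.mem_iUnion, Set.mem_preimage, not_exists, frontier, Set.mem_sdiff] at h
    rw [frontier, closure_pi_set, interior_pi_set Set.finite_univ] at hξ
    refine hξ.2 fun q _ => ?_
    by_contra h2
    exact h q ⟨hξ.1 q trivial, h2⟩
  refine measure_mono_null h1 (measure_iUnion_null fun q => ?_)
  exact Measure.pi_eval_preimage_null _ (hA q)

theorem measurable_ncard_beadPos (W : Weights n m) (j₀ : ZMod n) (γ t : ℝ) (k : ℤ) {A : Set ℝ}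
    (hA : MeasurableSet A) :
    Measurable fun M => (labelSet k A (W.beadPos j₀ γ t M)).ncard := by
  simp only [ncard_labelSet, ← W.tupleCount_beadEnc]
  exact Nat.measurable_floor.comp ((measurable_tupleCount _ (measurableSet_ofPred_unit hA)).comp
    (W.measurable_beadEnc j₀ γ t)).ennreal_toReal

theorem Weights.finite_labelSet_beadPos (W : Weights n m) {j₀ : ZMod n} {γ t : ℝ}
    (hc : W.cellHeight j₀ γ t ≠ 0) (M : DimerConfig) (k : ℤ) {A : Set ℝ} {r : ℝ}
    (hA : ∀ ξ ∈ A, |ξ| ≤ r) : (labelSet k A (W.beadPos j₀ γ t M)).Finite := by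
  refine (Finset.finite_toSet
    (Finset.Icc (-⌊r * m / |W.cellHeight j₀ γ t|⌋) ⌊r * m / |W.cellHeight j₀ γ t|⌋)).subset ?_
  rintro y ⟨ξ, hξ, h⟩
  rw [W.beadPos_eq_coe] at h
  exact (W.abs_height_le_iff hc r y).1 (h.2 ▸ hA ξ hξ)

-- On both sides the probability is the same series in the factorial moments. These converge, and
-- Hadamard's bound, uniform in small `t`, dominates the series.
open scoped _root_.Nat in
theorem Weights.tendsto_ncard_of_disjoint (W : Weights n m) {j₀ : ZMod n}
    (hgen : ∀ j, j ≠ j₀ → W.abscissa j ≠ W.abscissa j₀) {γ : ℝ} (hγ : γ ∈ Set.Ioo (-1 : ℝ) 1)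
    {μ : ℝ → Measure DimerConfig}
    (hμ : ∀ᶠ t in 𝓝[>] (0 : ℝ), W.HasBeadKernel j₀ γ t (μ t)) {ν : Measure PointConfig}
    (hν : IsBeadModel γ ν) {p : ℕ} (k : Fin p → ℤ) {A : Fin p → Set ℝ}
    (hA : ∀ a, MeasurableSet (A a)) {r : ℝ} (hr : 0 ≤ r) (hb : ∀ a, ∀ ξ ∈ A a, |ξ| ≤ r)
    (hfr : ∀ a, volume (frontier (A a)) = 0)
    (hdisj : ∀ a a', a ≠ a' → k a = k a' → Disjoint (A a) (A a')) (v : Fin p → ℕ) :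
    Tendsto (fun t => μ t {M | ∀ a, (labelSet (k a) (A a) (W.beadPos j₀ γ t M)).ncard = v a})
      (𝓝[>] 0) (𝓝 (ν {S | ∀ a, S.count (k a) (A a) = v a})) := by
  have hνp := hν.isProbabilityMeasure
  have hb' : ∀ a, Bornology.IsBounded (A a) := fun a =>
    (Metric.isBounded_Icc (-r) r).subset fun ξ hξ => abs_le.1 (hb a ξ hξ)
  set κ : ∀ j : Fin p → ℕ, (Σ a, Fin (j a)) → ℤ := fun j q => k q.1 with hκ
  set B : ∀ j : Fin p → ℕ, Set ((Σ a, Fin (j a)) → ℝ) := fun j => {ξ | ∀ q, ξ q ∈ A q.1} with hB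
  have hBpi : ∀ j, B j = Set.univ.pi fun q : Σ a, Fin (j a) => A q.1 := fun j => by
    ext ξ; simp [hB]
  have hBm : ∀ j, MeasurableSet (B j) := fun j => by
    rw [hBpi]
    exact MeasurableSet.univ_pi fun q => hA q.1
  have hBb : ∀ j, ∀ ξ ∈ B j, ∀ q, |ξ q| ≤ r := fun j ξ hξ q => hb _ _ (hξ q)
  set m1 : ℝ → (Fin p → ℕ) → ℝ := fun t j =>
    (∫⁻ M, tupleCount (κ j) (B j) (W.beadPos j₀ γ t M) ∂(μ t)).toReal with hm1
  set m0 : (Fin p → ℕ) → ℝ := fun j => (∫⁻ ξ in B j, ‖beadDet γ (κ j) ξ‖ₑ).toReal with hm0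
  have hlim : ∀ j, Tendsto (fun t => m1 t j) (𝓝[>] 0) (𝓝 (m0 j)) := fun j =>
    (ENNReal.tendsto_toReal (W.integrableOn_beadDet hgen hγ hμ (κ j)
      (volume_ne_top_of_abs_le (hBb j))).2.ne).comp
      (W.tendsto_lintegral_tupleCount hgen hγ hμ (κ j) (hBm j) hr (hBb j) (by
        rw [hBpi]
        exact volume_frontier_pi fun q => hfr q.1))
  obtain ⟨D, hD0, hD⟩ := W.exists_lintegral_tupleCount_le hgen hγ hμ hr
  have hcard : ∀ j : Fin p → ℕ, Fintype.card (Σ a, Fin (j a)) = ∑ a, j a := fun j => by simp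
  set g : (Fin p → ℕ) → ℝ := fun j => (D * √((∑ a, j a : ℕ) : ℝ)) ^ (∑ a, j a) with hg
  have hDj : ∀ᶠ t in 𝓝[>] (0 : ℝ), ∀ j,
      ∫⁻ M, tupleCount (κ j) (B j) (W.beadPos j₀ γ t M) ∂(μ t) ≤ ENNReal.ofReal (g j) := by
    filter_upwards [hD] with t ht j
    have := ht _ (κ j) (B j) (hBb j)
    rwa [hcard] at this
  have hg0 : ∀ j, 0 ≤ g j := fun j => by positivity
  have hle1 : ∀ᶠ t in 𝓝[>] (0 : ℝ), ∀ j, m1 t j ≤ g j := by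
    filter_upwards [hDj] with t ht j
    exact ENNReal.toReal_le_of_le_ofReal (hg0 j) (ht j)
  have hle0 : ∀ j, m0 j ≤ g j := fun j => le_of_tendsto (hlim j) (hle1.mono fun t ht => ht j)
  have hsum := summable_factorial_bound v hD0
  have hcount : ∀ᶠ t in 𝓝[>] (0 : ℝ), HasSum (fun i : Fin p → ℕ =>
      (∏ a, (-1 : ℝ) ^ i a * (((v a) ! : ℝ)⁻¹ * ((i a) ! : ℝ)⁻¹)) * m1 t (v + i))
      ((μ t).real {M | ∀ a, (labelSet (k a) (A a) (W.beadPos j₀ γ t M)).ncard = v a}) := by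
    filter_upwards [hDj, hle1, self_mem_nhdsWithin] with t h1 h2 ht
    have hc := W.cellHeight_ne_zero hgen hγ ht
    have hT : ∀ j, Measurable fun M => tupleCount (κ j) (B j) (W.beadPos j₀ γ t M) := fun j => by
      simp only [← W.tupleCount_beadEnc]
      exact (measurable_tupleCount _ (hBm j)).comp (W.measurable_beadEnc j₀ γ t)
    have hne : ∀ j, ∫⁻ M, tupleCount (κ j) (B j) (W.beadPos j₀ γ t M) ∂(μ t) ≠ ⊤ := fun j =>
      ((h1 j).trans_lt ENNReal.ofReal_lt_top).ne
    have heq : ∀ (j : Fin p → ℕ) M, ∏ a, (((labelSet (k a) (A a)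
        (W.beadPos j₀ γ t M)).ncard.descFactorial (j a) : ℕ) : ℝ) =
        (tupleCount (κ j) (B j) (W.beadPos j₀ γ t M)).toReal := fun j M => by
      rw [tupleCount_sigma _ k A j hdisj fun a => W.finite_labelSet_beadPos hc M _ (hb a),
        ENNReal.toReal_natCast]
      push_cast
      rfl
    refine hasSum_measureReal_of_factorialMoments
      (X := fun a M => (labelSet (k a) (A a) (W.beadPos j₀ γ t M)).ncard) (fun j => ?_)
      (fun j => ?_) ?_ ?_
    · simp only [heq]
      exact integrable_toReal_of_lintegral_ne_top (hT j).aemeasurable (hne j)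
    · simp only [heq]
      exact integral_toReal (hT j).aemeasurable (ae_lt_top (hT j) (hne j))
    · refine Summable.of_nonneg_of_le (fun i => ?_) (fun i => ?_) hsum
      · exact mul_nonneg (Finset.prod_nonneg fun _ _ => by positivity) ENNReal.toReal_nonneg
      · exact mul_le_mul_of_nonneg_left (h2 (v + i)) (Finset.prod_nonneg fun _ _ => by positivity)
    · rw [Set.ofPred_forall]
      exact MeasurableSet.iInter fun a =>
        measurable_ncard_beadPos W j₀ γ t (k a) (hA a) (measurableSet_singleton _)
  have hcount0 : HasSum (fun i : Fin p → ℕ =>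
      (∏ a, (-1 : ℝ) ^ i a * (((v a) ! : ℝ)⁻¹ * ((i a) ! : ℝ)⁻¹)) * m0 (v + i))
      (ν.real {S | ∀ a, S.count (k a) (A a) = v a}) := by
    have h1 := fun j => hν.factorialMoments p k A j hA hb' hdisj
    refine hasSum_measureReal_of_factorialMoments
      (X := fun a (S : PointConfig) => S.count (k a) (A a)) (fun j => (h1 j).1) (fun j => ?_) ?_ ?_
    · have h2 := (h1 j).2.trans (W.setIntegral_beadDet hgen hγ hμ (κ j) (B j))
      exact_mod_cast h2
    · refine Summable.of_nonneg_of_le (fun i => ?_) (fun i => ?_) hsum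
      · exact mul_nonneg (Finset.prod_nonneg fun _ _ => by positivity) ENNReal.toReal_nonneg
      · exact mul_le_mul_of_nonneg_left (hle0 (v + i)) (Finset.prod_nonneg fun _ _ => by positivity)
    · rw [Set.ofPred_forall]
      exact MeasurableSet.iInter fun a =>
        measurable_count (k a) (hA a) (hb' a) (measurableSet_singleton _)
  have hmain : Tendsto (fun t => (μ t).real
      {M | ∀ a, (labelSet (k a) (A a) (W.beadPos j₀ γ t M)).ncard = v a}) (𝓝[>] 0)
      (𝓝 (ν.real {S | ∀ a, S.count (k a) (A a) = v a})) := by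
    rw [← hcount0.tsum_eq]
    refine (tendsto_tsum_of_dominated_convergence hsum (fun i => (hlim (v + i)).const_mul _)
      ?_).congr' (hcount.mono fun t ht => ht.tsum_eq)
    filter_upwards [hle1] with t ht i
    rw [norm_mul, norm_prod, Real.norm_of_nonneg (show 0 ≤ m1 t (v + i) from ENNReal.toReal_nonneg)]
    refine mul_le_mul (Finset.prod_le_prod (fun _ _ => norm_nonneg _) fun a _ => ?_) (ht _)
      ENNReal.toReal_nonneg (Finset.prod_nonneg fun _ _ => by positivity)
    rw [norm_mul, norm_pow, norm_neg, norm_one, one_pow, one_mul, norm_mul, norm_inv, norm_inv,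
      Real.norm_natCast, Real.norm_natCast]
    refine mul_le_of_le_one_left (by positivity) (inv_le_one_of_one_le₀ ?_)
    exact_mod_cast Nat.factorial_pos (v a)
  have h1 := (ENNReal.continuous_ofReal.tendsto _).comp hmain
  rw [ofReal_measureReal] at h1
  refine h1.congr' ?_
  filter_upwards [hμ] with t ht
  have := ht.isProbabilityMeasure
  exact ofReal_measureReal

/-! ### Overlapping sets -/

/-- For `a = (l₀, σ)` with `l₀` the least element of `σ`: the points that are in the sets `I l`,
`l ∈ σ`, and in no other set of the thread `k l₀`. -/
def atomSet {p : ℕ} (k : Fin p → ℤ) (I : Fin p → Set ℝ) (a : Fin p × Finset (Fin p)) : Set ℝ :=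
  {ξ | (a.1 ∈ a.2 ∧ ∀ l ∈ a.2, a.1 ≤ l) ∧ ∀ l, l ∈ a.2 ↔ k l = k a.1 ∧ ξ ∈ I l}

section

variable {p : ℕ} (k : Fin p → ℤ) (I : Fin p → Set ℝ)

theorem atomSet_subset (a : Fin p × Finset (Fin p)) : atomSet k I a ⊆ I a.1 :=
  fun _ hξ => ((hξ.2 a.1).1 hξ.1.1).2

theorem disjoint_atomSet {a a' : Fin p × Finset (Fin p)} (h : a ≠ a') (hk : k a.1 = k a'.1) :
    Disjoint (atomSet k I a) (atomSet k I a') := by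
  refine Set.disjoint_left.2 fun ξ hξ hξ' => h ?_
  have h1 : a.2 = a'.2 := Finset.ext fun l => by rw [hξ.2, hξ'.2, hk]
  exact Prod.ext (le_antisymm (hξ.1.2 _ (h1 ▸ hξ'.1.1)) (hξ'.1.2 _ (h1 ▸ hξ.1.1))) h1

theorem measurableSet_atomSet (hI : ∀ l, MeasurableSet (I l)) (a : Fin p × Finset (Fin p)) :
    MeasurableSet (atomSet k I a) := by
  have h1 : MeasurableSet {ξ : ℝ | ∀ l, l ∈ a.2 ↔ k l = k a.1 ∧ ξ ∈ I l} := by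
    rw [Set.ofPred_forall]
    exact MeasurableSet.iInter fun l =>
      (MeasurableSet.const _).iff ((MeasurableSet.const _).inter (hI l))
  exact (MeasurableSet.const _).inter h1

/-- Off the frontiers of the sets `I l`, membership in each of them is locally constant, hence so is
membership in an atom. -/
theorem volume_frontier_atomSet (hI : ∀ l, volume (frontier (I l)) = 0)
    (a : Fin p × Finset (Fin p)) : volume (frontier (atomSet k I a)) = 0 := by
  refine measure_mono_null (fun ξ hξ => ?_) (measure_iUnion_null hI)
  by_contra h
  simp only [Set.mem_iUnion, not_exists] at h
  have h1 : ∀ᶠ η in 𝓝 ξ, ∀ l, η ∈ I l ↔ ξ ∈ I l := eventually_all.2 fun l => by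
    by_cases hl : ξ ∈ I l
    · have h2 : I l ∈ 𝓝 ξ := mem_interior_iff_mem_nhds.1 (by
        by_contra h2
        exact h l ⟨subset_closure hl, h2⟩)
      filter_upwards [h2] with η hη using ⟨fun _ => hl, fun _ => hη⟩
    · have h2 : ξ ∉ closure (I l) := fun h2 => h l ⟨h2, fun h3 => hl (interior_subset h3)⟩
      filter_upwards [isClosed_closure.isOpen_compl.mem_nhds h2] with η hη
      exact ⟨fun h3 => absurd (subset_closure h3) hη, fun h3 => absurd h3 hl⟩
  have h2 : ∀ᶠ η in 𝓝 ξ, η ∈ atomSet k I a ↔ ξ ∈ atomSet k I a := by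
    filter_upwards [h1] with η hη
    simp only [atomSet, Set.mem_ofPred_eq, hη]
  by_cases h3 : ξ ∈ atomSet k I a
  · exact hξ.2 (mem_interior_iff_mem_nhds.2 (h2.mono fun η hη => hη.2 h3))
  · refine mem_closure_iff_frequently.1 hξ.1 (h2.mono fun η hη h4 => h3 (hη.1 h4))

/-- The atoms of the set `I l`. -/
def atomsOf (l : Fin p) : Finset (Fin p × Finset (Fin p)) := {a | l ∈ a.2 ∧ k a.1 = k l}

theorem ncard_labelSet_eq_sum {L : Type*} (e : ℤ × L → EReal) (l : Fin p)
    (hfin : (labelSet (k l) (I l) e).Finite) : (labelSet (k l) (I l) e).ncard =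
      ∑ a ∈ atomsOf k l, (labelSet (k a.1) (atomSet k I a) e).ncard := by
  classical
  have hsub : ∀ a ∈ atomsOf k l, labelSet (k a.1) (atomSet k I a) e ⊆ labelSet (k l) (I l) e := by
    rintro a ha i ⟨ξ, hξ, h⟩
    rw [atomsOf, Finset.mem_filter_univ] at ha
    exact ⟨ξ, ((hξ.2 l).1 ha.1).2, ha.2 ▸ h⟩
  have h1 : labelSet (k l) (I l) e =
      ⋃ a ∈ atomsOf k l, labelSet (k a.1) (atomSet k I a) e := by
    refine Set.Subset.antisymm ?_ (Set.iUnion₂_subset hsub)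
    rintro i ⟨ξ, hξ, h⟩
    obtain ⟨σ, hσ⟩ : ∃ σ : Finset (Fin p), ∀ l', l' ∈ σ ↔ k l' = k l ∧ ξ ∈ I l' :=
      ⟨Finset.univ.filter fun l' => k l' = k l ∧ ξ ∈ I l', fun l' => Finset.mem_filter_univ l'⟩
    have hl : l ∈ σ := (hσ l).2 ⟨rfl, hξ⟩
    have hmin : k (σ.min' ⟨l, hl⟩) = k l := ((hσ _).1 (σ.min'_mem ⟨l, hl⟩)).1
    refine Set.mem_iUnion₂.2 ⟨(σ.min' ⟨l, hl⟩, σ), ?_, ξ, ⟨⟨σ.min'_mem ⟨l, hl⟩, σ.min'_le⟩, ?_⟩, ?_⟩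
    · rw [atomsOf, Finset.mem_filter_univ]
      exact ⟨hl, hmin⟩
    · intro l'
      rw [hmin, hσ]
    · rw [hmin, h]
  have h2 : ∀ a ∈ atomsOf k l, (labelSet (k a.1) (atomSet k I a) e).ncard =
      (hfin.toFinset.filter (· ∈ labelSet (k a.1) (atomSet k I a) e)).card := fun a ha => by
    rw [← Set.ncard_coe_finset]
    congr 1
    ext i
    simpa using @hsub a ha i
  rw [Finset.sum_congr rfl h2, ← Finset.card_biUnion, Set.ncard_eq_toFinset_card _ hfin]
  · congr 1
    ext i
    have h3 := Set.ext_iff.1 h1 i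
    simp only [Set.mem_iUnion] at h3
    simp only [Set.Finite.mem_toFinset, Finset.mem_biUnion, Finset.mem_filter]
    exact ⟨fun h => (h3.1 h).imp fun a ⟨ha, h4⟩ => ⟨ha, h, h4⟩, fun ⟨a, ha, h, _⟩ => h⟩
  · intro a ha a' ha' hne
    refine Finset.disjoint_left.2 fun i hi hi' => ?_
    obtain ⟨ξ, hξ, h⟩ := (Finset.mem_filter.1 hi).2
    obtain ⟨ξ', hξ', h'⟩ := (Finset.mem_filter.1 hi').2
    rw [Finset.mem_coe, atomsOf, Finset.mem_filter_univ] at ha ha'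
    rw [ha.2] at h
    rw [ha'.2, h, EReal.coe_eq_coe_iff] at h'
    exact Set.disjoint_left.1 (disjoint_atomSet k I hne (ha.2.trans ha'.2.symm)) hξ (h' ▸ hξ')

end

/-- The event on the sums is a disjoint union of events on the values of all `X a`; the bound `b`
makes this union finite, so that limits can be taken term by term. -/
theorem measure_sum_eq {Ω α β : Type*} [MeasurableSpace Ω] [Fintype α] [DecidableEq α] [Fintype β]
    (P : Measure Ω) {X : α → Ω → ℕ} (hX : ∀ v : α → ℕ, MeasurableSet {ω | ∀ a, X a ω = v a})
    (F : β → Finset α) (N : β → ℕ) (b : α → ℕ)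
    (hb : ∀ ω, (∀ l, ∑ a ∈ F l, X a ω = N l) → ∀ a, X a ω ≤ b a) :
    P {ω | ∀ l, ∑ a ∈ F l, X a ω = N l} =
      ∑ v ∈ {v ∈ Fintype.piFinset fun a => Finset.range (b a + 1) | ∀ l, ∑ a ∈ F l, v a = N l},
        P {ω | ∀ a, X a ω = v a} := by
  rw [← measure_biUnion_finset _ fun v _ => hX v]
  · congr 1
    ext ω
    simp only [Set.mem_ofPred_eq, Set.mem_iUnion, Finset.mem_filter, Fintype.mem_piFinset,
      Finset.mem_range, exists_prop]
    constructor
    · exact fun h => ⟨fun a => X a ω, ⟨fun a => Nat.lt_succ_of_le (hb ω h a), h⟩, fun a => rfl⟩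
    · rintro ⟨v, ⟨-, h⟩, hv⟩ l
      simp only [hv, h]
  · intro v _ v' _ hne
    refine Set.disjoint_left.2 fun ω h h' => hne (funext fun a => ?_)
    rw [← h a, ← h' a]

/-- Labelling points by their own positions makes the lemmas on `labelSet` available for the bead
model too. -/
theorem PointConfig.exists_labelling (S : PointConfig) :
    ∃ e : ℤ × ℝ → EReal, ∀ k A, S.count k A = (labelSet k A e).ncard ∧
      (Bornology.IsBounded A → (labelSet k A e).Finite) := by
  classical
  have h1 : ∀ k A, labelSet k A (fun p => if p ∈ S.1 then (p.2 : EReal) else ⊤) =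
      {ξ : ℝ | (k, ξ) ∈ S.1 ∧ ξ ∈ A} := fun k A => by
    ext ξ
    constructor
    · rintro ⟨ξ', hξ', h⟩
      simp only at h
      split_ifs at h with hS
      · rw [EReal.coe_eq_coe_iff] at h
        exact ⟨hS, h ▸ hξ'⟩
      · exact absurd h.symm (EReal.coe_ne_top _)
    · rintro ⟨h, hξ⟩
      exact ⟨ξ, hξ, if_pos h⟩
  refine ⟨_, fun k A => ⟨by rw [h1]; rfl, fun hA => ?_⟩⟩
  obtain ⟨r, hr⟩ := hA.subset_closedBall 0
  rw [h1]
  refine (S.2 k r).subset fun ξ hξ => ⟨hξ.1, ?_⟩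
  simpa using hr hξ.2

/-- Factorial moments require disjoint sets on each thread, so overlapping sets are cut into atoms,
on which the convergence is known. -/
theorem Weights.tendsto_ncard (W : Weights n m) {j₀ : ZMod n}
    (hgen : ∀ j, j ≠ j₀ → W.abscissa j ≠ W.abscissa j₀) {γ : ℝ} (hγ : γ ∈ Set.Ioo (-1 : ℝ) 1)
    {μ : ℝ → Measure DimerConfig}
    (hμ : ∀ᶠ t in 𝓝[>] (0 : ℝ), W.HasBeadKernel j₀ γ t (μ t)) {ν : Measure PointConfig}
    (hν : IsBeadModel γ ν) {p : ℕ} (k : Fin p → ℤ) {I : Fin p → Set ℝ}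
    (hI : ∀ l, MeasurableSet (I l)) {r : ℝ} (hr : 0 ≤ r) (hb : ∀ l, ∀ ξ ∈ I l, |ξ| ≤ r)
    (hfr : ∀ l, volume (frontier (I l)) = 0) (N : Fin p → ℕ) :
    Tendsto (fun t => μ t {M | ∀ l, (labelSet (k l) (I l) (W.beadPos j₀ γ t M)).ncard = N l})
      (𝓝[>] 0) (𝓝 (ν {S | ∀ l, S.count (k l) (I l) = N l})) := by
  classical
  set E := (Fintype.equivFin (Fin p × Finset (Fin p))).symm with hE
  have hbA : ∀ a, ∀ ξ ∈ atomSet k I a, |ξ| ≤ r := fun a ξ hξ => hb _ _ (atomSet_subset k I a hξ)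
  have hbd : ∀ {A : Set ℝ}, (∀ ξ ∈ A, |ξ| ≤ r) → Bornology.IsBounded A := fun h =>
    (Metric.isBounded_Icc (-r) r).subset fun ξ hξ => abs_le.1 (h ξ hξ)
  have hatom : ∀ v : Fin p × Finset (Fin p) → ℕ, Tendsto (fun t => μ t {M | ∀ a,
      (labelSet (k a.1) (atomSet k I a) (W.beadPos j₀ γ t M)).ncard = v a}) (𝓝[>] 0)
      (𝓝 (ν {S | ∀ a : Fin p × Finset (Fin p), S.count (k a.1) (atomSet k I a) = v a})) := fun v => by
    have h1 := W.tendsto_ncard_of_disjoint hgen hγ hμ hν (fun i => k (E i).1)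
      (A := fun i => atomSet k I (E i)) (fun i => measurableSet_atomSet k I hI _) hr
      (fun i => hbA _) (fun i => volume_frontier_atomSet k I hfr _)
      (fun i i' h hk => disjoint_atomSet k I (E.injective.ne h) hk) fun i => v (E i)
    simpa only [E.forall_congr_left (p := fun i => _ = v (E i)), Equiv.apply_symm_apply] using h1
  have hle : ∀ {L : Type} (e : ℤ × L → EReal), (∀ l, (labelSet (k l) (I l) e).Finite) →
      ∀ a : Fin p × Finset (Fin p),
        (labelSet (k a.1) (atomSet k I a) e).ncard ≤ (labelSet (k a.1) (I a.1) e).ncard :=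
    fun e hfin a => Set.ncard_le_ncard (fun i ⟨ξ, hξ, h⟩ => ⟨ξ, atomSet_subset k I a hξ, h⟩)
      (hfin a.1)
  have hνe := measure_sum_eq ν (X := fun a (S : PointConfig) => S.count (k a.1) (atomSet k I a))
    (fun v => by
      rw [Set.ofPred_forall]
      exact MeasurableSet.iInter fun a => measurable_count _ (measurableSet_atomSet k I hI a)
        (hbd (hbA a)) (measurableSet_singleton _)) (atomsOf k) N (fun a => N a.1) (fun S hS a => by
      obtain ⟨e, he⟩ := S.exists_labelling
      simp only [fun k A => (he k A).1] at hS ⊢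
      have hfin := fun l => (he (k l) (I l)).2 (hbd (hb l))
      rw [← hS, ← ncard_labelSet_eq_sum k I e _ (hfin _)]
      exact hle e hfin a)
  have hν1 : {S : PointConfig | ∀ l, S.count (k l) (I l) = N l} = {S : PointConfig | ∀ l,
      ∑ a ∈ atomsOf k l, S.count (k a.1) (atomSet k I a) = N l} := by
    ext S
    obtain ⟨e, he⟩ := S.exists_labelling
    simp only [Set.mem_ofPred_eq, fun k A => (he k A).1]
    exact forall_congr' fun l => by
      rw [ncard_labelSet_eq_sum k I e _ ((he (k l) (I l)).2 (hbd (hb l)))]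
  rw [hν1, hνe]
  refine (tendsto_finsetSum _ fun v _ => hatom v).congr' ?_
  filter_upwards [self_mem_nhdsWithin] with t ht
  have hc := W.cellHeight_ne_zero hgen hγ ht
  have hfin := fun M l => W.finite_labelSet_beadPos hc M (k l) (hb l)
  rw [← measure_sum_eq (μ t)
    (X := fun a M => (labelSet (k a.1) (atomSet k I a) (W.beadPos j₀ γ t M)).ncard) (fun v => by
      rw [Set.ofPred_forall]
      exact MeasurableSet.iInter fun a => measurable_ncard_beadPos W j₀ γ t _
        (measurableSet_atomSet k I hI a) (measurableSet_singleton _)) (atomsOf k) N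
        (fun a => N a.1) fun M hM a => by
      rw [← hM, ← ncard_labelSet_eq_sum k I _ _ (hfin M _)]
      exact hle _ (hfin M) a]
  congr 1
  ext M
  exact forall_congr' fun l => by rw [ncard_labelSet_eq_sum k I _ _ (hfin M l)]

end BeadDimer

end

/-! ### Frozen columns, and the transfer to all the threads of a bundle. -/

noncomputable section

namespace BeadDimer

variable {n m : ℕ} [NeZero n] [NeZero m]

/-! ### Frozen columns -/

section

variable (M : DimerConfig)

theorem white_cases (x y : ℤ) : ((x, y), EdgeType.a) ∈ M.1 ∨ IsBead M x y ∨
    ((x, y), EdgeType.c) ∈ M.1 := by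
  obtain ⟨⟨v, s⟩, ⟨h, hv⟩, -⟩ := M.2.1 (x, y)
  obtain rfl : v = (x, y) := hv
  cases s
  exacts [Or.inl h, Or.inr (Or.inl h), Or.inr (Or.inr h)]

theorem black_cases (x y : ℤ) : ((x, y), EdgeType.a) ∈ M.1 ∨ IsBead M (x - 1) y ∨
    ((x, y + 1), EdgeType.c) ∈ M.1 := by
  obtain ⟨⟨v, s⟩, ⟨h, hv⟩, -⟩ := M.2.2 (x, y)
  cases s <;> simp only [blackEnd, Prod.ext_iff] at hv
  · exact Or.inl (by rwa [show v = (x, y) from Prod.ext hv.1 hv.2] at h)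
  · exact Or.inr (Or.inl (by
      rwa [show v = (x - 1, y) from Prod.ext (by simp only; omega) hv.2] at h))
  · exact Or.inr (Or.inr (by
      rwa [show v = (x, y + 1) from Prod.ext hv.1 (by simp only; omega)] at h))

variable {M}

theorem eq_of_whiteEnd_eq {e e' : Edge} (h : e ∈ M.1) (h' : e' ∈ M.1)
    (hw : whiteEnd e = whiteEnd e') : e = e' :=
  (M.2.1 (whiteEnd e')).unique ⟨h, hw⟩ ⟨h', rfl⟩

theorem eq_of_blackEnd_eq {e e' : Edge} (h : e ∈ M.1) (h' : e' ∈ M.1)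
    (hw : blackEnd e = blackEnd e') : e = e' :=
  (M.2.2 (blackEnd e')).unique ⟨h, hw⟩ ⟨h', rfl⟩

theorem not_a_of_isBead {x y : ℤ} (h : IsBead M x y) : ((x, y), EdgeType.a) ∉ M.1 :=
  fun h' => by simpa using eq_of_whiteEnd_eq h h' rfl

theorem not_c_of_isBead {x y : ℤ} (h : IsBead M x y) : ((x, y), EdgeType.c) ∉ M.1 :=
  fun h' => by simpa using eq_of_whiteEnd_eq h h' rfl

theorem not_a_of_isBead_left {x y : ℤ} (h : IsBead M (x - 1) y) : ((x, y), EdgeType.a) ∉ M.1 :=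
  fun h' => by simpa using eq_of_blackEnd_eq h h' (by simp [blackEnd])

theorem not_c_of_isBead_left {x y : ℤ} (h : IsBead M (x - 1) y) :
    ((x, y + 1), EdgeType.c) ∉ M.1 :=
  fun h' => by simpa using eq_of_blackEnd_eq h h' (by simp [blackEnd])

theorem not_c_of_a {x y : ℤ} (h : ((x, y), EdgeType.a) ∈ M.1) : ((x, y), EdgeType.c) ∉ M.1 :=
  fun h' => by simpa using eq_of_whiteEnd_eq h h' rfl

theorem not_c_succ_of_a {x y : ℤ} (h : ((x, y), EdgeType.a) ∈ M.1) :
    ((x, y + 1), EdgeType.c) ∉ M.1 :=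
  fun h' => by simpa using eq_of_blackEnd_eq h h' (by simp [blackEnd])

end

/-- The walk stops at the first `i` where `N` fails; since `N` holds before, `T` must hold there. -/
theorem exists_walk_end {N T : ℕ → Prop} (h : ∀ i, (∀ i' < i, N i') → T i ∨ N i) {K : ℕ}
    (hK : ∃ i < K, ¬ N i) : ∃ i < K, T i ∧ ∀ i' < i, N i' := by
  classical
  obtain ⟨i, hi, hN⟩ := hK
  have hex : ∃ i, ¬ N i := ⟨i, hN⟩
  have h1 : ∀ i' < Nat.find hex, N i' := fun i' hi' => not_not.1 (Nat.find_min hex hi')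
  exact ⟨Nat.find hex, (Nat.find_min' hex hN).trans_lt hi,
    (h _ h1).resolve_right (Nat.find_spec hex), h1⟩

/-- A walk that continued past a bead would use a non-typical edge at a vertex already matched by
that bead. -/
theorem Weights.paired_unique_right {W : Weights n m} {j : ZMod n} {M : DimerConfig} {x u v v' : ℤ}
    (h : W.Paired j M x u v) (h' : W.Paired j M x u v') : v = v' := by
  obtain ⟨-, hv, h⟩ := h
  obtain ⟨-, hv', h'⟩ := h'
  rcases h with ⟨hlt, h1, h2⟩ | ⟨hlt, h1, h2⟩ <;> rcases h' with ⟨hlt', h1', h2'⟩ | ⟨hlt', h1', h2'⟩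
  · rcases lt_trichotomy v v' with h3 | h3 | h3
    · exact absurd (h2 v' h3 h1') (not_c_of_isBead hv')
    · exact h3
    · exact absurd (h2' v h3 h1) (not_c_of_isBead hv)
  · exact absurd hlt hlt'.not_gt
  · exact absurd hlt hlt'.not_gt
  · rcases lt_trichotomy v v' with h3 | h3 | h3
    · exact absurd (h2' v h1 h3) (not_a_of_isBead hv)
    · exact h3
    · exact absurd (h2 v' h1' h3) (not_a_of_isBead hv')

theorem Weights.paired_unique_left {W : Weights n m} {j : ZMod n} {M : DimerConfig} {x u u' v : ℤ}
    (h : W.Paired j M x u v) (h' : W.Paired j M x u' v) : u = u' := by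
  obtain ⟨hu, -, h⟩ := h
  obtain ⟨hu', -, h'⟩ := h'
  rcases h with ⟨hlt, h1, h2⟩ | ⟨hlt, h1, h2⟩ <;> rcases h' with ⟨hlt', h1', h2'⟩ | ⟨hlt', h1', h2'⟩
  · rcases lt_trichotomy u u' with h3 | h3 | h3
    · exact absurd (h2' (u + 1) (by omega) h3) (not_c_of_isBead_left hu)
    · exact h3
    · exact absurd (h2 (u' + 1) (by omega) h3) (not_c_of_isBead_left hu')
  · exact absurd hlt hlt'.not_gt
  · exact absurd hlt hlt'.not_gt
  · rcases lt_trichotomy u u' with h3 | h3 | h3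
    · exact absurd (h2 u' h3 h1') (not_a_of_isBead_left hu')
    · exact h3
    · exact absurd (h2' u h3 h1) (not_a_of_isBead_left hu)

open Classical in
/-- The non-typical edge at `w (x, y)` in a frozen column. -/
def Weights.nontypical (W : Weights n m) (j₀ : ZMod n) (x y : ℤ) : Edge :=
  ((x, y), if W.abscissa j₀ < W.abscissa (x : ZMod n) then EdgeType.c else EdgeType.a)

theorem Weights.height_sub (W : Weights n m) (j₀ : ZMod n) (γ t : ℝ) (u v : ℤ) :
    W.height j₀ γ t u - W.height j₀ γ t v = W.cellHeight j₀ γ t * ((u - v : ℤ) / m) := by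
  rw [W.height_eq, W.height_eq]
  push_cast
  ring

/-- The two sides of a frozen column are close when it has few non-typical edges. -/
theorem Weights.sidesClose_of_card_lt (W : Weights n m) {j₀ : ZMod n} {γ t R ε : ℝ} {x : ℤ}
    (hx : W.abscissa (x : ZMod n) ≠ W.abscissa j₀) {M : DimerConfig} {K : ℕ}
    (hK : |W.cellHeight j₀ γ t| * (K / m) ≤ ε) {s : Finset ℤ}
    (hs : ∀ y, |W.height j₀ γ t y| ≤ R + ε → W.nontypical j₀ x y ∈ M.1 → y ∈ s)
    (hcard : s.card < K) : W.SidesClose j₀ γ t R ε x M := by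
  have hm : (0 : ℝ) < m := by exact_mod_cast NeZero.pos m
  have hclose : ∀ u v : ℤ, |u - v| ≤ K → |W.height j₀ γ t u - W.height j₀ γ t v| ≤ ε := by
    intro u v h
    rw [W.height_sub, abs_mul, abs_div, abs_of_pos hm]
    refine le_trans ?_ hK
    have : |((u - v : ℤ) : ℝ)| ≤ K := by exact_mod_cast h
    gcongr
  -- A walk starting in the window `[-R, R]` stays within `ε` of its start for `K` steps, hence in
  -- the larger window. It cannot meet `K` distinct non-typical edges there.
  have hex : ∀ (u : ℤ) (f : ℕ → ℤ), |W.height j₀ γ t u| ≤ R → Function.Injective f →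
      (∀ i < K, |u - f i| ≤ K) → ∃ i < K, W.nontypical j₀ x (f i) ∉ M.1 := by
    intro u f hu hf hfK
    by_contra! h
    have h1 : (Finset.range K).image f ⊆ s := by
      intro y hy
      obtain ⟨i, hi, rfl⟩ := Finset.mem_image.1 hy
      rw [Finset.mem_range] at hi
      refine hs _ ?_ (h i hi)
      have h2 := hclose _ _ (hfK i hi)
      have h3 := abs_sub_abs_le_abs_sub (W.height j₀ γ t (f i)) (W.height j₀ γ t u)
      rw [abs_sub_comm] at h3
      linarith
    have h2 := Finset.card_le_card h1
    rw [Finset.card_image_of_injective _ hf, Finset.card_range] at h2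
    omega
  rcases lt_or_gt_of_ne hx with hlt | hlt
  · have hnt : ∀ y, W.nontypical j₀ x y = ((x, y), EdgeType.a) := fun y => by
      rw [Weights.nontypical, if_neg hlt.not_gt]
    simp only [hnt] at hex
    constructor
    · intro u hu huR
      -- The black vertex just below the current white vertex is matched, by the initial bead or by
      -- the previous `a`-edge, which excludes the `c`-edge.
      have hstep : ∀ i : ℕ, (∀ i' < i, ((x, u + 1 + (i' : ℤ)), EdgeType.a) ∈ M.1) →
          IsBead M x (u + 1 + i) ∨ ((x, u + 1 + i), EdgeType.a) ∈ M.1 := by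
        intro i hi
        rcases white_cases M x (u + 1 + i) with h | h | h
        · exact Or.inr h
        · exact Or.inl h
        · exfalso
          rcases i with - | i
          · exact not_c_of_isBead_left hu (by simpa using h)
          · have := not_c_succ_of_a (hi i (by omega))
            rw [show u + 1 + (i : ℤ) + 1 = u + 1 + ((i + 1 : ℕ) : ℤ) by push_cast; ring] at this
            exact this h
      obtain ⟨i, hi, hT, hN⟩ := exists_walk_end hstep (hex u (fun i => u + 1 + i) huR
        (fun i i' h => by simpa using h) fun i hi => by rw [abs_le]; omega)
      refine ⟨u + 1 + i, ⟨hu, hT, Or.inr ⟨hlt, by omega, fun y h1 h2 => ?_⟩⟩,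
        hclose _ _ (by rw [abs_le]; omega)⟩
      have := hN (y - u - 1).toNat (by omega)
      rwa [show u + 1 + ((y - u - 1).toNat : ℤ) = y by omega] at this
    · intro v hv hvR
      -- The same walk in the other direction, followed at the black vertices: the white vertex just
      -- above is matched, which again excludes the `c`-edge.
      have hstep : ∀ i : ℕ, (∀ i' < i, ((x, v - 1 - (i' : ℤ)), EdgeType.a) ∈ M.1) →
          IsBead M (x - 1) (v - 1 - i) ∨ ((x, v - 1 - i), EdgeType.a) ∈ M.1 := by
        intro i hi
        rcases black_cases M x (v - 1 - i) with h | h | h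
        · exact Or.inr h
        · exact Or.inl h
        · exfalso
          rcases i with - | i
          · exact not_c_of_isBead hv (by simpa using h)
          · have := not_c_of_a (hi i (by omega))
            rw [show v - 1 - (i : ℤ) = v - 1 - ((i + 1 : ℕ) : ℤ) + 1 by push_cast; ring] at this
            exact this h
      obtain ⟨i, hi, hT, hN⟩ := exists_walk_end hstep (hex v (fun i => v - 1 - i) hvR
        (fun i i' h => by simpa using h) fun i hi => by rw [abs_le]; omega)
      refine ⟨v - 1 - i, ⟨hT, hv, Or.inr ⟨hlt, by omega, fun y h1 h2 => ?_⟩⟩,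
        hclose _ _ (by rw [abs_le]; omega)⟩
      have := hN (v - 1 - y).toNat (by omega)
      rwa [show v - 1 - ((v - 1 - y).toNat : ℤ) = y by omega] at this
  · have hnt : ∀ y, W.nontypical j₀ x y = ((x, y), EdgeType.c) := fun y => by
      rw [Weights.nontypical, if_pos hlt]
    simp only [hnt] at hex
    constructor
    · intro u hu huR
      -- Now the black vertex of the current row is matched, by the initial bead or by the previous
      -- `c`-edge, which excludes the `a`-edge.
      have hstep : ∀ i : ℕ, (∀ i' < i, ((x, u - (i' : ℤ)), EdgeType.c) ∈ M.1) →
          IsBead M x (u - i) ∨ ((x, u - i), EdgeType.c) ∈ M.1 := by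
        intro i hi
        rcases white_cases M x (u - i) with h | h | h
        · exfalso
          rcases i with - | i
          · exact not_a_of_isBead_left hu (by simpa using h)
          · have := not_c_succ_of_a h
            rw [show u - ((i + 1 : ℕ) : ℤ) + 1 = u - (i : ℤ) by push_cast; ring] at this
            exact this (hi i (by omega))
        · exact Or.inl h
        · exact Or.inr h
      obtain ⟨i, hi, hT, hN⟩ := exists_walk_end hstep (hex u (fun i => u - i) huR
        (fun i i' h => by simpa using h) fun i hi => by rw [abs_le]; omega)
      refine ⟨u - i, ⟨hu, hT, Or.inl ⟨hlt, by omega, fun y h1 h2 => ?_⟩⟩,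
        hclose _ _ (by rw [abs_le]; omega)⟩
      have := hN (u - y).toNat (by omega)
      rwa [show u - ((u - y).toNat : ℤ) = y by omega] at this
    · intro v hv hvR
      have hstep : ∀ i : ℕ, (∀ i' < i, ((x, v + (i' : ℤ) + 1), EdgeType.c) ∈ M.1) →
          IsBead M (x - 1) (v + i) ∨ ((x, v + i + 1), EdgeType.c) ∈ M.1 := by
        intro i hi
        rcases black_cases M x (v + i) with h | h | h
        · exfalso
          rcases i with - | i
          · exact not_a_of_isBead hv (by simpa using h)
          · have := not_c_of_a h
            rw [show v + ((i + 1 : ℕ) : ℤ) = v + (i : ℤ) + 1 by push_cast; ring] at this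
            exact this (hi i (by omega))
        · exact Or.inl h
        · exact Or.inr h
      obtain ⟨i, hi, hT, hN⟩ := exists_walk_end hstep (hex v (fun i => v + i + 1) hvR
        (fun i i' h => by simpa using h) fun i hi => by rw [abs_le]; omega)
      refine ⟨v + i, ⟨hT, hv, Or.inl ⟨hlt, by omega, fun y h1 h2 => ?_⟩⟩,
        hclose _ _ (by rw [abs_le]; omega)⟩
      have := hN (y - v - 1).toNat (by omega)
      rwa [show v + ((y - v - 1).toNat : ℤ) + 1 = y by omega] at this

section

variable (W : Weights n m) {j₀ : ZMod n}
  (hgen : ∀ j, j ≠ j₀ → W.abscissa j ≠ W.abscissa j₀) {γ : ℝ} (hγ : γ ∈ Set.Ioo (-1 : ℝ) 1)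
  {μ : ℝ → Measure DimerConfig}
  (hμ : ∀ᶠ t in 𝓝[>] (0 : ℝ), IsGibbsMeasure W (W.fieldX j₀ γ t) (Real.log t) (μ t))
  {x : ℤ} (hx : (x : ZMod n) ≠ j₀)
include hgen hγ hμ hx

/-- By periodicity only finitely many probabilities of `a`-edges occur. If they tend to one, the
`c`-edge at the same white vertex, which excludes the `a`-edge, has probability at most the
complement. -/
theorem Weights.exists_nontypical_bound : ∃ q : ℝ → ℝ, Tendsto q (𝓝[>] 0) (𝓝 0) ∧
    ∀ᶠ t in 𝓝[>] (0 : ℝ), ∀ y, (μ t).real {M | W.nontypical j₀ x y ∈ M.1} ≤ q t := by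
  obtain ⟨D⟩ := W.nonempty_poleData hgen
  set j : ZMod n := (x : ZMod n) with hj
  set L : ℂ := if W.abscissa j₀ < W.abscissa j then 1 else 0 with hL
  set G : ℝ → ZMod m → ℂ := fun t i => W.a i j * W.kerInt j₀ γ t (-1) 0 (i, j) (i, j) with hG
  refine ⟨fun t => ∑ i, ‖G t i - L‖, ?_, ?_⟩
  · have := tendsto_finsetSum Finset.univ fun i (_ : i ∈ Finset.univ) =>
      ((W.tendsto_kerInt_diag hgen hγ hx i).sub_const L).norm
    simpa [hL] using this
  filter_upwards [hμ, D.eventually_integrableOn γ hgen hγ, self_mem_nhdsWithin] with t h1 h2 ht y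
  have := h1.isProbabilityMeasure
  have h3 : (((μ t).real {M | ((x, y), EdgeType.a) ∈ M.1} : ℝ) : ℂ) = G t y := by
    have h4 := h1.localStatistics 1 (fun _ => ((x, y), EdgeType.a))
      (Function.injective_of_subsingleton _)
    simp only [Fin.forall_fin_one, Matrix.det_unique, Matrix.of_apply, Finset.univ_unique,
      Finset.prod_singleton] at h4
    rw [h4, W.invKasteleyn_eq_kerInt ht h2]
    simp [hG, Weights.edgeWeight, blackEnd, whiteEnd, proj, hj]
  have h5 : ‖G t y - L‖ ≤ ∑ i, ‖G t i - L‖ :=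
    Finset.single_le_sum (f := fun i => ‖G t i - L‖) (fun _ _ => norm_nonneg _)
      (Finset.mem_univ (y : ZMod m))
  refine le_trans ?_ h5
  rw [← h3]
  by_cases hlt : W.abscissa j₀ < W.abscissa j
  · have h6 : (μ t).real {M | ((x, y), EdgeType.a) ∈ M.1} +
        (μ t).real {M | ((x, y), EdgeType.c) ∈ M.1} ≤ 1 := by
      rw [← measureReal_union (μ := μ t) (s₁ := {M : DimerConfig | ((x, y), EdgeType.a) ∈ M.1})
        (s₂ := {M : DimerConfig | ((x, y), EdgeType.c) ∈ M.1})
        (Set.disjoint_left.2 fun M h h' => not_c_of_a h h') (measurableSet_mem_edge _)]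
      exact measureReal_le_one
    simp only [hL, Weights.nontypical, ← hj, if_pos hlt]
    rw [← Complex.ofReal_one, ← Complex.ofReal_sub, Complex.norm_real, Real.norm_eq_abs, abs_sub_comm]
    exact le_trans (by linarith) (le_abs_self _)
  · simp only [hL, Weights.nontypical, ← hj, if_neg hlt, sub_zero]
    rw [Complex.norm_real]
    exact le_abs_self _

/-- A first moment argument: failure requires `K` non-typical edges in the window. Here `K` and the
number of rows of the window are of the same order `1 / t`, while each row is non-typical with
probability at most `q t → 0`. -/
theorem Weights.tendsto_not_sidesClose {R ε : ℝ} (hR : 0 < R) (hε : 0 < ε) :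
    Tendsto (fun t => μ t {M | ¬ W.SidesClose j₀ γ t R ε x M}) (𝓝[>] 0) (𝓝 0) := by
  classical
  obtain ⟨q, hq, hle⟩ := W.exists_nontypical_bound hgen hγ hμ hx
  have hm : (0 : ℝ) < m := by exact_mod_cast NeZero.pos m
  -- Once `ε m / c > 2`, the window has at most `(2 (R + ε) + ε) m / c` rows and `K ≥ ε m / (2 c)`;
  -- `C` is the quotient.
  set C := 2 * (2 * (R + ε) + ε) / ε with hC
  have hlim : Tendsto (fun t => ENNReal.ofReal (C * q t)) (𝓝[>] 0) (𝓝 0) := by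
    simpa [Function.comp_def] using
      (ENNReal.continuous_ofReal.tendsto _).comp (hq.const_mul C)
  have hsmall : ∀ᶠ t in 𝓝[>] (0 : ℝ), |W.cellHeight j₀ γ t| < ε * m / 2 :=
    by
    simpa using (W.tendsto_cellHeight γ).abs.eventually
      (gt_mem_nhds (show |(0 : ℝ)| < ε * m / 2 by simpa using by positivity))
  refine tendsto_of_tendsto_of_tendsto_of_le_of_le' tendsto_const_nhds hlim
    (Eventually.of_forall fun _ => zero_le) ?_
  filter_upwards [hle, hμ, hsmall, self_mem_nhdsWithin] with t h1 h2 h3 ht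
  have := h2.isProbabilityMeasure
  set c := |W.cellHeight j₀ γ t| with hc
  have hc0 : 0 < c := abs_pos.2 (W.cellHeight_ne_zero hgen hγ ht)
  set K := ⌊ε * m / c⌋₊ with hKdef
  set s := Finset.Icc (-⌊(R + ε) * m / c⌋) ⌊(R + ε) * m / c⌋ with hs
  have hq0 : 0 ≤ q t := measureReal_nonneg.trans (h1 0)
  have hK1 : ε * m / c < K + 1 := Nat.lt_floor_add_one _
  have hK2 : 2 < ε * m / c := by rw [lt_div_iff₀ hc0]; linarith
  have hK3 : ε * m / c ≤ 2 * K := by linarith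
  have hK0 : (0 : ℝ) < K := by linarith
  obtain ⟨X, hX⟩ : ∃ X : DimerConfig → ENNReal, X = fun M =>
    ∑ y ∈ s, {M : DimerConfig | W.nontypical j₀ x y ∈ M.1}.indicator 1 M := ⟨_, rfl⟩
  have hXm : Measurable X := hX ▸ Finset.measurable_fun_sum _ fun y _ =>
    measurable_one.indicator (measurableSet_mem_edge _)
  have hsub : {M | ¬ W.SidesClose j₀ γ t R ε x M} ⊆ {M | (K : ENNReal) ≤ X M} := by
    intro M hM
    by_contra h
    refine hM (W.sidesClose_of_card_lt (K := K) (hgen _ hx)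
      (s := s.filter fun y => W.nontypical j₀ x y ∈ M.1) ?_ (fun y hy hN => ?_) ?_)
    · rw [← hc, ← mul_div_assoc, div_le_iff₀ hm, mul_comm, ← le_div_iff₀ hc0]
      exact Nat.floor_le (by positivity)
    · exact Finset.mem_filter.2 ⟨(W.abs_height_le_iff (abs_pos.1 hc0) _ y).1 hy, hN⟩
    · rw [Set.mem_ofPred_eq, not_le] at h
      have h4 : X M = ((s.filter fun y => W.nontypical j₀ x y ∈ M.1).card : ENNReal) := by
        simp [hX, Set.indicator_apply]
      rw [h4] at h
      exact_mod_cast h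
  have hlin : ∫⁻ M, X M ∂(μ t) ≤ ENNReal.ofReal (s.card * q t) := by
    rw [hX, lintegral_finsetSum _ fun y _ => measurable_one.indicator (measurableSet_mem_edge _)]
    calc _ ≤ ∑ y ∈ s, ENNReal.ofReal (q t) := Finset.sum_le_sum fun y _ => by
          rw [lintegral_indicator_one (measurableSet_mem_edge _), ← ofReal_measureReal]
          exact ENNReal.ofReal_le_ofReal (h1 y)
      _ = _ := by
          rw [Finset.sum_const, nsmul_eq_mul, ENNReal.ofReal_mul (by positivity),
            ENNReal.ofReal_natCast]
  have hcard : (s.card : ℝ) ≤ 2 * ((R + ε) * m / c) + 1 := by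
    have h5 := Int.floor_le ((R + ε) * m / c)
    have h6 : 0 ≤ ⌊(R + ε) * m / c⌋ := Int.floor_nonneg.2 (by positivity)
    have h7 : (s.card : ℤ) = 2 * ⌊(R + ε) * m / c⌋ + 1 := by
      rw [hs, Int.card_Icc, Int.toNat_of_nonneg (by omega)]
      ring
    have h8 : (s.card : ℝ) = 2 * (⌊(R + ε) * m / c⌋ : ℝ) + 1 := by exact_mod_cast h7
    linarith
  rw [← ENNReal.ofReal_natCast] at hsub
  have hmark := (mul_meas_ge_le_lintegral hXm (ENNReal.ofReal K) (μ := μ t)).trans hlin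
  refine (measure_mono hsub).trans ?_
  rw [← ofReal_measureReal, ← ENNReal.ofReal_mul hK0.le] at hmark
  rw [← ofReal_measureReal]
  refine ENNReal.ofReal_le_ofReal ?_
  rw [ENNReal.ofReal_le_ofReal_iff (by positivity)] at hmark
  refine le_of_mul_le_mul_left (hmark.trans ?_) hK0
  rw [← mul_assoc]
  refine mul_le_mul_of_nonneg_right (hcard.trans ?_) hq0
  calc _ ≤ 2 * ((R + ε) * m / c) + ε * m / c := by linarith
    _ = (C / 2) * (ε * m / c) := by rw [hC]; field_simp
    _ ≤ (C / 2) * (2 * K) := by gcongr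
    _ = _ := by ring

end

end BeadDimer

end

noncomputable section

namespace BeadDimer

variable {n m : ℕ} [NeZero n] [NeZero m]

/-! ### The threads of a bundle -/

/-- The beads of the thread `x` at height at most `R` are sent injectively to beads of the thread
`x'` at distance at most `ε`. -/
def Weights.Matched (W : Weights n m) (j₀ : ZMod n) (γ t : ℝ) (M : DimerConfig) (x x' : ℤ)
    (R ε : ℝ) : Prop :=
  ∃ f : ℤ → ℤ, (∀ u, IsBead M x u → |W.height j₀ γ t u| ≤ R →
    IsBead M x' (f u) ∧ |W.height j₀ γ t u - W.height j₀ γ t (f u)| ≤ ε) ∧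
    Set.InjOn f {u | IsBead M x u ∧ |W.height j₀ γ t u| ≤ R}

section

variable {W : Weights n m} {j₀ : ZMod n} {γ t : ℝ} {M : DimerConfig} {x x' x'' : ℤ} {R R' ε ε' : ℝ}

theorem Weights.Matched.mono (h : W.Matched j₀ γ t M x x' R' ε) (hR : R ≤ R') :
    W.Matched j₀ γ t M x x' R ε := by
  obtain ⟨f, h1, h2⟩ := h
  have hs : {u | IsBead M x u ∧ |W.height j₀ γ t u| ≤ R} ⊆
      {u | IsBead M x u ∧ |W.height j₀ γ t u| ≤ R'} := fun u hu => ⟨hu.1, hu.2.trans hR⟩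
  exact ⟨f, fun u hu huR => h1 u hu (huR.trans hR), h2.mono hs⟩

theorem Weights.Matched.trans (h : W.Matched j₀ γ t M x x' R ε)
    (h' : W.Matched j₀ γ t M x' x'' (R + ε) ε') : W.Matched j₀ γ t M x x'' R (ε + ε') := by
  obtain ⟨f, h1, h2⟩ := h
  obtain ⟨f', h1', h2'⟩ := h'
  have h3 : ∀ u, IsBead M x u → |W.height j₀ γ t u| ≤ R → |W.height j₀ γ t (f u)| ≤ R + ε :=
    fun u hu huR => by
    have h4 := (h1 u hu huR).2
    have h5 := abs_sub_abs_le_abs_sub (W.height j₀ γ t (f u)) (W.height j₀ γ t u)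
    rw [abs_sub_comm] at h5
    linarith
  refine ⟨f' ∘ f, fun u hu huR => ?_, fun u hu v hv huv => ?_⟩
  · obtain ⟨h4, h5⟩ := h1 u hu huR
    obtain ⟨h6, h7⟩ := h1' _ h4 (h3 u hu huR)
    exact ⟨h6, (abs_sub_le _ (W.height j₀ γ t (f u)) _).trans (add_le_add h5 h7)⟩
  · exact h2 hu hv (h2' ⟨(h1 u hu.1 hu.2).1, h3 u hu.1 hu.2⟩ ⟨(h1 v hv.1 hv.2).1, h3 v hv.1 hv.2⟩ huv)

theorem Weights.SidesClose.matched (h : W.SidesClose j₀ γ t R ε x M) :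
    W.Matched j₀ γ t M (x - 1) x R ε ∧ W.Matched j₀ γ t M x (x - 1) R ε := by
  constructor
  · have h1 : ∀ u, ∃ v, IsBead M (x - 1) u → |W.height j₀ γ t u| ≤ R →
        W.Paired j₀ M x u v ∧ |W.height j₀ γ t u - W.height j₀ γ t v| ≤ ε := fun u => by
      by_cases hu : IsBead M (x - 1) u ∧ |W.height j₀ γ t u| ≤ R
      · exact (h.1 u hu.1 hu.2).imp fun v hv _ _ => hv
      · exact ⟨0, fun h1 h2 => absurd ⟨h1, h2⟩ hu⟩
    choose f hf using h1
    refine ⟨f, fun u hu huR => ⟨(hf u hu huR).1.2.1, (hf u hu huR).2⟩, fun u hu v hv huv => ?_⟩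
    exact paired_unique_left (huv ▸ (hf u hu.1 hu.2).1) (hf v hv.1 hv.2).1
  · have h1 : ∀ v, ∃ u, IsBead M x v → |W.height j₀ γ t v| ≤ R →
        W.Paired j₀ M x u v ∧ |W.height j₀ γ t u - W.height j₀ γ t v| ≤ ε := fun v => by
      by_cases hv : IsBead M x v ∧ |W.height j₀ γ t v| ≤ R
      · exact (h.2 v hv.1 hv.2).imp fun u hu _ _ => hu
      · exact ⟨0, fun h1 h2 => absurd ⟨h1, h2⟩ hv⟩
    choose f hf using h1
    refine ⟨f, fun v hv hvR => ⟨(hf v hv hvR).1.1, by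
      rw [abs_sub_comm]
      exact (hf v hv hvR).2⟩,
      fun v hv v' hv' hvv => ?_⟩
    exact paired_unique_right (hvv ▸ (hf v hv.1 hv.2).1) (hf v' hv'.1 hv'.2).1

theorem Weights.finite_beads (hc : W.cellHeight j₀ γ t ≠ 0) (r s : ℝ) :
    {y | IsBead M x y ∧ W.height j₀ γ t y ∈ Set.Icc r s}.Finite := by
  refine (Finset.finite_toSet (Finset.Icc (-⌊(|r| + |s|) * m / |W.cellHeight j₀ γ t|⌋)
    ⌊(|r| + |s|) * m / |W.cellHeight j₀ γ t|⌋)).subset fun y hy => ?_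
  refine (W.abs_height_le_iff hc _ y).1 (abs_le.2 ⟨?_, ?_⟩)
  · linarith [hy.2.1, neg_abs_le r, abs_nonneg s]
  · linarith [hy.2.2, le_abs_self s, abs_nonneg r]

/-- Two matched threads have the same number of beads in an interval, when no bead is close to its
ends. -/
theorem Weights.Matched.beadCount_eq (hc : W.cellHeight j₀ γ t ≠ 0) {r s : ℝ}
    (h : W.Matched j₀ γ t M x x' (|r| + |s|) ε) (h' : W.Matched j₀ γ t M x' x (|r| + |s|) ε)
    (hends : ∀ y, IsBead M x' y → ε < |W.height j₀ γ t y - r| ∧ ε < |W.height j₀ γ t y - s|) :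
    W.beadCount j₀ γ t M x (Set.Icc r s) = W.beadCount j₀ γ t M x' (Set.Icc r s) := by
  have hR : ∀ ξ ∈ Set.Icc r s, |ξ| ≤ |r| + |s| := fun ξ hξ => abs_le.2
    ⟨by linarith [hξ.1, neg_abs_le r, abs_nonneg s], by linarith [hξ.2, le_abs_self s, abs_nonneg r]⟩
  have hsub : ∀ z, {y | IsBead M z y ∧ W.height j₀ γ t y ∈ Set.Icc r s} ⊆
      {y | IsBead M z y ∧ |W.height j₀ γ t y| ≤ |r| + |s|} := fun z u hu => ⟨hu.1, hR _ hu.2⟩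
  obtain ⟨f, h1, h2⟩ := h
  obtain ⟨f', h1', h2'⟩ := h'
  refine le_antisymm (Set.ncard_le_ncard_of_injOn f (fun u hu => ?_)
    (h2.mono (hsub x)) (finite_beads hc r s))
    (Set.ncard_le_ncard_of_injOn f' (fun u hu => ?_)
    (h2'.mono (hsub x')) (finite_beads hc r s))
  · obtain ⟨h3, h4⟩ := h1 u hu.1 (hR _ hu.2)
    obtain ⟨h5, h6⟩ := hends _ h3
    refine ⟨h3, ?_⟩
    rw [abs_le] at h4
    have hr := hu.2.1
    have hs := hu.2.2
    constructor
    · by_contra! h7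
      rw [abs_of_neg (by linarith)] at h5
      linarith
    · by_contra! h7
      rw [abs_of_pos (by linarith)] at h6
      linarith
  · obtain ⟨h3, h4⟩ := h1' u hu.1 (hR _ hu.2)
    obtain ⟨h5, h6⟩ := hends _ hu.1
    refine ⟨h3, ?_⟩
    rw [abs_of_nonneg (by linarith [hu.2.1])] at h5
    rw [abs_of_nonpos (by linarith [hu.2.2])] at h6
    rw [abs_le] at h4
    constructor <;> linarith

end

theorem intCast_ne_of_bundle {j₀ : ZMod n} {k i : ℤ} (h1 : j₀.val + k * n < i)
    (h2 : i < j₀.val + (k + 1) * n) : (i : ZMod n) ≠ j₀ := by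
  intro h
  have h3 : (((j₀.val : ℤ) : ZMod n)) = (i : ZMod n) := by
    rw [h, Int.cast_natCast, ZMod.natCast_zmod_val]
  obtain ⟨q, hq⟩ := (ZMod.intCast_eq_intCast_iff_dvd_sub _ _ _).1 h3
  have hn : (0 : ℤ) < n := by exact_mod_cast NeZero.pos n
  have h4 : k < q := by nlinarith
  have h5 : q < k + 1 := by nlinarith
  omega

theorem labelSet_beadPos (W : Weights n m) (j₀ : ZMod n) (γ t : ℝ) (M : DimerConfig) (k : ℤ)
    (A : Set ℝ) : labelSet k A (W.beadPos j₀ γ t M) =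
      {y | IsBead M (repThread n k) y ∧ W.height j₀ γ t y ∈ A} := by
  ext y
  constructor
  · rintro ⟨ξ, hξ, h⟩
    rw [W.beadPos_eq_coe] at h
    exact ⟨h.1, h.2 ▸ hξ⟩
  · rintro ⟨h, hξ⟩
    exact ⟨_, hξ, (W.beadPos_eq_coe ..).2 ⟨h, rfl⟩⟩

section

variable (W : Weights n m) {j₀ : ZMod n}
  (hgen : ∀ j, j ≠ j₀ → W.abscissa j ≠ W.abscissa j₀) {γ : ℝ} (hγ : γ ∈ Set.Ioo (-1 : ℝ) 1)
  {μ : ℝ → Measure DimerConfig}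
  (hμ : ∀ᶠ t in 𝓝[>] (0 : ℝ), IsGibbsMeasure W (W.fieldX j₀ γ t) (Real.log t) (μ t))
include hgen hγ hμ

/-- The frozen columns between the two threads are crossed one at a time and the matchings composed.
-/
theorem Weights.tendsto_not_matched {x : ℤ} (d : ℕ)
    (hx : ∀ i : ℤ, x < i → i ≤ x + d → (i : ZMod n) ≠ j₀) {R ε : ℝ} (hR : 0 < R) (hε : 0 < ε) :
    Tendsto (fun t => μ t {M | ¬ (W.Matched j₀ γ t M x (x + d) R ε ∧
      W.Matched j₀ γ t M (x + d) x R ε)}) (𝓝[>] 0) (𝓝 0) := by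
  induction d generalizing R ε with
  | zero =>
    refine tendsto_const_nhds.congr fun t => ?_
    have h2 : ∀ M, W.Matched j₀ γ t M x x R ε := fun M =>
      ⟨id, fun u hu _ => ⟨hu, by simpa using hε.le⟩, Set.injOn_id _⟩
    simp [h2]
  | succ d ih =>
    -- Half of `ε` is spent on each of the two matchings to be composed; the window grows by `ε / 2`
    -- because a bead may have moved by this much.
    have h1 := ih (fun i h1 h2 => hx i h1 (by push_cast; omega)) (R := R + ε / 2) (ε := ε / 2)
      (by positivity) (by positivity)
    have h2 := W.tendsto_not_sidesClose hgen hγ hμ (x := x + d + 1)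
      (hx _ (by omega) (by push_cast; omega)) (R := R + ε / 2) (ε := ε / 2)
      (by positivity) (by positivity)
    have h3 := h1.add h2
    rw [add_zero] at h3
    refine tendsto_of_tendsto_of_tendsto_of_le_of_le tendsto_const_nhds h3 (fun _ => zero_le)
      fun t => (measure_mono fun M hM => ?_).trans (measure_union_le _ _)
    by_contra h
    simp only [Set.mem_union, Set.mem_ofPred_eq, not_or, not_not] at h
    obtain ⟨⟨h4, h5⟩, h6⟩ := h
    have h7 := h6.matched
    rw [add_sub_cancel_right] at h7
    refine hM ?_
    rw [show x + ((d + 1 : ℕ) : ℤ) = x + d + 1 by push_cast; ring, ← add_halves ε]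
    exact ⟨(h4.mono (by linarith)).trans h7.1, (h7.2.mono (by linarith)).trans h5⟩

/-- All columns between `x` and the representative thread of its bundle are frozen, as a bundle lies
between two consecutive columns of type `j₀`. The representative may be on either side of `x`. -/
theorem Weights.tendsto_not_matched_repThread (x : ℤ) {R ε : ℝ} (hR : 0 < R) (hε : 0 < ε) :
    Tendsto (fun t => μ t {M | ¬ (W.Matched j₀ γ t M x (repThread n (bundle j₀ x)) R ε ∧
      W.Matched j₀ γ t M (repThread n (bundle j₀ x)) x R ε)}) (𝓝[>] 0) (𝓝 0) := by
  obtain ⟨k, hk⟩ : ∃ k, k = bundle j₀ x := ⟨_, rfl⟩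
  have hn : (0 : ℤ) < n := by exact_mod_cast NeZero.pos n
  have hj : (j₀.val : ℤ) < n := by exact_mod_cast ZMod.val_lt j₀
  have h1 := Int.ediv_mul_le (x - (j₀.val : ℤ)) hn.ne'
  have h2 := Int.lt_ediv_add_one_mul_self (x - (j₀.val : ℤ)) hn
  change bundle j₀ x * n ≤ _ at h1
  change _ < (bundle j₀ x + 1) * n at h2
  rw [← hk] at h1 h2 ⊢
  have hexp : (k + 1) * (n : ℤ) = k * n + n := by ring
  have hrep : repThread n k = k * n + n - 1 := by rw [repThread, hexp]
  have hbet : ∀ i : ℤ, (j₀.val : ℤ) + k * n < i → i < j₀.val + k * n + n → (i : ZMod n) ≠ j₀ :=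
    fun i h3 h4 => intCast_ne_of_bundle h3 (by rw [hexp]; omega)
  rcases le_total x (repThread n k) with h | h
  · obtain ⟨d, hd⟩ := Int.eq_ofNat_of_zero_le (sub_nonneg.2 h)
    have h3 := W.tendsto_not_matched hgen hγ hμ (x := x) d
      (fun i h3 h4 => hbet i (by omega) (by omega)) hR hε
    rwa [show x + (d : ℤ) = repThread n k by omega] at h3
  · obtain ⟨d, hd⟩ := Int.eq_ofNat_of_zero_le (sub_nonneg.2 h)
    have h3 := W.tendsto_not_matched hgen hγ hμ (x := repThread n k) d
      (fun i h3 h4 => hbet i (by omega) (by omega)) hR hε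
    rw [show repThread n k + (d : ℤ) = x by omega] at h3
    simpa only [and_comm] using h3

/-- The intensity of the limit is the constant `beadKernel γ 0 0`, so the expected number of beads
in a window of length `2 ε` tends to a multiple of `ε`. Markov's inequality concludes. -/
theorem Weights.exists_measure_near_le (k : ℤ) (r : ℝ) {δ : ENNReal} (hδ : 0 < δ) :
    ∃ ε : ℝ, 0 < ε ∧ ∀ᶠ t in 𝓝[>] (0 : ℝ),
      μ t {M | ∃ y, IsBead M (repThread n k) y ∧ |W.height j₀ γ t y - r| ≤ ε} ≤ δ := by
  have hμ' := W.eventually_hasBeadKernel hgen hγ hμ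
  have h1 : Tendsto (fun ε : ℝ => ‖beadKernel γ 0 0‖ₑ * ENNReal.ofReal (2 * ε)) (𝓝[>] 0) (𝓝 0) := by
    have h2 : Tendsto (fun ε : ℝ => ENNReal.ofReal (2 * ε)) (𝓝[>] 0) (𝓝 0) := by
      have h3 : Continuous fun ε : ℝ => ENNReal.ofReal (2 * ε) :=
        ENNReal.continuous_ofReal.comp (continuous_const.mul continuous_id)
      simpa using (h3.tendsto 0).mono_left nhdsWithin_le_nhds
    simpa using ENNReal.Tendsto.const_mul h2 (Or.inr enorm_ne_top)
  obtain ⟨ε, hε, hε0⟩ := ((h1.eventually (gt_mem_nhds hδ)).and self_mem_nhdsWithin).exists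
  have hε0' : (0 : ℝ) < ε := hε0
  refine ⟨ε, hε0, ?_⟩
  set B : Set (Unit → ℝ) := {ξ | ξ () ∈ Set.Icc (r - ε) (r + ε)} with hB
  have hBI : B = Set.Icc (fun _ => r - ε) fun _ => r + ε := by
    ext ξ
    simp only [hB, Set.mem_ofPred_eq, Set.mem_Icc, Pi.le_def]
    exact ⟨fun h => ⟨fun _ => h.1, fun _ => h.2⟩, fun h => ⟨h.1 (), h.2 ()⟩⟩
  have hBm : MeasurableSet B := measurableSet_ofPred_unit measurableSet_Icc
  have h2 := W.tendsto_lintegral_tupleCount hgen hγ hμ' (fun _ : Unit => k) hBm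
    (r := |r| + ε) (by positivity) (fun ξ hξ q => abs_le.2
      ⟨by linarith [hξ.1, neg_abs_le r], by linarith [hξ.2, le_abs_self r]⟩)
    (by rw [hBI]; exact (convex_Icc _ _).addHaar_frontier volume)
  have h3 : ∫⁻ ξ in B, ‖beadDet γ (fun _ : Unit => k) ξ‖ₑ =
      ‖beadKernel γ 0 0‖ₑ * ENNReal.ofReal (2 * ε) := by
    simp only [beadDet, Matrix.det_unique, Matrix.of_apply, sub_self, setLIntegral_const]
    rw [hBI, Real.volume_Icc_pi]
    simp only [Finset.univ_unique, Finset.prod_singleton]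
    ring_nf
  rw [h3] at h2
  filter_upwards [h2.eventually (gt_mem_nhds hε)] with t ht
  have hT : Measurable fun M => tupleCount (fun _ : Unit => k) B (W.beadPos j₀ γ t M) := by
    simp only [← W.tupleCount_beadEnc]
    exact (measurable_tupleCount _ hBm).comp (W.measurable_beadEnc j₀ γ t)
  have h4 := mul_meas_ge_le_lintegral hT 1 (μ := μ t)
  rw [one_mul] at h4
  refine ((measure_mono fun M hM => ?_).trans h4).trans ht.le
  obtain ⟨y, hy, hyr⟩ := hM
  rw [Set.mem_ofPred_eq, hB, tupleCount_unit]
  have h5 : 1 ≤ (labelSet k (Set.Icc (r - ε) (r + ε)) (W.beadPos j₀ γ t M)).encard := by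
    rw [Set.one_le_encard_iff_nonempty, labelSet_beadPos]
    rw [abs_le] at hyr
    exact ⟨y, hy, by linarith, by linarith⟩
  exact_mod_cast h5

/-- If the counts differ, then the threads are not matched up to `min ε₁ ε₂`, or some bead of the
representative thread is close to one end of the interval. Only this thread needs the estimate near
the ends. -/
theorem Weights.tendsto_beadCount_ne (x : ℤ) (r s : ℝ) :
    Tendsto (fun t => μ t {M | W.beadCount j₀ γ t M x (Set.Icc r s) ≠
      W.beadCount j₀ γ t M (repThread n (bundle j₀ x)) (Set.Icc r s)}) (𝓝[>] 0) (𝓝 0) := by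
  refine ENNReal.tendsto_nhds_zero.2 fun δ hδ => ?_
  have hδ3 : 0 < δ / 3 := ENNReal.div_pos hδ.ne' (by simp)
  obtain ⟨ε₁, hε₁, h1⟩ := W.exists_measure_near_le hgen hγ hμ (bundle j₀ x) r hδ3
  obtain ⟨ε₂, hε₂, h2⟩ := W.exists_measure_near_le hgen hγ hμ (bundle j₀ x) s hδ3
  have h3 := ENNReal.tendsto_nhds_zero.1 (W.tendsto_not_matched_repThread hgen hγ hμ x
    (R := |r| + |s| + 1) (by positivity) (lt_min hε₁ hε₂)) _ hδ3
  filter_upwards [h1, h2, h3, self_mem_nhdsWithin] with t h1 h2 h3 ht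
  have hc := W.cellHeight_ne_zero hgen hγ ht
  rw [← ENNReal.add_thirds δ]
  refine le_trans ?_ (add_le_add (add_le_add h1 h2) h3)
  refine (measure_mono fun M hM => ?_).trans ((measure_union_le _ _).trans
    (add_le_add (measure_union_le _ _) le_rfl))
  by_contra h
  simp only [Set.mem_union, Set.mem_ofPred_eq, not_or, not_not] at h
  obtain ⟨⟨h4, h5⟩, h6, h7⟩ := h
  push Not at h4 h5
  exact hM ((h6.mono (by linarith)).beadCount_eq hc (h7.mono (by linarith)) fun y hy =>
    ⟨(min_le_left _ _).trans_lt (h4 y hy), (min_le_right _ _).trans_lt (h5 y hy)⟩)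

/-- Up to an event of vanishing probability the counts are those of the representative threads.
Threads of one bundle share their representative, so sets on the same limiting thread may overlap,
as `Weights.tendsto_ncard` allows. -/
theorem Weights.tendsto_measure_beadCount {ν : Measure PointConfig} (hν : IsBeadModel γ ν) {p : ℕ}
    (x : Fin p → ℤ) (r s : Fin p → ℝ) (N : Fin p → ℕ) :
    Tendsto (fun t => μ t {M | ∀ l, W.beadCount j₀ γ t M (x l) (Set.Icc (r l) (s l)) = N l})
      (𝓝[>] 0) (𝓝 (ν {S | ∀ l, S.count (bundle j₀ (x l)) (Set.Icc (r l) (s l)) = N l})) := by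
  have hνp := hν.isProbabilityMeasure
  have h1 := W.tendsto_ncard hgen hγ (W.eventually_hasBeadKernel hgen hγ hμ) hν
    (fun l => bundle j₀ (x l)) (I := fun l => Set.Icc (r l) (s l)) (fun l => measurableSet_Icc)
    (r := ∑ l, (|r l| + |s l|)) (Finset.sum_nonneg fun _ _ => by positivity) (fun l ξ hξ => by
      refine le_trans ?_ (Finset.single_le_sum (f := fun l => |r l| + |s l|)
        (fun _ _ => by positivity) (Finset.mem_univ l))
      exact abs_le.2 ⟨by linarith [hξ.1, neg_abs_le (r l), abs_nonneg (s l)],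
        by linarith [hξ.2, le_abs_self (s l), abs_nonneg (r l)]⟩)
    (fun l => (convex_Icc _ _).addHaar_frontier volume) N
  simp only [labelSet_beadPos] at h1
  have h2 := tendsto_finsetSum Finset.univ fun l (_ : l ∈ Finset.univ) =>
    W.tendsto_beadCount_ne hgen hγ hμ (x l) (r l) (s l)
  rw [Finset.sum_const_zero] at h2
  have h3 := ENNReal.Tendsto.sub h1 h2 (Or.inr ENNReal.zero_ne_top)
  have h4 := h1.add h2
  rw [tsub_zero] at h3
  rw [add_zero] at h4
  have hD : ∀ t, μ t (⋃ l, {M | W.beadCount j₀ γ t M (x l) (Set.Icc (r l) (s l)) ≠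
      W.beadCount j₀ γ t M (repThread n (bundle j₀ (x l))) (Set.Icc (r l) (s l))}) ≤ ∑ l, μ t
        {M | W.beadCount j₀ γ t M (x l) (Set.Icc (r l) (s l)) ≠
          W.beadCount j₀ γ t M (repThread n (bundle j₀ (x l))) (Set.Icc (r l) (s l))} :=
    fun t => measure_iUnion_fintype_le _ _
  refine tendsto_of_tendsto_of_tendsto_of_le_of_le h3 h4 (fun t => ?_) fun t => ?_
  · refine tsub_le_iff_right.2 (le_trans ?_ (add_le_add le_rfl (hD t)))
    refine (measure_mono fun M hM => ?_).trans (measure_union_le _ _)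
    by_contra h
    simp only [Set.mem_union, Set.mem_ofPred_eq, Set.mem_iUnion, not_or, not_exists, not_not] at h
    exact h.1 fun l => (h.2 l).trans (hM l)
  · refine le_trans ?_ (add_le_add le_rfl (hD t))
    refine (measure_mono fun M hM => ?_).trans (measure_union_le _ _)
    by_contra h
    simp only [Set.mem_union, Set.mem_ofPred_eq, Set.mem_iUnion, not_or, not_exists, not_not] at h
    exact h.1 fun l => (h.2 l).symm.trans (hM l)

theorem Weights.tendsto_sidesClose {x : ℤ} (hx : (x : ZMod n) ≠ j₀) {R ε : ℝ} (hR : 0 < R)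
    (hε : 0 < ε) :
    Tendsto (fun t => μ t {M | W.SidesClose j₀ γ t R ε x M}) (𝓝[>] 0) (𝓝 1) := by
  have h1 := ENNReal.Tendsto.sub (tendsto_const_nhds (x := (1 : ENNReal)))
    (W.tendsto_not_sidesClose hgen hγ hμ hx hR hε) (Or.inr ENNReal.zero_ne_top)
  rw [tsub_zero] at h1
  refine tendsto_of_tendsto_of_tendsto_of_le_of_le' h1 tendsto_const_nhds ?_ ?_
  · filter_upwards [hμ] with t ht
    have := ht.isProbabilityMeasure
    rw [tsub_le_iff_right, ← measure_univ (μ := μ t)]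
    refine (measure_mono fun M _ => ?_).trans (measure_union_le _ _)
    exact em _
  · filter_upwards [hμ] with t ht
    have := ht.isProbabilityMeasure
    exact prob_le_one

end

end BeadDimer

end

theorem mainTheorem8 (n m : ℕ) [NeZero n] [NeZero m] (W : BeadDimer.Weights n m) (j₀ : ZMod n)
    (hgen : ∀ j, j ≠ j₀ → W.abscissa j ≠ W.abscissa j₀)
    (γ : ℝ) (hγ : γ ∈ Set.Ioo (-1 : ℝ) 1)
    (μ : ℝ → Measure BeadDimer.DimerConfig)
    (hμ : ∀ᶠ t in 𝓝[>] (0 : ℝ),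
      BeadDimer.IsGibbsMeasure W (W.fieldX j₀ γ t) (Real.log t) (μ t)) :
    (∃ ν : Measure BeadDimer.PointConfig, BeadDimer.IsBeadModel γ ν ∧
      ∀ (p : ℕ) (x : Fin p → ℤ) (r s : Fin p → ℝ) (N : Fin p → ℕ),
        Tendsto
          (fun t => μ t {M | ∀ l, W.beadCount j₀ γ t M (x l) (Set.Icc (r l) (s l)) = N l})
          (𝓝[>] (0 : ℝ))
          (𝓝 (ν {S | ∀ l, S.count (BeadDimer.bundle j₀ (x l)) (Set.Icc (r l) (s l)) = N l}))) ∧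
    (∀ x : ℤ, (x : ZMod n) ≠ j₀ → ∀ R ε : ℝ, 0 < R → 0 < ε →
      Tendsto (fun t => μ t {M | W.SidesClose j₀ γ t R ε x M}) (𝓝[>] (0 : ℝ)) (𝓝 1)) := by
  have hμ' := W.eventually_hasBeadKernel hgen hγ hμ
  obtain ⟨ν, hν⟩ := W.exists_beadModel hgen hγ hμ'
  exact ⟨⟨ν, hν, fun p x r s N => W.tendsto_measure_beadCount hgen hγ hμ hν x r s N⟩,
    fun x hx R ε hR hε => W.tendsto_sidesClose hgen hγ hμ hx hR hε⟩
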